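/- Consider finite groups $G$ of invertible $2\times2$ matrices over the quaternions $\mathbb{H}$, acting on the left of the right vector space $\mathbb{H}^2$. A reflection is an element of finite order whose fixed space has dimension one. A system of imprimitivity of $G$ is a set of at least two nonzero subspaces that $G$ permutes and whose internal direct sum is $\mathbb{H}^2$. An imprimitive quaternionic reflection group (of rank two) is a finite irreducible group $G$ generated by reflections that has a system of imprimitivity and is not conjugate in $GL(\mathbb{H}^2)$ to an (irreducible) imprimitive complex reflection group. If $G$ is monomial, put $H(G)=\{h:\mathrm{diag}(h,1)\in G\}$. For sets $\mathcal L,\mathcal H$ of unit quaternions let $\mathcal G(\mathcal L,\mathcal H)$ be the group generated by the matrices $\begin{pmatrix}0&\beta\\ \overline\beta&0\end{pmatrix}$, $\beta\in\mathcal L$, and $\begin{pmatrix}h&0\\0&1\end{pmatrix}$, $h\in\mathcal H$. Put $G(n,a,b,r)=\mathcal G(\{1,\omega^a,j,\omega^bj\},\{\omega^{2n/r}\})$ with $\omega=e^{\pi i/n}$, and $q_0=\frac{1+i+j+k}2$, $x=\frac{j-k}{\sqrt2}$, $o=\frac{1+i}{\sqrt2}$, $\tau=\frac{1+\sqrt5}2$,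 $\sigma=1-\tau$, $t=\frac{\tau+\sigma i-j}2$, $p=\frac{j-\tau i-\sigma k}2$, $y=\frac{i+\sigma j+\tau k}2$. Let $G$ be an imprimitive quaternionic reflection group of rank two. 1. If $G$ has more than one system of imprimitivity, then $H(G')$ is $\{1\}$ or $\{1,-1\}$ for every monomial conjugate $G'$ of $G$, and every reflection in $G$ has order two. (If $G$ is monomial, then $H(G)\in\{\{1\},\{1,-1\}\}$ if and only if every reflection in $G$ has order two.) 2. This condition is not sufficient: $\mathcal G(\{1,i,q_0,y\},\emptyset)$ and $\mathcal G(\{1,i,q_0,y\},\{-1\})$ are imprimitive quaternionic reflection groups with $H=\{1\}$ and $H=\{1,-1\}$ respectively, all of whose reflections have order two, and each has exactly one system of imprimitivity. 3. The number of systems of imprimitivity of $G$ is one, two, three, five or infinite, and the following hold, where all the groups listed are imprimitive quaternionic reflection groups. - One: this happens for infinitely many pairwise nonconjugate groups. - Two: if and only if $G$ is conjugate to one of the three pairwise nonconjugate groups $\mathcal G(\{1,i,q_0\},\{-1\})$, $\mathcal G(\{1,o,q_0,x\},\emptyset)$, $\mathcal G(\{1,q_0,t,p\},\emptyset)$. -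 Three: if and only if $G$ is conjugate to a group in one of the three infinite families $G(n,1,n,2)$ ($n\ge3$ odd), $G(n,1,\frac n2,2)$ ($n\ge4$ even), $G(n,2,\frac n2,1)$ ($n\ge6$ even, $\frac n2$ odd). The groups within a family are pairwise nonconjugate; no group of the second family is conjugate to one of the first or third; and $G(m,1,m,2)$ of the first family is conjugate to $G(n,2,\frac n2,1)$ of the third if and only if $n=2m$. - Five: if and only if $G$ is conjugate to $G(2,1,1,2)$. - Infinite: if and only if $G$ is conjugate to one of the three pairwise nonconjugate groups $\mathcal G(\{1,i,q_0\},\emptyset)$, $\mathcal G(\{1,o,q_0\},\emptyset)$, $\mathcal G(\{1,q_0,t\},\emptyset)$. -/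

import Mathlib

open scoped Quaternion Matrix

noncomputable section

namespace QRefl

/-! ### Groups of matrices acting on the right vector space `F ^ d` -/

/-- `GL (F ^ d)` for a division ring `F`: the invertible `d × d` matrices over `F`. -/
abbrev GLd (d : ℕ) (F : Type*) [DivisionRing F] : Type _ := (Matrix (Fin d) (Fin d) F)ˣ

/-- Subspaces of the right `F`-vector space of column vectors `F ^ d`
(the scalar `a` acts by `v ↦ v * a`). -/
abbrev RSub (d : ℕ) (F : Type*) [DivisionRing F] : Type _ := Submodule Fᵐᵒᵖ (Fin d → F)

/-- The right-linear map `v ↦ g v` of `F ^ d` given by a matrix `g` applied on the left. -/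
def act {d : ℕ} {F : Type*} [DivisionRing F] (g : GLd d F) :
    (Fin d → F) →ₗ[Fᵐᵒᵖ] (Fin d → F) :=
  Matrix.mulVecBilin F Fᵐᵒᵖ (g : Matrix (Fin d) (Fin d) F)

/-- A reflection: an element of finite order whose fixed vectors form a hyperplane. -/
def IsReflection {d : ℕ} {F : Type*} [DivisionRing F] (g : GLd d F) : Prop :=
  IsOfFinOrder g ∧
    Module.finrank Fᵐᵒᵖ (LinearMap.ker (act g - LinearMap.id) : RSub d F) + 1 = d

/-- A reflection group: a finite group generated by reflections. -/
def IsReflectionGroup {d : ℕ} {F : Type*} [DivisionRing F] (G : Subgroup (GLd d F)) : Prop :=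
  Finite G ∧ Subgroup.closure {g | g ∈ G ∧ IsReflection g} = G

/-- `G` is irreducible: every nonzero orbit spans `F ^ d`. -/
def IsIrreducible {d : ℕ} {F : Type*} [DivisionRing F] (G : Subgroup (GLd d F)) : Prop :=
  ∀ v : Fin d → F, v ≠ 0 → Submodule.span Fᵐᵒᵖ {w | ∃ g ∈ G, w = act g v} = ⊤

/-- A system of imprimitivity for `G`: a set of `m ≥ 2` nonzero subspaces which `G` permutes,
and of which `F ^ d` is the internal direct sum. -/
def IsSystem {d : ℕ} {F : Type*} [DivisionRing F] (G : Subgroup (GLd d F))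
    (S : Set (RSub d F)) : Prop :=
  S.Finite ∧ S.Nontrivial ∧ (∀ V ∈ S, V ≠ ⊥) ∧ sSupIndep S ∧ sSup S = ⊤ ∧
    ∀ g ∈ G, ∀ V ∈ S, V.map (act g) ∈ S

/-- The number of systems of imprimitivity of `G`. -/
def numSystems {d : ℕ} {F : Type*} [DivisionRing F] (G : Subgroup (GLd d F)) : ℕ∞ :=
  Set.encard {S : Set (RSub d F) | IsSystem G S}

/-- `G` is imprimitive: it has a system of imprimitivity. -/
def IsImprimitive {d : ℕ} {F : Type*} [DivisionRing F] (G : Subgroup (GLd d F)) : Prop :=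
  ∃ S : Set (RSub d F), IsSystem G S

/-- Conjugacy of subgroups in `GL (F ^ d)`. -/
def Conj {d : ℕ} {F : Type*} [DivisionRing F] (G G' : Subgroup (GLd d F)) : Prop :=
  ∃ U : GLd d F, G.map (MulAut.conj U).toMonoidHom = G'

/-- `G` is a group of monomial matrices: each row and each column of every element has
exactly one nonzero entry. -/
def IsMonomial {d : ℕ} {F : Type*} [DivisionRing F] (G : Subgroup (GLd d F)) : Prop :=
  ∀ g ∈ G, (∀ i, ∃! j, g.1 i j ≠ 0) ∧ (∀ j, ∃! i, g.1 i j ≠ 0)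

/-- The inclusion `GL (ℂ ^ 2) → GL (ℍ ^ 2)`. -/
def complexToQuaternion : GLd 2 ℂ →* GLd 2 ℍ[ℝ] :=
  Units.map (Quaternion.ofComplex.mapMatrix :
    Matrix (Fin 2) (Fin 2) ℂ →ₐ[ℝ] Matrix (Fin 2) (Fin 2) ℍ[ℝ])

/-- `C` is an (irreducible) imprimitive complex reflection group of rank two. -/
def IsImprimitiveComplexRG (C : Subgroup (GLd 2 ℂ)) : Prop :=
  IsReflectionGroup C ∧ IsIrreducible C ∧ IsImprimitive C

/-- `G` is an imprimitive quaternionic reflection group of rank two: an irreducible imprimitive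
reflection group on `ℍ ^ 2`, not conjugate to an imprimitive complex reflection group. -/
def IsImprimitiveQuaternionicRG (G : Subgroup (GLd 2 ℍ[ℝ])) : Prop :=
  IsReflectionGroup G ∧ IsIrreducible G ∧ IsImprimitive G ∧
    ¬ ∃ C : Subgroup (GLd 2 ℂ), IsImprimitiveComplexRG C ∧ Conj G (C.map complexToQuaternion)

/-- The set `H` attached to a monomial reflection group `G`: all `h` with `diag (h, 1) ∈ G`. -/
def setH (G : Subgroup (GLd 2 ℍ[ℝ])) : Set ℍ[ℝ] :=
  {h | ∃ g ∈ G, g.1 = !![h, 0; 0, 1]}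

/-- Every reflection in `G` has order two. -/
def AllReflectionsOrderTwo (G : Subgroup (GLd 2 ℍ[ℝ])) : Prop :=
  ∀ g ∈ G, IsReflection g → orderOf g = 2

/-! ### Explicit groups -/

/-- The group generated by the matrices `(0 β; β̄ 0)`, `β ∈ L`, and `(h 0; 0 1)`, `h ∈ H`
(for sets `L`, `H` of unit quaternions). -/
def genGroup (L H : Set ℍ[ℝ]) : Subgroup (GLd 2 ℍ[ℝ]) :=
  Subgroup.closure {g | (∃ β ∈ L, g.1 = !![0, β; star β, 0]) ∨ (∃ h ∈ H, g.1 = !![h, 0; 0, 1])}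

/-- The quaternion `i`. -/
def qi : ℍ[ℝ] := ⟨0, 1, 0, 0⟩

/-- The quaternion `j`. -/
def qj : ℍ[ℝ] := ⟨0, 0, 1, 0⟩

/-- `ω = exp (π i / n)`, a primitive `2n`-th root of unity. -/
def omega (n : ℕ) : ℍ[ℝ] := ⟨Real.cos (Real.pi / n), Real.sin (Real.pi / n), 0, 0⟩

/-- `G(n,a,b,r)`, generated by `{1, ω^a, j, ω^b j}` and `{ω^(2n/r)}` (used with `r ∣ 2n`). -/
def Gnabr (n a b r : ℕ) : Subgroup (GLd 2 ℍ[ℝ]) :=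
  genGroup {1, omega n ^ a, qj, omega n ^ b * qj} {omega n ^ (2 * n / r)}

/-- `τ = (1 + √5) / 2`. -/
def tau : ℝ := (1 + √5) / 2

/-- `σ = 1 - τ`. -/
def sig : ℝ := 1 - tau

/-- `(1 + i + j + k) / 2`. -/
def qh : ℍ[ℝ] := ⟨1 / 2, 1 / 2, 1 / 2, 1 / 2⟩

/-- `(1 + i) / √2`. -/
def qo : ℍ[ℝ] := ⟨1 / √2, 1 / √2, 0, 0⟩

/-- `(j - k) / √2`. -/
def qx : ℍ[ℝ] := ⟨0, 0, 1 / √2, -(1 / √2)⟩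

/-- `(τ + σ i - j) / 2`. -/
def qt : ℍ[ℝ] := ⟨tau / 2, sig / 2, -(1 / 2), 0⟩

/-- `(j - τ i - σ k) / 2`. -/
def qp : ℍ[ℝ] := ⟨0, -(tau / 2), 1 / 2, -(sig / 2)⟩

/-- `(i + σ j + τ k) / 2`. -/
def qy : ℍ[ℝ] := ⟨0, 1 / 2, sig / 2, tau / 2⟩

/-- The group for the binary tetrahedral group with `|L| = 12`, `H = 1`. -/
def GT12 : Subgroup (GLd 2 ℍ[ℝ]) := genGroup {1, qi, qh} ∅

/-- The group for the binary tetrahedral group with `|L| = 12`, `H = C₂`. -/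
def GT12C2 : Subgroup (GLd 2 ℍ[ℝ]) := genGroup {1, qi, qh} {-1}

/-- The group for the binary octahedral group with `|L| = 18`, `H = 1`. -/
def GO18 : Subgroup (GLd 2 ℍ[ℝ]) := genGroup {1, qo, qh} ∅

/-- The group for the binary octahedral group with `|L| = 20`, `H = C₂`. -/
def GO20C2 : Subgroup (GLd 2 ℍ[ℝ]) := genGroup {1, qo, qh, qx} ∅

/-- The group for the binary icosahedral group with `|L| = 30`, `H = 1`. -/
def GI30 : Subgroup (GLd 2 ℍ[ℝ]) := genGroup {1, qh, qt} ∅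

/-- The group for the binary icosahedral group with `|L| = 32`, `H = C₂`. -/
def GI32C2 : Subgroup (GLd 2 ℍ[ℝ]) := genGroup {1, qh, qt, qp} ∅

/-- The group for the binary icosahedral group with `|L| = 20`, `H = 1`. -/
def GI20 : Subgroup (GLd 2 ℍ[ℝ]) := genGroup {1, qi, qh, qy} ∅

/-- The group for the binary icosahedral group with `|L| = 20`, `H = C₂`. -/
def GI20C2 : Subgroup (GLd 2 ℍ[ℝ]) := genGroup {1, qi, qh, qy} {-1}

/-- The three groups with exactly two systems of imprimitivity. -/
def twoCase : Fin 3 → Subgroup (GLd 2 ℍ[ℝ]) := ![GT12C2, GO20C2, GI32C2]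

/-- The three groups with infinitely many systems of imprimitivity. -/
def infCase : Fin 3 → Subgroup (GLd 2 ℍ[ℝ]) := ![GT12, GO18, GI30]

/-- The indices of the three infinite families
`G(n,1,n,2)`, `n ≥ 3` odd; `G(n,1,n/2,2)`, `n ≥ 4` even; `G(n,2,n/2,1)`, `n ≥ 6`, `n/2` odd. -/
def FamIndex : Fin 3 → ℕ → Prop :=
  ![fun n => 3 ≤ n ∧ Odd n, fun n => 4 ≤ n ∧ Even n, fun n => 6 ≤ n ∧ Even n ∧ Odd (n / 2)]

/-- The groups of the three infinite families. -/
def family : Fin 3 → ℕ → Subgroup (GLd 2 ℍ[ℝ]) :=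
  ![fun n => Gnabr n 1 n 2, fun n => Gnabr n 1 (n / 2) 2, fun n => Gnabr n 2 (n / 2) 1]

end QRefl

end

/-! In a plane a system of imprimitivity is a pair of lines permuted by the group. Moving one system
to the coordinate axes makes `G` monomial. A second system then consists of two lines of nonzero
slope, and a diagonal change of basis gives one of them slope 1. Testing the reflections on this
pair (`exists_type_of_pair`) leaves two shapes up to conjugacy: either every reflection is
antidiagonal with an entry `b` such that `b² = -1`, or `diag (-1, 1)` lies in `G` and the
antidiagonal reflections have `b² = ±1`. In both shapes all reflections are involutions, which gives
the necessary condition on `H`.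

Let `K` be the group generated by the entries `b` with `b² = -1`; it is finite because each of its
elements occurs in `G`, up to sign, as a scalar or antidiagonal matrix (`scalar_mem`). A finite
group of quaternions fixing no axis has only large rotation angles (`re_sq_lt`), hence only a few
traces (`isTrace_of_mem`). Axes of elements of order eight are pairwise orthogonal, axes of elements
of order ten meet at the angles of an icosahedron, and so the group is the stabilizer of an
octahedron or an icosahedron. If neither kind of element occurs, a group generated by square roots
of `-1` has an axis after all (`hasAxis_or_bin`).

Without an axis `G` is conjugate to a normal form `nf K u e` with `K` binary tetrahedral, octahedral
or icosahedral and `e = ±1`; the tetrahedral case hides inside the octahedral one (`eq_nf_binO`).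
With an axis the first shape is conjugate to a complex group and is excluded, while the second gives
`nf (dic n) 1 (-1)` with `n ≥ 2`. This is `classification`.

Systems are counted on slopes. If `e = 1`, all pairs `{r, -r⁻¹}` with `r` real are systems, so there
are infinitely many. If `e = -1`, a system other than the axes is a pair `{w, -w}` whose slope is
fixed up to sign by `K` and by the antidiagonal generator: only `w = 1` in the polyhedral cases, `1`
and `i` for `dic n` with `n ≥ 3`, and `1, i, j, k` for `n = 2`. Adding the axes gives two, three and
five. The listed groups are matched with normal forms by explicit changes of basis.

Nonconjugacy follows from the real part of the trace, from orders of elements, and from exponents.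
Groups with one system come from diagonal reflections of order greater than two (`numSystems_big`).
The two icosahedral counterexamples are handled by Galois conjugation in `ℚ(√5)`, which controls
`H`, and by linear equations on a possible second slope (`numSystems_ico`). -/

namespace QRefl

/-! ### Lines, systems and reflections in a right plane over a division ring -/

section Plane

variable {F : Type*} [DivisionRing F]

/-- The coordinate space `F` as a one-dimensional right vector space. -/
def opEquiv (F : Type*) [DivisionRing F] : F ≃ₗ[Fᵐᵒᵖ] Fᵐᵒᵖ where
  toFun := MulOpposite.op
  invFun := MulOpposite.unop
  map_add' _ _ := rfl
  map_smul' _ _ := rfl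
  left_inv _ := rfl
  right_inv _ := rfl

theorem finrank_plane : Module.finrank Fᵐᵒᵖ (Fin 2 → F) = 2 := by
  rw [LinearEquiv.finrank_eq (LinearEquiv.piCongrRight fun _ : Fin 2 => opEquiv F)]
  simp

/-- The right line spanned by a vector. -/
abbrev ray (v : Fin 2 → F) : RSub 2 F := Submodule.span Fᵐᵒᵖ {v}

theorem ray_ne_top (v : Fin 2 → F) : ray v ≠ ⊤ := by
  intro h
  have h1 := finrank_span_le_card (R := Fᵐᵒᵖ) ({v} : Set (Fin 2 → F))
  have h2 : Module.finrank Fᵐᵒᵖ (ray v) = 2 := by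
    rw [h, finrank_top, finrank_plane]
  simp only [Set.toFinset_singleton, Finset.card_singleton] at h1
  change Module.finrank Fᵐᵒᵖ (ray v) ≤ 1 at h1
  omega

theorem linInd_pair {v w : Fin 2 → F} (hv : v ≠ 0) (hw : w ∉ ray v) :
    LinearIndependent Fᵐᵒᵖ ![v, w] := by
  rw [LinearIndependent.pair_iff' hv]
  intro a ha
  exact hw (Submodule.mem_span_singleton.2 ⟨a, ha⟩)

theorem span_pair_top {v w : Fin 2 → F} (hv : v ≠ 0) (hw : w ∉ ray v) :
    Submodule.span Fᵐᵒᵖ {v, w} = ⊤ := by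
  have := (linInd_pair hv hw).span_eq_top_of_card_eq_finrank (by rw [finrank_plane]; simp)
  rwa [Matrix.range_cons, Matrix.range_cons, Matrix.range_empty, Set.union_empty,
    Set.singleton_union] at this

theorem mem_ray {v w : Fin 2 → F} : w ∈ ray v ↔ ∃ a : F, w = fun i => v i * a := by
  rw [Submodule.mem_span_singleton]
  constructor
  · rintro ⟨a, rfl⟩
    exact ⟨a.unop, rfl⟩
  · rintro ⟨a, rfl⟩
    exact ⟨MulOpposite.op a, rfl⟩

theorem ray_eq_of_mem {v w : Fin 2 → F} (hw : w ≠ 0) (h : w ∈ ray v) : ray w = ray v := by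
  obtain ⟨a, rfl⟩ := Submodule.mem_span_singleton.1 h
  have ha : a ≠ 0 := by
    rintro rfl
    simp at hw
  exact Submodule.span_singleton_smul_eq (IsUnit.mk0 a ha) v

@[simp] theorem act_apply (g : GLd 2 F) (v : Fin 2 → F) : act g v = g.1 *ᵥ v := rfl

/-- The action of matrices on subspaces. -/
def mv (g : GLd 2 F) (V : RSub 2 F) : RSub 2 F := V.map (act g)

theorem act_mul (g h : GLd 2 F) : act (g * h) = act g ∘ₗ act h :=
  LinearMap.ext fun v => (Matrix.mulVec_mulVec v g.1 h.1).symm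

theorem act_one : act (1 : GLd 2 F) = LinearMap.id :=
  LinearMap.ext fun v => Matrix.one_mulVec v

theorem mv_mul (g h : GLd 2 F) (V : RSub 2 F) : mv (g * h) V = mv g (mv h V) := by
  rw [mv, mv, mv, act_mul, Submodule.map_comp]

@[simp] theorem mv_one (V : RSub 2 F) : mv 1 V = V := by
  rw [mv, act_one, Submodule.map_id]

@[simp] theorem mv_inv_mv (g : GLd 2 F) (V : RSub 2 F) : mv g⁻¹ (mv g V) = V := by
  rw [← mv_mul, inv_mul_cancel, mv_one]

theorem mv_injective (g : GLd 2 F) : Function.Injective (mv g) :=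
  Function.LeftInverse.injective (mv_inv_mv g)

theorem mv_ray (g : GLd 2 F) (v : Fin 2 → F) : mv g (ray v) = ray (g.1 *ᵥ v) := by
  rw [mv, Submodule.map_span, Set.image_singleton, act_apply]

theorem mulVec_ne_zero (g : GLd 2 F) {v : Fin 2 → F} (hv : v ≠ 0) : g.1 *ᵥ v ≠ 0 := by
  intro h
  apply hv
  have : g.2 *ᵥ (g.1 *ᵥ v) = 0 := by rw [h, Matrix.mulVec_zero]
  rwa [Matrix.mulVec_mulVec, g.inv_val, Matrix.one_mulVec] at this

/-- The invertible matrix with two given independent columns. -/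
theorem exists_matrix_of_columns {v w : Fin 2 → F} (hv : v ≠ 0) (hw : w ∉ ray v) :
    ∃ P : GLd 2 F, P.1 = !![v 0, w 0; v 1, w 1] := by
  have htop := span_pair_top hv hw
  have key : ∀ x : Fin 2 → F, ∃ a b : F, x = fun i => v i * a + w i * b := by
    intro x
    have hx : x ∈ Submodule.span Fᵐᵒᵖ {v, w} := htop ▸ Submodule.mem_top
    obtain ⟨a, b, rfl⟩ := Submodule.mem_span_pair.1 hx
    exact ⟨a.unop, b.unop, rfl⟩
  obtain ⟨a, b, h1⟩ := key ![1, 0]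
  obtain ⟨c, d, h2⟩ := key ![0, 1]
  have h10 := congrFun h1 0
  have h11 := congrFun h1 1
  have h20 := congrFun h2 0
  have h21 := congrFun h2 1
  simp only [Matrix.cons_val_zero, Matrix.cons_val_one] at h10 h11 h20 h21
  have hm : !![v 0, w 0; v 1, w 1] * !![a, c; b, d] = 1 := by
    rw [Matrix.mul_fin_two, ← h10, ← h11, ← h20, ← h21, Matrix.one_fin_two]
  exact ⟨⟨_, _, hm, mul_eq_one_symm hm⟩, rfl⟩

/-- The vector `(1, w)`. -/
abbrev vec (w : F) : Fin 2 → F := ![1, w]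

/-- The line spanned by `(1, w)`. -/
abbrev ell (w : F) : RSub 2 F := ray (vec w)

/-- The second coordinate axis. -/
abbrev ellInf : RSub 2 F := ray ![0, 1]

/-- The pair of coordinate axes. -/
def stdSys (F : Type*) [DivisionRing F] : Set (RSub 2 F) := {ell 0, ellInf}

theorem ell_inj {w w' : F} : ell w = ell w' ↔ w = w' := by
  constructor
  · intro h
    have : vec w ∈ ell w' := h ▸ Submodule.mem_span_singleton_self _
    obtain ⟨a, ha⟩ := mem_ray.1 this
    have h0 := congrFun ha 0
    have h1 := congrFun ha 1
    simp only [vec, Matrix.cons_val_zero, Matrix.cons_val_one, one_mul] at h0 h1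
    rw [h1, ← h0, mul_one]
  · rintro rfl
    rfl

theorem ell_ne_ellInf (w : F) : ell w ≠ ellInf := by
  intro h
  have : vec w ∈ (ellInf : RSub 2 F) := h ▸ Submodule.mem_span_singleton_self _
  obtain ⟨a, ha⟩ := mem_ray.1 this
  have h0 := congrFun ha 0
  simp [vec] at h0

theorem ray_eq_ell {x y : F} (hx : x ≠ 0) : ray ![x, y] = ell (y * x⁻¹) := by
  apply ray_eq_of_mem
  · intro h
    exact hx (congrFun h 0)
  · rw [mem_ray]
    refine ⟨x, ?_⟩
    ext i
    fin_cases i <;> simp [vec, hx]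

theorem ray_eq_ellInf {y : F} (hy : y ≠ 0) : ray ![0, y] = ellInf := by
  apply ray_eq_of_mem
  · intro h
    exact hy (congrFun h 1)
  · rw [mem_ray]
    refine ⟨y, ?_⟩
    ext i
    fin_cases i <;> simp

theorem ray_cases {v : Fin 2 → F} (hv : v ≠ 0) : ray v = ellInf ∨ ∃ w, ray v = ell w := by
  have hv' : v = ![v 0, v 1] := by
    ext i
    fin_cases i <;> rfl
  by_cases h : v 0 = 0
  · left
    have h1 : v 1 ≠ 0 := by
      intro h1
      apply hv
      rw [hv', h, h1]
      ext i
      fin_cases i <;> rfl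
    rw [hv', h]
    exact ray_eq_ellInf h1
  · right
    exact ⟨v 1 * (v 0)⁻¹, by rw [hv']; exact ray_eq_ell h⟩

theorem vec_ne_zero (w : F) : vec w ≠ 0 := by
  intro h
  exact one_ne_zero (congrFun h 0)

theorem vecInf_ne_zero : (![0, 1] : Fin 2 → F) ≠ 0 := by
  intro h
  exact one_ne_zero (congrFun h 1)

/-- A system of imprimitivity of the plane is a permuted pair of independent lines. -/
theorem isSystem_iff {G : Subgroup (GLd 2 F)} {S : Set (RSub 2 F)} :
    IsSystem G S ↔ (∃ v w : Fin 2 → F, v ≠ 0 ∧ w ≠ 0 ∧ ray v ≠ ray w ∧ S = {ray v, ray w}) ∧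
      ∀ g ∈ G, ∀ V ∈ S, mv g V ∈ S := by
  constructor
  · rintro ⟨-, ⟨V, hV, W, hW, hVW⟩, hne, hind, -, hG⟩
    refine ⟨?_, hG⟩
    have hdis := hind.pairwiseDisjoint hV hW hVW
    obtain ⟨v, hv, hv0⟩ := Submodule.exists_mem_ne_zero_of_ne_bot (hne V hV)
    obtain ⟨w, hw, hw0⟩ := Submodule.exists_mem_ne_zero_of_ne_bot (hne W hW)
    have hwv : w ∉ ray v := by
      intro h
      exact hw0 (Submodule.disjoint_def.1 hdis w
        ((Submodule.span_singleton_le_iff_mem _ _).2 hv h) hw)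
    have htop := span_pair_top hv0 hwv
    -- Independence of `V` and `W` leaves no room for a `w`-component in a vector of `V`; the same
    -- argument applies to `W`.
    have hVv : V = ray v := by
      refine le_antisymm (fun x hx => ?_) ((Submodule.span_singleton_le_iff_mem _ _).2 hv)
      have hx' : x ∈ Submodule.span Fᵐᵒᵖ {v, w} := htop ▸ Submodule.mem_top
      obtain ⟨a, b, rfl⟩ := Submodule.mem_span_pair.1 hx'
      have h1 : b • w ∈ V := by
        have := V.sub_mem hx (V.smul_mem a hv)
        rwa [add_sub_cancel_left] at this
      rw [Submodule.disjoint_def.1 hdis _ h1 (W.smul_mem b hw), add_zero]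
      exact Submodule.mem_span_singleton.2 ⟨a, rfl⟩
    have hWw : W = ray w := by
      refine le_antisymm (fun x hx => ?_) ((Submodule.span_singleton_le_iff_mem _ _).2 hw)
      have hx' : x ∈ Submodule.span Fᵐᵒᵖ {v, w} := htop ▸ Submodule.mem_top
      obtain ⟨a, b, rfl⟩ := Submodule.mem_span_pair.1 hx'
      have h1 : a • v ∈ W := by
        have := W.sub_mem hx (W.smul_mem b hw)
        rwa [add_sub_cancel_right] at this
      rw [Submodule.disjoint_def.1 hdis _ (V.smul_mem a hv) h1, zero_add]
      exact Submodule.mem_span_singleton.2 ⟨b, rfl⟩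
    refine ⟨v, w, hv0, hw0, hVv ▸ hWw ▸ hVW, ?_⟩
    rw [← hVv, ← hWw]
    refine Set.Subset.antisymm (fun U hU => ?_) ?_
    -- A third member would be disjoint from the span of the other two, which is already the whole
    -- plane.
    · by_contra hcon
      simp only [Set.mem_insert_iff, Set.mem_singleton_iff, not_or] at hcon
      have h1 := hind hU
      have h2 : sSup (S \ {U}) = ⊤ := by
        rw [eq_top_iff, ← htop, Submodule.span_le]
        have hVs : V ≤ sSup (S \ {U}) := le_sSup ⟨hV, fun h => hcon.1 h.symm⟩
        have hWs : W ≤ sSup (S \ {U}) := le_sSup ⟨hW, fun h => hcon.2 h.symm⟩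
        rintro x (rfl | rfl)
        · exact hVs hv
        · exact hWs hw
      rw [h2, disjoint_top] at h1
      exact hne U hU h1
    · rintro U (rfl | rfl)
      · exact hV
      · exact hW
  · rintro ⟨⟨v, w, hv, hw, hvw, rfl⟩, hG⟩
    have hwv : w ∉ ray v := fun h => hvw (ray_eq_of_mem hw h).symm
    refine ⟨by simp, Set.nontrivial_pair hvw, ?_, ?_, ?_, hG⟩
    · rintro V (rfl | rfl)
      · simpa using hv
      · simpa using hw
    · rw [sSupIndep_pair hvw]
      rw [Submodule.disjoint_span_singleton' hw]
      intro h
      exact hwv h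
    · rw [sSup_pair, ← Submodule.span_union, Set.singleton_union]
      exact span_pair_top hv hwv

/-- In dimension two a vector and an image of it off its line already span everything, so
irreducibility only has to exclude invariant lines. -/
theorem isIrreducible_iff {G : Subgroup (GLd 2 F)} :
    IsIrreducible G ↔ ∀ v : Fin 2 → F, v ≠ 0 → ∃ g ∈ G, mv g (ray v) ≠ ray v := by
  constructor
  · intro h v hv
    by_contra! hcon
    apply ray_ne_top v
    rw [eq_top_iff, ← h v hv, Submodule.span_le]
    rintro _ ⟨g, hg, rfl⟩
    rw [SetLike.mem_coe, ← hcon g hg, mv_ray]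
    exact Submodule.mem_span_singleton_self _
  · intro h v hv
    obtain ⟨g, hg, hgv⟩ := h v hv
    rw [eq_top_iff, ← span_pair_top hv (w := g.1 *ᵥ v), Submodule.span_le]
    · rintro x (rfl | rfl)
      · exact Submodule.subset_span ⟨1, G.one_mem, by simp⟩
      · exact Submodule.subset_span ⟨g, hg, rfl⟩
    · intro hmem
      rw [mv_ray] at hgv
      exact hgv (ray_eq_of_mem (mulVec_ne_zero g hv) hmem)

/-- A fixed space that is neither zero nor the whole plane has dimension one; this form frees the
later arguments from dimension counts. -/
theorem isReflection_iff {g : GLd 2 F} :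
    IsReflection g ↔ IsOfFinOrder g ∧ g ≠ 1 ∧ ∃ v : Fin 2 → F, v ≠ 0 ∧ g.1 *ᵥ v = v := by
  rw [IsReflection]
  refine and_congr_right fun _ => ?_
  have hmem : ∀ v, v ∈ (LinearMap.ker (act g - LinearMap.id) : RSub 2 F) ↔ g.1 *ᵥ v = v := by
    intro v
    rw [LinearMap.mem_ker, LinearMap.sub_apply, sub_eq_zero, act_apply, LinearMap.id_apply]
  constructor
  · intro h
    constructor
    · rintro rfl
      rw [act_one, sub_self, LinearMap.ker_zero, finrank_top, finrank_plane] at h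
      omega
    · have h1 : (LinearMap.ker (act g - LinearMap.id) : RSub 2 F) ≠ ⊥ := by
        intro h0
        rw [h0, finrank_bot] at h
        omega
      obtain ⟨v, hv, hv0⟩ := Submodule.exists_mem_ne_zero_of_ne_bot h1
      exact ⟨v, hv0, (hmem v).1 hv⟩
  · rintro ⟨hg, v, hv0, hv⟩
    have : (LinearMap.ker (act g - LinearMap.id) : RSub 2 F) = ray v := by
      refine le_antisymm (fun w hw => ?_)
        ((Submodule.span_singleton_le_iff_mem _ _).2 ((hmem v).2 hv))
      by_contra hwv
      apply hg
      have htop := span_pair_top hv0 hwv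
      have hall : ∀ x, g.1 *ᵥ x = x := by
        intro x
        rw [← hmem]
        have hx' : x ∈ Submodule.span Fᵐᵒᵖ {v, w} := htop ▸ Submodule.mem_top
        refine (Submodule.span_le.2 ?_) hx'
        rintro y (rfl | rfl)
        · exact (hmem _).2 hv
        · exact hw
      ext1
      exact Matrix.ext_of_mulVec_single fun i => by
        rw [hall, Units.val_one, Matrix.one_mulVec]
    rw [this, finrank_span_singleton hv0]

/-! ### Conjugation -/

theorem mem_map_conj {G : Subgroup (GLd 2 F)} {U g : GLd 2 F} :
    g ∈ G.map (MulAut.conj U).toMonoidHom ↔ U⁻¹ * g * U ∈ G := by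
  constructor
  · rintro ⟨h, hh, rfl⟩
    simpa [mul_assoc] using hh
  · intro h
    exact ⟨_, h, by simp [mul_assoc]⟩

theorem Conj.refl (G : Subgroup (GLd 2 F)) : Conj G G :=
  ⟨1, by ext g; simp⟩

theorem Conj.symm {G G' : Subgroup (GLd 2 F)} (h : Conj G G') : Conj G' G := by
  obtain ⟨U, rfl⟩ := h
  refine ⟨U⁻¹, ?_⟩
  ext g
  rw [mem_map_conj, mem_map_conj]
  simp [mul_assoc]

theorem Conj.trans {G G' G'' : Subgroup (GLd 2 F)} (h : Conj G G') (h' : Conj G' G'') :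
    Conj G G'' := by
  obtain ⟨U, rfl⟩ := h
  obtain ⟨V, rfl⟩ := h'
  refine ⟨V * U, ?_⟩
  ext g
  rw [mem_map_conj, mem_map_conj, mem_map_conj]
  simp [mul_assoc]

theorem isReflection_conj {g : GLd 2 F} (U : GLd 2 F) (h : IsReflection g) :
    IsReflection (U * g * U⁻¹) := by
  rw [isReflection_iff] at h ⊢
  obtain ⟨h1, h2, v, hv, hgv⟩ := h
  refine ⟨?_, ?_, U.1 *ᵥ v, mulVec_ne_zero U hv, ?_⟩
  · exact (MulAut.conj U).toMonoidHom.isOfFinOrder h1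
  · intro h
    exact h2 (by simpa using h)
  · rw [Matrix.mulVec_mulVec, Units.val_mul, Units.val_mul, mul_assoc, mul_assoc,
      ← Units.val_mul U⁻¹, inv_mul_cancel, Units.val_one, mul_one, ← Matrix.mulVec_mulVec, hgv]

theorem IsSystem.conj {G : Subgroup (GLd 2 F)} {S : Set (RSub 2 F)} (U : GLd 2 F)
    (h : IsSystem G S) : IsSystem (G.map (MulAut.conj U).toMonoidHom) (mv U '' S) := by
  rw [isSystem_iff] at h ⊢
  obtain ⟨⟨v, w, hv, hw, hvw, rfl⟩, hG⟩ := h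
  constructor
  · refine ⟨U.1 *ᵥ v, U.1 *ᵥ w, mulVec_ne_zero U hv, mulVec_ne_zero U hw, ?_, ?_⟩
    · rw [← mv_ray, ← mv_ray]
      exact fun h => hvw (mv_injective U h)
    · rw [Set.image_pair, mv_ray, mv_ray]
  · rintro _ ⟨g, hg, rfl⟩ _ ⟨V, hV, rfl⟩
    refine ⟨mv g V, hG g hg V hV, ?_⟩
    simp [mv_mul]

theorem Conj.numSystems_eq {G G' : Subgroup (GLd 2 F)} (h : Conj G G') :
    numSystems G = numSystems G' := by
  have key : ∀ {G G' : Subgroup (GLd 2 F)}, Conj G G' → numSystems G ≤ numSystems G' := by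
    rintro G _ ⟨U, rfl⟩
    refine Set.encard_le_encard_of_injOn (f := Set.image (mv U)) ?_ ?_
    · intro S hS
      exact hS.conj U
    · exact (mv_injective U).image_injective.injOn
  exact le_antisymm (key h) (key h.symm)

theorem Conj.isIrreducible {G G' : Subgroup (GLd 2 F)} (h : Conj G G') (hG : IsIrreducible G) :
    IsIrreducible G' := by
  obtain ⟨U, rfl⟩ := h
  rw [isIrreducible_iff] at hG ⊢
  intro v hv
  obtain ⟨g, hg, hgv⟩ := hG (U⁻¹.1 *ᵥ v) (mulVec_ne_zero _ hv)
  refine ⟨U * g * U⁻¹, ⟨g, hg, rfl⟩, fun h => hgv ?_⟩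
  rw [mv_mul, mv_mul, mv_ray U⁻¹] at h
  apply mv_injective U
  rw [h, mv_ray, Matrix.mulVec_mulVec, ← Units.val_mul, mul_inv_cancel]
  simp

theorem Conj.isReflectionGroup {G G' : Subgroup (GLd 2 F)} (h : Conj G G')
    (hG : IsReflectionGroup G) : IsReflectionGroup G' := by
  obtain ⟨U, rfl⟩ := h
  obtain ⟨h1, h2⟩ := hG
  refine ⟨?_, le_antisymm ((Subgroup.closure_le _).2 fun g hg => hg.1) ?_⟩
  · exact Set.Finite.image _ (Set.toFinite (G : Set (GLd 2 F)))
  · conv_lhs => rw [← h2, MonoidHom.map_closure]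
    apply Subgroup.closure_mono
    rintro _ ⟨g, ⟨hg, hr⟩, rfl⟩
    exact ⟨⟨g, hg, rfl⟩, isReflection_conj U hr⟩

theorem Conj.isImprimitive {G G' : Subgroup (GLd 2 F)} (h : Conj G G')
    (hG : IsImprimitive G) : IsImprimitive G' := by
  obtain ⟨U, rfl⟩ := h
  obtain ⟨S, hS⟩ := hG
  exact ⟨_, hS.conj U⟩

/-- A system of imprimitivity can be moved to the coordinate axes. -/
theorem IsSystem.exists_conj {G : Subgroup (GLd 2 F)} {S : Set (RSub 2 F)} (h : IsSystem G S) :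
    ∃ U : GLd 2 F, mv U '' S = stdSys F := by
  obtain ⟨⟨v, w, hv, hw, hvw, rfl⟩, -⟩ := isSystem_iff.1 h
  have hwv : w ∉ ray v := fun h => hvw (ray_eq_of_mem hw h).symm
  obtain ⟨P, hP⟩ := exists_matrix_of_columns hv hwv
  refine ⟨P⁻¹, ?_⟩
  have h0 : ray v = mv P (ell 0) := by
    rw [mv_ray, hP]
    congr 2
    ext i
    fin_cases i <;> simp [Matrix.mulVec, dotProduct]
  have h1 : ray w = mv P ellInf := by
    rw [mv_ray, hP]
    congr 2
    ext i
    fin_cases i <;> simp [Matrix.mulVec, dotProduct]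
  rw [Set.image_pair, h0, h1, mv_inv_mv, mv_inv_mv, stdSys]

end Plane

/-! ### Monomial matrices and their action on slopes -/

section Monomial

variable {F : Type*} [DivisionRing F]

/-- The diagonal matrix with entries `a`, `b`. -/
def dg (a b : Fˣ) : GLd 2 F where
  val := !![(a : F), 0; 0, b]
  inv := !![((a⁻¹ : Fˣ) : F), 0; 0, (b⁻¹ : Fˣ)]
  val_inv := by simp [Matrix.one_fin_two]
  inv_val := by simp [Matrix.one_fin_two]

/-- The antidiagonal matrix with entries `a`, `b`. -/
def ad (a b : Fˣ) : GLd 2 F where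
  val := !![0, (a : F); b, 0]
  inv := !![0, ((b⁻¹ : Fˣ) : F); (a⁻¹ : Fˣ), 0]
  val_inv := by simp [Matrix.one_fin_two]
  inv_val := by simp [Matrix.one_fin_two]

theorem dg_val (a b : Fˣ) : (dg a b).1 = !![(a : F), 0; 0, b] := rfl
theorem ad_val (a b : Fˣ) : (ad a b).1 = !![0, (a : F); b, 0] := rfl

theorem dg_mul_dg (a b c d : Fˣ) : dg a b * dg c d = dg (a * c) (b * d) := by
  ext1; simp [dg_val]
theorem dg_mul_ad (a b c d : Fˣ) : dg a b * ad c d = ad (a * c) (b * d) := by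
  ext1; simp [dg_val, ad_val]
theorem ad_mul_dg (a b c d : Fˣ) : ad a b * dg c d = ad (a * d) (b * c) := by
  ext1; simp [dg_val, ad_val]
theorem ad_mul_ad (a b c d : Fˣ) : ad a b * ad c d = dg (a * d) (b * c) := by
  ext1; simp [dg_val, ad_val]
theorem dg_inv (a b : Fˣ) : (dg a b)⁻¹ = dg a⁻¹ b⁻¹ := by
  ext1; rfl
theorem ad_inv (a b : Fˣ) : (ad a b)⁻¹ = ad b⁻¹ a⁻¹ := by
  ext1; rfl
theorem dg_one : dg (1 : Fˣ) 1 = 1 := by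
  ext1; simp [dg_val, Matrix.one_fin_two]

theorem dg_inj {a b c d : Fˣ} : dg a b = dg c d ↔ a = c ∧ b = d := by
  constructor
  · intro h
    have h0 := congrArg (fun g : GLd 2 F => g.1 0 0) h
    have h1 := congrArg (fun g : GLd 2 F => g.1 1 1) h
    simp only [dg_val, Matrix.of_apply, Matrix.cons_val', Matrix.cons_val_zero,
      Matrix.cons_val_one, Matrix.cons_val_fin_one] at h0 h1
    exact ⟨Units.ext h0, Units.ext h1⟩
  · rintro ⟨rfl, rfl⟩; rfl

theorem ad_inj {a b c d : Fˣ} : ad a b = ad c d ↔ a = c ∧ b = d := by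
  constructor
  · intro h
    have h0 := congrArg (fun g : GLd 2 F => g.1 0 1) h
    have h1 := congrArg (fun g : GLd 2 F => g.1 1 0) h
    simp only [ad_val, Matrix.of_apply, Matrix.cons_val', Matrix.cons_val_zero,
      Matrix.cons_val_one, Matrix.cons_val_fin_one] at h0 h1
    exact ⟨Units.ext h0, Units.ext h1⟩
  · rintro ⟨rfl, rfl⟩; rfl

theorem dg_ne_ad {a b c d : Fˣ} : dg a b ≠ ad c d := by
  intro h
  have h0 := congrArg (fun g : GLd 2 F => g.1 0 0) h
  simp [dg_val, ad_val] at h0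

/-- The line `ell w` is the graph of `x ↦ w x`, so monomial matrices act on slopes by `w ↦ b w a⁻¹`
or `w ↦ b w⁻¹ a⁻¹`. All later questions about systems are decided on slopes. -/
theorem mv_dg_ell (a b : Fˣ) (w : F) : mv (dg a b) (ell w) = ell (b * w * (a : F)⁻¹) := by
  rw [mv_ray, ← ray_eq_ell a.ne_zero]
  congr 2
  ext i
  fin_cases i <;> simp [dg_val, vec]

theorem mv_dg_inf (a b : Fˣ) : mv (dg a b) ellInf = ellInf := by
  rw [mv_ray, ← ray_eq_ellInf b.ne_zero]
  congr 2
  ext i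
  fin_cases i <;> simp [dg_val]

theorem mv_ad_ell (a b : Fˣ) {w : F} (hw : w ≠ 0) :
    mv (ad a b) (ell w) = ell (b * w⁻¹ * (a : F)⁻¹) := by
  rw [mv_ray, mul_assoc, ← mul_inv_rev, ← ray_eq_ell (mul_ne_zero a.ne_zero hw)]
  congr 2
  ext i
  fin_cases i <;> simp [ad_val, vec]

theorem mv_ad_zero (a b : Fˣ) : mv (ad a b) (ell 0) = ellInf := by
  rw [mv_ray, ← ray_eq_ellInf b.ne_zero]
  congr 2
  ext i
  fin_cases i <;> simp [ad_val, vec]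

theorem mv_ad_inf (a b : Fˣ) : mv (ad a b) ellInf = ell 0 := by
  rw [mv_ray, ← zero_mul (a : F)⁻¹, ← ray_eq_ell a.ne_zero]
  congr 2
  ext i
  fin_cases i <;> simp [ad_val]

/-- The monomial matrices. -/
def IsMono (g : GLd 2 F) : Prop := (∃ a b, g = dg a b) ∨ ∃ a b, g = ad a b

/-- The group of all monomial matrices. -/
def monoGroup (F : Type*) [DivisionRing F] : Subgroup (GLd 2 F) where
  carrier := {g | IsMono g}
  one_mem' := Or.inl ⟨1, 1, dg_one.symm⟩
  mul_mem' := by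
    rintro _ _ (⟨a, b, rfl⟩ | ⟨a, b, rfl⟩) (⟨c, d, rfl⟩ | ⟨c, d, rfl⟩)
    · exact Or.inl ⟨_, _, dg_mul_dg a b c d⟩
    · exact Or.inr ⟨_, _, dg_mul_ad a b c d⟩
    · exact Or.inr ⟨_, _, ad_mul_dg a b c d⟩
    · exact Or.inl ⟨_, _, ad_mul_ad a b c d⟩
  inv_mem' := by
    rintro _ (⟨a, b, rfl⟩ | ⟨a, b, rfl⟩)
    · exact Or.inl ⟨_, _, dg_inv a b⟩
    · exact Or.inr ⟨_, _, ad_inv a b⟩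

theorem dg_mem_mono (a b : Fˣ) : dg a b ∈ monoGroup F := Or.inl ⟨a, b, rfl⟩
theorem ad_mem_mono (a b : Fˣ) : ad a b ∈ monoGroup F := Or.inr ⟨a, b, rfl⟩

/-- A zero entry on the diagonal would make the invertible matrix kill a coordinate vector. -/
theorem exists_dg {g : GLd 2 F} {x y : F} (h : g.1 = !![x, 0; 0, y]) :
    ∃ a b : Fˣ, (a : F) = x ∧ (b : F) = y ∧ g = dg a b := by
  have hx : x ≠ 0 := by
    rintro rfl
    apply vec_ne_zero (0 : F)
    by_contra h0
    apply mulVec_ne_zero g h0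
    ext i
    fin_cases i <;> simp [h, vec]
  have hy : y ≠ 0 := by
    rintro rfl
    apply vecInf_ne_zero (F := F)
    by_contra h0
    apply mulVec_ne_zero g h0
    ext i
    fin_cases i <;> simp [h]
  exact ⟨Units.mk0 x hx, Units.mk0 y hy, rfl, rfl, Units.ext h⟩

theorem exists_ad {g : GLd 2 F} {x y : F} (h : g.1 = !![0, x; y, 0]) :
    ∃ a b : Fˣ, (a : F) = x ∧ (b : F) = y ∧ g = ad a b := by
  have hy : y ≠ 0 := by
    rintro rfl
    apply vec_ne_zero (0 : F)
    by_contra h0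
    apply mulVec_ne_zero g h0
    ext i
    fin_cases i <;> simp [h, vec]
  have hx : x ≠ 0 := by
    rintro rfl
    apply vecInf_ne_zero (F := F)
    by_contra h0
    apply mulVec_ne_zero g h0
    ext i
    fin_cases i <;> simp [h]
  exact ⟨Units.mk0 x hx, Units.mk0 y hy, rfl, rfl, Units.ext h⟩

theorem isMonomial_iff {G : Subgroup (GLd 2 F)} : IsMonomial G ↔ G ≤ monoGroup F := by
  constructor
  · intro h g hg
    obtain ⟨h1, h2⟩ := h g hg
    have hg2 := Matrix.eta_fin_two g.1
    obtain ⟨j, hj, hj'⟩ := h1 0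
    obtain ⟨k, hk, hk'⟩ := h1 1
    fin_cases j
    · have h01 : g.1 0 1 = 0 := by
        by_contra hne
        exact absurd (hj' 1 hne) (by simp)
      have h10 : g.1 1 0 = 0 := by
        by_contra hne
        obtain ⟨i, -, hi⟩ := h2 0
        have := (hi 0 hj).trans (hi 1 hne).symm
        exact absurd this (by simp)
      rw [h01, h10] at hg2
      obtain ⟨a, b, -, -, rfl⟩ := exists_dg hg2
      exact dg_mem_mono a b
    · have h00 : g.1 0 0 = 0 := by
        by_contra hne
        exact absurd (hj' 0 hne) (by simp)
      have h11 : g.1 1 1 = 0 := by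
        by_contra hne
        obtain ⟨i, -, hi⟩ := h2 1
        have := (hi 0 hj).trans (hi 1 hne).symm
        exact absurd this (by simp)
      rw [h00, h11] at hg2
      obtain ⟨a, b, -, -, rfl⟩ := exists_ad hg2
      exact ad_mem_mono a b
  · intro h g hg
    obtain ⟨a, b, rfl⟩ | ⟨a, b, rfl⟩ := h hg
    · constructor <;> intro i <;> refine ⟨i, ?_, ?_⟩ <;> fin_cases i <;>
        simp [dg_val, Fin.forall_fin_two]
    · constructor <;> intro i <;> refine ⟨1 - i, ?_, ?_⟩ <;> fin_cases i <;>
        simp [ad_val, Fin.forall_fin_two]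

/-- This is the bridge between systems and matrices: conjugating a system to the axes makes the
group monomial, and conversely. -/
theorem isSystem_stdSys_iff {G : Subgroup (GLd 2 F)} :
    IsSystem G (stdSys F) ↔ G ≤ monoGroup F := by
  rw [isSystem_iff]
  constructor
  · rintro ⟨-, h⟩ g hg
    have hg2 := Matrix.eta_fin_two g.1
    have e0 : mv g (ell 0) = ray ![g.1 0 0, g.1 1 0] := by
      rw [mv_ray]
      congr 2
      ext i
      fin_cases i <;> simp [vec, Matrix.mulVec, dotProduct]
    have e1 : mv g ellInf = ray ![g.1 0 1, g.1 1 1] := by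
      rw [mv_ray]
      congr 2
      ext i
      fin_cases i <;> simp [Matrix.mulVec, dotProduct]
    have hne : mv g (ell 0) ≠ mv g ellInf := fun h => ell_ne_ellInf 0 (mv_injective g h)
    have m0 : ∀ x y : F, ray ![x, y] = ell 0 → y = 0 := by
      intro x y hxy
      have : ![x, y] ∈ ell (0 : F) := hxy ▸ Submodule.mem_span_singleton_self _
      obtain ⟨a, ha⟩ := mem_ray.1 this
      simpa [vec] using congrFun ha 1
    have m1 : ∀ x y : F, ray ![x, y] = ellInf → x = 0 := by
      intro x y hxy
      have : ![x, y] ∈ (ellInf : RSub 2 F) := hxy ▸ Submodule.mem_span_singleton_self _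
      obtain ⟨a, ha⟩ := mem_ray.1 this
      simpa using congrFun ha 0
    rcases h g hg (ell 0) (Or.inl rfl) with h0 | h0 <;>
      rcases h g hg ellInf (Or.inr rfl) with h1 | h1
    · exact absurd (h0.trans h1.symm) hne
    · rw [m0 _ _ (e0.symm.trans h0), m1 _ _ (e1.symm.trans h1)] at hg2
      obtain ⟨a, b, -, -, rfl⟩ := exists_dg hg2
      exact dg_mem_mono a b
    · rw [m1 _ _ (e0.symm.trans h0), m0 _ _ (e1.symm.trans h1)] at hg2
      obtain ⟨a, b, -, -, rfl⟩ := exists_ad hg2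
      exact ad_mem_mono a b
    · exact absurd (h0.trans h1.symm) hne
  · intro h
    refine ⟨⟨vec 0, _, vec_ne_zero 0, vecInf_ne_zero, ell_ne_ellInf 0, rfl⟩, ?_⟩
    intro g hg V hV
    obtain ⟨a, b, rfl⟩ | ⟨a, b, rfl⟩ := h hg <;> obtain rfl | rfl := hV
    · left
      rw [mv_dg_ell]
      simp
    · right
      rw [mv_dg_inf]
      rfl
    · right
      rw [mv_ad_zero]
      rfl
    · left
      rw [mv_ad_inf]

theorem isReflection_dg {a b : Fˣ} (h : IsReflection (dg a b)) :
    (a ≠ 1 ∧ b = 1) ∨ (a = 1 ∧ b ≠ 1) := by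
  obtain ⟨-, h1, v, hv, hgv⟩ := isReflection_iff.1 h
  have h0 := congrFun hgv 0
  have h1' := congrFun hgv 1
  simp only [dg_val, Matrix.mulVec, dotProduct, Fin.sum_univ_two, Matrix.of_apply,
    Matrix.cons_val', Matrix.cons_val_zero, Matrix.cons_val_one, Matrix.cons_val_fin_one,
    zero_mul, add_zero, zero_add] at h0 h1'
  have key : ∀ (c : Fˣ) (x : F), x ≠ 0 → (c : F) * x = x → c = 1 := by
    intro c x hx hc
    ext
    exact mul_right_cancel₀ hx (by rw [hc, Units.val_one, one_mul])
  by_cases hv0 : v 0 = 0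
  · have hv1 : v 1 ≠ 0 := by
      intro hv1
      apply hv
      ext i
      fin_cases i <;> assumption
    have hb := key b _ hv1 h1'
    refine Or.inl ⟨?_, hb⟩
    rintro rfl
    exact h1 (by rw [hb, dg_one])
  · have ha := key a _ hv0 h0
    refine Or.inr ⟨ha, ?_⟩
    rintro rfl
    exact h1 (by rw [ha, dg_one])

theorem dg_isReflection {a b : Fˣ} (h : (a ≠ 1 ∧ b = 1) ∨ (a = 1 ∧ b ≠ 1))
    (hf : IsOfFinOrder (dg a b)) : IsReflection (dg a b) := by
  rw [isReflection_iff]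
  refine ⟨hf, ?_, ?_⟩
  · rw [← dg_one, Ne, dg_inj]
    tauto
  · obtain ⟨-, rfl⟩ | ⟨rfl, -⟩ := h
    · refine ⟨_, vecInf_ne_zero, ?_⟩
      ext i
      fin_cases i <;> simp [dg_val]
    · refine ⟨_, vec_ne_zero 0, ?_⟩
      ext i
      fin_cases i <;> simp [dg_val, vec]

/-- A fixed vector `(x, y)` satisfies `x = a y` and `y = b x` with `x ≠ 0`, whence `a b = 1`. In
particular antidiagonal reflections are always involutions. -/
theorem isReflection_ad {a b : Fˣ} : IsReflection (ad a b) ↔ b = a⁻¹ := by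
  constructor
  · intro h
    obtain ⟨-, -, v, hv, hgv⟩ := isReflection_iff.1 h
    have h0 := congrFun hgv 0
    have h1 := congrFun hgv 1
    simp only [ad_val, Matrix.mulVec, dotProduct, Fin.sum_univ_two, Matrix.of_apply,
      Matrix.cons_val', Matrix.cons_val_zero, Matrix.cons_val_one, Matrix.cons_val_fin_one,
      zero_mul, add_zero, zero_add] at h0 h1
    have hv0 : v 0 ≠ 0 := by
      intro hv0
      rw [hv0, mul_zero] at h1
      apply hv
      ext i
      fin_cases i
      · exact hv0
      · exact h1.symm
    refine eq_inv_of_mul_eq_one_right ?_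
    ext
    refine mul_right_cancel₀ hv0 ?_
    rw [Units.val_mul, mul_assoc, h1, h0, Units.val_one, one_mul]
  · rintro rfl
    rw [isReflection_iff]
    refine ⟨?_, ?_, ?_⟩
    · rw [isOfFinOrder_iff_pow_eq_one]
      refine ⟨2, by norm_num, ?_⟩
      rw [pow_two, ad_mul_ad, mul_inv_cancel, inv_mul_cancel, dg_one]
    · rw [← dg_one]
      exact dg_ne_ad.symm
    · refine ⟨vec (a : F)⁻¹, vec_ne_zero _, ?_⟩
      ext i
      fin_cases i <;> simp [ad_val, vec]

theorem mem_mono {G : Subgroup (GLd 2 F)} (hG : G ≤ monoGroup F) {g : GLd 2 F} (hg : g ∈ G) :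
    (∃ a b, g = dg a b) ∨ ∃ a b, g = ad a b := hG hg

/-- An irreducible monomial group contains an antidiagonal element. -/
theorem exists_ad_mem {G : Subgroup (GLd 2 F)} (hG : G ≤ monoGroup F) (hi : IsIrreducible G) :
    ∃ a b, ad a b ∈ G := by
  obtain ⟨g, hg, hgv⟩ := isIrreducible_iff.1 hi _ (vecInf_ne_zero (F := F))
  obtain ⟨a, b, rfl⟩ | ⟨a, b, rfl⟩ := mem_mono hG hg
  · exact absurd (mv_dg_inf a b) hgv
  · exact ⟨a, b, hg⟩

/-- A second system of imprimitivity is disjoint from the first one. -/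
theorem system_eq_pair {G : Subgroup (GLd 2 F)} (hG : G ≤ monoGroup F) (hi : IsIrreducible G)
    {S : Set (RSub 2 F)} (hS : IsSystem G S) (hne : S ≠ stdSys F) :
    ∃ w w' : F, w ≠ 0 ∧ w' ≠ 0 ∧ w ≠ w' ∧ S = {ell w, ell w'} := by
  obtain ⟨a, b, hab⟩ := exists_ad_mem hG hi
  obtain ⟨⟨v, v', hv, hv', hvv, rfl⟩, hperm⟩ := isSystem_iff.1 hS
  -- An antidiagonal element exchanges the two axes, so a system containing one axis contains both.
  have key : ∀ u u' : Fin 2 → F, ray u ≠ ray u' → ({ray u, ray u'} : Set (RSub 2 F)) ≠ stdSys F →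
      (∀ g ∈ G, ∀ V ∈ ({ray u, ray u'} : Set (RSub 2 F)),
        mv g V ∈ ({ray u, ray u'} : Set (RSub 2 F))) → ray u ≠ ellInf ∧ ray u ≠ ell 0 := by
    intro u u' _ hne' hp
    constructor
    · intro h
      apply hne'
      rcases hp _ hab _ (Or.inl rfl) with h1 | h1
      · rw [h, mv_ad_inf] at h1
        exact absurd h1 (ell_ne_ellInf 0)
      · rw [h, mv_ad_inf] at h1
        rw [← h1, h, stdSys, Set.pair_comm]
    · intro h
      apply hne'
      rcases hp _ hab _ (Or.inl rfl) with h1 | h1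
      · rw [h, mv_ad_zero] at h1
        exact absurd h1.symm (ell_ne_ellInf 0)
      · rw [h, mv_ad_zero] at h1
        rw [← h1, h, stdSys]
  obtain ⟨h1, h2⟩ := key v v' hvv hne hperm
  obtain ⟨h3, h4⟩ := key v' v hvv.symm (by rwa [Set.pair_comm])
    (by rw [Set.pair_comm]; exact hperm)
  obtain ⟨w, hw⟩ := (ray_cases hv).resolve_left h1
  obtain ⟨w', hw'⟩ := (ray_cases hv').resolve_left h3
  refine ⟨w, w', ?_, ?_, ?_, by rw [hw, hw']⟩
  · rintro rfl
    exact h2 hw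
  · rintro rfl
    exact h4 hw'
  · rintro rfl
    exact hvv (hw.trans hw'.symm)

end Monomial

/-- The invertible quaternions. -/
abbrev HU : Type := ℍ[ℝ]ˣ

/-! ### Reduction to reflections and passage to conjugate groups -/

section General

variable {F : Type*} [DivisionRing F]

theorem le_of_reflections {G H : Subgroup (GLd 2 F)} (hG : IsReflectionGroup G)
    (h : ∀ r ∈ G, IsReflection r → r ∈ H) : G ≤ H := by
  rw [← hG.2, Subgroup.closure_le]
  exact fun r hr => h r hr.1 hr.2

/-- The stabilizer of a subspace. -/
def stab (V : RSub 2 F) : Subgroup (GLd 2 F) where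
  carrier := {g | mv g V = V}
  one_mem' := mv_one V
  mul_mem' := by
    intro g h hg hh
    change mv (g * h) V = V
    rw [mv_mul, hh, hg]
  inv_mem' := by
    intro g hg
    change mv g⁻¹ V = V
    conv_lhs => rw [← hg, mv_inv_mv]

/-- The stabilizer of a line is a subgroup; if it contained all reflections it would contain `G`,
against irreducibility. -/
theorem exists_reflection_moving {G : Subgroup (GLd 2 F)} (hG : IsReflectionGroup G)
    (hi : IsIrreducible G) {v : Fin 2 → F} (hv : v ≠ 0) :
    ∃ r ∈ G, IsReflection r ∧ mv r (ray v) ≠ ray v := by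
  by_contra! hcon
  obtain ⟨g, hg, hgv⟩ := isIrreducible_iff.1 hi v hv
  exact hgv (le_of_reflections hG (H := stab (ray v)) hcon hg)

/-- Conjugation of `G` by `U`. -/
abbrev cj (U : GLd 2 F) (G : Subgroup (GLd 2 F)) : Subgroup (GLd 2 F) :=
  G.map (MulAut.conj U).toMonoidHom

theorem conj_cj (U : GLd 2 F) (G : Subgroup (GLd 2 F)) : Conj G (cj U G) := ⟨U, rfl⟩

theorem mem_cj {U g : GLd 2 F} {G : Subgroup (GLd 2 F)} (h : g ∈ G) : U * g * U⁻¹ ∈ cj U G :=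
  ⟨g, h, rfl⟩

theorem isReflection_conj_iff {g : GLd 2 F} (U : GLd 2 F) :
    IsReflection (U * g * U⁻¹) ↔ IsReflection g := by
  refine ⟨fun h => ?_, isReflection_conj U⟩
  have := isReflection_conj U⁻¹ h
  simpa [mul_assoc] using this

/-- Reflections of a conjugate group. -/
theorem forall_reflection_cj {U : GLd 2 F} {G : Subgroup (GLd 2 F)} {p : GLd 2 F → Prop} :
    (∀ r ∈ cj U G, IsReflection r → p r) ↔
      ∀ r ∈ G, IsReflection r → p (U * r * U⁻¹) := by
  constructor
  · intro h r hr hr'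
    exact h _ (mem_cj hr) (isReflection_conj U hr')
  · rintro h _ ⟨r, hr, rfl⟩ hr'
    exact h r hr ((isReflection_conj_iff U).1 hr')

theorem mv_dg_stdSys (a b : Fˣ) : mv (dg a b) '' stdSys F = stdSys F := by
  rw [stdSys, Set.image_pair, mv_dg_ell, mv_dg_inf]
  simp

theorem mv_ad_inv_ell_one (b : Fˣ) : mv (ad b b⁻¹) (ell 1) = ell ((b⁻¹ * b⁻¹ : Fˣ) : F) := by
  rw [mv_ad_ell _ _ one_ne_zero]
  simp

end General

theorem two_ne_zero_quat : (2 : ℍ[ℝ]) ≠ 0 := by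
  intro h
  have := congrArg (fun q : ℍ[ℝ] => q.re) h
  rw [← one_add_one_eq_two] at this
  simp at this

theorem neg_one_ne_one_quat : (-1 : ℍ[ℝ]) ≠ 1 := by
  intro h
  have := congrArg (fun q : ℍ[ℝ] => q.re) h
  simp at this
  norm_num at this

theorem neg_one_ne_one_unit : (-1 : HU) ≠ 1 := fun h =>
  neg_one_ne_one_quat (by simpa using congrArg Units.val h)

theorem sq_eq_one_unit {a : HU} (h : a * a = 1) : a = 1 ∨ a = -1 := by
  have h' : (a : ℍ[ℝ]) * a = 1 := by
    rw [← Units.val_mul, h, Units.val_one]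
  rcases mul_self_eq_one_iff.1 h' with h1 | h1
  · exact Or.inl (Units.ext h1)
  · exact Or.inr (Units.ext h1)

/-! ### The two shapes of a group with a second system -/

/-- All reflections are antidiagonal with entries of square `-1`. -/
def TypeOne (G : Subgroup (GLd 2 ℍ[ℝ])) : Prop :=
  G ≤ monoGroup ℍ[ℝ] ∧
    ∀ r ∈ G, IsReflection r → ∃ b : HU, b * b = -1 ∧ r = ad b b⁻¹

/-- `diag (-1, 1)` belongs to the group, and the antidiagonal reflections have entries
of square `± 1`. -/
def TypeTwo (G : Subgroup (GLd 2 ℍ[ℝ])) : Prop :=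
  G ≤ monoGroup ℍ[ℝ] ∧ dg (-1) 1 ∈ G ∧
    ∀ r ∈ G, IsReflection r → r = dg (-1) 1 ∨ r = dg 1 (-1) ∨
      ∃ b : HU, (b * b = 1 ∨ b * b = -1) ∧ r = ad b b⁻¹

theorem swap_sign_mem {G : Subgroup (GLd 2 ℍ[ℝ])} (hG : G ≤ monoGroup ℍ[ℝ])
    (hi : IsIrreducible G) : dg (-1) 1 ∈ G ↔ dg 1 (-1) ∈ G := by
  obtain ⟨a, b, hab⟩ := exists_ad_mem hG hi
  have h1 := fun {x} (h : x ∈ G) => G.mul_mem (G.mul_mem hab h) (G.inv_mem hab)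
  constructor
  · intro h
    have := h1 h
    rw [ad_inv, ad_mul_dg, ad_mul_ad] at this
    simpa using this
  · intro h
    have := h1 h
    rw [ad_inv, ad_mul_dg, ad_mul_ad] at this
    simpa using this

/-- The image of the slope `1` must be `±1`. It is `b a⁻¹` for a diagonal element and `a⁻²` for an
antidiagonal reflection, which pins down the entries. -/
theorem typeTwo_of_system {G : Subgroup (GLd 2 ℍ[ℝ])} (hG : G ≤ monoGroup ℍ[ℝ])
    (hi : IsIrreducible G) (hS : IsSystem G {ell 1, ell (-1)})
    (h : dg (-1) 1 ∈ G ∨ dg 1 (-1) ∈ G) : TypeTwo G := by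
  refine ⟨hG, ?_, ?_⟩
  · rcases h with h | h
    · exact h
    · exact (swap_sign_mem hG hi).2 h
  · intro r hr hr'
    have h1 := (isSystem_iff.1 hS).2 r hr (ell 1) (Or.inl rfl)
    obtain ⟨a, b, rfl⟩ | ⟨a, b, rfl⟩ := mem_mono hG hr
    · rw [mv_dg_ell, Set.mem_insert_iff, Set.mem_singleton_iff, ell_inj, ell_inj] at h1
      have h2 := isReflection_dg hr'
      obtain ⟨h3, rfl⟩ | ⟨rfl, h3⟩ := h2
      · left
        rw [dg_inj]
        refine ⟨?_, rfl⟩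
        have : ((a⁻¹ : HU) : ℍ[ℝ]) = 1 ∨ ((a⁻¹ : HU) : ℍ[ℝ]) = -1 := by simpa using h1
        rcases this with h4 | h4
        · exact absurd (inv_eq_one.1 (Units.ext h4)) h3
        · have h5 : a⁻¹ = -1 := Units.ext h4
          rw [← inv_inv a, h5]
          simp
      · right; left
        rw [dg_inj]
        refine ⟨rfl, ?_⟩
        have : (b : ℍ[ℝ]) = 1 ∨ (b : ℍ[ℝ]) = -1 := by simpa using h1
        rcases this with h4 | h4
        · exact absurd (Units.ext h4) h3
        · exact Units.ext h4
    · right; right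
      rw [isReflection_ad] at hr'
      subst hr'
      rw [mv_ad_inv_ell_one, Set.mem_insert_iff, Set.mem_singleton_iff, ell_inj, ell_inj] at h1
      refine ⟨a, ?_, rfl⟩
      have h2 : a⁻¹ * a⁻¹ = 1 ∨ a⁻¹ * a⁻¹ = -1 := by
        rcases h1 with h1 | h1
        · exact Or.inl (Units.ext h1)
        · exact Or.inr (Units.ext (by rw [h1]; simp))
      rw [← mul_inv_rev] at h2
      rcases h2 with h2 | h2
      · exact Or.inl (inv_eq_one.1 h2)
      · right
        rw [← inv_inv (a * a), h2]
        simp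

/-- The matrix with columns `(1, 1)` and `(1, -1)`. -/
noncomputable def hadamard : GLd 2 ℍ[ℝ] where
  val := !![1, 1; 1, -1]
  inv := !![2⁻¹, 2⁻¹; 2⁻¹, -2⁻¹]
  val_inv := by
    have := two_ne_zero_quat
    have h : (2 : ℍ[ℝ])⁻¹ + 2⁻¹ = 1 := by rw [← two_mul, mul_inv_cancel₀ this]
    simp [Matrix.one_fin_two, h]
  inv_val := by
    have := two_ne_zero_quat
    have h : (2 : ℍ[ℝ])⁻¹ + 2⁻¹ = 1 := by rw [← two_mul, mul_inv_cancel₀ this]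
    simp [Matrix.one_fin_two, h]

/-- The matrix `hadamard` interchanges the axes with the lines of slope `±1`, so it swaps the roles
of the two systems. -/
theorem hadamard_mv_one : mv hadamard (ell 1) = ell 0 := by
  have h := ray_eq_ell (y := (0 : ℍ[ℝ])) two_ne_zero_quat
  rw [zero_mul] at h
  rw [mv_ray, ← h]
  congr 2
  ext i : 1
  fin_cases i <;> simp [hadamard, vec, one_add_one_eq_two]

theorem hadamard_mv_neg : mv hadamard (ell (-1)) = ellInf := by
  rw [mv_ray, ← ray_eq_ellInf two_ne_zero_quat]
  congr 2
  ext i : 1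
  fin_cases i <;> simp [hadamard, vec, one_add_one_eq_two]

theorem hadamard_mv_zero : mv hadamard (ell 0) = ell 1 := by
  rw [mv_ray]
  congr 2
  ext i : 1
  fin_cases i <;> simp [hadamard, vec]

theorem hadamard_mv_inf : mv hadamard ellInf = ell (-1) := by
  rw [mv_ray]
  congr 2
  ext i : 1
  fin_cases i <;> simp [hadamard, vec]

/-- Swapping the two systems turns an antidiagonal reflection with entries `±1` into a diagonal one.
-/
theorem hadamard_conj : hadamard * ad 1 1 * hadamard⁻¹ = dg 1 (-1) := by
  rw [mul_inv_eq_iff_eq_mul]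
  ext1
  simp [hadamard, ad_val, dg_val]

theorem hadamard_conj_neg : hadamard * ad (-1) (-1) * hadamard⁻¹ = dg (-1) 1 := by
  rw [mul_inv_eq_iff_eq_mul]
  ext1
  simp [hadamard, ad_val, dg_val]

/-- Quaternionic square roots of an element that is not a negative real are unique up to sign. -/
theorem eq_or_neg_of_sq_eq {b c : ℍ[ℝ]} (h : b * b = c * c) (hb : b.re ≠ 0) : c = b ∨ c = -b := by
  have hn : Quaternion.normSq b = Quaternion.normSq c := by
    have h1 := congrArg Quaternion.normSq h
    rw [map_mul, map_mul] at h1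
    exact (mul_self_inj Quaternion.normSq_nonneg Quaternion.normSq_nonneg).1 h1
  rw [Quaternion.normSq_def', Quaternion.normSq_def'] at hn
  have e0 := congrArg (fun q : ℍ[ℝ] => q.re) h
  have e1 := congrArg (fun q : ℍ[ℝ] => q.imI) h
  have e2 := congrArg (fun q : ℍ[ℝ] => q.imJ) h
  have e3 := congrArg (fun q : ℍ[ℝ] => q.imK) h
  simp only [Quaternion.re_mul, Quaternion.imI_mul, Quaternion.imJ_mul, Quaternion.imK_mul]
    at e0 e1 e2 e3
  -- The real part of `b²` is `2 re(b)² - |b|²`, and the norms agree.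
  have hre : b.re ^ 2 = c.re ^ 2 := by linarith
  have e1' : b.re * b.imI = c.re * c.imI := by linarith
  have e2' : b.re * b.imJ = c.re * c.imJ := by linarith
  have e3' : b.re * b.imK = c.re * c.imK := by linarith
  rcases sq_eq_sq_iff_eq_or_eq_neg.1 hre with h0 | h0
  · left
    rw [h0] at e1' e2' e3' hb
    ext
    · exact h0.symm
    · exact (mul_left_cancel₀ hb e1').symm
    · exact (mul_left_cancel₀ hb e2').symm
    · exact (mul_left_cancel₀ hb e3').symm
  · right
    have hc : c.re ≠ 0 := by
      intro hc
      rw [hc, neg_zero] at h0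
      exact hb h0
    rw [h0] at e1' e2' e3'
    ext
    · simp [h0]
    · simpa using (mul_left_cancel₀ hc (by linarith : c.re * c.imI = c.re * (-b.imI)))
    · simpa using (mul_left_cancel₀ hc (by linarith : c.re * c.imJ = c.re * (-b.imJ)))
    · simpa using (mul_left_cancel₀ hc (by linarith : c.re * c.imK = c.re * (-b.imK)))

theorem mul_self_of_re_eq_zero {b : ℍ[ℝ]} (hb : b.re = 0) :
    b * b = ((-Quaternion.normSq b : ℝ) : ℍ[ℝ]) := by
  ext
  · simp only [Quaternion.re_mul, Quaternion.re_coe, Quaternion.normSq_def', hb]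
    ring
  · simp only [Quaternion.imI_mul, Quaternion.imI_coe, hb]
    ring
  · simp only [Quaternion.imJ_mul, Quaternion.imJ_coe, hb]
    ring
  · simp only [Quaternion.imK_mul, Quaternion.imK_coe, hb]
    ring

/-- Structure of an irreducible reflection group with a second system of imprimitivity. -/
theorem exists_type_of_pair {G : Subgroup (GLd 2 ℍ[ℝ])} (hR : IsReflectionGroup G)
    (hG : G ≤ monoGroup ℍ[ℝ]) (hi : IsIrreducible G) {c : ℍ[ℝ]} (hc0 : c ≠ 0) (hc1 : c ≠ 1)
    (hS : IsSystem G {ell 1, ell c}) : ∃ G', Conj G G' ∧ (TypeOne G' ∨ TypeTwo G') := by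
  have hperm := (isSystem_iff.1 hS).2
  -- A diagonal reflection fixing the slope `1` would be trivial, so it exchanges `1` and `c`; doing
  -- so in both directions forces `c² = 1`.
  by_cases hA : ∃ a b, dg a b ∈ G ∧ IsReflection (dg a b)
  · obtain ⟨a, b, hab, hr⟩ := hA
    have h1 := hperm _ hab (ell 1) (Or.inl rfl)
    have h2 := hperm _ hab (ell c) (Or.inr rfl)
    have hne : mv (dg a b) (ell 1) ≠ mv (dg a b) (ell c) :=
      fun h => hc1 (ell_inj.1 (mv_injective _ h)).symm
    rw [mv_dg_ell, Set.mem_insert_iff, Set.mem_singleton_iff, ell_inj, ell_inj] at h1 h2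
    rw [mv_dg_ell, mv_dg_ell, Ne, ell_inj] at hne
    have hc : c = -1 ∧ (dg (-1) 1 ∈ G ∨ dg 1 (-1) ∈ G) := by
      obtain ⟨ha, rfl⟩ | ⟨rfl, hb⟩ := isReflection_dg hr
      · have e1 : (a : ℍ[ℝ])⁻¹ = c := by
          rcases h1 with h1 | h1
          · refine absurd ?_ ha
            ext1
            simpa using h1
          · simpa using h1
        have e2 : c * (a : ℍ[ℝ])⁻¹ = 1 := by
          rcases h2 with h2 | h2
          · simpa using h2
          · exact absurd (by rw [h2]; simpa using e1) hne
        rw [e1] at e2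
        have hcc := (mul_self_eq_one_iff.1 e2).resolve_left hc1
        refine ⟨hcc, Or.inl ?_⟩
        have : a = -1 := by
          ext1
          rw [← inv_inv (a : ℍ[ℝ]), e1, hcc]
          simp
        rwa [this] at hab
      · have e1 : (b : ℍ[ℝ]) = c := by
          rcases h1 with h1 | h1
          · refine absurd ?_ hb
            ext1
            simpa using h1
          · simpa using h1
        have e2 : (b : ℍ[ℝ]) * c = 1 := by
          rcases h2 with h2 | h2
          · simpa using h2
          · exact absurd (by rw [h2]; simpa using e1) hne
        rw [e1] at e2
        have hcc := (mul_self_eq_one_iff.1 e2).resolve_left hc1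
        refine ⟨hcc, Or.inr ?_⟩
        have : b = -1 := by
          ext1
          rw [e1, hcc]
          simp
        rwa [this] at hab
    obtain ⟨rfl, h⟩ := hc
    exact ⟨G, Conj.refl G, Or.inr (typeTwo_of_system hG hi hS h)⟩
  have hB : ∀ r ∈ G, IsReflection r → ∃ b, r = ad b b⁻¹ := by
    intro r hr hr'
    obtain ⟨a, b, rfl⟩ | ⟨a, b, rfl⟩ := mem_mono hG hr
    · exact absurd ⟨a, b, hr, hr'⟩ hA
    · rw [isReflection_ad] at hr'
      exact ⟨a, by rw [hr']⟩
  -- Here `b = ±1` and the reflection acts on slopes by inversion. It fixes `1`, hence `c`, so again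
  -- `c = -1`, and `hadamard` reduces to the diagonal case.
  by_cases hC : ∃ b, ad b b⁻¹ ∈ G ∧ b * b = 1
  · obtain ⟨b, hb, hbb⟩ := hC
    have hb1 : b = 1 ∨ b = -1 := sq_eq_one_unit hbb
    have hcc : c = -1 := by
      have h1 := hperm _ hb (ell 1) (Or.inl rfl)
      have h2 := hperm _ hb (ell c) (Or.inr rfl)
      have hne : mv (ad b b⁻¹) (ell 1) ≠ mv (ad b b⁻¹) (ell c) :=
        fun h => hc1 (ell_inj.1 (mv_injective _ h)).symm
      rw [mv_ad_ell _ _ hc0, Set.mem_insert_iff, Set.mem_singleton_iff, ell_inj, ell_inj] at h2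
      have e1 : (((b⁻¹ : HU) : ℍ[ℝ]) * c⁻¹ * (b : ℍ[ℝ])⁻¹) = c⁻¹ := by
        rcases hb1 with rfl | rfl <;> simp
      rw [e1] at h2
      rcases h2 with h2 | h2
      · exact absurd (inv_eq_one.1 h2) hc1
      · have : c * c = 1 := by
          nth_rewrite 1 [← h2]
          exact inv_mul_cancel₀ hc0
        exact (mul_self_eq_one_iff.1 this).resolve_left hc1
    subst hcc
    refine ⟨cj hadamard G, conj_cj _ _, Or.inr (typeTwo_of_system ?_ ?_ ?_ ?_)⟩
    · rw [← isSystem_stdSys_iff]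
      have := hS.conj hadamard
      rwa [Set.image_pair, hadamard_mv_one, hadamard_mv_neg] at this
    · exact (conj_cj _ _).isIrreducible hi
    · have := (isSystem_stdSys_iff.2 hG).conj hadamard
      rwa [stdSys, Set.image_pair, hadamard_mv_zero, hadamard_mv_inf] at this
    · have := mem_cj (U := hadamard) hb
      rcases hb1 with rfl | rfl
      · right
        rwa [inv_one, hadamard_conj] at this
      · left
        rwa [show (-1 : HU)⁻¹ = -1 by simp, hadamard_conj_neg] at this
  -- In the remaining case every reflection moves the slope `1` to `c`, so all entries `b` have the
  -- same square.
  have hD : ∀ b : HU, ad b b⁻¹ ∈ G → ((b⁻¹ * b⁻¹ : HU) : ℍ[ℝ]) = c := by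
    intro b hb
    have h1 := hperm _ hb (ell 1) (Or.inl rfl)
    rw [mv_ad_inv_ell_one, Set.mem_insert_iff, Set.mem_singleton_iff, ell_inj, ell_inj] at h1
    rcases h1 with h1 | h1
    · refine absurd ⟨b, hb, ?_⟩ hC
      rw [← mul_inv_rev, Units.val_eq_one, inv_eq_one] at h1
      exact h1
    · exact h1
  have hsq : ∀ b b' : HU, ad b b⁻¹ ∈ G → ad b' b'⁻¹ ∈ G → (b : ℍ[ℝ]) * b = b' * b' := by
    intro b b' hb hb'
    have h1 : b⁻¹ * b⁻¹ = b'⁻¹ * b'⁻¹ := Units.ext ((hD b hb).trans (hD b' hb').symm)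
    rw [← mul_inv_rev, ← mul_inv_rev, inv_inj] at h1
    exact_mod_cast congrArg Units.val h1
  -- An entry `b` that is not purely imaginary is determined by its square up to sign. All
  -- reflections would then be `±` one matrix and preserve the line of slope `b⁻¹`.
  by_cases hE : ∃ b : HU, ad b b⁻¹ ∈ G ∧ (b : ℍ[ℝ]).re ≠ 0
  · exfalso
    obtain ⟨b, hb, hbre⟩ := hE
    obtain ⟨r, hr, hr', hrv⟩ := exists_reflection_moving hR hi (vec_ne_zero (b : ℍ[ℝ])⁻¹)
    obtain ⟨b', rfl⟩ := hB r hr hr'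
    apply hrv
    rw [mv_ad_ell _ _ (inv_ne_zero b.ne_zero), inv_inv]
    rcases eq_or_neg_of_sq_eq (hsq b b' hb hr) hbre with h | h
    · rw [Units.val_inv_eq_inv_val, h]
      simp
    · rw [Units.val_inv_eq_inv_val, h]
      simp [inv_neg]
  · push Not at hE
    obtain ⟨r, hr, hr', -⟩ := exists_reflection_moving hR hi (vec_ne_zero (1 : ℍ[ℝ]))
    obtain ⟨b, rfl⟩ := hB r hr hr'
    -- All entries are imaginary of the same norm; scaling one coordinate by the real number `ρ =
    -- |b|` makes every square equal to `-1`.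
    have hN : 0 < Quaternion.normSq (b : ℍ[ℝ]) :=
      lt_of_le_of_ne Quaternion.normSq_nonneg (Ne.symm (Quaternion.normSq_ne_zero.2 b.ne_zero))
    have hs : √(Quaternion.normSq (b : ℍ[ℝ])) ≠ 0 := (Real.sqrt_pos.2 hN).ne'
    have hρ0 : ((√(Quaternion.normSq (b : ℍ[ℝ])) : ℝ) : ℍ[ℝ]) ≠ 0 := by
      intro h0
      exact hs (by simpa using congrArg (fun q : ℍ[ℝ] => q.re) h0)
    obtain ⟨ρ, hρ⟩ : ∃ ρ : HU, (ρ : ℍ[ℝ]) = ((√(Quaternion.normSq (b : ℍ[ℝ])) : ℝ) : ℍ[ℝ]) :=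
      ⟨Units.mk0 _ hρ0, rfl⟩
    refine ⟨cj (dg 1 ρ) G, conj_cj _ _, Or.inl ⟨?_, ?_⟩⟩
    · rw [← isSystem_stdSys_iff, ← mv_dg_stdSys 1 ρ]
      exact (isSystem_stdSys_iff.2 hG).conj _
    · rw [forall_reflection_cj]
      intro r hr2 hr2'
      obtain ⟨b', rfl⟩ := hB r hr2 hr2'
      refine ⟨b' * ρ⁻¹, ?_, ?_⟩
      · have h1 := hsq b' b hr2 hr
        rw [mul_self_of_re_eq_zero (hE b hr)] at h1
        have hcomm : ∀ x : ℍ[ℝ], (ρ : ℍ[ℝ]) * x = x * ρ := by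
          intro x
          rw [hρ]
          exact Quaternion.coe_commutes _ _
        have h2 : (ρ : ℍ[ℝ]) * ρ = (Quaternion.normSq (b : ℍ[ℝ]) : ℝ) := by
          rw [hρ, ← Quaternion.coe_mul, Real.mul_self_sqrt hN.le]
        have hc2 : Commute ρ b' := Units.ext (by simpa using hcomm b')
        have h3 : b' * b' = -(ρ * ρ) := by
          ext1
          push_cast
          rw [h1, h2]
          simp
        have hc3 : ρ⁻¹ * b' = b' * ρ⁻¹ := hc2.inv_left.eq
        calc b' * ρ⁻¹ * (b' * ρ⁻¹) = b' * (ρ⁻¹ * b') * ρ⁻¹ := by group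
          _ = b' * b' * (ρ⁻¹ * ρ⁻¹) := by rw [hc3]; group
          _ = -1 := by rw [h3, neg_mul]; simp
      · rw [dg_inv, dg_mul_ad, ad_mul_dg, ad_inj]
        simp

/-- The second system has two nonzero slopes, and a diagonal matrix brings one of them to `1`
without moving the axes. -/
theorem exists_type {G : Subgroup (GLd 2 ℍ[ℝ])} (hR : IsReflectionGroup G)
    (hi : IsIrreducible G) (h : 1 < numSystems G) :
    ∃ G', Conj G G' ∧ (TypeOne G' ∨ TypeTwo G') := by
  obtain ⟨S, S', hS, hS', hne⟩ := Set.one_lt_encard_iff.1 h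
  obtain ⟨U, hU⟩ := IsSystem.exists_conj hS
  have h1 := conj_cj U G
  have hG1 : cj U G ≤ monoGroup ℍ[ℝ] := by
    rw [← isSystem_stdSys_iff, ← hU]
    exact hS.conj U
  have hi1 := h1.isIrreducible hi
  have hR1 := h1.isReflectionGroup hR
  obtain ⟨w, w', hw, hw', hww, hS1⟩ := system_eq_pair hG1 hi1 (hS'.conj U) (by
    rw [← hU]
    exact fun h => hne ((mv_injective U).image_injective h).symm)
  have hS2 : IsSystem (cj U G) {ell w, ell w'} := hS1 ▸ hS'.conj U
  obtain ⟨u, rfl⟩ : ∃ u : HU, (u : ℍ[ℝ]) = w := ⟨Units.mk0 w hw, rfl⟩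
  have h2 := conj_cj (dg 1 u⁻¹) (cj U G)
  have hS3 := hS2.conj (dg 1 u⁻¹)
  rw [Set.image_pair, mv_dg_ell, mv_dg_ell] at hS3
  have e1 : ((u⁻¹ : HU) : ℍ[ℝ]) * u * (((1 : HU) : ℍ[ℝ]))⁻¹ = 1 := by simp
  rw [e1] at hS3
  obtain ⟨G', hG', ht⟩ := exists_type_of_pair (h2.isReflectionGroup hR1)
    (by
      rw [← isSystem_stdSys_iff, ← mv_dg_stdSys 1 u⁻¹]
      exact (isSystem_stdSys_iff.2 hG1).conj _)
    (h2.isIrreducible hi1) (by simp [hw']) (by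
      intro h
      apply hww
      have h' : ((u⁻¹ : HU) : ℍ[ℝ]) * w' = 1 := by simpa using h
      rw [← Units.inv_mul u] at h'
      exact (mul_left_cancel₀ (Units.ne_zero _) h').symm) hS3
  exact ⟨G', (h1.trans h2).trans hG', ht⟩

/-! ### Criteria separating quaternionic from complex groups -/

/-- The inclusion of the invertible complex numbers in the invertible quaternions. -/
noncomputable abbrev cu : ℂˣ →* HU := Units.map (Quaternion.ofComplex : ℂ →* ℍ[ℝ])

theorem ofComplex_injective : Function.Injective (Quaternion.ofComplex : ℂ → ℍ[ℝ]) :=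
  (Quaternion.ofComplex : ℂ →+* ℍ[ℝ]).injective

theorem cu_injective : Function.Injective cu := Units.map_injective ofComplex_injective

theorem complexToQuaternion_injective : Function.Injective complexToQuaternion := by
  apply Units.map_injective
  intro A B h
  ext1 i j
  have := congrFun (congrFun h i) j
  exact ofComplex_injective this

theorem complexToQuaternion_dg (a b : ℂˣ) : complexToQuaternion (dg a b) = dg (cu a) (cu b) := by
  ext1
  ext1 i j
  fin_cases i <;> fin_cases j <;> simp [complexToQuaternion, dg_val]

theorem complexToQuaternion_ad (a b : ℂˣ) : complexToQuaternion (ad a b) = ad (cu a) (cu b) := by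
  ext1
  ext1 i j
  fin_cases i <;> fin_cases j <;> simp [complexToQuaternion, ad_val]

theorem isOfFinOrder_of_map {g : GLd 2 ℂ} (h : IsOfFinOrder (complexToQuaternion g)) :
    IsOfFinOrder g := by
  rwa [complexToQuaternion_injective.isOfFinOrder_iff] at h

theorem isReflection_of_complex {g : GLd 2 ℂ} (hg : g ∈ monoGroup ℂ)
    (h : IsReflection (complexToQuaternion g)) : IsReflection g := by
  obtain ⟨a, b, rfl⟩ | ⟨a, b, rfl⟩ := hg
  · have hf := isOfFinOrder_of_map h.1
    rw [complexToQuaternion_dg] at h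
    have h1 := isReflection_dg h
    simp only [ne_eq, map_eq_one_iff _ cu_injective] at h1
    exact dg_isReflection h1 hf
  · rw [complexToQuaternion_ad, isReflection_ad, ← map_inv] at h
    exact isReflection_ad.2 (cu_injective h)

/-- A quaternionic reflection group is not conjugate to a group of complex monomial matrices. -/
theorem false_of_complex {G : Subgroup (GLd 2 ℍ[ℝ])} (hG : IsImprimitiveQuaternionicRG G)
    (h : ∀ r ∈ G, IsReflection r → r ∈ (monoGroup ℂ).map complexToQuaternion) : False := by
  obtain ⟨hR, hi, -, hn⟩ := hG
  have hle : G ≤ (monoGroup ℂ).map complexToQuaternion := le_of_reflections hR h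
  have hmap : (G.comap complexToQuaternion).map complexToQuaternion = G := by
    rw [Subgroup.map_comap_eq, inf_eq_right]
    exact hle.trans (Subgroup.map_le_range _ _)
  have hmono : G.comap complexToQuaternion ≤ monoGroup ℂ := by
    intro g hg
    obtain ⟨g', hg', hgg⟩ := hle hg
    rwa [← complexToQuaternion_injective hgg]
  -- The preimage of `G` in `GL (ℂ ^ 2)` inherits finiteness, generation by reflections,
  -- irreducibility and the axes as a system.
  refine hn ⟨G.comap complexToQuaternion, ⟨⟨?_, ?_⟩, ?_, ?_⟩, by rw [hmap]; exact Conj.refl G⟩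
  · have := hR.1
    exact Finite.of_injective (fun g : G.comap complexToQuaternion =>
      (⟨complexToQuaternion g.1, g.2⟩ : G)) fun a b hab =>
        Subtype.ext (complexToQuaternion_injective (congrArg Subtype.val hab))
  · refine le_antisymm ((Subgroup.closure_le _).2 fun g hg => hg.1) ?_
    have hle2 : G ≤ (Subgroup.closure {g | g ∈ G.comap complexToQuaternion ∧ IsReflection g}).map
        complexToQuaternion := by
      refine le_of_reflections hR fun r hr hr' => ?_
      obtain ⟨s, hs, rfl⟩ := h r hr hr'
      exact ⟨s, Subgroup.subset_closure ⟨hr, isReflection_of_complex hs hr'⟩, rfl⟩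
    intro g hg
    obtain ⟨g', hg', hgg⟩ := hle2 hg
    rwa [← complexToQuaternion_injective hgg]
  · rw [isIrreducible_iff]
    intro v hv
    let v' : Fin 2 → ℍ[ℝ] := fun i => Quaternion.ofComplex (v i)
    have hv' : v' ≠ 0 := by
      intro h0
      apply hv
      ext1 i
      apply ofComplex_injective
      rw [Pi.zero_apply, map_zero]
      exact congrFun h0 i
    obtain ⟨g, hg, hgv⟩ := isIrreducible_iff.1 hi v' hv'
    obtain ⟨s, hs, rfl⟩ := hle hg
    refine ⟨s, hg, fun hsv => hgv ?_⟩
    rw [mv_ray] at hsv ⊢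
    have h1 : s.1 *ᵥ v ∈ ray v := hsv ▸ Submodule.mem_span_singleton_self _
    obtain ⟨a, ha⟩ := mem_ray.1 h1
    apply ray_eq_of_mem (mulVec_ne_zero _ hv')
    rw [mem_ray]
    refine ⟨Quaternion.ofComplex a, ?_⟩
    ext1 i
    have h2 := congrArg Quaternion.ofComplex (congrFun ha i)
    rw [map_mul] at h2
    rw [← h2]
    simp [complexToQuaternion, Matrix.mulVec, dotProduct, v']
  · exact ⟨_, isSystem_stdSys_iff.2 hmono⟩

/-- Squares of monomial `2 × 2` matrices are diagonal, and complex diagonal matrices commute. -/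
theorem sq_comm_of_mono {g h : GLd 2 ℂ} (hg : g ∈ monoGroup ℂ) (hh : h ∈ monoGroup ℂ) :
    g * g * (h * h) = h * h * (g * g) := by
  obtain ⟨a, b, rfl⟩ | ⟨a, b, rfl⟩ := hg <;> obtain ⟨c, d, rfl⟩ | ⟨c, d, rfl⟩ := hh <;>
    simp only [dg_mul_dg, ad_mul_ad] <;> rw [dg_inj] <;> constructor <;>
    simp only [mul_comm, mul_left_comm]

/-- In an imprimitive complex reflection group, squares commute. -/
theorem not_complex_of_sq {G : Subgroup (GLd 2 ℍ[ℝ])} {g h : GLd 2 ℍ[ℝ]} (hg : g ∈ G) (hh : h ∈ G)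
    (hgh : g * g * (h * h) ≠ h * h * (g * g)) :
    ¬ ∃ C : Subgroup (GLd 2 ℂ), IsImprimitiveComplexRG C ∧ Conj G (C.map complexToQuaternion) := by
  rintro ⟨C, ⟨-, -, S, hS⟩, U, hU⟩
  obtain ⟨V, hV⟩ := hS.exists_conj
  have hC : cj V C ≤ monoGroup ℂ := by
    rw [← isSystem_stdSys_iff, ← hV]
    exact hS.conj V
  have key : ∀ x ∈ G, ∃ c ∈ C, complexToQuaternion c = U * x * U⁻¹ := by
    intro x hx
    have : U * x * U⁻¹ ∈ C.map complexToQuaternion := hU ▸ mem_cj hx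
    exact this
  obtain ⟨c, hc, hcg⟩ := key g hg
  obtain ⟨d, hd, hdh⟩ := key h hh
  have h1 := sq_comm_of_mono (hC (mem_cj hc)) (hC (mem_cj hd))
  have h2 : c * c * (d * d) = d * d * (c * c) := by
    have h3 : V * (c * c * (d * d)) * V⁻¹ = V * (d * d * (c * c)) * V⁻¹ := by
      simpa [mul_assoc] using h1
    simpa using h3
  have h4 := congrArg complexToQuaternion h2
  simp only [map_mul, hcg, hdh] at h4
  apply hgh
  have h5 : U * (g * g * (h * h)) * U⁻¹ = U * (h * h * (g * g)) * U⁻¹ := by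
    simpa [mul_assoc] using h4
  simpa using h5

/-- A group conjugate to a complex one commutes with a square root of `-1`. -/
theorem not_complex_of_centralizer {G : Subgroup (GLd 2 ℍ[ℝ])}
    (h : ∀ T : Matrix (Fin 2) (Fin 2) ℍ[ℝ], (∀ g ∈ G, T * g.1 = g.1 * T) → T * T ≠ -1) :
    ¬ ∃ C : Subgroup (GLd 2 ℂ), IsImprimitiveComplexRG C ∧ Conj G (C.map complexToQuaternion) := by
  rintro ⟨C, -, U, hU⟩
  -- The scalar matrix `i` commutes with every complex matrix; conjugating it back gives a square
  -- root of `-1` commuting with `G`.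
  let I : Matrix (Fin 2) (Fin 2) ℍ[ℝ] := (Quaternion.ofComplex.mapMatrix :
    Matrix (Fin 2) (Fin 2) ℂ →ₐ[ℝ] Matrix (Fin 2) (Fin 2) ℍ[ℝ]) (Complex.I • 1)
  have hII : I * I = -1 := by
    simp only [I, ← map_mul]
    rw [smul_mul_smul_comm, Complex.I_mul_I, mul_one, neg_smul, one_smul, map_neg, map_one]
  refine h (U.2 * I * U.1) ?_ ?_
  · intro g hg
    have : U * g * U⁻¹ ∈ C.map complexToQuaternion := hU ▸ mem_cj hg
    obtain ⟨c, -, hc⟩ := this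
    have hcI : I * (complexToQuaternion c).1 = (complexToQuaternion c).1 * I := by
      change I * (Quaternion.ofComplex.mapMatrix :
        Matrix (Fin 2) (Fin 2) ℂ →ₐ[ℝ] Matrix (Fin 2) (Fin 2) ℍ[ℝ]) c.1 = (Quaternion.ofComplex.mapMatrix :
        Matrix (Fin 2) (Fin 2) ℂ →ₐ[ℝ] Matrix (Fin 2) (Fin 2) ℍ[ℝ]) c.1 * I
      simp only [I, ← map_mul]
      rw [smul_mul_assoc, one_mul, mul_smul_comm, mul_one]
    rw [hc] at hcI
    have h2 : I * (U.1 * g.1 * U.2) = U.1 * g.1 * U.2 * I := hcI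
    calc U.2 * I * U.1 * g.1 = U.2 * (I * (U.1 * g.1 * U.2)) * U.1 := by
          simp only [mul_assoc, U.inv_val, mul_one]
      _ = U.2 * (U.1 * g.1 * U.2 * I) * U.1 := by rw [h2]
      _ = (U.2 * U.1) * (g.1 * (U.2 * I * U.1)) := by simp only [mul_assoc]
      _ = g.1 * (U.2 * I * U.1) := by rw [U.inv_val, one_mul]
  · calc U.2 * I * U.1 * (U.2 * I * U.1) = U.2 * (I * (U.1 * U.2) * I) * U.1 := by
          simp only [mul_assoc]
      _ = -1 := by rw [U.val_inv, mul_one, hII]; simp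

theorem Conj.not_complex {G G' : Subgroup (GLd 2 ℍ[ℝ])} (h : Conj G G')
    (hG : ¬ ∃ C : Subgroup (GLd 2 ℂ), IsImprimitiveComplexRG C ∧
      Conj G (C.map complexToQuaternion)) :
    ¬ ∃ C : Subgroup (GLd 2 ℂ), IsImprimitiveComplexRG C ∧
      Conj G' (C.map complexToQuaternion) := by
  rintro ⟨C, hC, hC'⟩
  exact hG ⟨C, hC, h.trans hC'⟩

theorem Conj.isQuaternionic {G G' : Subgroup (GLd 2 ℍ[ℝ])} (h : Conj G G')
    (hG : IsImprimitiveQuaternionicRG G) : IsImprimitiveQuaternionicRG G' :=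
  ⟨h.isReflectionGroup hG.1, h.isIrreducible hG.2.1, h.isImprimitive hG.2.2.1,
    h.not_complex hG.2.2.2⟩

theorem numSystems_ne_zero {G : Subgroup (GLd 2 ℍ[ℝ])} (h : IsImprimitive G) :
    numSystems G ≠ 0 := by
  rw [numSystems, Set.encard_ne_zero]
  exact h

/-! ### Finite groups of quaternions -/

theorem re_mul_comm (a b : ℍ[ℝ]) : (a * b).re = (b * a).re := by
  simp only [Quaternion.re_mul]
  ring

/-- Conjugation of quaternions. -/
noncomputable def rot (q : HU) (v : ℍ[ℝ]) : ℍ[ℝ] := q * v * (q⁻¹ : HU)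

theorem rot_mul_left (q r : HU) (v : ℍ[ℝ]) : rot (q * r) v = rot q (rot r v) := by
  simp [rot, mul_assoc]

@[simp] theorem rot_one_left (v : ℍ[ℝ]) : rot 1 v = v := by simp [rot]

@[simp] theorem rot_neg_left (q : HU) (v : ℍ[ℝ]) : rot (-q) v = rot q v := by
  simp [rot]

@[simp] theorem rot_neg (q : HU) (v : ℍ[ℝ]) : rot q (-v) = -rot q v := by
  simp [rot]

theorem rot_add (q : HU) (v w : ℍ[ℝ]) : rot q (v + w) = rot q v + rot q w := by
  simp [rot, mul_add, add_mul]

theorem rot_mul (q : HU) (v w : ℍ[ℝ]) : rot q (v * w) = rot q v * rot q w := by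
  simp [rot, mul_assoc]

theorem rot_coe (q : HU) (r : ℝ) : rot q (r : ℍ[ℝ]) = r := by
  rw [rot, ← Quaternion.coe_commutes, mul_assoc, Units.mul_inv, mul_one]

theorem rot_smul (q : HU) (r : ℝ) (v : ℍ[ℝ]) : rot q (r • v) = r • rot q v := by
  simp [rot]

theorem rot_unit (q a : HU) : rot q a = ((q * a * q⁻¹ : HU) : ℍ[ℝ]) := by simp [rot]

@[simp] theorem rot_re (q : HU) (v : ℍ[ℝ]) : (rot q v).re = v.re := by
  rw [rot, re_mul_comm, ← mul_assoc, Units.inv_mul, one_mul]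

theorem rot_inv_rot (q : HU) (v : ℍ[ℝ]) : rot q⁻¹ (rot q v) = v := by
  rw [← rot_mul_left, inv_mul_cancel, rot_one_left]

theorem rot_injective (q : HU) : Function.Injective (rot q) :=
  Function.LeftInverse.injective (rot_inv_rot q)

theorem rot_eq_self_iff {q : HU} {v : ℍ[ℝ]} : rot q v = v ↔ (q : ℍ[ℝ]) * v = v * q := by
  rw [rot, Units.mul_inv_eq_iff_eq_mul]

/-- The group fixes an axis. -/
def HasAxis (K : Subgroup HU) : Prop :=
  ∃ p : ℍ[ℝ], p.re = 0 ∧ p ≠ 0 ∧ ∀ g ∈ K, rot g p = p ∨ rot g p = -p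

theorem normSq_eq_one {x : HU} (hx : IsOfFinOrder x) : Quaternion.normSq (x : ℍ[ℝ]) = 1 := by
  obtain ⟨n, hn, h⟩ := isOfFinOrder_iff_pow_eq_one.1 hx
  have h1 : Quaternion.normSq (x : ℍ[ℝ]) ^ n = 1 := by
    rw [← map_pow, ← Units.val_pow_eq_pow_val, h, Units.val_one, map_one]
  exact (pow_eq_one_iff_of_nonneg Quaternion.normSq_nonneg hn.ne').1 h1

theorem normSq_of_mem {K : Subgroup HU} (hK : (K : Set HU).Finite) {x : HU} (hx : x ∈ K) :
    Quaternion.normSq (x : ℍ[ℝ]) = 1 := by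
  have : Finite K := hK
  have h := isOfFinOrder_of_finite (⟨x, hx⟩ : K)
  exact normSq_eq_one (K.subtype.isOfFinOrder h)

theorem inv_eq_star {x : HU} (hx : Quaternion.normSq (x : ℍ[ℝ]) = 1) :
    ((x⁻¹ : HU) : ℍ[ℝ]) = star (x : ℍ[ℝ]) := by
  rw [Units.inv_eq_of_mul_eq_one_right]
  rw [Quaternion.self_mul_star, hx, Quaternion.coe_one]

/-- The imaginary part as a quaternion. -/
def imPart (x : ℍ[ℝ]) : ℍ[ℝ] := ⟨0, x.imI, x.imJ, x.imK⟩

@[simp] theorem imPart_re (x : ℍ[ℝ]) : (imPart x).re = 0 := rfl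
@[simp] theorem imPart_imI (x : ℍ[ℝ]) : (imPart x).imI = x.imI := rfl
@[simp] theorem imPart_imJ (x : ℍ[ℝ]) : (imPart x).imJ = x.imJ := rfl
@[simp] theorem imPart_imK (x : ℍ[ℝ]) : (imPart x).imK = x.imK := rfl

/-- The inner product of imaginary quaternions is `-(v * w).re`; with this convention the identity
is Rodrigues' rotation formula, with axis `imPart x`. -/
theorem rot_dot_identity {x : HU} (hx : Quaternion.normSq (x : ℍ[ℝ]) = 1) {v : ℍ[ℝ]}
    (hv : v.re = 0) :
    (rot x v * v).re = (1 - 2 * (x : ℍ[ℝ]).re ^ 2) * (-(v * v).re)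
      - 2 * (v * imPart x).re ^ 2 := by
  rw [Quaternion.normSq_def'] at hx
  have h1 : (x : ℍ[ℝ]).re ^ 2 = 1 - ((x : ℍ[ℝ]).imI ^ 2 + (x : ℍ[ℝ]).imJ ^ 2
    + (x : ℍ[ℝ]).imK ^ 2) := by linarith
  rw [rot, inv_eq_star (by rw [Quaternion.normSq_def']; linarith)]
  simp only [Quaternion.re_mul, Quaternion.imI_mul, Quaternion.imJ_mul, Quaternion.imK_mul,
    Quaternion.re_star, Quaternion.imI_star, Quaternion.imJ_star, Quaternion.imK_star,
    imPart_re, imPart_imI, imPart_imJ, imPart_imK, hv]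
  linear_combination (v.imI ^ 2 + v.imJ ^ 2 + v.imK ^ 2) * h1

theorem imPart_sq (x : ℍ[ℝ]) (hx : Quaternion.normSq x = 1) :
    -(imPart x * imPart x).re = 1 - x.re ^ 2 := by
  rw [Quaternion.normSq_def'] at hx
  simp only [Quaternion.re_mul, imPart_re, imPart_imI, imPart_imJ, imPart_imK]
  linarith

theorem neg_sq_re_nonneg {v : ℍ[ℝ]} (hv : v.re = 0) : 0 ≤ -(v * v).re := by
  simp only [Quaternion.re_mul, hv]
  nlinarith [sq_nonneg v.imI, sq_nonneg v.imJ, sq_nonneg v.imK]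

theorem eq_zero_of_sq_re {v : ℍ[ℝ]} (hv : v.re = 0) (h : (v * v).re = 0) : v = 0 := by
  simp only [Quaternion.re_mul, hv] at h
  have h1 : v.imI = 0 := by nlinarith [sq_nonneg v.imI, sq_nonneg v.imJ, sq_nonneg v.imK]
  have h2 : v.imJ = 0 := by nlinarith [sq_nonneg v.imI, sq_nonneg v.imJ, sq_nonneg v.imK]
  have h3 : v.imK = 0 := by nlinarith [sq_nonneg v.imI, sq_nonneg v.imJ, sq_nonneg v.imK]
  ext <;> simp [hv, h1, h2, h3]

/-- Imaginary vectors of equal length with maximal inner product agree. -/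
theorem eq_of_dot_eq {v w : ℍ[ℝ]} (hv : v.re = 0) (hw : w.re = 0)
    (h1 : (v * v).re = (w * w).re) (h2 : (v * w).re = (w * w).re) : v = w := by
  rw [← sub_eq_zero]
  apply eq_zero_of_sq_re
  · simp [hv, hw]
  · have h3 := re_mul_comm w v
    simp only [mul_sub, sub_mul, Quaternion.re_sub]
    linarith

theorem imPart_ne_zero {x : ℍ[ℝ]} (hx : Quaternion.normSq x = 1) (h1 : x ≠ 1) (h2 : x ≠ -1) :
    imPart x ≠ 0 := by
  intro h
  have e1 := congrArg (fun q : ℍ[ℝ] => q.imI) h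
  have e2 := congrArg (fun q : ℍ[ℝ] => q.imJ) h
  have e3 := congrArg (fun q : ℍ[ℝ] => q.imK) h
  simp only [imPart_imI, imPart_imJ, imPart_imK, Quaternion.imI_zero, Quaternion.imJ_zero, Quaternion.imK_zero] at e1 e2 e3
  rw [Quaternion.normSq_def', e1, e2, e3] at hx
  have : x.re * x.re = 1 := by linarith
  rcases mul_self_eq_one_iff.1 this with h | h
  · exact h1 (by ext <;> simp [*])
  · exact h2 (by ext <;> simp [*])

/-! ### Orders and traces in finite groups without axis -/

/-- In a finite group without axis all rotation angles are large. -/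
theorem re_sq_lt {K : Subgroup HU} (hK : (K : Set HU).Finite) (hax : ¬ HasAxis K) {x : HU}
    (hx : x ∈ K) (hx1 : x ≠ 1) (hx2 : x ≠ -1) : (x : ℍ[ℝ]).re ^ 2 < 3 / 4 := by
  by_contra hcon
  rw [not_lt] at hcon
  have hxn := normSq_of_mem hK hx
  set p := imPart (x : ℍ[ℝ]) with hp
  have hpre : p.re = 0 := rfl
  have hp0 : p ≠ 0 := imPart_ne_zero hxn (fun h => hx1 (Units.ext h))
    (fun h => hx2 (Units.ext (by simpa using h)))
  have hS := imPart_sq _ hxn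
  rw [← hp] at hS
  let O : Set ℍ[ℝ] := {v | ∃ g ∈ K, v = rot g p ∨ v = -rot g p}
  have hO : O.Finite := by
    refine ((hK.image fun g => rot g p).union (hK.image fun g => -rot g p)).subset ?_
    rintro v ⟨g, hg, rfl | rfl⟩
    · exact Or.inl ⟨g, hg, rfl⟩
    · exact Or.inr ⟨g, hg, rfl⟩
  have hO2 : (O \ {p, -p}).Nonempty := by
    by_contra hne
    apply hax
    refine ⟨p, hpre, hp0, fun g hg => ?_⟩
    by_contra h
    exact hne ⟨rot g p, ⟨g, hg, Or.inl rfl⟩, h⟩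
  -- Among the images of the axis and their negatives, other than `±p`, choose one closest to `p`.
  obtain ⟨v, ⟨hvO, hvp⟩, hmax⟩ :=
    (hO.subset Set.sdiff_subset).exists_maximalFor (fun v => -(v * p).re) (O \ {p, -p}) hO2
  simp only [Set.mem_insert_iff, Set.mem_singleton_iff, not_or] at hvp
  have hmax' : ∀ w ∈ O, w ≠ p → w ≠ -p → -(w * p).re ≤ -(v * p).re := by
    intro w hw h1 h2
    by_contra h
    rw [not_le] at h
    exact absurd (hmax (j := w) ⟨hw, by simp [h1, h2]⟩ h.le) (not_le.2 h)
  obtain ⟨g, hg, hvg⟩ := hvO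
  have hvre : v.re = 0 := by
    rcases hvg with rfl | rfl <;> simp [hpre]
  have hvv : (v * v).re = (p * p).re := by
    rcases hvg with rfl | rfl
    · rw [← rot_mul, rot_re]
    · rw [neg_mul_neg, ← rot_mul, rot_re]
  have hd0 : 0 ≤ -(v * p).re := by
    have hmem : -v ∈ O := by
      rcases hvg with rfl | rfl
      · exact ⟨g, hg, Or.inr rfl⟩
      · exact ⟨g, hg, Or.inl (neg_neg _)⟩
    have := hmax' (-v) hmem (fun h => hvp.2 (by rw [← h, neg_neg]))
      (fun h => hvp.1 (neg_injective h))
    rw [neg_mul, Quaternion.re_neg] at this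
    linarith
  have hid := rot_dot_identity hxn hvre
  rw [← hp, hvv, hS] at hid
  let h := g⁻¹ * x * g
  have hh : h ∈ K := K.mul_mem (K.mul_mem (K.inv_mem hg) hx) hg
  have hxg : x * g = g * h := by simp [h, mul_assoc]
  have hdot : (rot h p * p).re = (rot x v * v).re := by
    rw [← rot_re g, rot_mul, ← rot_mul_left, ← hxg]
    rcases hvg with rfl | rfl
    · rw [rot_mul_left]
    · rw [rot_mul_left, rot_neg, neg_mul_neg]
  have hlt : -(v * p).re < -(p * p).re := by
    have h1 : 0 ≤ -((v - p) * (v - p)).re := neg_sq_re_nonneg (by simp [hvre, hpre])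
    have h2 : ((v - p) * (v - p)).re ≠ 0 := fun h =>
      hvp.1 (sub_eq_zero.1 (eq_zero_of_sq_re (by simp [hvre, hpre]) h))
    have h3 := re_mul_comm p v
    have h4 : 0 < -((v - p) * (v - p)).re := lt_of_le_of_ne h1 (by
      intro h0
      exact h2 (by linarith))
    simp only [mul_sub, sub_mul, Quaternion.re_sub] at h4
    linarith
  rw [hS] at hlt
  have hpp : (p * p).re = -(1 - (x : ℍ[ℝ]).re ^ 2) := by linarith
  have hc1 : (x : ℍ[ℝ]).re ^ 2 ≤ 1 := by
    have := neg_sq_re_nonneg hpre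
    linarith
  set c2 := (x : ℍ[ℝ]).re ^ 2 with hc2
  set d := -(v * p).re with hd
  have hd2 : (v * p).re ^ 2 = d ^ 2 := by rw [hd]; ring
  rw [hd2] at hid
  by_cases e1 : rot h p = p
  · rw [e1, hid, hpp] at hdot
    nlinarith
  by_cases e2 : rot h p = -p
  · rw [e2, hid, neg_mul, Quaternion.re_neg, hpp] at hdot
    nlinarith
  -- With `S = 1 - c2`, the new inner product exceeds `d` by `(S - d)(1 - 2S - 2d)`, which is
  -- positive because `d < S ≤ 1/4`.
  · have h1 := hmax' _ ⟨h, hh, Or.inl rfl⟩ e1 e2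
    rw [hdot, hid] at h1
    nlinarith [mul_nonneg hd0 (sub_nonneg.2 hcon), mul_pos (sub_pos.2 hlt) (sub_pos.2 hlt)]

theorem cos_sq_ge {θ : ℝ} (h0 : 0 ≤ θ) (h1 : θ ≤ Real.pi / 6) : 3 / 4 ≤ Real.cos θ ^ 2 := by
  have h2 := Real.cos_le_cos_of_nonneg_of_le_pi h0 (by linarith [Real.pi_pos]) h1
  rw [Real.cos_pi_div_six] at h2
  have h3 : (√3 / 2) ^ 2 = 3 / 4 := by
    rw [div_pow, Real.sq_sqrt (by norm_num)]
    norm_num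
  rw [← h3]
  exact pow_le_pow_left₀ (by positivity) h2 2

/-- A nonreal unit quaternion lies in a copy of the complex numbers. -/
theorem exists_complex {x : ℍ[ℝ]} (hx : Quaternion.normSq x = 1) (h1 : x ≠ 1) (h2 : x ≠ -1) :
    ∃ (f : ℂ →ₐ[ℝ] ℍ[ℝ]) (z : ℂ), f z = x ∧ ∀ w : ℂ, (f w).re = w.re := by
  have hp0 := imPart_ne_zero hx h1 h2
  have hS := imPart_sq x hx
  have hSpos : 0 < 1 - x.re ^ 2 := by
    rw [← hS]
    refine lt_of_le_of_ne (neg_sq_re_nonneg rfl) fun h => ?_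
    exact hp0 (eq_zero_of_sq_re rfl (by linarith))
  obtain ⟨s, hs, hss⟩ : ∃ s : ℝ, s ≠ 0 ∧ s * s = 1 - x.re ^ 2 :=
    ⟨√(1 - x.re ^ 2), (Real.sqrt_pos.2 hSpos).ne', Real.mul_self_sqrt hSpos.le⟩
  have hu : (s⁻¹ • imPart x) * (s⁻¹ • imPart x) = -1 := by
    rw [smul_mul_smul_comm, mul_self_of_re_eq_zero rfl]
    have : Quaternion.normSq (imPart x) = s * s := by
      rw [hss, ← hS, Quaternion.normSq_def']
      simp only [Quaternion.re_mul, imPart_re, imPart_imI, imPart_imJ, imPart_imK]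
      ring
    rw [this]
    ext <;> simp
    field_simp
  refine ⟨Complex.lift ⟨_, hu⟩, ⟨x.re, s⟩, ?_, ?_⟩
  · rw [Complex.lift_apply, Complex.liftAux_apply]
    ext <;> simp [hs]
  · intro w
    rw [Complex.lift_apply, Complex.liftAux_apply]
    simp

/-- In a copy of `ℂ` the powers of `x` are all the `d`-th roots of unity, where `d` is its order. A
root of unity too close to `±1` contradicts `re_sq_lt`, so `d` is at most 10 if even and at most 5
if odd. -/
theorem pow_eq_pm_one {K : Subgroup HU} (hK : (K : Set HU).Finite) (hax : ¬ HasAxis K) {x : HU}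
    (hx : x ∈ K) : ∃ m, m ≤ 5 ∧ m ≠ 0 ∧ (x ^ m = 1 ∨ x ^ m = -1) := by
  by_cases hx1 : x = 1
  · exact ⟨1, by norm_num, by norm_num, Or.inl (by simp [hx1])⟩
  by_cases hx2 : x = -1
  · exact ⟨1, by norm_num, by norm_num, Or.inr (by simp [hx2])⟩
  have hn := normSq_of_mem hK hx
  obtain ⟨f, z, hfz, hre⟩ := exists_complex hn (fun h => hx1 (Units.ext h))
    (fun h => hx2 (Units.ext (by simpa using h)))
  have hfi : Function.Injective f := (f : ℂ →+* ℍ[ℝ]).injective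
  have hpow : ∀ n, ((x ^ n : HU) : ℍ[ℝ]) = f (z ^ n) := by
    intro n
    rw [map_pow, hfz, Units.val_pow_eq_pow_val]
  have hKf : Finite K := hK
  obtain ⟨N, hN, hN1⟩ := isOfFinOrder_iff_pow_eq_one.1
    (K.subtype.isOfFinOrder (isOfFinOrder_of_finite (⟨x, hx⟩ : K)))
  have hzf : IsOfFinOrder z := by
    refine isOfFinOrder_iff_pow_eq_one.2 ⟨N, hN, hfi ?_⟩
    rw [← hpow, map_one]
    exact congrArg Units.val hN1
  set d := orderOf z with hd
  have hd0 : 0 < d := hzf.orderOf_pos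
  have : NeZero d := ⟨hd0.ne'⟩
  have hprim : IsPrimitiveRoot z d := IsPrimitiveRoot.orderOf z
  have hbig : ∀ w : ℂ, w ^ d = 1 → 3 / 4 ≤ w.re ^ 2 → w = 1 ∨ w = -1 := by
    intro w hw hre2
    obtain ⟨n, -, rfl⟩ := hprim.eq_pow_of_pow_eq_one hw
    have h1 := re_sq_lt hK hax (K.pow_mem hx n)
    rw [hpow, hre] at h1
    by_contra! hcon
    have := h1 (fun h => hcon.1 (hfi (by rw [← hpow, h, map_one]; rfl)))
      (fun h => hcon.2 (hfi (by rw [← hpow, h, map_neg, map_one]; rfl)))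
    linarith
  have hζ := Complex.isPrimitiveRoot_exp d hd0.ne'
  set ζ := Complex.exp (2 * Real.pi * Complex.I / d) with hζd
  have hzre : ∀ m : ℕ, (ζ ^ m).re = Real.cos (2 * Real.pi * m / d) := by
    intro m
    rw [hζd, ← Complex.exp_nat_mul,
      show (m : ℂ) * (2 * Real.pi * Complex.I / d) = ((2 * Real.pi * m / d : ℝ) : ℂ) * Complex.I by
        push_cast; ring, Complex.exp_ofReal_mul_I_re]
  have hdR : (0 : ℝ) < d := by exact_mod_cast hd0
  have hpi := Real.pi_pos
  have hfin : ∀ m : ℕ, (z ^ m = 1 ∨ z ^ m = -1) → (x ^ m = 1 ∨ x ^ m = -1) := by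
    rintro m (h | h)
    · exact Or.inl (Units.ext (by rw [hpow, h, map_one]; rfl))
    · exact Or.inr (Units.ext (by rw [hpow, h, map_neg, map_one]; rfl))
  rcases Nat.even_or_odd' d with ⟨e, he | he⟩
  · refine ⟨e, ?_, by omega, hfin e ?_⟩
    · by_contra hcon
      have h12 : 12 ≤ d := by omega
      have h12R : (12 : ℝ) ≤ d := by exact_mod_cast h12
      have h1 := hbig ζ hζ.pow_eq_one (by
        have := hzre 1
        rw [pow_one, Nat.cast_one, mul_one] at this
        rw [this]
        refine cos_sq_ge (by positivity) ?_
        rw [div_le_div_iff₀ hdR (by norm_num)]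
        nlinarith)
      rcases h1 with h1 | h1
      · have := hζ.eq_orderOf
        rw [h1, orderOf_one] at this
        omega
      · have h2 : ζ ^ 2 = 1 := by rw [h1]; norm_num
        have := Nat.le_of_dvd (by norm_num) (hζ.dvd_of_pow_eq_one 2 h2)
        omega
    · have : (z ^ e) * (z ^ e) = 1 := by
        rw [← pow_add, ← two_mul, ← he, hd, pow_orderOf_eq_one]
      exact mul_self_eq_one_iff.1 this
  · refine ⟨d, ?_, by omega, hfin d (Or.inl (pow_orderOf_eq_one z))⟩
    by_contra hcon
    have h7 : 7 ≤ d := by omega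
    have h7R : (7 : ℝ) ≤ d := by exact_mod_cast h7
    -- For odd `d = 2 e + 1` this root is `-exp (π i / d)`, closer to `-1` than `ζ` is to `1`.
    have h1 := hbig (ζ ^ (e + 1)) (by rw [← pow_mul, mul_comm, pow_mul, hζ.pow_eq_one, one_pow]) (by
      rw [hzre]
      have heR : (d : ℝ) = 2 * e + 1 := by exact_mod_cast he
      have : 2 * Real.pi * ((e + 1 : ℕ) : ℝ) / d = Real.pi / d + Real.pi := by
        rw [eq_comm, div_add' _ _ _ hdR.ne', div_left_inj' hdR.ne', heR]
        push_cast
        ring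
      rw [this, Real.cos_add_pi, neg_sq]
      refine cos_sq_ge (by positivity) ?_
      rw [div_le_div_iff₀ hdR (by norm_num)]
      nlinarith)
    have h2 : ζ ^ ((e + 1) * 2) = 1 := by
      rw [pow_mul]
      rcases h1 with h1 | h1 <;> rw [h1] <;> norm_num
    rw [show (e + 1) * 2 = d + 1 by omega, pow_succ, hζ.pow_eq_one, one_mul] at h2
    have := hζ.eq_orderOf
    rw [h2, orderOf_one] at this
    omega

/-- Twice the real part. -/
def tr (x : ℍ[ℝ]) : ℝ := 2 * x.re

theorem sq_eq_tr {x : ℍ[ℝ]} (hx : Quaternion.normSq x = 1) : x * x = tr x • x - 1 := by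
  rw [Quaternion.normSq_def'] at hx
  ext
  · simp only [Quaternion.re_mul, Quaternion.re_sub, Quaternion.re_smul, Quaternion.re_one, tr,
      smul_eq_mul]
    linarith
  all_goals simp [tr]; ring

/-- The traces that occur in finite groups without axis. -/
def IsTrace (t : ℝ) : Prop :=
  t = 2 ∨ t = -2 ∨ t = 0 ∨ t ^ 2 = 1 ∨ t ^ 2 = 2 ∨ t ^ 4 - 3 * t ^ 2 + 1 = 0

/-- By `x² = t x - 1` each power of `x` is `a x - b` with polynomials `a`, `b` in the trace `t`. If
`x` is not real and `x ^ m = ±1`, then `a = 0`; for `m ≤ 5` this leaves the listed equations. -/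
theorem isTrace_of_mem {K : Subgroup HU} (hK : (K : Set HU).Finite) (hax : ¬ HasAxis K) {x : HU}
    (hx : x ∈ K) : IsTrace (tr x) := by
  have hn := normSq_of_mem hK hx
  by_cases hx1 : x = 1
  · exact Or.inl (by simp [hx1, tr])
  by_cases hx2 : x = -1
  · exact Or.inr (Or.inl (by simp [hx2, tr]))
  have hp0 := imPart_ne_zero hn (fun h => hx1 (Units.ext h))
    (fun h => hx2 (Units.ext (by simpa using h)))
  set t := tr x with ht
  have h2 := sq_eq_tr hn
  rw [← ht] at h2
  have step : ∀ a b : ℝ, (a • (x : ℍ[ℝ]) - b • 1) * x = (t * a - b) • (x : ℍ[ℝ]) - a • 1 := by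
    intro a b
    rw [sub_mul, smul_mul_assoc, h2, smul_mul_assoc, one_mul]
    module
  have p1 : (x : ℍ[ℝ]) ^ 1 = (1 : ℝ) • (x : ℍ[ℝ]) - (0 : ℝ) • 1 := by simp
  have p2 : (x : ℍ[ℝ]) ^ 2 = (t * 1 - 0) • (x : ℍ[ℝ]) - (1 : ℝ) • 1 := by
    rw [pow_succ, p1, step]
  have p3 : (x : ℍ[ℝ]) ^ 3 = (t * (t * 1 - 0) - 1) • (x : ℍ[ℝ]) - (t * 1 - 0) • 1 := by
    rw [pow_succ, p2, step]
  have p4 : (x : ℍ[ℝ]) ^ 4 = (t * (t * (t * 1 - 0) - 1) - (t * 1 - 0)) • (x : ℍ[ℝ])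
      - (t * (t * 1 - 0) - 1) • 1 := by
    rw [pow_succ, p3, step]
  have p5 : (x : ℍ[ℝ]) ^ 5 = (t * (t * (t * (t * 1 - 0) - 1) - (t * 1 - 0))
      - (t * (t * 1 - 0) - 1)) • (x : ℍ[ℝ])
      - (t * (t * (t * 1 - 0) - 1) - (t * 1 - 0)) • 1 := by
    rw [pow_succ, p4, step]
  have key : ∀ (m : ℕ) (a b : ℝ), (x : ℍ[ℝ]) ^ m = a • (x : ℍ[ℝ]) - b • 1 →
      (x ^ m = 1 ∨ x ^ m = -1) → a = 0 := by
    intro m a b h h'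
    by_contra ha
    apply hp0
    have h3 : (x : ℍ[ℝ]) ^ m = 1 ∨ (x : ℍ[ℝ]) ^ m = -1 := by
      rcases h' with h' | h'
      · left; rw [← Units.val_pow_eq_pow_val, h']; rfl
      · right; rw [← Units.val_pow_eq_pow_val, h']; rfl
    rw [h] at h3
    have e1 : a * (x : ℍ[ℝ]).imI = 0 := by
      rcases h3 with h3 | h3 <;> simpa using congrArg (fun q : ℍ[ℝ] => q.imI) h3
    have e2 : a * (x : ℍ[ℝ]).imJ = 0 := by
      rcases h3 with h3 | h3 <;> simpa using congrArg (fun q : ℍ[ℝ] => q.imJ) h3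
    have e3 : a * (x : ℍ[ℝ]).imK = 0 := by
      rcases h3 with h3 | h3 <;> simpa using congrArg (fun q : ℍ[ℝ] => q.imK) h3
    ext
    · rfl
    · simpa [ha] using e1
    · simpa [ha] using e2
    · simpa [ha] using e3
  obtain ⟨m, hm, hm0, h⟩ := pow_eq_pm_one hK hax hx
  have hm5 : m = 1 ∨ m = 2 ∨ m = 3 ∨ m = 4 ∨ m = 5 := by omega
  rcases hm5 with rfl | rfl | rfl | rfl | rfl
  · have := key 1 _ _ p1 h
    norm_num at this
  · have := key 2 _ _ p2 h
    exact Or.inr (Or.inr (Or.inl (by linarith)))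
  · have := key 3 _ _ p3 h
    exact Or.inr (Or.inr (Or.inr (Or.inl (by linarith))))
  · have := key 4 _ _ p4 h
    have h3 : t * (t ^ 2 - 2) = 0 := by linarith
    rcases mul_eq_zero.1 h3 with h3 | h3
    · exact Or.inr (Or.inr (Or.inl h3))
    · exact Or.inr (Or.inr (Or.inr (Or.inr (Or.inl (by linarith)))))
  · have := key 5 _ _ p5 h
    exact Or.inr (Or.inr (Or.inr (Or.inr (Or.inr (by linarith)))))

/-! ### The golden ratio and the explicit unit quaternions -/

theorem tau_sq : tau ^ 2 = tau + 1 := by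
  have h : √5 ^ 2 = 5 := Real.sq_sqrt (by norm_num)
  rw [tau]
  linear_combination h / 4

theorem tau_cu : tau ^ 3 = 2 * tau + 1 := by
  linear_combination (tau + 1) * tau_sq

theorem tau_bounds : 1.618 < tau ∧ tau < 1.6181 := by
  have h0 : 0 ≤ √5 := Real.sqrt_nonneg 5
  have h : √5 ^ 2 = 5 := Real.sq_sqrt (by norm_num)
  rw [tau]
  constructor <;> nlinarith

theorem inv_sqrt_two_sq : (√2)⁻¹ ^ 2 = 1 / 2 := by
  rw [inv_pow, Real.sq_sqrt (by norm_num)]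
  norm_num

/-- The imaginary quaternion with given coordinates. -/
def im3 (a b c : ℝ) : ℍ[ℝ] := ⟨0, a, b, c⟩

section Coordinates

variable (a b c : ℝ)

@[simp] theorem im3_re : (im3 a b c).re = 0 := rfl
@[simp] theorem im3_imI : (im3 a b c).imI = a := rfl
@[simp] theorem im3_imJ : (im3 a b c).imJ = b := rfl
@[simp] theorem im3_imK : (im3 a b c).imK = c := rfl

@[simp] theorem qi_re : qi.re = 0 := rfl
@[simp] theorem qi_imI : qi.imI = 1 := rfl
@[simp] theorem qi_imJ : qi.imJ = 0 := rfl
@[simp] theorem qi_imK : qi.imK = 0 := rfl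
@[simp] theorem qj_re : qj.re = 0 := rfl
@[simp] theorem qj_imI : qj.imI = 0 := rfl
@[simp] theorem qj_imJ : qj.imJ = 1 := rfl
@[simp] theorem qj_imK : qj.imK = 0 := rfl
@[simp] theorem qh_re : qh.re = 1 / 2 := rfl
@[simp] theorem qh_imI : qh.imI = 1 / 2 := rfl
@[simp] theorem qh_imJ : qh.imJ = 1 / 2 := rfl
@[simp] theorem qh_imK : qh.imK = 1 / 2 := rfl
@[simp] theorem qo_re : qo.re = (√2)⁻¹ := one_div _
@[simp] theorem qo_imI : qo.imI = (√2)⁻¹ := one_div _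
@[simp] theorem qo_imJ : qo.imJ = 0 := rfl
@[simp] theorem qo_imK : qo.imK = 0 := rfl
@[simp] theorem qx_re : qx.re = 0 := rfl
@[simp] theorem qx_imI : qx.imI = 0 := rfl
@[simp] theorem qx_imJ : qx.imJ = (√2)⁻¹ := one_div _
@[simp] theorem qx_imK : qx.imK = -(√2)⁻¹ := by
  change -(1 / √2) = _
  rw [one_div]
@[simp] theorem qt_re : qt.re = tau / 2 := rfl
@[simp] theorem qt_imI : qt.imI = (1 - tau) / 2 := rfl
@[simp] theorem qt_imJ : qt.imJ = -(1 / 2) := rfl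
@[simp] theorem qt_imK : qt.imK = 0 := rfl
@[simp] theorem qp_re : qp.re = 0 := rfl
@[simp] theorem qp_imI : qp.imI = -(tau / 2) := rfl
@[simp] theorem qp_imJ : qp.imJ = 1 / 2 := rfl
@[simp] theorem qp_imK : qp.imK = -((1 - tau) / 2) := rfl
@[simp] theorem qy_re : qy.re = 0 := rfl
@[simp] theorem qy_imI : qy.imI = 1 / 2 := rfl
@[simp] theorem qy_imJ : qy.imJ = (1 - tau) / 2 := rfl
@[simp] theorem qy_imK : qy.imK = tau / 2 := rfl

end Coordinates

theorem sig_eq : sig = 1 - tau := rfl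

/-- A quaternion of norm one as a unit. -/
noncomputable def ofNorm (q : ℍ[ℝ]) (h : Quaternion.normSq q = 1) : HU where
  val := q
  inv := star q
  val_inv := by rw [Quaternion.self_mul_star, h, Quaternion.coe_one]
  inv_val := by rw [Quaternion.star_mul_self, h, Quaternion.coe_one]

@[simp] theorem ofNorm_val (q : ℍ[ℝ]) (h : Quaternion.normSq q = 1) :
    ((ofNorm q h : HU) : ℍ[ℝ]) = q := rfl

theorem normSq_qi : Quaternion.normSq qi = 1 := by simp [Quaternion.normSq_def']
theorem normSq_qj : Quaternion.normSq qj = 1 := by simp [Quaternion.normSq_def']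
theorem normSq_qk : Quaternion.normSq (im3 0 0 1) = 1 := by simp [Quaternion.normSq_def']
theorem normSq_qh : Quaternion.normSq qh = 1 := by
  simp only [Quaternion.normSq_def', qh_re, qh_imI, qh_imJ, qh_imK]
  norm_num
theorem normSq_qo : Quaternion.normSq qo = 1 := by
  simp only [Quaternion.normSq_def', qo_re, qo_imI, qo_imJ, qo_imK, inv_sqrt_two_sq]
  norm_num
theorem normSq_qx : Quaternion.normSq qx = 1 := by
  simp only [Quaternion.normSq_def', qx_re, qx_imI, qx_imJ, qx_imK, inv_sqrt_two_sq, neg_sq]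
  norm_num
theorem normSq_qt : Quaternion.normSq qt = 1 := by
  simp only [Quaternion.normSq_def', qt_re, qt_imI, qt_imJ, qt_imK]
  linear_combination tau_sq / 2
theorem normSq_qp : Quaternion.normSq qp = 1 := by
  simp only [Quaternion.normSq_def', qp_re, qp_imI, qp_imJ, qp_imK]
  linear_combination tau_sq / 2
theorem normSq_qy : Quaternion.normSq qy = 1 := by
  simp only [Quaternion.normSq_def', qy_re, qy_imI, qy_imJ, qy_imK]
  linear_combination tau_sq / 2

/-- The quaternion `i` as a unit. -/
noncomputable def uI : HU := ofNorm qi normSq_qi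
/-- The quaternion `j` as a unit. -/
noncomputable def uJ : HU := ofNorm qj normSq_qj
/-- The quaternion `k` as a unit. -/
noncomputable def uK : HU := ofNorm (im3 0 0 1) normSq_qk
/-- `(1 + i + j + k) / 2` as a unit. -/
noncomputable def uQ : HU := ofNorm qh normSq_qh
/-- `(1 + i) / √2` as a unit. -/
noncomputable def uO : HU := ofNorm qo normSq_qo
/-- `(j - k) / √2` as a unit. -/
noncomputable def uX : HU := ofNorm qx normSq_qx
/-- `(τ + σ i - j) / 2` as a unit. -/
noncomputable def uT : HU := ofNorm qt normSq_qt
/-- `(j - τ i - σ k) / 2` as a unit. -/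
noncomputable def uP : HU := ofNorm qp normSq_qp
/-- `(i + σ j + τ k) / 2` as a unit. -/
noncomputable def uY : HU := ofNorm qy normSq_qy

@[simp] theorem uI_val : (uI : ℍ[ℝ]) = qi := rfl
@[simp] theorem uJ_val : (uJ : ℍ[ℝ]) = qj := rfl
@[simp] theorem uK_val : (uK : ℍ[ℝ]) = im3 0 0 1 := rfl
@[simp] theorem uQ_val : (uQ : ℍ[ℝ]) = qh := rfl
@[simp] theorem uO_val : (uO : ℍ[ℝ]) = qo := rfl
@[simp] theorem uX_val : (uX : ℍ[ℝ]) = qx := rfl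
@[simp] theorem uT_val : (uT : ℍ[ℝ]) = qt := rfl
@[simp] theorem uP_val : (uP : ℍ[ℝ]) = qp := rfl
@[simp] theorem uY_val : (uY : ℍ[ℝ]) = qy := rfl

theorem uI_mul_self : uI * uI = -1 := by ext <;> simp
theorem uJ_mul_self : uJ * uJ = -1 := by ext <;> simp
theorem uK_mul_self : uK * uK = -1 := by ext <;> simp
theorem uI_mul_uJ : uI * uJ = uK := by ext <;> simp

theorem uX_mul_self : uX * uX = -1 := by
  ext
  · simp only [Units.val_mul, Units.val_neg, Units.val_one, uX_val, Quaternion.re_mul, qx_re,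
      qx_imI, qx_imJ, qx_imK, Quaternion.re_neg, Quaternion.re_one]
    linear_combination (-2) * inv_sqrt_two_sq
  all_goals simp

theorem uP_mul_self : uP * uP = -1 := by
  ext
  · simp only [Units.val_mul, Units.val_neg, Units.val_one, uP_val, Quaternion.re_mul, qp_re,
      qp_imI, qp_imJ, qp_imK, Quaternion.re_neg, Quaternion.re_one]
    linear_combination (-1 / 2) * tau_sq
  all_goals simp; try ring

theorem uO_mul_self : uO * uO = uI := by
  have h := inv_sqrt_two_sq
  ext
  · simp
  · simp only [Units.val_mul, uO_val, uI_val, Quaternion.imI_mul, qo_re, qo_imI, qo_imJ, qo_imK,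
      qi_imI]
    linear_combination 2 * h
  all_goals simp

theorem uJ_mul_uO : uJ * uO = uX := by
  ext <;> simp

theorem uQ_mul_uI : uQ * uI = uJ * uQ := by
  ext <;> simp

theorem uQ_mul_uJ : uQ * uJ = uK * uQ := by
  ext <;> simp

theorem uK_mul_uT : uK * uT = uY := by
  ext <;> simp

theorem uT_mul_uT_mul_uK : uT * uT * uK = uP := by
  have h := tau_sq
  ext <;> simp <;> first | done | linarith

/-- This writes `i` as a word in the generators of `binI`. -/
theorem uT_relation : uQ * uT * (uQ * uT) = uT * uI := by
  have h := tau_sq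
  ext <;> simp <;> first | done | linarith

/-- This recovers `uQ` from two elements of order ten, `uT` and its conjugate by `uI`; it is how a
generator is found from two axes. -/
theorem uQ_relation (u : HU) (hu : u = uI * uT * uI⁻¹) : uQ * (uT * uT) = u⁻¹ := by
  rw [eq_inv_iff_mul_eq_one, hu]
  have h := tau_sq
  have h3 := tau_cu
  rw [← mul_assoc, mul_inv_eq_one]
  ext <;> simp <;> first | done | linarith

/-! ### The binary octahedral and icosahedral groups as stabilizers of vertex sets -/

/-- The binary octahedral group. -/
noncomputable def binO : Subgroup HU := Subgroup.closure {uO, uQ}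

/-- The binary icosahedral group. -/
noncomputable def binI : Subgroup HU := Subgroup.closure {uQ, uT}

theorem uO_mem : uO ∈ binO := Subgroup.subset_closure (Or.inl rfl)
theorem uQ_mem_O : uQ ∈ binO := Subgroup.subset_closure (Or.inr rfl)
theorem uI_mem_O : uI ∈ binO := uO_mul_self ▸ binO.mul_mem uO_mem uO_mem
theorem uQ_mem_I : uQ ∈ binI := Subgroup.subset_closure (Or.inl rfl)
theorem uT_mem : uT ∈ binI := Subgroup.subset_closure (Or.inr rfl)

theorem uI_mem_I : uI ∈ binI := by
  have h : uI = uT⁻¹ * (uQ * uT * (uQ * uT)) := by rw [uT_relation, inv_mul_cancel_left]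
  rw [h]
  have h1 := binI.mul_mem uQ_mem_I uT_mem
  exact binI.mul_mem (binI.inv_mem uT_mem) (binI.mul_mem h1 h1)

theorem uJ_mem_of {K : Subgroup HU} (hi : uI ∈ K) (hq : uQ ∈ K) : uJ ∈ K := by
  rw [← mul_inv_eq_iff_eq_mul.2 uQ_mul_uI]
  exact K.mul_mem (K.mul_mem hq hi) (K.inv_mem hq)

theorem uK_mem_of {K : Subgroup HU} (hi : uI ∈ K) (hq : uQ ∈ K) : uK ∈ K := by
  rw [← uI_mul_uJ]
  exact K.mul_mem hi (uJ_mem_of hi hq)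

theorem neg_one_mem_of {K : Subgroup HU} (hi : uI ∈ K) : -1 ∈ K := by
  rw [← uI_mul_self]
  exact K.mul_mem hi hi

theorem uX_mem : uX ∈ binO := by
  rw [← uJ_mul_uO]
  exact binO.mul_mem (uJ_mem_of uI_mem_O uQ_mem_O) uO_mem

theorem uP_mem : uP ∈ binI := by
  rw [← uT_mul_uT_mul_uK]
  exact binI.mul_mem (binI.mul_mem uT_mem uT_mem) (uK_mem_of uI_mem_I uQ_mem_I)

theorem uY_mem : uY ∈ binI := by
  rw [← uK_mul_uT]
  exact binI.mul_mem (uK_mem_of uI_mem_I uQ_mem_I) uT_mem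

theorem rot_eq_iff {q : HU} {v w : ℍ[ℝ]} : rot q v = w ↔ (q : ℍ[ℝ]) * v = w * q := by
  rw [rot, Units.mul_inv_eq_iff_eq_mul]

/-- Elements of norm one permuting a set of vectors. -/
def stabSet (A : Set ℍ[ℝ]) : Subgroup HU where
  carrier := {g | Quaternion.normSq (g : ℍ[ℝ]) = 1 ∧ ∀ v ∈ A, rot g v ∈ A ∧ rot g⁻¹ v ∈ A}
  one_mem' := by simp
  mul_mem' := by
    rintro g h ⟨hg, hg'⟩ ⟨hh, hh'⟩
    refine ⟨by rw [Units.val_mul, map_mul, hg, hh, one_mul], fun v hv => ⟨?_, ?_⟩⟩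
    · rw [rot_mul_left]
      exact (hg' _ (hh' v hv).1).1
    · rw [mul_inv_rev, rot_mul_left]
      exact (hh' _ (hg' v hv).2).2
  inv_mem' := by
    rintro g ⟨hg, hg'⟩
    refine ⟨?_, fun v hv => ⟨(hg' v hv).2, by rw [inv_inv]; exact (hg' v hv).1⟩⟩
    rw [inv_eq_star hg, Quaternion.normSq_star, hg]

/-- An injective map of a finite set into itself is onto, so the inverse needs no separate check. -/
theorem mem_stabSet {A : Set ℍ[ℝ]} (hA : A.Finite) {g : HU}
    (hg : Quaternion.normSq (g : ℍ[ℝ]) = 1) (h : ∀ v ∈ A, rot g v ∈ A) : g ∈ stabSet A := by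
  refine ⟨hg, fun v hv => ⟨h v hv, ?_⟩⟩
  have hb := (hA.injOn_iff_bijOn_of_mapsTo (f := rot g) h).1 (rot_injective g).injOn
  obtain ⟨w, hw, rfl⟩ := hb.surjOn hv
  rwa [rot_inv_rot]

/-- A quaternion commuting with `i` and `j` is real. -/
theorem eq_pm_one_of_rot {g : HU} (hg : Quaternion.normSq (g : ℍ[ℝ]) = 1) (h1 : rot g qi = qi)
    (h2 : rot g qj = qj) : g = 1 ∨ g = -1 := by
  rw [rot_eq_iff] at h1 h2
  have a1 := congrArg (fun q : ℍ[ℝ] => q.imJ) h1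
  have a2 := congrArg (fun q : ℍ[ℝ] => q.imK) h1
  have a3 := congrArg (fun q : ℍ[ℝ] => q.imK) h2
  simp at a1 a2 a3
  have b1 : (g : ℍ[ℝ]).imK = 0 := by linarith
  have b2 : (g : ℍ[ℝ]).imJ = 0 := by linarith
  have b3 : (g : ℍ[ℝ]).imI = 0 := by linarith
  rw [Quaternion.normSq_def', b1, b2, b3] at hg
  have h3 : (g : ℍ[ℝ]).re * (g : ℍ[ℝ]).re = 1 := by linarith
  rcases mul_self_eq_one_iff.1 h3 with h | h
  · left
    ext <;> simp [b1, b2, b3, h]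
  · right
    ext <;> simp [b1, b2, b3, h]

/-- An element is determined up to sign by the images of `p` and `q`, which range over a finite set.
-/
theorem stabSet_finite {A : Set ℍ[ℝ]} (hA : A.Finite) {p q : ℍ[ℝ]} (hp : p ∈ A) (hq : q ∈ A)
    (hpq : ∀ g : HU, Quaternion.normSq (g : ℍ[ℝ]) = 1 → rot g p = p → rot g q = q →
      g = 1 ∨ g = -1) : (stabSet A : Set HU).Finite := by
  have hf : ∀ b ∈ A ×ˢ A, ((stabSet A : Set HU) ∩ (fun g => (rot g p, rot g q)) ⁻¹' {b}).Finite := by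
    intro b _
    by_cases hne : ((stabSet A : Set HU) ∩ (fun g => (rot g p, rot g q)) ⁻¹' {b}).Nonempty
    · obtain ⟨g, hg, hgb⟩ := hne
      refine (Set.toFinite {g, -g}).subset ?_
      rintro h ⟨hh, hhb⟩
      have e : (rot h p, rot h q) = (rot g p, rot g q) := hhb.trans hgb.symm
      rw [Prod.mk.injEq] at e
      have hm := (stabSet A).mul_mem ((stabSet A).inv_mem hg) hh
      rcases hpq (g⁻¹ * h) hm.1 (by rw [rot_mul_left, e.1, rot_inv_rot])
        (by rw [rot_mul_left, e.2, rot_inv_rot]) with h1 | h1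
      · left
        rw [inv_mul_eq_one] at h1
        exact h1.symm
      · right
        rw [inv_mul_eq_iff_eq_mul] at h1
        rw [h1]
        simp
    · rw [Set.not_nonempty_iff_eq_empty.1 hne]
      exact Set.finite_empty
  refine ((hA.prod hA).biUnion hf).subset ?_
  intro g hg
  simp only [Set.mem_iUnion]
  exact ⟨(rot g p, rot g q), ⟨(hg.2 p hp).1, (hg.2 q hq).1⟩, hg, rfl⟩

/-- The six unit vectors along the coordinate axes. -/
def octSet : Set ℍ[ℝ] := {qi, -qi, qj, -qj, im3 0 0 1, -im3 0 0 1}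

/-- The twelve vertices of an icosahedron. -/
def icoSet : Set ℍ[ℝ] :=
  {im3 sig (-1) 0, im3 sig 1 0, im3 0 sig 1, im3 0 sig (-1), im3 1 0 sig, im3 (-1) 0 sig,
   -im3 sig (-1) 0, -im3 sig 1 0, -im3 0 sig 1, -im3 0 sig (-1), -im3 1 0 sig, -im3 (-1) 0 sig}

theorem octSet_finite : octSet.Finite := by
  simp only [octSet]
  exact Set.toFinite _

theorem icoSet_finite : icoSet.Finite := by
  simp only [icoSet]
  exact Set.toFinite _

theorem uI_qi : rot uI qi = qi := by rw [rot_eq_iff]; ext <;> simp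
theorem uI_qj : rot uI qj = -qj := by rw [rot_eq_iff]; ext <;> simp
theorem uJ_qi : rot uJ qi = -qi := by rw [rot_eq_iff]; ext <;> simp
theorem uJ_qj : rot uJ qj = qj := by rw [rot_eq_iff]; ext <;> simp
theorem uQ_qi : rot uQ qi = qj := by rw [rot_eq_iff]; ext <;> simp
theorem uQ_qj : rot uQ qj = im3 0 0 1 := by rw [rot_eq_iff]; ext <;> simp
theorem uQ_qk : rot uQ (im3 0 0 1) = qi := by rw [rot_eq_iff]; ext <;> simp
theorem uO_qi : rot uO qi = qi := by rw [rot_eq_iff]; ext <;> simp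
theorem uO_qj : rot uO qj = im3 0 0 1 := by rw [rot_eq_iff]; ext <;> simp
theorem uO_qk : rot uO (im3 0 0 1) = -qj := by rw [rot_eq_iff]; ext <;> simp

theorem uQ_im3 (a b c : ℝ) : rot uQ (im3 a b c) = im3 c a b := by
  rw [rot_eq_iff]; ext <;> simp <;> ring
theorem uI_im3 (a b c : ℝ) : rot uI (im3 a b c) = im3 a (-b) (-c) := by
  rw [rot_eq_iff]; ext <;> simp
theorem uJ_im3 (a b c : ℝ) : rot uJ (im3 a b c) = im3 (-a) b (-c) := by
  rw [rot_eq_iff]; ext <;> simp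
theorem neg_im3 (a b c : ℝ) : -im3 a b c = im3 (-a) (-b) (-c) := by
  ext <;> simp

/-- Together the next relations say that `uT` turns the icosahedron about this vertex and permutes
cyclically five vertices having equal inner product with it. -/
theorem uT_v1 : rot uT (im3 sig (-1) 0) = im3 sig (-1) 0 := by
  rw [rot_eq_iff]; ext <;> simp [sig_eq] <;> ring
theorem uT_v2 : rot uT (im3 sig 1 0) = -im3 0 sig 1 := by
  have h := tau_sq
  rw [rot_eq_iff]; ext <;> simp [sig_eq] <;> linarith
theorem uT_v3 : rot uT (im3 0 sig 1) = -im3 1 0 sig := by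
  have h := tau_sq
  rw [rot_eq_iff]; ext <;> simp [sig_eq] <;> linarith
theorem uT_v4 : rot uT (im3 0 sig (-1)) = -im3 sig 1 0 := by
  have h := tau_sq
  rw [rot_eq_iff]; ext <;> simp [sig_eq] <;> linarith
theorem uT_v5 : rot uT (im3 1 0 sig) = -im3 (-1) 0 sig := by
  have h := tau_sq
  rw [rot_eq_iff]; ext <;> simp [sig_eq] <;> linarith
theorem uT_v6 : rot uT (im3 (-1) 0 sig) = im3 0 sig (-1) := by
  have h := tau_sq
  rw [rot_eq_iff]; ext <;> simp [sig_eq] <;> linarith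

theorem binO_le : binO ≤ stabSet octSet := by
  rw [binO, Subgroup.closure_le]
  rintro g (rfl | rfl)
  · refine mem_stabSet octSet_finite normSq_qo ?_
    rintro v (rfl | rfl | rfl | rfl | rfl | rfl) <;>
      simp [uO_qi, uO_qj, uO_qk, octSet]
  · refine mem_stabSet octSet_finite normSq_qh ?_
    rintro v (rfl | rfl | rfl | rfl | rfl | rfl) <;>
      simp [uQ_qi, uQ_qj, uQ_qk, octSet]

theorem binI_le : binI ≤ stabSet icoSet := by
  rw [binI, Subgroup.closure_le]
  rintro g (rfl | rfl)
  · refine mem_stabSet icoSet_finite normSq_qh ?_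
    rintro v (rfl | rfl | rfl | rfl | rfl | rfl | rfl | rfl | rfl | rfl | rfl | rfl) <;>
      simp [uQ_im3, neg_im3, icoSet]
  · refine mem_stabSet icoSet_finite normSq_qt ?_
    rintro v (rfl | rfl | rfl | rfl | rfl | rfl | rfl | rfl | rfl | rfl | rfl | rfl) <;>
      simp [uT_v1, uT_v2, uT_v3, uT_v4, uT_v5, uT_v6, icoSet]

theorem sig_ne_zero : sig ≠ 0 := by
  have := tau_bounds
  rw [sig_eq]
  linarith

theorem eq_pm_one_of_rot_ico {g : HU} (hg : Quaternion.normSq (g : ℍ[ℝ]) = 1)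
    (h1 : rot g (im3 sig (-1) 0) = im3 sig (-1) 0) (h2 : rot g (im3 sig 1 0) = im3 sig 1 0) :
    g = 1 ∨ g = -1 := by
  have e1 : qi = (2 * sig)⁻¹ • (im3 sig (-1) 0 + im3 sig 1 0) := by
    have := sig_ne_zero
    ext <;> simp
    field_simp
    norm_num
  have e2 : qj = (2⁻¹ : ℝ) • (im3 sig 1 0 + -im3 sig (-1) 0) := by
    ext <;> simp
    norm_num
  refine eq_pm_one_of_rot hg ?_ ?_
  · rw [e1, rot_smul, rot_add, h1, h2]
  · rw [e2, rot_smul, rot_add, rot_neg, h1, h2]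

theorem binO_finite : (binO : Set HU).Finite :=
  (stabSet_finite octSet_finite (p := qi) (q := qj) (by simp [octSet]) (by simp [octSet])
    fun _ => eq_pm_one_of_rot).subset binO_le

theorem binI_finite : (binI : Set HU).Finite :=
  (stabSet_finite icoSet_finite (p := im3 sig (-1) 0) (q := im3 sig 1 0) (by simp [icoSet])
    (by simp [icoSet]) fun _ => eq_pm_one_of_rot_ico).subset binI_le

theorem neg_one_ne_zero_vec {v : ℍ[ℝ]} (hv : v ≠ 0) : v ≠ -v := by
  intro h
  apply hv
  have : (2 : ℍ[ℝ]) * v = 0 := by rw [two_mul]; nth_rewrite 2 [h]; simp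
  exact (mul_eq_zero.1 this).resolve_left two_ne_zero_quat

theorem qi_ne_zero : qi ≠ 0 := uI_val ▸ uI.ne_zero

/-- The group `binO` is transitive on the six vertices, and the stabilizer of `i` in it is
transitive on the four vertices orthogonal to `i`. After correcting by `binO`, a symmetry fixes `i`
and `j` and is `±1`. -/
theorem stabSet_octSet_le : stabSet octSet ≤ binO := by
  intro g hg
  have hI := uI_mem_O
  have hQ := uQ_mem_O
  have hJ := uJ_mem_of hI hQ
  have step1 : ∀ v ∈ octSet, ∃ h ∈ binO, rot h v = qi := by
    have hq : rot uQ⁻¹ qj = qi := by rw [← uQ_qi, rot_inv_rot]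
    rintro v (rfl | rfl | rfl | rfl | rfl | rfl)
    · exact ⟨1, binO.one_mem, rot_one_left _⟩
    · exact ⟨uJ, hJ, by rw [rot_neg, uJ_qi, neg_neg]⟩
    · exact ⟨uQ⁻¹, binO.inv_mem hQ, hq⟩
    · exact ⟨uJ * uQ⁻¹, binO.mul_mem hJ (binO.inv_mem hQ), by
        rw [rot_mul_left, rot_neg, hq, rot_neg, uJ_qi, neg_neg]⟩
    · exact ⟨uQ, hQ, uQ_qk⟩
    · exact ⟨uJ * uQ, binO.mul_mem hJ hQ, by
        rw [rot_mul_left, rot_neg, uQ_qk, rot_neg, uJ_qi, neg_neg]⟩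
  have step2 : ∀ v ∈ octSet, v ≠ qi → v ≠ -qi → ∃ h ∈ binO, rot h qi = qi ∧ rot h v = qj := by
    rintro v (rfl | rfl | rfl | rfl | rfl | rfl) h1 h2
    · exact absurd rfl h1
    · exact absurd rfl h2
    · exact ⟨1, binO.one_mem, rot_one_left _, rot_one_left _⟩
    · exact ⟨uI, hI, uI_qi, by rw [rot_neg, uI_qj, neg_neg]⟩
    · refine ⟨uO⁻¹, binO.inv_mem uO_mem, ?_, ?_⟩
      · conv_lhs => rw [← uO_qi, rot_inv_rot]
      · rw [← uO_qj, rot_inv_rot]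
    · exact ⟨uO, uO_mem, uO_qi, by rw [rot_neg, uO_qk, neg_neg]⟩
  have hqi : qi ∈ octSet := by simp [octSet]
  have hqj : qj ∈ octSet := by simp [octSet]
  obtain ⟨h, hh, hgi⟩ := step1 _ (hg.2 qi hqi).1
  rw [← rot_mul_left] at hgi
  have hg1 := (stabSet octSet).mul_mem (binO_le hh) hg
  have hne : qj ≠ qi ∧ qj ≠ -qi := by
    constructor <;> intro h <;> simpa using congrArg (fun q : ℍ[ℝ] => q.imJ) h
  obtain ⟨h', hh', hh'i, hgj⟩ := step2 _ (hg1.2 qj hqj).1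
    (fun e => hne.1 (rot_injective (h * g) (e.trans hgi.symm)))
    (fun e => hne.2 (rot_injective (h * g) (by rw [e, rot_neg, hgi])))
  rw [← rot_mul_left] at hgj
  have hg2 := (stabSet octSet).mul_mem (binO_le hh') hg1
  have hfix := eq_pm_one_of_rot hg2.1 (by rw [rot_mul_left, hgi, hh'i]) hgj
  have hmem : h' * (h * g) ∈ binO := by
    rcases hfix with e | e <;> rw [e]
    · exact binO.one_mem
    · exact neg_one_mem_of hI
  have := binO.mul_mem (binO.inv_mem hh) (binO.mul_mem (binO.inv_mem hh') hmem)
  simpa [mul_assoc] using this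

theorem re_mul_im3 (a b c a' b' c' : ℝ) :
    (im3 a b c * im3 a' b' c').re = -(a * a' + b * b' + c * c') := by
  simp only [Quaternion.re_mul, im3_re, im3_imI, im3_imJ, im3_imK]
  ring

theorem exists_rot_icoSet {v : ℍ[ℝ]} (hv : v ∈ icoSet) :
    ∃ h ∈ binI, rot h v = im3 sig (-1) 0 := by
  have hI := uI_mem_I
  have hQ := uQ_mem_I
  have hJ := uJ_mem_of hI hQ
  have m := fun {x y} (hx : x ∈ binI) (hy : y ∈ binI) => binI.mul_mem hx hy
  revert v
  rintro v (rfl | rfl | rfl | rfl | rfl | rfl | rfl | rfl | rfl | rfl | rfl | rfl)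
  · exact ⟨1, binI.one_mem, rot_one_left _⟩
  · exact ⟨uI, hI, by simp [uI_im3]⟩
  · exact ⟨uI * (uQ * uQ), m hI (m hQ hQ), by simp [rot_mul_left, uI_im3, uQ_im3]⟩
  · exact ⟨uQ * uQ, m hQ hQ, by simp [rot_mul_left, uQ_im3]⟩
  · exact ⟨uI * uQ, m hI hQ, by simp [rot_mul_left, uI_im3, uQ_im3]⟩
  · exact ⟨uQ, hQ, by simp [uQ_im3]⟩
  · exact ⟨uI * uJ, m hI hJ, by simp [rot_mul_left, uI_im3, uJ_im3, neg_im3]⟩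
  · exact ⟨uJ, hJ, by simp [uJ_im3, neg_im3]⟩
  · exact ⟨uJ * (uQ * uQ), m hJ (m hQ hQ), by
      simp [rot_mul_left, uJ_im3, uQ_im3, neg_im3]⟩
  · exact ⟨uI * uJ * (uQ * uQ), m (m hI hJ) (m hQ hQ), by
      simp [rot_mul_left, uI_im3, uJ_im3, uQ_im3, neg_im3]⟩
  · exact ⟨uJ * uQ, m hJ hQ, by simp [rot_mul_left, uJ_im3, uQ_im3, neg_im3]⟩
  · exact ⟨uI * uJ * uQ, m (m hI hJ) hQ, by
      simp [rot_mul_left, uI_im3, uJ_im3, uQ_im3, neg_im3]⟩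

/-- As for the octahedron: `binI` is transitive on vertices, and the powers of `uT` are transitive
on the five vertices at the given inner product with its axis. -/
theorem stabSet_icoSet_le : stabSet icoSet ≤ binI := by
  intro g hg
  have hI := uI_mem_I
  have hQ := uQ_mem_I
  have hJ := uJ_mem_of hI hQ
  have hT := uT_mem
  have step2 : ∀ v ∈ icoSet, (v * im3 sig (-1) 0).re = (im3 sig 1 0 * im3 sig (-1) 0).re →
      ∃ h ∈ binI, rot h (im3 sig (-1) 0) = im3 sig (-1) 0 ∧ rot h v = im3 sig 1 0 := by
    have hb := tau_bounds
    have hs := sig_eq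
    have hsq : sig * sig = sig + 1 := by
      rw [sig_eq]
      linear_combination tau_sq
    have hp : ∀ n : ℕ, rot (uT ^ n) (im3 sig (-1) 0) = im3 sig (-1) 0 := by
      intro n
      induction n with
      | zero => simp
      | succ n ih => rw [pow_succ, rot_mul_left, uT_v1, ih]
    rintro v (rfl | rfl | rfl | rfl | rfl | rfl | rfl | rfl | rfl | rfl | rfl | rfl) hv <;>
      simp only [neg_im3, re_mul_im3] at hv
    · exfalso; linarith
    · exact ⟨1, binI.one_mem, by simp, by simp⟩
    · exfalso; linarith
    · exfalso; linarith
    · exact ⟨uT ^ 3, binI.pow_mem hT 3, hp 3, by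
        simp [pow_succ, rot_mul_left, uT_v5, uT_v6, uT_v4]⟩
    · exfalso; linarith
    · exfalso; linarith
    · exfalso; linarith
    · exact ⟨uT ^ 4, binI.pow_mem hT 4, hp 4, by
        simp [pow_succ, rot_mul_left, uT_v3, uT_v5, uT_v6, uT_v4]⟩
    · exact ⟨uT ^ 1, binI.pow_mem hT 1, hp 1, by simp [uT_v4]⟩
    · exfalso; linarith
    · exact ⟨uT ^ 2, binI.pow_mem hT 2, hp 2, by
        simp [pow_succ, rot_mul_left, uT_v6, uT_v4]⟩
  have hm1 : im3 sig (-1) 0 ∈ icoSet := by simp [icoSet]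
  have hm2 : im3 sig 1 0 ∈ icoSet := by simp [icoSet]
  obtain ⟨h, hh, hg1⟩ := exists_rot_icoSet (hg.2 _ hm1).1
  rw [← rot_mul_left] at hg1
  have hs1 := (stabSet icoSet).mul_mem (binI_le hh) hg
  obtain ⟨h', hh', hh'1, hg2⟩ := step2 _ (hs1.2 _ hm2).1 (by
    conv_lhs => rw [← hg1, ← rot_mul, rot_re])
  rw [← rot_mul_left] at hg2
  have hs2 := (stabSet icoSet).mul_mem (binI_le hh') hs1
  have hfix := eq_pm_one_of_rot_ico hs2.1 (by rw [rot_mul_left, hg1, hh'1]) hg2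
  have hmem : h' * (h * g) ∈ binI := by
    rcases hfix with e | e <;> rw [e]
    · exact binI.one_mem
    · exact neg_one_mem_of hI
  have := binI.mul_mem (binI.inv_mem hh) (binI.mul_mem (binI.inv_mem hh') hmem)
  simpa [mul_assoc] using this

/-! ### Moving axes into standard position, and sums of traces -/

/-- Conjugate subgroups of the invertible quaternions. -/
noncomputable abbrev kc (q : HU) (K : Subgroup HU) : Subgroup HU := K.map (MulAut.conj q).toMonoidHom

theorem mem_kc {q x : HU} {K : Subgroup HU} (h : x ∈ K) : q * x * q⁻¹ ∈ kc q K := ⟨x, h, rfl⟩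

theorem kc_finite {q : HU} {K : Subgroup HU} (hK : (K : Set HU).Finite) :
    (kc q K : Set HU).Finite := hK.image _

theorem kc_hasAxis {q : HU} {K : Subgroup HU} (hK : ¬ HasAxis K) : ¬ HasAxis (kc q K) := by
  rintro ⟨p, hp, hp0, h⟩
  refine hK ⟨rot q⁻¹ p, by simp [hp], ?_, fun g hg => ?_⟩
  · intro h0
    apply hp0
    have := congrArg (rot q) h0
    rw [← rot_mul_left, mul_inv_cancel, rot_one_left] at this
    simpa [rot] using this
  · have h1 := h _ (mem_kc hg)
    rw [rot_mul_left, rot_mul_left] at h1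
    rcases h1 with h1 | h1
    · left
      have := congrArg (rot q⁻¹) h1
      rwa [rot_inv_rot] at this
    · right
      have := congrArg (rot q⁻¹) h1
      rwa [rot_inv_rot, rot_neg] at this

/-- For `q = 1 - e u` both `q u` and `e q` equal `e + u`, and `q` vanishes only for `u = -e`. -/
theorem exists_rot_eq {e u : ℍ[ℝ]} (he : e * e = -1) (hu : u * u = -1) (h : u ≠ -e) :
    ∃ q : HU, (q : ℍ[ℝ]) = 1 - e * u ∧ rot q u = e := by
  have h0 : 1 - e * u ≠ 0 := by
    intro h0
    apply h
    have h1 : e * (e * u) = e := by rw [← sub_eq_zero.1 h0, mul_one]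
    rw [← mul_assoc, he, neg_one_mul] at h1
    rw [← h1, neg_neg]
  refine ⟨Units.mk0 _ h0, rfl, ?_⟩
  rw [rot_eq_iff, Units.val_mk0, sub_mul, mul_sub, mul_assoc, hu, ← mul_assoc, he]
  simp [add_comm]

/-- Two anticommuting square roots of `-1` can be moved to `i` and `j`. -/
theorem exists_frame {u v : ℍ[ℝ]} (hu : u * u = -1) (hv : v * v = -1) (huv : u * v = -(v * u)) :
    ∃ q : HU, rot q u = qi ∧ rot q v = qj := by
  have hi : qi * qi = -1 := congrArg Units.val uI_mul_self
  have hj : qj * qj = -1 := congrArg Units.val uJ_mul_self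
  have hij : qi * qj = -(qj * qi) := by ext <;> simp
  have h1 : ∃ q : HU, rot q u = qi := by
    by_cases h : u = -qi
    · exact ⟨uJ, by rw [h, rot_neg, uJ_qi, neg_neg]⟩
    · obtain ⟨q, -, hq⟩ := exists_rot_eq hi hu h
      exact ⟨q, hq⟩
  obtain ⟨q, hq⟩ := h1
  have hv' : rot q v * rot q v = -1 := by
    rw [← rot_mul, hv]
    simp [rot]
  have huv' : qi * rot q v = -(rot q v * qi) := by
    rw [← hq, ← rot_mul, huv, rot_neg, rot_mul]
  by_cases h : rot q v = -qj
  · exact ⟨uI * q, by rw [rot_mul_left, hq, uI_qi],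
      by rw [rot_mul_left, h, rot_neg, uI_qj, neg_neg]⟩
  · obtain ⟨r, hr, hrj⟩ := exists_rot_eq hj hv' h
    -- The element `r = 1 - j (rot q v)` commutes with `i`, because `i` anticommutes with both
    -- factors of the product. Hence the second rotation keeps `i` in place.
    refine ⟨r * q, ?_, by rw [rot_mul_left, hrj]⟩
    rw [rot_mul_left, hq, rot_eq_iff, hr, sub_mul, mul_sub, one_mul, mul_one, mul_assoc,
      ← mul_assoc qi, hij, neg_mul, mul_assoc, huv', mul_neg, neg_neg]

theorem anticomm_of_re {u v : ℍ[ℝ]} (hu : u.re = 0) (hv : v.re = 0) (h : (u * v).re = 0) :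
    u * v = -(v * u) := by
  simp only [Quaternion.re_mul, hu, hv] at h
  ext
  · simp [hu, hv]; linarith
  all_goals simp [hu, hv]; try ring

theorem trace_values {t : ℝ} (h : IsTrace t) (h0 : 0 < t) (h2 : t < 2) :
    t = 1 ∨ (1.414 < t ∧ t < 1.4143) ∨ t = tau ∨ t = tau - 1 := by
  have hb := tau_bounds
  rcases h with h | h | h | h | h | h
  · linarith
  · linarith
  · linarith
  · left; nlinarith
  · right; left; constructor <;> nlinarith
  · have h3 : (t - tau) * (t - (tau - 1)) * ((t + tau) * (t + (tau - 1))) = 0 := by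
      have e1 : (t - tau) * (t - (tau - 1)) = t ^ 2 - (2 * tau - 1) * t + 1 := by
        linear_combination tau_sq
      have e2 : (t + tau) * (t + (tau - 1)) = t ^ 2 + (2 * tau - 1) * t + 1 := by
        linear_combination tau_sq
      rw [e1, e2]
      linear_combination h - 4 * t ^ 2 * tau_sq
    have h4 : (t + tau) * (t + (tau - 1)) ≠ 0 := by
      have : 0 < (t + tau) * (t + (tau - 1)) := mul_pos (by linarith) (by linarith)
      exact this.ne'
    rcases mul_eq_zero.1 ((mul_eq_zero.1 h3).resolve_right h4) with h5 | h5
    · exact Or.inr (Or.inr (Or.inl (by linarith)))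
    · exact Or.inr (Or.inr (Or.inr (by linarith)))

/-- Among `1, √2, τ, τ - 1` the only two values adding up to `2` are `1` and `1`. This is applied to
the traces of `x y` and `x y⁻¹`, whose sum is `tr x · tr y`. -/
theorem trace_pair_two {t : ℝ} (h : IsTrace t) (h' : IsTrace (2 - t)) (h0 : 0 < t) (h2 : t < 2) :
    t = 1 := by
  have hb := tau_bounds
  rcases trace_values h h0 h2 with e | e | e | e
  · exact e
  all_goals
    exfalso
    rcases trace_values h' (by linarith) (by linarith) with e' | e' | e' | e' <;> linarith

/-- Here the prescribed sum is `τ² = τ + 1`, and only `1` and `τ` add up to it. -/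
theorem trace_pair_tau {t : ℝ} (h : IsTrace t) (h' : IsTrace (tau + 1 - t)) (h0 : tau + 1 - t < 2)
    (h2 : t < 2) : t = 1 ∨ t = tau := by
  have hb := tau_bounds
  rcases trace_values h (by linarith) h2 with e | e | e | e
  · exact Or.inl e
  · exfalso
    rcases trace_values h' (by linarith) (by linarith) with e' | e' | e' | e' <;> linarith
  · exact Or.inr e
  · linarith

theorem mul_self_neg_one {v : ℍ[ℝ]} (hv : v.re = 0) (h : (v * v).re = -1) : v * v = -1 := by
  rw [mul_self_of_re_eq_zero hv] at h ⊢
  rw [Quaternion.re_coe] at h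
  rw [h]
  simp

theorem re_of_sq {v : ℍ[ℝ]} (h : v * v = -1) : v.re = 0 := by
  have e0 := congrArg (fun q : ℍ[ℝ] => q.re) h
  have e1 := congrArg (fun q : ℍ[ℝ] => q.imI) h
  have e2 := congrArg (fun q : ℍ[ℝ] => q.imJ) h
  have e3 := congrArg (fun q : ℍ[ℝ] => q.imK) h
  simp only [Quaternion.re_mul, Quaternion.imI_mul, Quaternion.imJ_mul, Quaternion.imK_mul,
    Quaternion.re_neg, Quaternion.imI_neg, Quaternion.imJ_neg, Quaternion.imK_neg,
    Quaternion.re_one, Quaternion.imI_one, Quaternion.imJ_one, Quaternion.imK_one] at e0 e1 e2 e3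
  by_contra h0
  have f1 : v.imI = 0 := by
    have : v.re * v.imI = 0 := by linarith
    exact (mul_eq_zero.1 this).resolve_left h0
  have f2 : v.imJ = 0 := by
    have : v.re * v.imJ = 0 := by linarith
    exact (mul_eq_zero.1 this).resolve_left h0
  have f3 : v.imK = 0 := by
    have : v.re * v.imK = 0 := by linarith
    exact (mul_eq_zero.1 this).resolve_left h0
  rw [f1, f2, f3] at e0
  nlinarith

/-- Two vectors with products of real part in the open interval determined by their lengths,
or parallel. -/
theorem parallel_or_lt {u v : ℍ[ℝ]} (hu : u.re = 0) (hv : v.re = 0)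
    (huv : (u * u).re = (v * v).re) :
    u = v ∨ u = -v ∨ ((v * v).re < (u * v).re ∧ (u * v).re < -(v * v).re) := by
  by_cases h1 : u = v
  · exact Or.inl h1
  by_cases h2 : u = -v
  · exact Or.inr (Or.inl h2)
  right; right
  have h3 := re_mul_comm u v
  have key : ∀ w : ℍ[ℝ], w.re = 0 → w ≠ 0 → 0 < -(w * w).re := fun w hw hw0 =>
    lt_of_le_of_ne (neg_sq_re_nonneg hw) fun h => hw0 (eq_zero_of_sq_re hw (by linarith))
  have h4 := key (u - v) (by simp [hu, hv]) (sub_ne_zero.2 h1)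
  have h5 := key (u + v) (by simp [hu, hv]) (fun h => h2 (eq_neg_of_add_eq_zero_left h))
  simp only [mul_sub, sub_mul, Quaternion.re_sub, mul_add, add_mul, Quaternion.re_add] at h4 h5
  constructor <;> linarith

/-! ### Groups containing an element of order eight -/

section Octahedral

variable {K : Subgroup HU}

/-- `u` is the axis of an element of order eight. -/
def OctAxis (K : Subgroup HU) (u : ℍ[ℝ]) : Prop :=
  u * u = -1 ∧ ∃ x ∈ K, (x : ℍ[ℝ]) = (√2)⁻¹ • (1 + u)

theorem OctAxis.rot {q : HU} {u : ℍ[ℝ]} (h : OctAxis K u) : OctAxis (kc q K) (rot q u) := by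
  obtain ⟨hu, x, hx, hxu⟩ := h
  refine ⟨by rw [← rot_mul, hu]; simp [QRefl.rot], _, mem_kc hx, ?_⟩
  rw [← rot_unit, hxu, rot_smul, rot_add]
  congr 2
  simp [QRefl.rot]

theorem OctAxis.rot_mem {q : HU} (hq : q ∈ K) {u : ℍ[ℝ]} (h : OctAxis K u) :
    OctAxis K (QRefl.rot q u) := by
  obtain ⟨hu, x, hx, hxu⟩ := h
  refine ⟨by rw [← rot_mul, hu]; simp [QRefl.rot], q * x * q⁻¹,
    K.mul_mem (K.mul_mem hq hx) (K.inv_mem hq), ?_⟩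
  rw [← rot_unit, hxu, rot_smul, rot_add]
  congr 2
  simp [QRefl.rot]

theorem OctAxis.inv_val {u : ℍ[ℝ]} {x : HU} (hu : u * u = -1)
    (hx : (x : ℍ[ℝ]) = (√2)⁻¹ • (1 + u)) : ((x⁻¹ : HU) : ℍ[ℝ]) = (√2)⁻¹ • (1 - u) := by
  rw [Units.inv_eq_of_mul_eq_one_right]
  rw [hx, smul_mul_smul_comm, mul_sub, mul_one, add_mul, one_mul, hu, ← pow_two, inv_sqrt_two_sq]
  have : (1 : ℍ[ℝ]) + u - (u + -1) = (2 : ℝ) • 1 := by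
    rw [two_smul]; abel
  rw [this, smul_smul]
  norm_num

theorem OctAxis.neg {u : ℍ[ℝ]} (h : OctAxis K u) : OctAxis K (-u) := by
  obtain ⟨hu, x, hx, hxu⟩ := h
  exact ⟨by rw [neg_mul_neg, hu], x⁻¹, K.inv_mem hx, by rw [OctAxis.inv_val hu hxu, sub_eq_add_neg]⟩

/-- The traces of `x y` and `x y⁻¹` add up to `√2 · √2 = 2`. By `trace_pair_two` both are `1`, and
this says that the inner product of the axes vanishes. -/
theorem OctAxis.orthogonal (hK : (K : Set HU).Finite) (hax : ¬ HasAxis K) {u v : ℍ[ℝ]}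
    (hu : OctAxis K u) (hv : OctAxis K v) : u = v ∨ u = -v ∨ (u * v).re = 0 := by
  obtain ⟨hu2, x, hx, hxu⟩ := hu
  obtain ⟨hv2, y, hy, hyv⟩ := hv
  have hur := re_of_sq hu2
  have hvr := re_of_sq hv2
  rcases parallel_or_lt hur hvr (by rw [hu2, hv2]) with h | h | ⟨h1, h2⟩
  · exact Or.inl h
  · exact Or.inr (Or.inl h)
  · right; right
    rw [hv2] at h1 h2
    simp only [Quaternion.re_neg, Quaternion.re_one] at h1 h2
    have t1 := isTrace_of_mem hK hax (K.mul_mem hx hy)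
    have t2 := isTrace_of_mem hK hax (K.mul_mem hx (K.inv_mem hy))
    rw [Units.val_mul, hxu, hyv, smul_mul_smul_comm, ← pow_two, inv_sqrt_two_sq] at t1
    rw [Units.val_mul, hxu, OctAxis.inv_val hv2 hyv, smul_mul_smul_comm, ← pow_two,
      inv_sqrt_two_sq] at t2
    have e1 : tr ((1 / 2 : ℝ) • ((1 + u) * (1 + v))) = 1 + (u * v).re := by
      simp only [tr, Quaternion.re_smul, smul_eq_mul, mul_add, add_mul, mul_one, one_mul,
        Quaternion.re_add, Quaternion.re_one, hur, hvr]
      ring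
    have e2 : tr ((1 / 2 : ℝ) • ((1 + u) * (1 - v))) = 2 - (1 + (u * v).re) := by
      simp only [tr, Quaternion.re_smul, smul_eq_mul, mul_sub, add_mul, mul_one, one_mul,
        Quaternion.re_add, Quaternion.re_sub, Quaternion.re_one, hur, hvr]
      ring
    rw [e1] at t1
    rw [e2] at t2
    have := trace_pair_two t1 t2 (by linarith) (by linarith)
    linarith

theorem exists_octAxis (hK : (K : Set HU).Finite) {x : HU} (hx : x ∈ K) (ht : tr x ^ 2 = 2) :
    ∃ u, OctAxis K u := by
  have key : ∀ y ∈ K, tr (y : HU) = √2 → ∃ u, OctAxis K u := by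
    intro y hy hty
    refine ⟨√2 • (y : ℍ[ℝ]) - 1, ?_, y, hy, ?_⟩
    · have h2 := sq_eq_tr (normSq_of_mem hK hy)
      rw [hty] at h2
      rw [sub_mul, mul_sub, smul_mul_smul_comm, h2, Real.mul_self_sqrt (by norm_num)]
      have h3 : √2 • √2 • (y : ℍ[ℝ]) = (2 : ℝ) • (y : ℍ[ℝ]) := by
        rw [smul_smul, Real.mul_self_sqrt (by norm_num)]
      simp only [mul_one, one_mul]
      module
    · rw [add_sub_cancel, smul_smul, inv_mul_cancel₀ (by positivity), one_smul]
  have h2 : (tr x - √2) * (tr x + √2) = 0 := by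
    have := Real.sq_sqrt (show (0 : ℝ) ≤ 2 by norm_num)
    linear_combination ht - this
  rcases mul_eq_zero.1 h2 with h | h
  · exact key x hx (by linarith)
  -- Cubing changes the sign of the trace: `t³ - 3 t = -t` when `t² = 2`.
  · refine key (x * x * x) (K.mul_mem (K.mul_mem hx hx) hx) ?_
    have h3 := sq_eq_tr (normSq_of_mem hK hx)
    rw [Units.val_mul, Units.val_mul, h3, sub_mul, smul_mul_assoc, h3, one_mul]
    have : tr (tr (x : ℍ[ℝ]) • (tr (x : ℍ[ℝ]) • (x : ℍ[ℝ]) - 1) - (x : ℍ[ℝ]))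
        = tr (x : ℍ[ℝ]) * (tr (x : ℍ[ℝ]) ^ 2 - 3) := by
      simp only [tr, Quaternion.re_sub, Quaternion.re_smul, smul_eq_mul, Quaternion.re_one]
      ring
    rw [this, ht]
    linarith

/-- Some element moves an axis of order eight, and the image is orthogonal to it. Rotating the two
to `i` and `j` puts the generators of `binO` into the group. Conversely, an axis is parallel to `i`,
`j` or `k`, since it cannot be orthogonal to all three; so the group permutes the six vertices. -/
theorem kc_eq_binO (hK : (K : Set HU).Finite) (hax : ¬ HasAxis K) {x : HU} (hx : x ∈ K)
    (ht : tr x ^ 2 = 2) : ∃ q, kc q K = binO := by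
  obtain ⟨u, hu⟩ := exists_octAxis hK hx ht
  have hur := re_of_sq hu.1
  obtain ⟨g, hg, hgu⟩ : ∃ g ∈ K, ¬ (rot g u = u ∨ rot g u = -u) := by
    by_contra! hcon
    refine hax ⟨u, hur, ?_, hcon⟩
    rintro rfl
    simpa using hu.1
  have hv := hu.rot_mem hg
  have horth : (u * rot g u).re = 0 := by
    rcases hu.orthogonal hK hax hv with h | h | h
    · exact absurd (Or.inl h.symm) hgu
    · exact absurd (Or.inr (by rw [eq_comm, neg_eq_iff_eq_neg]; exact h)) hgu
    · exact h
  obtain ⟨q, hq1, hq2⟩ := exists_frame hu.1 hv.1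
    (anticomm_of_re hur (by rw [rot_re, hur]) horth)
  refine ⟨q, ?_⟩
  have hK' := kc_finite (q := q) hK
  have hax' := kc_hasAxis (q := q) hax
  have hi : OctAxis (kc q K) qi := hq1 ▸ hu.rot
  have hj : OctAxis (kc q K) qj := hq2 ▸ hv.rot
  have hO : uO ∈ kc q K := by
    obtain ⟨-, y, hy, hyi⟩ := hi
    have : y = uO := by
      ext1
      rw [hyi]
      ext <;> simp
    rwa [← this]
  have hQ : uQ ∈ kc q K := by
    obtain ⟨-, y, hy, hyj⟩ := hj
    have : uO * y = uQ := by
      have h2 := inv_sqrt_two_sq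
      rw [pow_two] at h2
      ext1
      rw [Units.val_mul, hyj]
      ext <;> simp [h2]
    rw [← this]
    exact (kc q K).mul_mem hO hy
  have hle : binO ≤ kc q K := by
    rw [binO, Subgroup.closure_le]
    rintro _ (rfl | rfl)
    · exact hO
    · exact hQ
  refine le_antisymm (le_trans ?_ stabSet_octSet_le) hle
  have hk : OctAxis (kc q K) (im3 0 0 1) := by
    have := hj.rot_mem (hle uQ_mem_O)
    rwa [uQ_qj] at this
  intro y hy
  refine mem_stabSet octSet_finite (normSq_of_mem hK' hy) ?_
  intro v hv
  have hvO : OctAxis (kc q K) v := by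
    rcases hv with rfl | rfl | rfl | rfl | rfl | rfl
    · exact hi
    · exact hi.neg
    · exact hj
    · exact hj.neg
    · exact hk
    · exact hk.neg
  have hw := hvO.rot_mem hy
  rcases hw.orthogonal hK' hax' hi with h | h | h1
  · rw [h]; simp [octSet]
  · rw [h]; simp [octSet]
  rcases hw.orthogonal hK' hax' hj with h | h | h2
  · rw [h]; simp [octSet]
  · rw [h]; simp [octSet]
  rcases hw.orthogonal hK' hax' hk with h | h | h3
  · rw [h]; simp [octSet]
  · rw [h]; simp [octSet]
  exfalso
  have hwr := re_of_sq hw.1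
  simp at h1 h2 h3
  have h0 : rot y v = 0 := by
    ext
    · exact hwr
    · simpa using h1
    · simpa using h2
    · simpa using h3
  have := hw.1
  rw [h0] at this
  simp at this

end Octahedral

/-! ### Groups containing an element of order five or ten -/

section Icosahedral

variable {K : Subgroup HU}

/-- `P` is the direction of the axis of an element of order ten. -/
def IcoAxis (K : Subgroup HU) (P : ℍ[ℝ]) : Prop :=
  P.re = 0 ∧ (P * P).re = tau - 3 ∧ ∃ x ∈ K, (x : ℍ[ℝ]) = (1 / 2 : ℝ) • ((tau : ℍ[ℝ]) + P)

theorem IcoAxis.rot {q : HU} {P : ℍ[ℝ]} (h : IcoAxis K P) : IcoAxis (kc q K) (rot q P) := by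
  obtain ⟨h0, h1, x, hx, hxP⟩ := h
  refine ⟨by rw [rot_re, h0], by rw [← rot_mul, rot_re, h1], _, mem_kc hx, ?_⟩
  rw [← rot_unit, hxP, rot_smul, rot_add, rot_coe]

theorem IcoAxis.rot_mem {q : HU} (hq : q ∈ K) {P : ℍ[ℝ]} (h : IcoAxis K P) :
    IcoAxis K (QRefl.rot q P) := by
  obtain ⟨h0, h1, x, hx, hxP⟩ := h
  refine ⟨by rw [rot_re, h0], by rw [← rot_mul, rot_re, h1], q * x * q⁻¹,
    K.mul_mem (K.mul_mem hq hx) (K.inv_mem hq), ?_⟩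
  rw [← rot_unit, hxP, rot_smul, rot_add, rot_coe]

theorem IcoAxis.inv_val {P : ℍ[ℝ]} {x : HU} (h0 : P.re = 0) (h1 : (P * P).re = tau - 3)
    (hx : (x : ℍ[ℝ]) = (1 / 2 : ℝ) • ((tau : ℍ[ℝ]) + P)) :
    ((x⁻¹ : HU) : ℍ[ℝ]) = (1 / 2 : ℝ) • ((tau : ℍ[ℝ]) - P) := by
  rw [Units.inv_eq_of_mul_eq_one_right]
  have h2 := mul_self_of_re_eq_zero h0
  have h3 : P * P = ((tau - 3 : ℝ) : ℍ[ℝ]) := by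
    rw [h2, Quaternion.re_coe] at h1
    rw [h2, h1]
  rw [hx, smul_mul_smul_comm, mul_sub, add_mul, add_mul, h3, Quaternion.coe_commutes tau P]
  have : (tau : ℍ[ℝ]) * tau + P * tau - (P * tau + ((tau - 3 : ℝ) : ℍ[ℝ])) = (4 : ℝ) • 1 := by
    have e : (tau : ℍ[ℝ]) * tau = ((tau + 1 : ℝ) : ℍ[ℝ]) := by
      rw [← Quaternion.coe_mul, ← pow_two, tau_sq]
    rw [e]
    ext <;> simp
    ring
  rw [this, smul_smul]
  norm_num

theorem IcoAxis.neg {P : ℍ[ℝ]} (h : IcoAxis K P) : IcoAxis K (-P) := by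
  obtain ⟨h0, h1, x, hx, hxP⟩ := h
  exact ⟨by simp [h0], by rw [neg_mul_neg, h1], x⁻¹, K.inv_mem hx,
    by rw [IcoAxis.inv_val h0 h1 hxP, sub_eq_add_neg]⟩

/-- The traces of `x y` and `x y⁻¹` add up to `τ²`, so by `trace_pair_tau` they are `1` and `τ` in
some order. -/
theorem IcoAxis.angle (hK : (K : Set HU).Finite) (hax : ¬ HasAxis K) {P Q : ℍ[ℝ]}
    (hP : IcoAxis K P) (hQ : IcoAxis K Q) :
    P = Q ∨ P = -Q ∨ (P * Q).re = tau - 1 ∨ (P * Q).re = -(tau - 1) := by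
  obtain ⟨hPr, hP2, x, hx, hxP⟩ := hP
  obtain ⟨hQr, hQ2, y, hy, hyQ⟩ := hQ
  rcases parallel_or_lt hPr hQr (by rw [hP2, hQ2]) with h | h | ⟨h1, h2⟩
  · exact Or.inl h
  · exact Or.inr (Or.inl h)
  · right; right
    rw [hQ2] at h1 h2
    have t1 := isTrace_of_mem hK hax (K.mul_mem hx hy)
    have t2 := isTrace_of_mem hK hax (K.mul_mem hx (K.inv_mem hy))
    rw [Units.val_mul, hxP, hyQ, smul_mul_smul_comm] at t1
    rw [Units.val_mul, hxP, IcoAxis.inv_val hQr hQ2 hyQ, smul_mul_smul_comm] at t2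
    have e1 : tr ((1 / 2 * (1 / 2) : ℝ) • (((tau : ℍ[ℝ]) + P) * ((tau : ℍ[ℝ]) + Q)))
        = (tau + 1 + (P * Q).re) / 2 := by
      simp only [tr, Quaternion.re_smul, smul_eq_mul, mul_add, add_mul, Quaternion.re_add,
        Quaternion.re_mul, Quaternion.re_coe, Quaternion.imI_coe, Quaternion.imJ_coe,
        Quaternion.imK_coe, hPr, hQr]
      linear_combination tau_sq / 2
    have e2 : tr ((1 / 2 * (1 / 2) : ℝ) • (((tau : ℍ[ℝ]) + P) * ((tau : ℍ[ℝ]) - Q)))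
        = tau + 1 - (tau + 1 + (P * Q).re) / 2 := by
      simp only [tr, Quaternion.re_smul, smul_eq_mul, mul_sub, add_mul, Quaternion.re_add,
        Quaternion.re_sub, Quaternion.re_mul, Quaternion.re_coe, Quaternion.imI_coe,
        Quaternion.imJ_coe, Quaternion.imK_coe, hPr, hQr]
      linear_combination tau_sq / 2
    rw [e1] at t1
    rw [e2] at t2
    rcases trace_pair_tau t1 t2 (by linarith) (by linarith) with h | h
    · right; linarith
    · left; linarith

/-- The roots of the quartic are `±τ` and `±(τ - 1)`. A change of sign, or passing to `-x²` with
trace `2 - (τ - 1)² = τ`, leads to trace `τ`. -/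
theorem exists_icoAxis (hK : (K : Set HU).Finite) (hneg : -1 ∈ K) {x : HU} (hx : x ∈ K)
    (ht : tr x ^ 4 - 3 * tr x ^ 2 + 1 = 0) : ∃ P, IcoAxis K P := by
  have key : ∀ y ∈ K, tr (y : HU) = tau → ∃ P, IcoAxis K P := by
    intro y hy hty
    have hyre : (y : ℍ[ℝ]).re = tau / 2 := by rw [tr] at hty; linarith
    refine ⟨(2 : ℝ) • imPart y, by simp, ?_, y, hy, ?_⟩
    · have := imPart_sq _ (normSq_of_mem hK hy)
      rw [hyre] at this
      rw [smul_mul_smul_comm, Quaternion.re_smul, smul_eq_mul]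
      linear_combination (-4) * this + tau_sq
    · ext <;> simp [hyre]
      ring
  have hneg' : ∀ y ∈ K, -y ∈ K := fun y hy => by simpa using K.mul_mem hneg hy
  have htr : ∀ y : HU, tr ((-y : HU) : ℍ[ℝ]) = -tr y := fun y => by simp [tr]
  have hsq : ∀ y ∈ K, tr ((y * y : HU) : ℍ[ℝ]) = tr y ^ 2 - 2 := by
    intro y hy
    rw [Units.val_mul, sq_eq_tr (normSq_of_mem hK hy)]
    simp only [tr, Quaternion.re_sub, Quaternion.re_smul, smul_eq_mul, Quaternion.re_one]
    ring
  have h3 : ((tr x - tau) * (tr x + tau)) * ((tr x - (tau - 1)) * (tr x + (tau - 1))) = 0 := by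
    linear_combination ht + (-(2 * tr x ^ 2) + tau ^ 2 - tau + 1) * tau_sq
  rcases mul_eq_zero.1 h3 with h | h
  · rcases mul_eq_zero.1 h with h | h
    · exact key x hx (by linarith)
    · exact key (-x) (hneg' x hx) (by rw [htr]; linarith)
  · refine key (-(x * x)) (hneg' _ (K.mul_mem hx hx)) ?_
    rw [htr, hsq x hx]
    linear_combination -h - tau_sq

/-- Two nonparallel axes are rotated to two vertices of the standard icosahedron. The corresponding
elements are `uT` and its conjugate by `uI`, which yield `uQ`. Conversely, by `IcoAxis.angle` no
axis lies off the icosahedron, so the group permutes its vertices. -/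
theorem kc_eq_binI (hK : (K : Set HU).Finite) (hax : ¬ HasAxis K) (hneg : -1 ∈ K) {x : HU}
    (hx : x ∈ K) (ht : tr x ^ 4 - 3 * tr x ^ 2 + 1 = 0) : ∃ q, kc q K = binI := by
  have hb := tau_bounds
  have hs := sig_ne_zero
  have hsq : sig ^ 2 = 2 - tau := by
    rw [sig_eq]
    linear_combination tau_sq
  obtain ⟨P, hP⟩ := exists_icoAxis hK hneg hx ht
  obtain ⟨Q, hQ, hPQ⟩ : ∃ Q, IcoAxis K Q ∧ (P * Q).re = tau - 1 := by
    obtain ⟨g, hg, hgu⟩ : ∃ g ∈ K, ¬ (QRefl.rot g P = P ∨ QRefl.rot g P = -P) := by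
      by_contra! hcon
      refine hax ⟨P, hP.1, ?_, hcon⟩
      rintro rfl
      have := hP.2.1
      simp at this
      linarith
    have hv := hP.rot_mem hg
    rcases hP.angle hK hax hv with h | h | h | h
    · exact absurd (Or.inl h.symm) hgu
    · exact absurd (Or.inr (by rw [eq_comm, neg_eq_iff_eq_neg]; exact h)) hgu
    · exact ⟨_, hv, h⟩
    · exact ⟨_, hv.neg, by rw [mul_neg, Quaternion.re_neg, h, neg_neg]⟩
  have hQP : (Q * P).re = tau - 1 := by rw [re_mul_comm, hPQ]
  -- The sum and difference of vectors of equal length are orthogonal; normalized, they become the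
  -- frame `i`, `j`.
  obtain ⟨q, hq1, hq2⟩ := exists_frame (u := (2 * sig)⁻¹ • (P + Q)) (v := (1 / 2 : ℝ) • (Q - P))
    (mul_self_neg_one (by simp [hP.1, hQ.1]) (by
      rw [smul_mul_smul_comm, Quaternion.re_smul, smul_eq_mul]
      simp only [mul_add, add_mul, Quaternion.re_add, hPQ, hQP, hP.2.1, hQ.2.1]
      field_simp
      linarith))
    (mul_self_neg_one (by simp [hP.1, hQ.1]) (by
      rw [smul_mul_smul_comm, Quaternion.re_smul, smul_eq_mul]
      simp only [mul_sub, sub_mul, Quaternion.re_sub, hPQ, hQP, hP.2.1, hQ.2.1]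
      ring))
    (anticomm_of_re (by simp [hP.1, hQ.1]) (by simp [hP.1, hQ.1]) (by
      rw [smul_mul_smul_comm, Quaternion.re_smul, smul_eq_mul]
      simp only [mul_sub, add_mul, Quaternion.re_add, Quaternion.re_sub, hPQ, hQP, hP.2.1, hQ.2.1]
      ring))
  have hrP : QRefl.rot q P = im3 sig (-1) 0 := by
    have : P = sig • ((2 * sig)⁻¹ • (P + Q)) + (-1 : ℝ) • ((1 / 2 : ℝ) • (Q - P)) := by
      rw [smul_smul, show sig * (2 * sig)⁻¹ = 1 / 2 by field_simp]
      module
    rw [this, rot_add, rot_smul q sig, hq1, rot_smul q (-1), hq2]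
    ext <;> simp
  have hrQ : QRefl.rot q Q = im3 sig 1 0 := by
    have : Q = sig • ((2 * sig)⁻¹ • (P + Q)) + ((1 / 2 : ℝ) • (Q - P)) := by
      rw [smul_smul, show sig * (2 * sig)⁻¹ = 1 / 2 by field_simp]
      module
    rw [this, rot_add, rot_smul q sig, hq1, hq2]
    ext <;> simp
  refine ⟨q, ?_⟩
  have hK' := kc_finite (q := q) hK
  have hax' := kc_hasAxis (q := q) hax
  have h1 : IcoAxis (kc q K) (im3 sig (-1) 0) := hrP ▸ hP.rot
  have h2 : IcoAxis (kc q K) (im3 sig 1 0) := hrQ ▸ hQ.rot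
  have hT : uT ∈ kc q K := by
    obtain ⟨-, -, y, hy, hyi⟩ := h1
    have : y = uT := by
      ext1
      rw [hyi]
      ext <;> simp [sig_eq] <;> ring
    rwa [← this]
  have hU : uI * uT * uI⁻¹ ∈ kc q K := by
    obtain ⟨-, -, y, hy, hyi⟩ := h2
    have : y = uI * uT * uI⁻¹ := by
      rw [eq_mul_inv_iff_mul_eq]
      ext1
      rw [Units.val_mul, Units.val_mul, hyi]
      ext <;> simp [sig_eq] <;> ring
    rwa [← this]
  have hQ' : uQ ∈ kc q K := by
    rw [← mul_inv_eq_iff_eq_mul.2 (uQ_relation _ rfl).symm]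
    exact (kc q K).mul_mem ((kc q K).inv_mem hU)
      ((kc q K).inv_mem ((kc q K).mul_mem hT hT))
  have hle : binI ≤ kc q K := by
    rw [binI, Subgroup.closure_le]
    rintro _ (rfl | rfl)
    · exact hQ'
    · exact hT
  refine le_antisymm (le_trans ?_ stabSet_icoSet_le) hle
  have hall : ∀ v ∈ icoSet, IcoAxis (kc q K) v := by
    intro v hv
    obtain ⟨h, hh, hhv⟩ := exists_rot_icoSet hv
    have := h1.rot_mem ((kc q K).inv_mem (hle hh))
    rwa [← hhv, rot_inv_rot] at this
  intro y hy
  refine mem_stabSet icoSet_finite (normSq_of_mem hK' hy) ?_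
  intro v hv
  have hw := (hall v hv).rot_mem hy
  by_contra hcon
  have hdot : ∀ a ∈ icoSet, -a ∈ icoSet →
      ((QRefl.rot y v * a).re) ^ 2 = sig ^ 2 := by
    intro a ha ha'
    rcases hw.angle hK' hax' (hall a ha) with h | h | h | h
    · exact absurd (h ▸ ha) hcon
    · exact absurd (h ▸ ha') hcon
    · rw [h, sig_eq]; ring
    · rw [h, sig_eq]; ring
  obtain ⟨a, b, c, habc⟩ : ∃ a b c, QRefl.rot y v = im3 a b c :=
    ⟨_, _, _, by ext; exacts [hw.1, rfl, rfl, rfl]⟩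
  rw [habc] at hdot
  have d1 := hdot (im3 sig (-1) 0) (by simp [icoSet]) (by simp [icoSet])
  have d2 := hdot (im3 sig 1 0) (by simp [icoSet]) (by simp [icoSet])
  have d3 := hdot (im3 0 sig 1) (by simp [icoSet]) (by simp [icoSet])
  have d4 := hdot (im3 0 sig (-1)) (by simp [icoSet]) (by simp [icoSet])
  have d5 := hdot (im3 1 0 sig) (by simp [icoSet]) (by simp [icoSet])
  have d6 := hdot (im3 (-1) 0 sig) (by simp [icoSet]) (by simp [icoSet])
  rw [re_mul_im3] at d1 d2 d3 d4 d5 d6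
  -- Comparing two vertices that differ in one sign kills a product of coordinates. Then at most one
  -- coordinate of the vector survives, and some vertex is orthogonal to it, although every inner
  -- product has square `σ² ≠ 0`.
  have e1 : a * b = 0 := by
    have : sig * (a * b) = 0 := by linarith
    exact (mul_eq_zero.1 this).resolve_left hs
  have e2 : b * c = 0 := by
    have : sig * (b * c) = 0 := by linarith
    exact (mul_eq_zero.1 this).resolve_left hs
  have e3 : c * a = 0 := by
    have : sig * (c * a) = 0 := by linarith
    exact (mul_eq_zero.1 this).resolve_left hs
  have hs2 : sig ^ 2 ≠ 0 := pow_ne_zero 2 hs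
  rcases mul_eq_zero.1 e1 with rfl | rfl
  · rcases mul_eq_zero.1 e2 with rfl | rfl
    · apply hs2; rw [← d1]; ring
    · apply hs2; rw [← d5]; ring
  · rcases mul_eq_zero.1 e3 with rfl | rfl
    · apply hs2; rw [← d3]; ring
    · apply hs2; rw [← d1]; ring

end Icosahedral

/-! ### Finite groups generated by square roots of minus one -/

theorem rot_closure {Y : Set HU} {p : ℍ[ℝ]} (h : ∀ b ∈ Y, rot b p = p ∨ rot b p = -p) :
    ∀ g ∈ Subgroup.closure Y, rot g p = p ∨ rot g p = -p := by
  intro g hg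
  induction hg using Subgroup.closure_induction with
  | mem x hx => exact h x hx
  | one => exact Or.inl (rot_one_left p)
  | mul x y _ _ hx hy =>
    rw [rot_mul_left]
    rcases hy with hy | hy <;> rcases hx with hx | hx <;> simp [hy, hx, rot_neg]
  | inv x _ hx =>
    rcases hx with hx | hx
    · left
      conv_lhs => rw [← hx, rot_inv_rot]
    · right
      have h1 : p = rot x (-p) := by rw [rot_neg, hx, neg_neg]
      conv_lhs => rw [h1, rot_inv_rot]

theorem hasAxis_closure {Y : Set HU} {p : ℍ[ℝ]} (hp : p.re = 0) (hp0 : p ≠ 0)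
    (h : ∀ b ∈ Y, rot b p = p ∨ rot b p = -p) : HasAxis (Subgroup.closure Y) :=
  ⟨p, hp, hp0, rot_closure h⟩

theorem rot_eq_neg_of_orthogonal {b : HU} {p : ℍ[ℝ]} (hb : (b : ℍ[ℝ]).re = 0) (hp : p.re = 0)
    (h : ((b : ℍ[ℝ]) * p).re = 0) : rot b p = -p := by
  rw [rot_eq_iff, anticomm_of_re hb hp h, neg_mul]

/-- For imaginary quaternions `re (u v w)` is minus the triple product, whose square is the Gram
determinant. -/
theorem gram_identity {u v w : ℍ[ℝ]} (hu : u.re = 0) (hv : v.re = 0) (hw : w.re = 0) :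
    (u * v * w).re ^ 2 = (u * u).re * (v * w).re ^ 2 + (v * v).re * (u * w).re ^ 2
      + (w * w).re * (u * v).re ^ 2 - (u * u).re * (v * v).re * (w * w).re
      - 2 * (u * v).re * (v * w).re * (u * w).re := by
  simp only [Quaternion.re_mul, Quaternion.imI_mul, Quaternion.imJ_mul, Quaternion.imK_mul,
    hu, hv, hw]
  ring

/-- Finite groups of quaternions generated by square roots of `-1`. -/
theorem hasAxis_or_bin {Y : Set HU} (hne : Y.Nonempty) (hY : ∀ b ∈ Y, b * b = -1)
    (hK : (Subgroup.closure Y : Set HU).Finite) :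
    HasAxis (Subgroup.closure Y) ∨ (∃ q, kc q (Subgroup.closure Y) = binO) ∨
      ∃ q, kc q (Subgroup.closure Y) = binI := by
  by_cases hax : HasAxis (Subgroup.closure Y)
  · exact Or.inl hax
  right
  have hmem : ∀ b ∈ Y, b ∈ Subgroup.closure Y := fun b hb => Subgroup.subset_closure hb
  have hY' : ∀ b ∈ Y, (b : ℍ[ℝ]) * b = -1 := fun b hb => congrArg Units.val (hY b hb)
  have hre : ∀ b ∈ Y, (b : ℍ[ℝ]).re = 0 := fun b hb => re_of_sq (hY' b hb)
  by_cases h2 : ∃ x ∈ Subgroup.closure Y, tr (x : HU) ^ 2 = 2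
  · obtain ⟨x, hx, ht⟩ := h2
    exact Or.inl (kc_eq_binO hK hax hx ht)
  by_cases h5 : ∃ x ∈ Subgroup.closure Y, tr (x : HU) ^ 4 - 3 * tr (x : HU) ^ 2 + 1 = 0
  · obtain ⟨x, hx, ht⟩ := h5
    obtain ⟨b, hb⟩ := hne
    refine Or.inr (kc_eq_binI hK hax ?_ hx ht)
    rw [← hY b hb]
    exact mul_mem (hmem b hb) (hmem b hb)
  -- Only the traces `0, ±1, ±2` are left, as in the binary tetrahedral group. Its square roots of
  -- `-1` generate just the quaternion group, which has an axis; the rest shows that an axis always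
  -- exists here.
  exfalso
  have htr : ∀ x ∈ Subgroup.closure Y,
      (x : ℍ[ℝ]).re ^ 2 = 1 ∨ (x : ℍ[ℝ]).re = 0 ∨ (x : ℍ[ℝ]).re ^ 2 = 1 / 4 := by
    intro x hx
    rcases isTrace_of_mem hK hax hx with h | h | h | h | h | h
    · left; rw [tr] at h; nlinarith
    · left; rw [tr] at h; nlinarith
    · right; left; rw [tr] at h; linarith
    · right; right; rw [tr] at h; linarith
    · exact absurd ⟨x, hx, h⟩ h2
    · exact absurd ⟨x, hx, h⟩ h5
  have hpar : ∀ b ∈ Y, ∀ c ∈ Y, b = c ∨ b = -c ∨ ((b : ℍ[ℝ]) * c).re = 0 ∨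
      ((b : ℍ[ℝ]) * c).re ^ 2 = 1 / 4 := by
    intro b hb c hc
    rcases parallel_or_lt (hre b hb) (hre c hc) (by rw [hY' b hb, hY' c hc]) with h | h | ⟨h, h'⟩
    · exact Or.inl (Units.ext h)
    · exact Or.inr (Or.inl (Units.ext h))
    · right; right
      rcases htr _ (mul_mem (hmem b hb) (hmem c hc)) with h3 | h3 | h3
      · exfalso
        rw [Units.val_mul] at h3
        rw [hY' c hc, Quaternion.re_neg, Quaternion.re_one] at h h'
        nlinarith
      · exact Or.inl h3
      · exact Or.inr h3
  -- If all generators are pairwise parallel or orthogonal, any one of them is an axis.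
  by_cases hall : ∀ b ∈ Y, ∀ c ∈ Y, b = c ∨ b = -c ∨ ((b : ℍ[ℝ]) * c).re = 0
  · obtain ⟨p, hp⟩ := hne
    refine hax (hasAxis_closure (hre p hp) p.ne_zero fun b hb => ?_)
    rcases hall b hb p hp with h | h | h
    · left; rw [h]; simp [rot]
    · left; rw [h]; simp [rot]
    · right; exact rot_eq_neg_of_orthogonal (hre b hb) (hre p hp) h
  · push Not at hall
    obtain ⟨b, hb, c, hc, hbc1, hbc2, hbc3⟩ := hall
    have hbc : ((b : ℍ[ℝ]) * c).re ^ 2 = 1 / 4 := by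
      rcases hpar b hb c hc with h | h | h | h
      · exact absurd h hbc1
      · exact absurd h hbc2
      · exact absurd h hbc3
      · exact h
    have hbn := normSq_of_mem hK (mul_mem (hmem b hb) (hmem c hc))
    -- Otherwise two generators have inner product `±1/2`, and their cross product is an axis
    -- because every other generator is coplanar with them.
    refine hax (hasAxis_closure (p := imPart ((b : ℍ[ℝ]) * c)) rfl ?_ fun d hd => ?_)
    · intro h0
      have := imPart_sq _ hbn
      rw [Units.val_mul, h0, hbc] at this
      norm_num at this
    · right
      refine rot_eq_neg_of_orthogonal (hre d hd) rfl ?_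
      rw [re_mul_comm]
      have e : (imPart ((b : ℍ[ℝ]) * (c : ℍ[ℝ])) * (d : ℍ[ℝ])).re = ((b : ℍ[ℝ]) * (c : ℍ[ℝ]) * (d : ℍ[ℝ])).re := by
        generalize (b : ℍ[ℝ]) * (c : ℍ[ℝ]) = m
        simp only [Quaternion.re_mul, imPart_re, imPart_imI, imPart_imJ, imPart_imK, hre d hd]
        ring
      rw [e]
      by_contra hne0
      have hperp : ∀ a ∈ Y, (a = b ∨ a = c) → ((a : ℍ[ℝ]) * d).re = 0 ∨
          ((a : ℍ[ℝ]) * d).re ^ 2 = 1 / 4 := by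
        intro a ha hac
        have key : ∀ s : ℍ[ℝ], (s = a ∨ s = -a) → ((b : ℍ[ℝ]) * c * s).re = 0 := by
          have h0 : ((b : ℍ[ℝ]) * c * a).re = 0 := by
            rcases hac with rfl | rfl
            · rw [re_mul_comm, ← mul_assoc, hY' a ha, neg_one_mul, Quaternion.re_neg, hre c hc,
                neg_zero]
            · rw [mul_assoc, hY' a ha, mul_neg_one, Quaternion.re_neg, hre b hb, neg_zero]
          rintro s (rfl | rfl)
          · exact h0
          · rw [mul_neg, Quaternion.re_neg, h0, neg_zero]
        rcases hpar d hd a ha with h | h | h | h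
        · exact absurd (key d (Or.inl (by rw [h]))) hne0
        · exact absurd (key d (Or.inr (by rw [h]; rfl))) hne0
        · exact Or.inl (by rw [re_mul_comm]; exact h)
        · exact Or.inr (by rw [re_mul_comm]; exact h)
      have g := gram_identity (hre b hb) (hre c hc) (hre d hd)
      rw [hY' b hb, hY' c hc, hY' d hd] at g
      simp only [Quaternion.re_neg, Quaternion.re_one] at g
      have ht := htr _ (mul_mem (mul_mem (hmem b hb) (hmem c hc)) (hmem d hd))
      simp only [Units.val_mul] at ht
      generalize ((b : ℍ[ℝ]) * c * d).re = T at *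
      have hpb := hperp b hb (Or.inl rfl)
      have hpc := hperp c hc (Or.inr rfl)
      generalize ((b : ℍ[ℝ]) * c).re = x at *
      generalize ((b : ℍ[ℝ]) * d).re = y at *
      generalize ((c : ℍ[ℝ]) * d).re = z at *
      have key : T ^ 2 = 1 ∨ T ^ 2 = 1 / 4 := by
        rcases ht with h | h | h
        · exact Or.inl h
        · exact absurd h hne0
        · exact Or.inr h
      have half : ∀ s : ℝ, s ^ 2 = 1 / 4 → s = 1 / 2 ∨ s = -(1 / 2) := by
        intro s hs
        apply sq_eq_sq_iff_eq_or_eq_neg.1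
        rw [hs]; norm_num
      have hT0 : T ^ 2 ≠ 0 := pow_ne_zero 2 hne0
      -- With one inner product `±1/2` and the others `0` or `±1/2`, the Gram determinant is `3/4`,
      -- `1/2` or `0`, whereas the traces would require `1` or `1/4`.
      rcases hpb with hy | hy <;> rcases hpc with hz | hz <;> simp only [hy, hz, hbc] at g
      · rcases key with h | h <;> rw [h] at g <;> norm_num at g
      · rcases key with h | h <;> rw [h] at g <;> norm_num at g
      · rcases key with h | h <;> rw [h] at g <;> norm_num at g
      · rcases half x hbc with rfl | rfl <;> rcases half y hy with rfl | rfl <;>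
          rcases half z hz with rfl | rfl <;> norm_num at g <;>
          first
          | exact hne0 g
          | (rcases key with h | h <;> rw [h] at g <;> norm_num at g)

/-! ### The normal forms -/

/-- The group generated by the scalar matrices with entries in `K`, the matrix
`(0 u; -u 0)` and `diag (e, 1)`. -/
noncomputable def nf (K : Subgroup HU) (u e : HU) : Subgroup (GLd 2 ℍ[ℝ]) :=
  Subgroup.closure ({g | ∃ x ∈ K, g = dg x x} ∪ {ad u (-u), dg e 1})

/-- Conditions under which the elements of `nf K u e` have a simple description. -/
structure IsNF (K : Subgroup HU) (u e : HU) : Prop where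
  norm : ∀ x ∈ K, u * x * u⁻¹ ∈ K
  sq : u * u ∈ K
  neg : -1 ∈ K
  sign : e = 1 ∨ e = -1

section NF

variable {K : Subgroup HU} {u e : HU}

theorem dg_mem_nf {x : HU} (hx : x ∈ K) : dg x x ∈ nf K u e :=
  Subgroup.subset_closure (Or.inl ⟨x, hx, rfl⟩)

theorem ad_mem_nf : ad u (-u) ∈ nf K u e := Subgroup.subset_closure (Or.inr (Or.inl rfl))

theorem sign_mem_nf : dg e 1 ∈ nf K u e := Subgroup.subset_closure (Or.inr (Or.inr rfl))

theorem nf_le {G : Subgroup (GLd 2 ℍ[ℝ])} (h1 : ∀ x ∈ K, dg x x ∈ G) (h2 : ad u (-u) ∈ G)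
    (h3 : dg e 1 ∈ G) : nf K u e ≤ G := by
  rw [nf, Subgroup.closure_le]
  rintro g (⟨x, hx, rfl⟩ | rfl | rfl)
  · exact h1 x hx
  · exact h2
  · exact h3

theorem sign_cases {e s : HU} (he : e = 1 ∨ e = -1) (hs : s = 1 ∨ s = e) : s = 1 ∨ s = -1 := by
  rcases hs with rfl | rfl
  · exact Or.inl rfl
  · exact he

theorem sign_mul {e s t : HU} (he : e = 1 ∨ e = -1) (hs : s = 1 ∨ s = e) (ht : t = 1 ∨ t = e) :
    s * t = 1 ∨ s * t = e := by
  rcases he with rfl | rfl <;> rcases hs with rfl | rfl <;> rcases ht with rfl | rfl <;> simp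

/-- The listed matrices form a group because `u` normalizes `K`, `u²` lies in `K` and signs are
central. -/
theorem mem_nf (h : IsNF K u e) {g : GLd 2 ℍ[ℝ]} :
    g ∈ nf K u e ↔ ∃ x ∈ K, ∃ s : HU, (s = 1 ∨ s = e) ∧
      (g = dg x (s * x) ∨ g = ad (x * u) (-(s * (x * u)))) := by
  have hneg : ∀ x ∈ K, -x ∈ K := fun x hx => by simpa using K.mul_mem h.neg hx
  have hsgn : ∀ {s x : HU}, (s = 1 ∨ s = e) → x ∈ K → s * x ∈ K := by
    intro s x hs hx
    rcases sign_cases h.sign hs with rfl | rfl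
    · simpa using hx
    · simpa using hneg x hx
  constructor
  · intro hg
    induction hg using Subgroup.closure_induction with
    | mem g hg =>
      rcases hg with ⟨x, hx, rfl⟩ | rfl | rfl
      · exact ⟨x, hx, 1, Or.inl rfl, Or.inl (by simp)⟩
      · exact ⟨1, K.one_mem, 1, Or.inl rfl, Or.inr (by simp)⟩
      · refine ⟨e, by simpa using hsgn (Or.inr rfl) K.one_mem, e, Or.inr rfl, Or.inl ?_⟩
        rcases h.sign with h | h <;> simp [h]
    | one => exact ⟨1, K.one_mem, 1, Or.inl rfl, Or.inl (by simp [dg_one])⟩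
    | mul g g' _ _ hg hg' =>
      obtain ⟨x, hx, s, hs, hg⟩ := hg
      obtain ⟨y, hy, t, ht, hg'⟩ := hg'
      have hs' := sign_cases h.sign hs
      have ht' := sign_cases h.sign ht
      have hz := K.mul_mem hx (h.norm y hy)
      rcases hg with rfl | rfl <;> rcases hg' with rfl | rfl
      · refine ⟨x * y, K.mul_mem hx hy, s * t, sign_mul h.sign hs ht, Or.inl ?_⟩
        rw [dg_mul_dg]
        rcases hs' with rfl | rfl <;> rcases ht' with rfl | rfl <;> simp
      · refine ⟨x * y, K.mul_mem hx hy, s * t, sign_mul h.sign hs ht, Or.inr ?_⟩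
        rw [dg_mul_ad]
        rcases hs' with rfl | rfl <;> rcases ht' with rfl | rfl <;> simp [mul_assoc]
      · refine ⟨t * (x * (u * y * u⁻¹)), hsgn ht hz, s * t, sign_mul h.sign hs ht, Or.inr ?_⟩
        rw [ad_mul_dg]
        rcases hs' with rfl | rfl <;> rcases ht' with rfl | rfl <;> simp [mul_assoc]
      · refine ⟨-(t * (x * (u * y * u⁻¹) * (u * u))), hneg _ ?_, s * t,
          sign_mul h.sign hs ht, Or.inl ?_⟩
        · exact hsgn ht (K.mul_mem hz h.sq)
        · rw [ad_mul_ad]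
          rcases hs' with rfl | rfl <;> rcases ht' with rfl | rfl <;> simp [mul_assoc]
    | inv g _ hg =>
      obtain ⟨x, hx, s, hs, hg⟩ := hg
      have hs' := sign_cases h.sign hs
      rcases hg with rfl | rfl
      · refine ⟨x⁻¹, K.inv_mem hx, s, hs, Or.inl ?_⟩
        rw [dg_inv]
        rcases hs' with rfl | rfl <;> simp [inv_neg]
      · have hz : -(s * ((u * u)⁻¹ * (u * x⁻¹ * u⁻¹))) ∈ K :=
          hneg _ (hsgn hs (K.mul_mem (K.inv_mem h.sq) (h.norm _ (K.inv_mem hx))))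
        refine ⟨_, hz, s, hs, Or.inr ?_⟩
        rw [ad_inv]
        rcases hs' with rfl | rfl <;> simp [mul_assoc, inv_neg]
  · rintro ⟨x, hx, s, hs, hg⟩
    have h1 : dg x (s * x) ∈ nf K u e := by
      have h2 : dg 1 s ∈ nf K u e := by
        rcases hs with rfl | rfl
        · rw [dg_one]; exact one_mem _
        · have h3 := mul_mem (sign_mem_nf (K := K) (u := u) (e := s))
            (dg_mem_nf (hsgn (Or.inr rfl) K.one_mem))
          rw [dg_mul_dg] at h3
          rcases h.sign with h | h <;> simpa [h] using h3
      have := mul_mem h2 (dg_mem_nf (u := u) (e := e) hx)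
      rwa [dg_mul_dg, one_mul] at this
    rcases hg with rfl | rfl
    · exact h1
    · have := mul_mem h1 (ad_mem_nf (K := K) (u := u) (e := e))
      rw [dg_mul_ad] at this
      simpa [mul_assoc] using this

theorem nf_le_mono (h : IsNF K u e) : nf K u e ≤ monoGroup ℍ[ℝ] := by
  intro g hg
  obtain ⟨x, -, s, -, rfl | rfl⟩ := (mem_nf h).1 hg
  · exact Or.inl ⟨_, _, rfl⟩
  · exact Or.inr ⟨_, _, rfl⟩

theorem nf_finite (h : IsNF K u e) (hK : (K : Set HU).Finite) : Finite (nf K u e) := by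
  have hs : ({1, e} : Set HU).Finite := Set.toFinite _
  have h1 := ((hK.prod hs).image fun p => dg p.1 (p.2 * p.1)).union
    ((hK.prod hs).image fun p => ad (p.1 * u) (-(p.2 * (p.1 * u))))
  refine (h1.subset ?_ : ((nf K u e : Subgroup _) : Set (GLd 2 ℍ[ℝ])).Finite)
  intro g hg
  obtain ⟨x, hx, s, hs, rfl | rfl⟩ := (mem_nf h).1 hg
  · exact Or.inl ⟨(x, s), ⟨hx, hs⟩, rfl⟩
  · exact Or.inr ⟨(x, s), ⟨hx, hs⟩, rfl⟩

/-- Only real quaternions commute with the group. -/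
def CentralReal (K : Subgroup HU) : Prop :=
  ∀ w : ℍ[ℝ], (∀ x ∈ K, rot x w = w) → ∃ r : ℝ, w = r

theorem mv_dg_self (x : HU) (w : ℍ[ℝ]) : mv (dg x x) (ell w) = ell (rot x w) := by
  rw [mv_dg_ell, rot, Units.val_inv_eq_inv_val]

theorem mv_ad_neg (u : HU) {w : ℍ[ℝ]} (hw : w ≠ 0) :
    mv (ad u (-u)) (ell w) = ell (-rot u w⁻¹) := by
  rw [mv_ad_ell _ _ hw, rot, Units.val_inv_eq_inv_val]
  simp

/-- An invariant slope commutes with `K`, so it is a real number `r`; the antidiagonal generator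
would give `r = -r⁻¹`. The axes are exchanged. -/
theorem nf_irreducible (hc : CentralReal K) : IsIrreducible (nf K u e) := by
  rw [isIrreducible_iff]
  intro v hv
  by_contra! hcon
  rcases ray_cases hv with h | ⟨w, h⟩
  · have := hcon _ (ad_mem_nf (K := K) (u := u) (e := e))
    rw [h, mv_ad_inf] at this
    exact ell_ne_ellInf _ this
  · rw [h] at hcon
    by_cases hw : w = 0
    · have := hcon _ (ad_mem_nf (K := K) (u := u) (e := e))
      rw [hw, mv_ad_zero] at this
      exact ell_ne_ellInf _ this.symm
    · obtain ⟨r, rfl⟩ := hc w fun x hx => by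
        have := hcon _ (dg_mem_nf hx)
        rwa [mv_dg_self, ell_inj] at this
      have := hcon _ (ad_mem_nf (K := K) (u := u) (e := e))
      rw [mv_ad_neg _ hw, ell_inj, ← Quaternion.coe_inv, rot_coe] at this
      have h2 : -r⁻¹ = r := by
        have := congrArg (fun q : ℍ[ℝ] => q.re) this
        rwa [Quaternion.re_neg, Quaternion.re_coe, Quaternion.re_coe] at this
      have hr : r ≠ 0 := by rintro rfl; simp at hw
      have h3 : r * r = -1 := by
        have e : -r⁻¹ * r = r * r := by rw [h2]
        rw [← e]
        field_simp
      nlinarith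

/-- The entries of a matrix commuting with `G` commute with `K` and are real. Commuting with `diag
(-1, 1)` removes the upper right entry, so the upper left entry would be a real square root of `-1`.
-/
theorem not_complex_of_nf_le {G : Subgroup (GLd 2 ℍ[ℝ])} (hc : CentralReal K)
    (hG : nf K u (-1) ≤ G) : ¬ ∃ C : Subgroup (GLd 2 ℂ), IsImprimitiveComplexRG C ∧
      Conj G (C.map complexToQuaternion) := by
  apply not_complex_of_centralizer
  intro T hT hTT
  have h1 := hT _ (hG (sign_mem_nf (K := K) (u := u)))
  have hent : ∀ x ∈ K, ∀ i j, (x : ℍ[ℝ]) * T i j = T i j * x := by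
    intro x hx i j
    have h2 := hT _ (hG (dg_mem_nf (u := u) (e := -1) hx))
    have := congrFun (congrFun h2 i) j
    fin_cases i <;> fin_cases j <;> simpa [dg_val, Matrix.mul_apply] using this.symm
  have h01 : T 0 1 = 0 := by
    have := congrFun (congrFun h1 0) 1
    simp [dg_val, Matrix.mul_apply] at this
    by_contra h0
    exact neg_one_ne_zero_vec h0 this
  obtain ⟨r, hr⟩ := hc (T 0 0) fun x hx => by rw [rot_eq_self_iff, hent x hx]
  have := congrFun (congrFun hTT 0) 0
  simp [Matrix.mul_apply, h01, hr] at this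
  have := congrArg (fun q : ℍ[ℝ] => q.re) this
  simp at this
  nlinarith

theorem nf_not_complex_neg (hc : CentralReal K) :
    ¬ ∃ C : Subgroup (GLd 2 ℂ), IsImprimitiveComplexRG C ∧
      Conj (nf K u (-1)) (C.map complexToQuaternion) :=
  not_complex_of_nf_le hc le_rfl

theorem nf_not_complex_of_sq {x y : HU} (hx : x ∈ K) (hy : y ∈ K)
    (hxy : x * x * (y * y) ≠ y * y * (x * x)) :
    ¬ ∃ C : Subgroup (GLd 2 ℂ), IsImprimitiveComplexRG C ∧
      Conj (nf K u e) (C.map complexToQuaternion) := by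
  refine not_complex_of_sq (dg_mem_nf hx) (dg_mem_nf hy) ?_
  simp only [dg_mul_dg, Ne, dg_inj]
  exact fun h => hxy h.1

end NF

/-! ### The real part of the trace as a conjugation invariant -/

section Trace

/-- The real part of the trace. -/
noncomputable def retr (g : GLd 2 ℍ[ℝ]) : ℝ := (g.1 0 0 + g.1 1 1).re

/-- The quaternionic trace itself is not invariant under conjugation, but `re (a b) = re (b a)`
makes its real part invariant. -/
theorem re_trace_mul_comm (A B : Matrix (Fin 2) (Fin 2) ℍ[ℝ]) :
    ((A * B) 0 0 + (A * B) 1 1).re = ((B * A) 0 0 + (B * A) 1 1).re := by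
  simp only [Matrix.mul_apply, Fin.sum_univ_two, Quaternion.re_add, re_mul_comm (A _ _)]
  ring

theorem retr_conj (U g : GLd 2 ℍ[ℝ]) : retr (U * g * U⁻¹) = retr g := by
  rw [retr, Units.val_mul, re_trace_mul_comm, ← Units.val_mul, ← mul_assoc, inv_mul_cancel,
    one_mul, retr]

@[simp] theorem retr_dg (a b : HU) : retr (dg a b) = (a : ℍ[ℝ]).re + (b : ℍ[ℝ]).re := by
  simp [retr, dg_val]

@[simp] theorem retr_ad (a b : HU) : retr (ad a b) = 0 := by
  simp [retr, ad_val]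

/-- Conjugate groups have elements of the same order and trace. -/
theorem Conj.exists_mem {G G' : Subgroup (GLd 2 ℍ[ℝ])} (h : Conj G G') {g : GLd 2 ℍ[ℝ]}
    (hg : g ∈ G) : ∃ g' ∈ G', retr g' = retr g ∧ ∀ n : ℕ, g' ^ n = 1 ↔ g ^ n = 1 := by
  obtain ⟨U, rfl⟩ := h
  refine ⟨_, mem_cj hg, retr_conj U g, fun n => ?_⟩
  rw [conj_pow, mul_inv_eq_one, mul_eq_left]

end Trace

/-! ### Counting the systems of a normal form -/

section Systems

/-- Generators act on the two lines injectively, hence bijectively, so their inverses preserve the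
pair as well. -/
theorem isSystem_closure {A : Set (GLd 2 ℍ[ℝ])} {v w : ℍ[ℝ]} (hvw : v ≠ w)
    (h : ∀ g ∈ A, ∀ V ∈ ({ell v, ell w} : Set (RSub 2 ℍ[ℝ])),
      mv g V ∈ ({ell v, ell w} : Set (RSub 2 ℍ[ℝ]))) :
    IsSystem (Subgroup.closure A) {ell v, ell w} := by
  rw [isSystem_iff]
  refine ⟨⟨_, _, vec_ne_zero v, vec_ne_zero w, fun h => hvw (ell_inj.1 h), rfl⟩, ?_⟩
  set S : Set (RSub 2 ℍ[ℝ]) := {ell v, ell w}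
  have hS : S.Finite := Set.toFinite _
  intro g hg
  suffices H : mv g '' S = S by
    intro V hV
    rw [← H]
    exact ⟨V, hV, rfl⟩
  induction hg using Subgroup.closure_induction with
  | mem g hg =>
    exact ((hS.injOn_iff_bijOn_of_mapsTo (f := mv g) (h g hg)).1 (mv_injective g).injOn).image_eq
  | one => simp
  | mul g g' _ _ hg hg' =>
    conv_rhs => rw [← hg, ← hg']
    rw [Set.image_image]
    simp only [mv_mul]
  | inv g _ hg =>
    conv_lhs => rw [← hg]
    rw [Set.image_image]
    simp

/-- The pair of lines with slopes `± w`. -/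
def sys (w : ℍ[ℝ]) : Set (RSub 2 ℍ[ℝ]) := {ell w, ell (-w)}

theorem sys_ne_stdSys {w : ℍ[ℝ]} : sys w ≠ stdSys ℍ[ℝ] := by
  intro h
  have : (ellInf : RSub 2 ℍ[ℝ]) ∈ sys w := by rw [h]; exact Or.inr rfl
  rcases this with h | h <;> exact ell_ne_ellInf _ h.symm

theorem sys_eq {w w' : ℍ[ℝ]} (h : sys w = sys w') : w = w' ∨ w = -w' := by
  have : ell w ∈ sys w' := h ▸ Or.inl rfl
  rcases this with h | h
  · exact Or.inl (ell_inj.1 h)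
  · exact Or.inr (ell_inj.1 h)

variable {K : Subgroup HU} {u : HU}

/-- The condition on `w` for `sys w` to be permuted. -/
def SysCond (K : Subgroup HU) (u : HU) (w : ℍ[ℝ]) : Prop :=
  w ≠ 0 ∧ (∀ x ∈ K, rot x w = w ∨ rot x w = -w) ∧ (rot u w⁻¹ = w ∨ rot u w⁻¹ = -w)

theorem isSystem_sys {w : ℍ[ℝ]} (h : SysCond K u w) : IsSystem (nf K u (-1)) (sys w) := by
  obtain ⟨h0, hK, hu⟩ := h
  refine isSystem_closure (neg_one_ne_zero_vec h0) ?_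
  rintro g (⟨x, hx, rfl⟩ | rfl | rfl) V (rfl | rfl)
  · rw [mv_dg_self]
    rcases hK x hx with h | h <;> simp [h]
  · rw [mv_dg_self, rot_neg]
    rcases hK x hx with h | h <;> simp [h]
  · rw [mv_ad_neg _ h0]
    rcases hu with h | h <;> simp [h]
  · rw [mv_ad_neg _ (neg_ne_zero.2 h0), inv_neg, rot_neg]
    rcases hu with h | h <;> simp [h]
  · rw [mv_dg_ell]; simp
  · rw [mv_dg_ell]; simp

/-- The element `diag (-1, 1)` sends the slope `w` to `-w`, so every system other than the axes is a
pair `{w, -w}`. -/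
theorem isSystem_nf_neg (h : IsNF K u (-1)) (hc : CentralReal K) {S : Set (RSub 2 ℍ[ℝ])} :
    IsSystem (nf K u (-1)) S ↔ S = stdSys ℍ[ℝ] ∨ ∃ w, SysCond K u w ∧ S = sys w := by
  constructor
  · intro hS
    by_cases hne : S = stdSys ℍ[ℝ]
    · exact Or.inl hne
    right
    obtain ⟨w, w', hw, hw', hww, rfl⟩ := system_eq_pair (nf_le_mono h) (nf_irreducible hc) hS hne
    have hperm := (isSystem_iff.1 hS).2
    have e : w' = -w := by
      have := hperm _ sign_mem_nf (ell w) (Or.inl rfl)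
      rw [mv_dg_ell] at this
      rcases this with h | h
      · rw [ell_inj] at h
        exact absurd (by simpa [eq_comm] using h) (neg_one_ne_zero_vec hw)
      · rw [Set.mem_singleton_iff, ell_inj] at h
        rw [← h]
        simp
    subst e
    refine ⟨w, ⟨hw, fun x hx => ?_, ?_⟩, rfl⟩
    · have := hperm _ (dg_mem_nf hx) (ell w) (Or.inl rfl)
      rwa [mv_dg_self, Set.mem_insert_iff, Set.mem_singleton_iff, ell_inj, ell_inj] at this
    · have := hperm _ ad_mem_nf (ell w) (Or.inl rfl)
      rw [mv_ad_neg _ hw, Set.mem_insert_iff, Set.mem_singleton_iff, ell_inj, ell_inj,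
        neg_inj, neg_eq_iff_eq_neg] at this
      exact this.symm
  · rintro (rfl | ⟨w, hw, rfl⟩)
    · exact isSystem_stdSys_iff.2 (nf_le_mono h)
    · exact isSystem_sys hw

/-- The set `T` represents the admissible slopes modulo sign; the summand `1` counts the axes. -/
theorem numSystems_nf_neg (h : IsNF K u (-1)) (hc : CentralReal K) {T : Set ℍ[ℝ]}
    (hT : ∀ w ∈ T, SysCond K u w) (hT' : ∀ w, SysCond K u w → w ∈ T ∨ -w ∈ T)
    (hneg : ∀ w ∈ T, -w ∉ T) : numSystems (nf K u (-1)) = T.encard + 1 := by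
  have e : {S | IsSystem (nf K u (-1)) S} = insert (stdSys ℍ[ℝ]) (sys '' T) := by
    ext S
    rw [Set.mem_ofPred_eq, isSystem_nf_neg h hc]
    refine or_congr Iff.rfl ⟨?_, ?_⟩
    · rintro ⟨w, hw, rfl⟩
      rcases hT' w hw with h | h
      · exact ⟨w, h, rfl⟩
      · exact ⟨-w, h, by rw [sys, sys, neg_neg, Set.pair_comm]⟩
    · rintro ⟨w, hw, rfl⟩
      exact ⟨w, hT w hw, rfl⟩
  rw [numSystems, e, Set.encard_insert_of_notMem, Set.InjOn.encard_image]
  · intro w hw w' hw' hww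
    rcases sys_eq hww with h | h
    · exact h
    · exact absurd (h ▸ hw) (hneg w' hw')
  · rintro ⟨w, -, hw⟩
    exact sys_ne_stdSys hw

/-- Scalars fix real slopes and the antidiagonal generator acts on them by `r ↦ -r⁻¹`, so every pair
`{r, -r⁻¹}` is a system. The positive slope `n + 1` tells the chosen ones apart. -/
theorem numSystems_nf_one : numSystems (nf K u 1) = ⊤ := by
  rw [numSystems, Set.encard_eq_top_iff]
  have hpos : ∀ n : ℕ, (0 : ℝ) < n + 1 := fun n => by positivity
  refine Set.infinite_of_injective_forall_mem (f := fun n : ℕ =>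
    ({ell (((n + 1 : ℝ) : ℍ[ℝ])), ell ((-(n + 1 : ℝ)⁻¹ : ℝ) : ℍ[ℝ])} : Set (RSub 2 ℍ[ℝ]))) ?_ ?_
  · intro m n hmn
    have : ell (((m + 1 : ℝ) : ℍ[ℝ])) ∈
        ({ell (((n + 1 : ℝ) : ℍ[ℝ])), ell ((-(n + 1 : ℝ)⁻¹ : ℝ) : ℍ[ℝ])} : Set (RSub 2 ℍ[ℝ])) := by
      beta_reduce at hmn
      rw [← hmn]; exact Or.inl rfl
    rcases this with h | h
    · rw [ell_inj, Quaternion.coe_inj] at h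
      have : (m : ℝ) = n := by linarith
      exact_mod_cast this
    · rw [Set.mem_singleton_iff, ell_inj, Quaternion.coe_inj] at h
      have := inv_pos.2 (hpos n)
      linarith [hpos m]
  · intro n
    have hn := hpos n
    have hn' := inv_pos.2 hn
    have h0 : (((n + 1 : ℝ)) : ℍ[ℝ]) ≠ 0 := by
      rw [Ne, ← Quaternion.coe_zero, Quaternion.coe_inj]; exact hn.ne'
    have h0' : ((-(n + 1 : ℝ)⁻¹ : ℝ) : ℍ[ℝ]) ≠ 0 := by
      rw [Ne, ← Quaternion.coe_zero, Quaternion.coe_inj]; linarith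
    refine isSystem_closure (fun h => ?_) ?_
    · rw [Quaternion.coe_inj] at h
      linarith
    · rintro g (⟨x, hx, rfl⟩ | rfl | rfl) V (rfl | rfl)
      · rw [mv_dg_self, rot_coe]; exact Or.inl rfl
      · rw [mv_dg_self, rot_coe]; exact Or.inr rfl
      · rw [mv_ad_neg _ h0, ← Quaternion.coe_inv, rot_coe, ← Quaternion.coe_neg]
        exact Or.inr rfl
      · rw [mv_ad_neg _ h0', ← Quaternion.coe_inv, rot_coe, ← Quaternion.coe_neg, inv_neg, inv_inv,
          neg_neg]
        exact Or.inl rfl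
      · rw [dg_one, mv_one]; exact Or.inl rfl
      · rw [dg_one, mv_one]; exact Or.inr rfl

theorem eq_coe_of_comm {w : ℍ[ℝ]} (h1 : rot uI w = w) (h2 : rot uJ w = w) : w = (w.re : ℍ[ℝ]) := by
  rw [rot_eq_self_iff] at h1 h2
  have a1 := congrArg (fun q : ℍ[ℝ] => q.imJ) h1
  have a2 := congrArg (fun q : ℍ[ℝ] => q.imK) h1
  have a3 := congrArg (fun q : ℍ[ℝ] => q.imK) h2
  simp at a1 a2 a3
  ext <;> simp <;> linarith

theorem centralReal_of_mem (hi : uI ∈ K) (hj : uJ ∈ K) : CentralReal K :=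
  fun _ hw => ⟨_, eq_coe_of_comm (hw _ hi) (hw _ hj)⟩

theorem uQ_cu : uQ * uQ * uQ = -1 := by
  ext <;> simp <;> norm_num

/-- Since `uQ` has cube `-1`, it cannot negate `w`. Then `i`, `j`, `k`, conjugate under `uQ`, act on
`w` by the same sign, and `i j = k` makes it `+`. So `w` is real, and `w⁻¹ = ±w` leaves `±1`. -/
theorem sysCond_polyhedral (hi : uI ∈ K) (hq : uQ ∈ K) {w : ℍ[ℝ]} (h : SysCond K u w) :
    w = 1 ∨ w = -1 := by
  obtain ⟨h0, hK, hu⟩ := h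
  have hne := neg_one_ne_zero_vec h0
  have hQ : rot uQ w = w := by
    rcases hK _ hq with h | h
    · exact h
    · exfalso
      have h3 : rot (uQ * uQ * uQ) w = -w := by
        rw [rot_mul_left, rot_mul_left, h, rot_neg, h, neg_neg, h]
      rw [uQ_cu] at h3
      simp at h3
      exact hne h3
  have hQ' : rot uQ⁻¹ w = w := by conv_lhs => rw [← hQ, rot_inv_rot]
  have hJ : rot uJ w = rot uQ (rot uI w) := by
    rw [← mul_inv_eq_iff_eq_mul.2 uQ_mul_uI, rot_mul_left, rot_mul_left, hQ']
  have hKK : rot uK w = rot uQ (rot uJ w) := by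
    rw [← mul_inv_eq_iff_eq_mul.2 uQ_mul_uJ, rot_mul_left, rot_mul_left, hQ']
  have hI : rot uI w = w := by
    rcases hK _ hi with h | h
    · exact h
    · exfalso
      rw [h, rot_neg, hQ] at hJ
      rw [hJ, rot_neg, hQ, ← uI_mul_uJ, rot_mul_left, hJ, rot_neg, h, neg_neg] at hKK
      exact hne hKK
  rw [hI, hQ] at hJ
  have hr := eq_coe_of_comm hI hJ
  generalize w.re = r at hr
  subst hr
  have hr0 : r ≠ 0 := by rintro rfl; simp at h0
  rw [← Quaternion.coe_inv, rot_coe, ← Quaternion.coe_neg, Quaternion.coe_inj,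
    Quaternion.coe_inj] at hu
  have : r = 1 ∨ r = -1 := by
    rcases hu with h | h
    · have e : r * r⁻¹ = 1 := mul_inv_cancel₀ hr0
      rw [h] at e
      exact mul_self_eq_one_iff.1 e
    · have : r * r = -1 := by
        have e : r * r⁻¹ = 1 := mul_inv_cancel₀ hr0
        rw [h] at e
        linarith
      nlinarith
  rcases this with rfl | rfl
  · left; simp
  · right; simp

theorem numSystems_polyhedral (h : IsNF K u (-1)) (hi : uI ∈ K) (hq : uQ ∈ K) :
    numSystems (nf K u (-1)) = 2 := by
  rw [numSystems_nf_neg h (centralReal_of_mem hi (uJ_mem_of hi hq)) (T := {1})]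
  · rw [Set.encard_singleton]; rfl
  · rintro _ rfl
    exact ⟨one_ne_zero, fun x _ => Or.inl (by simp [rot]), Or.inl (by simp [rot])⟩
  · intro w hw
    rcases sysCond_polyhedral hi hq hw with rfl | rfl <;> simp
  · rintro _ rfl
    exact neg_one_ne_one_quat

end Systems

/-! ### Binary dihedral groups and their systems -/

section Dicyclic

section

variable (n : ℕ)

@[simp] theorem omega_re : (omega n).re = Real.cos (Real.pi / n) := rfl
@[simp] theorem omega_imI : (omega n).imI = Real.sin (Real.pi / n) := rfl
@[simp] theorem omega_imJ : (omega n).imJ = 0 := rfl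
@[simp] theorem omega_imK : (omega n).imK = 0 := rfl

end

theorem normSq_omega (n : ℕ) : Quaternion.normSq (omega n) = 1 := by
  rw [Quaternion.normSq_def']
  simp

/-- `exp (π i / n)` as a unit. -/
noncomputable def omu (n : ℕ) : HU := ofNorm (omega n) (normSq_omega n)

@[simp] theorem omu_val (n : ℕ) : (omu n : ℍ[ℝ]) = omega n := rfl

theorem omega_eq (n : ℕ) :
    omega n = ((Complex.exp (2 * Real.pi * Complex.I / ((2 * n : ℕ) : ℂ)) : ℂ) : ℍ[ℝ]) := by
  have : 2 * Real.pi * Complex.I / ((2 * n : ℕ) : ℂ) = ((Real.pi / n : ℝ) : ℂ) * Complex.I := by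
    push_cast
    rw [mul_assoc, mul_div_mul_left _ _ two_ne_zero]
    ring
  rw [this, omega]
  generalize Real.pi / n = θ
  ext <;> simp [Complex.exp_ofReal_mul_I_re, Complex.exp_ofReal_mul_I_im]

theorem omu_pow_eq_one_iff {n : ℕ} (hn : n ≠ 0) (k : ℕ) : omu n ^ k = 1 ↔ 2 * n ∣ k := by
  have hp := Complex.isPrimitiveRoot_exp (2 * n) (by omega)
  rw [← hp.pow_eq_one_iff_dvd, ← ofComplex_injective.eq_iff, map_pow, map_one, ← Units.val_inj,
    Units.val_pow_eq_pow_val, omu_val, Units.val_one, omega_eq]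
  rfl

theorem omu_pow_self {n : ℕ} (hn : n ≠ 0) : omu n ^ n = -1 := by
  have h1 : omu n ^ n * omu n ^ n = 1 := by
    rw [← pow_add, omu_pow_eq_one_iff hn, two_mul]
  rcases sq_eq_one_unit h1 with h | h
  · rw [omu_pow_eq_one_iff hn] at h
    have := Nat.le_of_dvd (Nat.pos_of_ne_zero hn) h
    omega
  · exact h

theorem uJ_mul_omu (n : ℕ) : uJ * omu n = (omu n)⁻¹ * uJ := by
  ext1
  rw [Units.val_mul, Units.val_mul, inv_eq_star (normSq_omega n)]
  ext <;> simp

theorem uJ_mul_omu_zpow (n : ℕ) (k : ℤ) : uJ * omu n ^ k = omu n ^ (-k) * uJ := by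
  have h : uJ * omu n * uJ⁻¹ = (omu n)⁻¹ := by rw [uJ_mul_omu, mul_inv_cancel_right]
  rw [← mul_inv_eq_iff_eq_mul, ← conj_zpow, h, inv_zpow']

/-- The binary dihedral group of order `4 n`. -/
noncomputable def dic (n : ℕ) : Subgroup HU := Subgroup.closure {omu n, uJ}

theorem omu_mem (n : ℕ) : omu n ∈ dic n := Subgroup.subset_closure (Or.inl rfl)
theorem uJ_mem_dic (n : ℕ) : uJ ∈ dic n := Subgroup.subset_closure (Or.inr rfl)
theorem neg_one_mem_dic (n : ℕ) : -1 ∈ dic n :=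
  uJ_mul_self ▸ mul_mem (uJ_mem_dic n) (uJ_mem_dic n)

theorem uJ_inv : uJ⁻¹ = -uJ := by
  rw [inv_eq_iff_mul_eq_one, mul_neg, uJ_mul_self, neg_neg]

theorem mem_dic {n : ℕ} (hn : n ≠ 0) {x : HU} (hx : x ∈ dic n) :
    ∃ k : ℤ, x = omu n ^ k ∨ x = omu n ^ k * uJ := by
  have hneg : ∀ k : ℤ, -omu n ^ k = omu n ^ (k + n) := fun k => by
    rw [zpow_add, zpow_natCast, omu_pow_self hn, mul_neg_one]
  induction hx using Subgroup.closure_induction with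
  | mem x hx =>
    rcases hx with rfl | rfl
    · exact ⟨1, Or.inl (zpow_one _).symm⟩
    · exact ⟨0, Or.inr (by simp)⟩
  | one => exact ⟨0, Or.inl (zpow_zero _).symm⟩
  | mul x y _ _ hx hy =>
    obtain ⟨k, rfl | rfl⟩ := hx <;> obtain ⟨l, rfl | rfl⟩ := hy
    · exact ⟨k + l, Or.inl (zpow_add _ _ _).symm⟩
    · exact ⟨k + l, Or.inr (by rw [zpow_add, mul_assoc])⟩
    · exact ⟨k + -l, Or.inr (by rw [zpow_add, mul_assoc, uJ_mul_omu_zpow, mul_assoc])⟩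
    · refine ⟨k + -l + n, Or.inl ?_⟩
      rw [← hneg, zpow_add, mul_assoc, ← mul_assoc uJ, uJ_mul_omu_zpow, mul_assoc, uJ_mul_self]
      simp
  | inv x _ hx =>
    obtain ⟨k, rfl | rfl⟩ := hx
    · exact ⟨-k, Or.inl (zpow_neg _ _).symm⟩
    · refine ⟨k + n, Or.inr ?_⟩
      rw [mul_inv_rev, uJ_inv, ← zpow_neg, neg_mul, uJ_mul_omu_zpow, neg_neg, ← hneg, neg_mul]

theorem isOfFinOrder_omu {n : ℕ} (hn : n ≠ 0) : IsOfFinOrder (omu n) :=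
  isOfFinOrder_iff_pow_eq_one.2 ⟨2 * n, by omega, (omu_pow_eq_one_iff hn _).2 dvd_rfl⟩

theorem dic_finite {n : ℕ} (hn : n ≠ 0) : (dic n : Set HU).Finite := by
  have hf : (Subgroup.zpowers (omu n) : Set HU).Finite :=
    Set.finite_coe_iff.1 (isOfFinOrder_omu hn).finite_zpowers
  refine (hf.union (hf.image (· * uJ))).subset ?_
  intro x hx
  obtain ⟨k, rfl | rfl⟩ := mem_dic hn hx
  · exact Or.inl ⟨k, rfl⟩
  · exact Or.inr ⟨_, ⟨k, rfl⟩, rfl⟩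

theorem isNF_one {K : Subgroup HU} {e : HU} (h : -1 ∈ K) (he : e = 1 ∨ e = -1) : IsNF K 1 e :=
  ⟨fun x hx => by simpa using hx, by simp [K.one_mem], h, he⟩

theorem sin_pos {n : ℕ} (hn : 2 ≤ n) : 0 < Real.sin (Real.pi / n) := by
  have h : (2 : ℝ) ≤ n := by exact_mod_cast hn
  apply Real.sin_pos_of_pos_of_lt_pi
  · have := Real.pi_pos
    positivity
  · exact div_lt_self Real.pi_pos (by linarith)

theorem cos_pos {n : ℕ} (hn : 3 ≤ n) : 0 < Real.cos (Real.pi / n) := by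
  have h : (3 : ℝ) ≤ n := by exact_mod_cast hn
  have hp := Real.pi_pos
  apply Real.cos_pos_of_mem_Ioo
  constructor
  · have : 0 < Real.pi / n := by positivity
    linarith
  · exact div_lt_div_of_pos_left hp (by norm_num) (by linarith)

theorem comm_omega {n : ℕ} (hn : 2 ≤ n) {w : ℍ[ℝ]} (h : rot (omu n) w = w) :
    w.imJ = 0 ∧ w.imK = 0 := by
  have hs := sin_pos hn
  rw [rot_eq_self_iff] at h
  have a1 := congrArg (fun q : ℍ[ℝ] => q.imJ) h
  have a2 := congrArg (fun q : ℍ[ℝ] => q.imK) h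
  simp at a1 a2
  constructor
  · have : Real.sin (Real.pi / n) * w.imJ = 0 := by linarith
    exact (mul_eq_zero.1 this).resolve_left hs.ne'
  · have : Real.sin (Real.pi / n) * w.imK = 0 := by linarith
    exact (mul_eq_zero.1 this).resolve_left hs.ne'

/-- Conjugation by `ω` fixes `1` and `i` and turns the plane of `j` and `k` through `2π/n`, which is
a half-turn only for `n = 2`. -/
theorem anticomm_omega {n : ℕ} (hn : 2 ≤ n) {w : ℍ[ℝ]} (h : rot (omu n) w = -w) :
    w.re = 0 ∧ w.imI = 0 ∧ (3 ≤ n → w = 0) := by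
  have hs := sin_pos hn
  rw [rot_eq_iff] at h
  have a0 := congrArg (fun q : ℍ[ℝ] => q.re) h
  have a1 := congrArg (fun q : ℍ[ℝ] => q.imI) h
  have a2 := congrArg (fun q : ℍ[ℝ] => q.imJ) h
  have a3 := congrArg (fun q : ℍ[ℝ] => q.imK) h
  simp at a0 a1 a2 a3
  have hsc := Real.sin_sq_add_cos_sq (Real.pi / n)
  have hc : 3 ≤ n → 0 < Real.cos (Real.pi / n) := cos_pos
  generalize Real.sin (Real.pi / n) = s at *
  generalize Real.cos (Real.pi / n) = c at *
  have e0 : w.re = 0 := by linear_combination c * a0 / 2 + s * a1 / 2 - w.re * hsc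
  have e1 : w.imI = 0 := by linear_combination c * a1 / 2 - s * a0 / 2 - w.imI * hsc
  refine ⟨e0, e1, fun h3 => ?_⟩
  have e2 : c * w.imJ = 0 := by linarith
  have e3 : c * w.imK = 0 := by linarith
  ext
  · exact e0
  · exact e1
  · exact (mul_eq_zero.1 e2).resolve_left (hc h3).ne'
  · exact (mul_eq_zero.1 e3).resolve_left (hc h3).ne'

theorem comm_uJ {w : ℍ[ℝ]} (h : rot uJ w = w) : w.imI = 0 ∧ w.imK = 0 := by
  rw [rot_eq_self_iff] at h
  have a1 := congrArg (fun q : ℍ[ℝ] => q.imI) h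
  have a2 := congrArg (fun q : ℍ[ℝ] => q.imK) h
  simp at a1 a2
  constructor <;> linarith

theorem anticomm_uJ {w : ℍ[ℝ]} (h : rot uJ w = -w) : w.re = 0 ∧ w.imJ = 0 := by
  rw [rot_eq_iff] at h
  have a1 := congrArg (fun q : ℍ[ℝ] => q.re) h
  have a2 := congrArg (fun q : ℍ[ℝ] => q.imJ) h
  simp at a1 a2
  constructor <;> linarith

theorem dic_centralReal {n : ℕ} (hn : 2 ≤ n) : CentralReal (dic n) := by
  intro w hw
  obtain ⟨h1, h2⟩ := comm_omega hn (hw _ (omu_mem n))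
  obtain ⟨h3, -⟩ := comm_uJ (hw _ (uJ_mem_dic n))
  exact ⟨w.re, by ext <;> simp [h1, h2, h3]⟩

theorem mul_self_of_sysCond {K : Subgroup HU} {w : ℍ[ℝ]} (h : SysCond K 1 w) :
    w * w = 1 ∨ w * w = -1 := by
  obtain ⟨h0, -, h⟩ := h
  have e : w * w⁻¹ = 1 := mul_inv_cancel₀ h0
  rw [rot_one_left] at h
  rcases h with h | h
  · left; rwa [h] at e
  · right; rw [h, mul_neg] at e; rw [← e, neg_neg]

theorem real_sq {r : ℝ} (h : r * r = 1 ∨ r * r = -1) : r = 1 ∨ r = -1 := by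
  rcases h with h | h
  · exact mul_self_eq_one_iff.1 h
  · nlinarith

/-- The slope is a joint eigenvector, with eigenvalues `±1`, of conjugation by `ω` and by `j`. The
joint eigenspaces are the lines of `1` and `i`, and for `n = 2` also of `j` and `k`; the condition
`w² = ±1` fixes the length. -/
theorem sysCond_dic {n : ℕ} (hn : 2 ≤ n) {w : ℍ[ℝ]} (h : SysCond (dic n) 1 w) :
    (w ∈ ({1, qi} : Set ℍ[ℝ]) ∨ -w ∈ ({1, qi} : Set ℍ[ℝ])) ∨
      (n = 2 ∧ (w ∈ ({qj, im3 0 0 1} : Set ℍ[ℝ]) ∨ -w ∈ ({qj, im3 0 0 1} : Set ℍ[ℝ]))) := by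
  have hsq := mul_self_of_sysCond h
  have hre : (w * w).re = 1 ∨ (w * w).re = -1 := by
    rcases hsq with h | h <;> rw [h] <;> simp
  rw [Quaternion.re_mul] at hre
  rcases h.2.1 _ (omu_mem n) with ho | ho
  · obtain ⟨a1, a2⟩ := comm_omega hn ho
    left
    rcases h.2.1 _ (uJ_mem_dic n) with hj | hj
    · obtain ⟨b1, -⟩ := comm_uJ hj
      rcases real_sq (r := w.re) (by simpa [a1, a2, b1] using hre) with hr | hr
      · left; left; ext <;> simp [a1, a2, b1, hr]
      · right; left; ext <;> simp [a1, a2, b1, hr]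
    · obtain ⟨b1, -⟩ := anticomm_uJ hj
      have hre' : w.imI * w.imI = -1 ∨ w.imI * w.imI = 1 := by
        rcases hre with h | h <;> rw [a1, a2, b1] at h
        · left; linarith
        · right; linarith
      rcases real_sq hre'.symm with hr | hr
      · left; right; ext <;> simp [a1, a2, b1, hr]
      · right; right; ext <;> simp [a1, a2, b1, hr]
  · obtain ⟨a1, a2, a3⟩ := anticomm_omega hn ho
    right
    refine ⟨?_, ?_⟩
    · by_contra hne
      exact h.1 (a3 (by omega))
    rcases h.2.1 _ (uJ_mem_dic n) with hj | hj
    · obtain ⟨-, b1⟩ := comm_uJ hj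
      have hre' : w.imJ * w.imJ = -1 ∨ w.imJ * w.imJ = 1 := by
        rcases hre with h | h <;> rw [a1, a2, b1] at h
        · left; linarith
        · right; linarith
      rcases real_sq hre'.symm with hr | hr
      · left; left; ext <;> simp [a1, a2, b1, hr]
      · right; left; ext <;> simp [a1, a2, b1, hr]
    · obtain ⟨-, b1⟩ := anticomm_uJ hj
      have hre' : w.imK * w.imK = -1 ∨ w.imK * w.imK = 1 := by
        rcases hre with h | h <;> rw [a1, a2, b1] at h
        · left; linarith
        · right; linarith
      rcases real_sq hre'.symm with hr | hr
      · left; right; ext <;> simp [a1, a2, b1, hr]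
      · right; right; ext <;> simp [a1, a2, b1, hr]

theorem sysCond_of_gens {A : Set HU} {w : ℍ[ℝ]} (h0 : w ≠ 0)
    (hA : ∀ x ∈ A, rot x w = w ∨ rot x w = -w) (hw : w * w = 1 ∨ w * w = -1) :
    SysCond (Subgroup.closure A) 1 w := by
  refine ⟨h0, rot_closure hA, ?_⟩
  · rw [rot_one_left]
    rcases hw with h | h
    · exact Or.inl (inv_eq_of_mul_eq_one_right h)
    · right
      apply inv_eq_of_mul_eq_one_right
      rw [mul_neg, h, neg_neg]

end Dicyclic

theorem omega_two : omega 2 = qi := by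
  ext <;> simp

theorem omu_two : omu 2 = uI := by
  ext1
  exact omega_two

theorem numSystems_dic {n : ℕ} (hn : 3 ≤ n) : numSystems (nf (dic n) 1 (-1)) = 3 := by
  have hne : (1 : ℍ[ℝ]) ≠ qi := fun h => by simpa using congrArg (fun q : ℍ[ℝ] => q.re) h
  rw [numSystems_nf_neg (isNF_one (neg_one_mem_dic n) (Or.inr rfl)) (dic_centralReal (by omega))
    (T := {1, qi}), Set.encard_pair hne]
  · rfl
  · rintro _ (rfl | rfl)
    · exact sysCond_of_gens one_ne_zero (fun x _ => Or.inl (by simp [rot])) (Or.inl (mul_one 1))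
    · refine sysCond_of_gens qi_ne_zero ?_ (Or.inr (congrArg Units.val uI_mul_self))
      rintro x (rfl | rfl)
      · left; rw [rot_eq_iff]; ext <;> simp
      · right; exact uJ_qi
  · intro w hw
    rcases sysCond_dic (by omega) hw with h | ⟨h, -⟩
    · exact h
    · omega
  · rintro _ (rfl | rfl) (h | h)
    · exact neg_one_ne_one_quat h
    · simpa using congrArg (fun q : ℍ[ℝ] => q.re) h
    · simpa using congrArg (fun q : ℍ[ℝ] => q.re) h
    · exact neg_one_ne_zero_vec qi_ne_zero h.symm

theorem numSystems_dic_two : numSystems (nf (dic 2) 1 (-1)) = 5 := by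
  have ne1 : (1 : ℍ[ℝ]) ∉ ({qi, qj, im3 0 0 1} : Set ℍ[ℝ]) := by
    rintro (h | h | h) <;> simpa using congrArg (fun q : ℍ[ℝ] => q.re) h
  have ne2 : qi ∉ ({qj, im3 0 0 1} : Set ℍ[ℝ]) := by
    rintro (h | h) <;> simpa using congrArg (fun q : ℍ[ℝ] => q.imI) h
  have ne3 : qj ≠ im3 0 0 1 := fun h => by simpa using congrArg (fun q : ℍ[ℝ] => q.imJ) h
  rw [numSystems_nf_neg (isNF_one (neg_one_mem_dic 2) (Or.inr rfl)) (dic_centralReal le_rfl)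
    (T := {1, qi, qj, im3 0 0 1}), Set.encard_insert_of_notMem ne1, Set.encard_insert_of_notMem ne2,
    Set.encard_pair ne3]
  · norm_num
  · rintro _ (rfl | rfl | rfl | rfl)
    · exact sysCond_of_gens one_ne_zero (fun x _ => Or.inl (by simp [rot])) (Or.inl (mul_one 1))
    · refine sysCond_of_gens qi_ne_zero ?_ (Or.inr (congrArg Units.val uI_mul_self))
      rintro x (rfl | rfl)
      · left; rw [omu_two]; exact uI_qi
      · right; exact uJ_qi
    · refine sysCond_of_gens uJ.ne_zero ?_ (Or.inr (congrArg Units.val uJ_mul_self))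
      rintro x (rfl | rfl)
      · right; rw [omu_two]; exact uI_qj
      · left; exact uJ_qj
    · refine sysCond_of_gens uK.ne_zero ?_ (Or.inr (congrArg Units.val uK_mul_self))
      rintro x (rfl | rfl)
      · right; rw [omu_two, uI_im3, neg_im3]; simp
      · right; rw [uJ_im3, neg_im3]; simp
  · intro w hw
    rcases sysCond_dic le_rfl hw with (h | h) | ⟨-, h | h⟩
    · exact Or.inl (Or.elim h (fun h => Or.inl h) fun h => Or.inr (Or.inl h))
    · exact Or.inr (Or.elim h (fun h => Or.inl h) fun h => Or.inr (Or.inl h))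
    · exact Or.inl (Or.inr (Or.inr h))
    · exact Or.inr (Or.inr (Or.inr h))
  · rintro _ (rfl | rfl | rfl | rfl) (h | h | h | h)
    · exact neg_one_ne_one_quat h
    iterate 4 simpa using congrArg (fun q : ℍ[ℝ] => q.re) h
    · exact neg_one_ne_zero_vec qi_ne_zero h.symm
    · simpa using congrArg (fun q : ℍ[ℝ] => q.imI) h
    · simpa using congrArg (fun q : ℍ[ℝ] => q.imI) h
    · simpa using congrArg (fun q : ℍ[ℝ] => q.re) h
    · simpa using congrArg (fun q : ℍ[ℝ] => q.imI) h
    · exact neg_one_ne_zero_vec uJ.ne_zero h.symm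
    · simpa using congrArg (fun q : ℍ[ℝ] => q.imJ) h
    · simpa using congrArg (fun q : ℍ[ℝ] => q.re) h
    · simpa using congrArg (fun q : ℍ[ℝ] => q.imI) h
    · simpa using congrArg (fun q : ℍ[ℝ] => q.imJ) h
    · exact neg_one_ne_zero_vec uK.ne_zero h.symm

/-! ### From the given generators to normal forms -/

section Generators

/-- The group generated by the reflections `(0 b; b⁻¹ 0)`, `b ∈ L`, and `diag (e, 1)`. -/
noncomputable def cl (L : Set HU) (e : HU) : Subgroup (GLd 2 ℍ[ℝ]) :=
  Subgroup.closure ({g | ∃ b ∈ L, g = ad b b⁻¹} ∪ {dg e 1})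

variable {L : Set HU} {e u : HU}

theorem ad_mem_cl {b : HU} (hb : b ∈ L) : ad b b⁻¹ ∈ cl L e :=
  Subgroup.subset_closure (Or.inl ⟨b, hb, rfl⟩)

theorem sign_mem_cl : dg e 1 ∈ cl L e := Subgroup.subset_closure (Or.inr rfl)

theorem cl_le {G : Subgroup (GLd 2 ℍ[ℝ])} (h1 : ∀ b ∈ L, ad b b⁻¹ ∈ G) (h2 : dg e 1 ∈ G) :
    cl L e ≤ G := by
  rw [cl, Subgroup.closure_le]
  rintro g (⟨b, hb, rfl⟩ | rfl)
  · exact h1 b hb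
  · exact h2

theorem genGroup_eq_cl (hL : ∀ b ∈ L, Quaternion.normSq (b : ℍ[ℝ]) = 1) :
    genGroup (Units.val '' L) {(e : ℍ[ℝ])} = cl L e := by
  rw [genGroup, cl]
  congr 1
  ext g
  refine or_congr ⟨?_, ?_⟩ ⟨?_, ?_⟩
  · rintro ⟨_, ⟨b, hb, rfl⟩, hg⟩
    exact ⟨b, hb, Units.ext (by rw [hg, ad_val, inv_eq_star (hL b hb)])⟩
  · rintro ⟨b, hb, rfl⟩
    exact ⟨b, ⟨b, hb, rfl⟩, by rw [ad_val, inv_eq_star (hL b hb)]⟩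
  · rintro ⟨_, rfl, hg⟩
    exact Units.ext hg
  · rintro rfl
    exact ⟨e, rfl, rfl⟩

theorem genGroup_empty_eq_cl (hL : ∀ b ∈ L, Quaternion.normSq (b : ℍ[ℝ]) = 1) :
    genGroup (Units.val '' L) ∅ = cl L 1 := by
  rw [← genGroup_eq_cl hL]
  apply le_antisymm
  · rw [genGroup, Subgroup.closure_le]
    rintro g (h | ⟨h, hh, -⟩)
    · exact Subgroup.subset_closure (Or.inl h)
    · exact absurd hh (Set.notMem_empty h)
  · rw [genGroup, Subgroup.closure_le]
    rintro g (h | ⟨h, hh, hg⟩)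
    · exact Subgroup.subset_closure (Or.inl h)
    · have : g = 1 := by
        ext1
        rw [hg, hh, Units.val_one, Units.val_one, Matrix.one_fin_two]
      rw [this]
      exact one_mem _

theorem cl_isReflectionGroup (he : e = 1 ∨ e = -1) (hf : Finite (cl L e)) :
    IsReflectionGroup (cl L e) := by
  refine ⟨hf, le_antisymm ((Subgroup.closure_le _).2 fun g hg => hg.1) ?_⟩
  refine cl_le (fun b hb => ?_) ?_
  · exact Subgroup.subset_closure ⟨ad_mem_cl hb, isReflection_ad.2 rfl⟩
  · rcases he with rfl | rfl
    · rw [dg_one]; exact one_mem _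
    · refine Subgroup.subset_closure ⟨sign_mem_cl, dg_isReflection
        (Or.inl ⟨neg_one_ne_one_unit, rfl⟩) ?_⟩
      rw [isOfFinOrder_iff_pow_eq_one]
      exact ⟨2, two_pos, by rw [pow_two, dg_mul_dg]; simp [dg_one]⟩

/-- A diagonal change of basis shifts all antidiagonal entries by one right factor `u`; a good
choice of `u` gives them square `-1`. -/
theorem conj_ad (u b : HU) : dg 1 u⁻¹ * ad b b⁻¹ * (dg 1 u⁻¹)⁻¹ = ad (b * u) (b * u)⁻¹ := by
  rw [dg_inv, dg_mul_ad, ad_mul_dg]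
  simp [mul_inv_rev]

theorem conj_sign (u e : HU) : dg 1 u⁻¹ * dg e 1 * (dg 1 u⁻¹)⁻¹ = dg e 1 := by
  rw [dg_inv, dg_mul_dg, dg_mul_dg]
  simp

theorem cj_le {U : GLd 2 ℍ[ℝ]} {G : Subgroup (GLd 2 ℍ[ℝ])} (h1 : ∀ b ∈ L, U * ad b b⁻¹ * U⁻¹ ∈ G)
    (h2 : U * dg e 1 * U⁻¹ ∈ G) : cj U (cl L e) ≤ G := by
  rw [Subgroup.map_le_iff_le_comap]
  exact cl_le h1 h2

theorem inv_of_sq {x : HU} (h : x * x = -1) : x⁻¹ = -x := by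
  rw [inv_eq_iff_mul_eq_one, mul_neg, h, neg_neg]

theorem dg_mem_of_closure {G : Subgroup (GLd 2 ℍ[ℝ])} (h : ∀ b ∈ L, dg b b ∈ G) :
    ∀ x ∈ Subgroup.closure L, dg x x ∈ G := by
  intro x hx
  induction hx using Subgroup.closure_induction with
  | mem x hx => exact h x hx
  | one => rw [dg_one]; exact G.one_mem
  | mul x y _ _ hx hy => rw [← dg_mul_dg]; exact G.mul_mem hx hy
  | inv x _ hx => rw [← dg_inv]; exact G.inv_mem hx

theorem ad_mul_eq (b u : HU) : ad (b * u) (-(b * u)) = dg b b * ad u (-u) := by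
  rw [dg_mul_ad, mul_neg]

theorem le_cj_cl (h1 : 1 ∈ L) (hsq : ∀ x ∈ L, x * u * (x * u) = -1) {L' : Set HU} (hL : L ⊆ L') :
    (∀ x ∈ Subgroup.closure L, dg x x ∈ cj (dg 1 u⁻¹) (cl L' e)) ∧
      ad u (-u) ∈ cj (dg 1 u⁻¹) (cl L' e) ∧ dg e 1 ∈ cj (dg 1 u⁻¹) (cl L' e) := by
  have hb : ∀ b ∈ L, ad (b * u) (-(b * u)) ∈ cj (dg 1 u⁻¹) (cl L' e) := by
    intro b hb
    have := mem_cj (U := dg 1 u⁻¹) (ad_mem_cl (e := e) (hL hb))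
    rwa [conj_ad, inv_of_sq (hsq b hb)] at this
  have hu := hb 1 h1
  rw [one_mul] at hu
  refine ⟨dg_mem_of_closure fun b hbL => ?_, hu, ?_⟩
  · have := mul_mem (hb b hbL) (inv_mem hu)
    rwa [ad_mul_eq, mul_inv_cancel_right] at this
  · have := mem_cj (U := dg 1 u⁻¹) (sign_mem_cl (L := L') (e := e))
    rwa [conj_sign] at this

/-- After the shift each generator is the scalar `b` times `ad u (-u)`, and the latter comes from `1
∈ L`; so the scalars can be split off. -/
theorem conj_cl_nf (h1 : 1 ∈ L) (hsq : ∀ x ∈ L, x * u * (x * u) = -1) :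
    Conj (cl L e) (nf (Subgroup.closure L) u e) := by
  refine ⟨dg 1 u⁻¹, le_antisymm (cj_le (fun b hb => ?_) ?_) ?_⟩
  · rw [conj_ad, inv_of_sq (hsq b hb), ad_mul_eq]
    exact mul_mem (dg_mem_nf (Subgroup.subset_closure hb)) ad_mem_nf
  · rw [conj_sign]
    exact sign_mem_nf
  · obtain ⟨h1, h2, h3⟩ := le_cj_cl (e := e) h1 hsq subset_rfl
    exact nf_le h1 h2 h3

/-- The extra generator `u` shifts to `ad (-1) (-1)`. Combined with the scalar `u` and `ad u (-u)`
it produces `diag (-1, 1)`, although no diagonal generator was given. -/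
theorem conj_cl_insert_nf (h1 : 1 ∈ L) (hsq : ∀ x ∈ L, x * u * (x * u) = -1)
    (hu : u ∈ Subgroup.closure L) :
    Conj (cl (insert u L) 1) (nf (Subgroup.closure L) u (-1)) := by
  have huu : u * u = -1 := by simpa using hsq 1 h1
  have hneg : -1 ∈ Subgroup.closure L := huu ▸ mul_mem hu hu
  have hS : ad (u * u) (u * u)⁻¹ = (ad (-1) (-1) : GLd 2 ℍ[ℝ]) := by rw [huu]; simp
  have e1 : dg (-1 : HU) (-1) * dg (-1) 1 = dg 1 (-1) := by rw [dg_mul_dg]; simp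
  have e2 : dg u u * ad u (-u) = ad (-1) 1 := by rw [dg_mul_ad]; simp [huu]
  refine ⟨dg 1 u⁻¹, le_antisymm (cj_le (fun b hb => ?_) ?_) (nf_le ?_ ?_ ?_)⟩
  · rcases hb with rfl | hb
    · rw [conj_ad, hS]
      have h2 := mul_mem (mul_mem (dg_mem_nf (u := b) (e := -1) hu) ad_mem_nf)
        (mul_mem (dg_mem_nf hneg) sign_mem_nf)
      rw [e1, e2, ad_mul_dg] at h2
      have h3 := mul_mem (dg_mem_nf (u := b) (e := -1) hneg) h2
      rw [dg_mul_ad] at h3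
      simpa using h3
    · rw [conj_ad, inv_of_sq (hsq b hb), ad_mul_eq]
      exact mul_mem (dg_mem_nf (Subgroup.subset_closure hb)) ad_mem_nf
  · rw [conj_sign, dg_one]
    exact one_mem _
  all_goals obtain ⟨m1, m2, -⟩ := le_cj_cl (e := 1) h1 hsq (Set.subset_insert u L)
  · exact m1
  · exact m2
  · have m4 := mem_cj (U := dg 1 u⁻¹) (ad_mem_cl (e := 1) (Set.mem_insert u L))
    rw [conj_ad, hS] at m4
    have m5 := mul_mem (m1 _ hneg) (mul_mem (mul_mem (m1 _ hu) m2) m4)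
    rw [e2, ad_mul_ad, dg_mul_dg] at m5
    simpa using m5

end Generators

/-! ### The polyhedral groups in the lists with two and infinitely many systems -/

/-- The binary tetrahedral group. -/
noncomputable def binT : Subgroup HU := Subgroup.closure {uI, uQ}

theorem uI_mem_T : uI ∈ binT := Subgroup.subset_closure (Or.inl rfl)
theorem uQ_mem_T : uQ ∈ binT := Subgroup.subset_closure (Or.inr rfl)

theorem binT_le_binO : binT ≤ binO := by
  rw [binT, Subgroup.closure_le]
  rintro _ (rfl | rfl)
  · exact uI_mem_O
  · exact uQ_mem_O

theorem conj_mem_closure {A : Set HU} {u : HU} {K : Subgroup HU} (h : ∀ x ∈ A, u * x * u⁻¹ ∈ K) :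
    ∀ x ∈ Subgroup.closure A, u * x * u⁻¹ ∈ K := by
  have : Subgroup.closure A ≤ K.comap (MulAut.conj u).toMonoidHom := by
    rw [Subgroup.closure_le]
    exact h
  exact fun x hx => this hx

theorem uX_mul_uI : uX * uI = -(uI * uX) := by ext <;> simp

theorem uX_mul_uQ : uX * uQ = uQ⁻¹ * uX := by
  ext1
  rw [Units.val_mul, Units.val_mul, inv_eq_star normSq_qh]
  ext <;> simp <;> ring

theorem neg_mem_of {K : Subgroup HU} (hneg : -1 ∈ K) {x : HU} (hx : x ∈ K) : -x ∈ K := by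
  simpa using mul_mem hneg hx

theorem isNF_T {e : HU} (he : e = 1 ∨ e = -1) : IsNF binT uX e where
  norm := by
    apply conj_mem_closure
    rintro _ (rfl | rfl)
    · rw [uX_mul_uI, neg_mul, mul_inv_cancel_right]
      exact neg_mem_of (neg_one_mem_of uI_mem_T) uI_mem_T
    · rw [uX_mul_uQ, mul_inv_cancel_right]
      exact inv_mem uQ_mem_T
  sq := by rw [uX_mul_self]; exact neg_one_mem_of uI_mem_T
  neg := neg_one_mem_of uI_mem_T
  sign := he

/-- The polyhedral data: a group of quaternions and a square root of `-1`. -/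
noncomputable def polyK : Fin 3 → Subgroup HU := ![binT, binO, binI]

/-- The square roots of `-1` attached to the polyhedral groups. -/
noncomputable def polyU : Fin 3 → HU := ![uX, uX, uP]

theorem isNF_of_mem {K : Subgroup HU} {u e : HU} (hu : u ∈ K) (hneg : -1 ∈ K)
    (he : e = 1 ∨ e = -1) : IsNF K u e :=
  ⟨fun _ hx => mul_mem (mul_mem hu hx) (inv_mem hu), mul_mem hu hu, hneg, he⟩

theorem isNF_poly (t : Fin 3) {e : HU} (he : e = 1 ∨ e = -1) : IsNF (polyK t) (polyU t) e := by
  fin_cases t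
  · exact isNF_T he
  · exact isNF_of_mem uX_mem (neg_one_mem_of uI_mem_O) he
  · exact isNF_of_mem uP_mem (neg_one_mem_of uI_mem_I) he

theorem uI_mem_poly (t : Fin 3) : uI ∈ polyK t := by
  fin_cases t
  exacts [uI_mem_T, uI_mem_O, uI_mem_I]

theorem uQ_mem_poly (t : Fin 3) : uQ ∈ polyK t := by
  fin_cases t
  exacts [uQ_mem_T, uQ_mem_O, uQ_mem_I]

theorem polyK_finite (t : Fin 3) : (polyK t : Set HU).Finite := by
  fin_cases t
  exacts [binO_finite.subset binT_le_binO, binO_finite, binI_finite]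

/-- Noncommuting squares exclude imprimitive complex groups, also when no diagonal sign matrix is
available. -/
theorem poly_sq_ne : uQ * uQ * (uI * uQ * (uI * uQ)) ≠ uI * uQ * (uI * uQ) * (uQ * uQ) := by
  intro h
  have := congrArg (fun q : HU => (q : ℍ[ℝ]).imI) h
  simp at this
  norm_num at this

theorem poly_not_complex (t : Fin 3) (e : HU) :
    ¬ ∃ C : Subgroup (GLd 2 ℂ), IsImprimitiveComplexRG C ∧
      Conj (nf (polyK t) (polyU t) e) (C.map complexToQuaternion) :=
  nf_not_complex_of_sq (uQ_mem_poly t) (mul_mem (uI_mem_poly t) (uQ_mem_poly t)) poly_sq_ne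

/-- A group generated by the standard reflections and conjugate to a normal form is an imprimitive
quaternionic reflection group. -/
theorem isQuaternionic_of_conj {L : Set HU} {e e' u : HU} {K : Subgroup HU} (he : e = 1 ∨ e = -1)
    (h : Conj (cl L e) (nf K u e')) (hNF : IsNF K u e') (hK : (K : Set HU).Finite)
    (hc : CentralReal K)
    (hn : ¬ ∃ C : Subgroup (GLd 2 ℂ), IsImprimitiveComplexRG C ∧
      Conj (nf K u e') (C.map complexToQuaternion)) :
    IsImprimitiveQuaternionicRG (cl L e) := by
  refine ⟨cl_isReflectionGroup he ?_, h.symm.isIrreducible (nf_irreducible hc),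
    h.symm.isImprimitive ⟨_, isSystem_stdSys_iff.2 (nf_le_mono hNF)⟩, h.symm.not_complex hn⟩
  obtain ⟨U, hU⟩ := h.symm
  rw [← hU]
  exact Set.Finite.image _ (nf_finite hNF hK)

theorem isQuaternionic_of_conj_poly {L : Set HU} {e e' : HU} (t : Fin 3) (he : e = 1 ∨ e = -1)
    (he' : e' = 1 ∨ e' = -1) (h : Conj (cl L e) (nf (polyK t) (polyU t) e')) :
    IsImprimitiveQuaternionicRG (cl L e) :=
  isQuaternionic_of_conj he h (isNF_poly t he') (polyK_finite t)
    (centralReal_of_mem (uI_mem_poly t) (uJ_mem_of (uI_mem_poly t) (uQ_mem_poly t)))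
    (poly_not_complex t e')

theorem sq_of_re {x : HU} (hn : Quaternion.normSq (x : ℍ[ℝ]) = 1) (h : (x : ℍ[ℝ]).re = 0) :
    x * x = -1 := by
  ext1
  rw [Units.val_mul, sq_eq_tr hn, tr, h]
  simp

theorem sq_mul_of_re {x y : HU} (hx : Quaternion.normSq (x : ℍ[ℝ]) = 1)
    (hy : Quaternion.normSq (y : ℍ[ℝ]) = 1) (h : ((x : ℍ[ℝ]) * y).re = 0) :
    x * y * (x * y) = -1 :=
  sq_of_re (by rw [Units.val_mul, map_mul, hx, hy, one_mul]) h

theorem uIX_sq : uI * uX * (uI * uX) = -1 := sq_mul_of_re normSq_qi normSq_qx (by simp)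
theorem uQX_sq : uQ * uX * (uQ * uX) = -1 := sq_mul_of_re normSq_qh normSq_qx (by simp)
theorem uOX_sq : uO * uX * (uO * uX) = -1 := sq_mul_of_re normSq_qo normSq_qx (by simp)
theorem uQP_sq : uQ * uP * (uQ * uP) = -1 :=
  sq_mul_of_re normSq_qh normSq_qp (by simp; ring)
theorem uTP_sq : uT * uP * (uT * uP) = -1 :=
  sq_mul_of_re normSq_qt normSq_qp (by simp; linear_combination -tau_sq / 4)

theorem genGroup_eq_of {L : Set ℍ[ℝ]} {H : Set ℍ[ℝ]} {L' : Set HU} {e : HU} (hL : L = Units.val '' L')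
    (hH : (H = {(e : ℍ[ℝ])}) ∨ (H = ∅ ∧ e = 1))
    (h : ∀ b ∈ L', Quaternion.normSq (b : ℍ[ℝ]) = 1) : genGroup L H = cl L' e := by
  subst hL
  rcases hH with rfl | ⟨rfl, rfl⟩
  · exact genGroup_eq_cl h
  · exact genGroup_empty_eq_cl h

theorem infCase_eq (t : Fin 3) :
    infCase t = cl (![{1, uI, uQ}, {1, uO, uQ}, {1, uQ, uT}] t : Set HU) 1 := by
  fin_cases t
  · refine genGroup_eq_of (by simp [Set.image_insert_eq]) (Or.inr ⟨rfl, rfl⟩) ?_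
    rintro _ (rfl | rfl | rfl)
    exacts [map_one _, normSq_qi, normSq_qh]
  · refine genGroup_eq_of (by simp [Set.image_insert_eq]) (Or.inr ⟨rfl, rfl⟩) ?_
    rintro _ (rfl | rfl | rfl)
    exacts [map_one _, normSq_qo, normSq_qh]
  · refine genGroup_eq_of (by simp [Set.image_insert_eq]) (Or.inr ⟨rfl, rfl⟩) ?_
    rintro _ (rfl | rfl | rfl)
    exacts [map_one _, normSq_qh, normSq_qt]

theorem twoCase_eq (t : Fin 3) :
    twoCase t = cl (![{1, uI, uQ}, {uX, 1, uO, uQ}, {uP, 1, uQ, uT}] t : Set HU)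
      (![-1, 1, 1] t : HU) := by
  fin_cases t
  · refine genGroup_eq_of (by simp [Set.image_insert_eq]) (Or.inl (by simp)) ?_
    rintro _ (rfl | rfl | rfl)
    exacts [map_one _, normSq_qi, normSq_qh]
  · refine genGroup_eq_of ?_ (Or.inr ⟨rfl, rfl⟩) ?_
    · ext x
      simp [Set.image_insert_eq]
      tauto
    · rintro _ (rfl | rfl | rfl | rfl)
      exacts [normSq_qx, map_one _, normSq_qo, normSq_qh]
  · refine genGroup_eq_of ?_ (Or.inr ⟨rfl, rfl⟩) ?_
    · ext x
      simp [Set.image_insert_eq]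
      tauto
    · rintro _ (rfl | rfl | rfl | rfl)
      exacts [normSq_qp, map_one _, normSq_qh, normSq_qt]

theorem conj_T (e : HU) : Conj (cl {1, uI, uQ} e) (nf binT uX e) := by
  have := conj_cl_nf (L := {1, uI, uQ}) (e := e) (u := uX) (Or.inl rfl) (by
    rintro _ (rfl | rfl | rfl)
    exacts [by rw [one_mul, uX_mul_self], uIX_sq, uQX_sq])
  rwa [Subgroup.closure_insert_one] at this

theorem sq_O : ∀ x ∈ ({1, uO, uQ} : Set HU), x * uX * (x * uX) = -1 := by
  rintro _ (rfl | rfl | rfl)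
  exacts [by rw [one_mul, uX_mul_self], uOX_sq, uQX_sq]

theorem sq_I : ∀ x ∈ ({1, uQ, uT} : Set HU), x * uP * (x * uP) = -1 := by
  rintro _ (rfl | rfl | rfl)
  exacts [by rw [one_mul, uP_mul_self], uQP_sq, uTP_sq]

theorem infCase_conj (t : Fin 3) : Conj (infCase t) (nf (polyK t) (polyU t) 1) := by
  rw [infCase_eq]
  fin_cases t
  · exact conj_T 1
  · have := conj_cl_nf (e := 1) (Or.inl rfl) sq_O
    rwa [Subgroup.closure_insert_one] at this
  · have := conj_cl_nf (e := 1) (Or.inl rfl) sq_I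
    rwa [Subgroup.closure_insert_one] at this

theorem twoCase_conj (t : Fin 3) : Conj (twoCase t) (nf (polyK t) (polyU t) (-1)) := by
  rw [twoCase_eq]
  fin_cases t
  · exact conj_T (-1)
  · have := conj_cl_insert_nf (Or.inl rfl) sq_O (by rw [Subgroup.closure_insert_one]; exact uX_mem)
    rwa [Subgroup.closure_insert_one] at this
  · have := conj_cl_insert_nf (Or.inl rfl) sq_I (by rw [Subgroup.closure_insert_one]; exact uP_mem)
    rwa [Subgroup.closure_insert_one] at this

theorem infCase_isQuaternionic (t : Fin 3) : IsImprimitiveQuaternionicRG (infCase t) := by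
  have := infCase_conj t
  rw [infCase_eq] at this ⊢
  exact isQuaternionic_of_conj_poly t (Or.inl rfl) (Or.inl rfl) this

theorem twoCase_isQuaternionic (t : Fin 3) : IsImprimitiveQuaternionicRG (twoCase t) := by
  have := twoCase_conj t
  rw [twoCase_eq] at this ⊢
  refine isQuaternionic_of_conj_poly t ?_ (Or.inr rfl) this
  fin_cases t
  exacts [Or.inr rfl, Or.inl rfl, Or.inl rfl]

theorem numSystems_infCase (t : Fin 3) : numSystems (infCase t) = ⊤ := by
  rw [(infCase_conj t).numSystems_eq, numSystems_nf_one]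

theorem numSystems_twoCase (t : Fin 3) : numSystems (twoCase t) = 2 := by
  rw [(twoCase_conj t).numSystems_eq,
    numSystems_polyhedral (isNF_poly t (Or.inr rfl)) (uI_mem_poly t) (uQ_mem_poly t)]

/-! ### Nonconjugacy of polyhedral groups by fields of traces -/

section Coordinates

/-- Quaternions with coordinates in a subring. -/
def CoordsIn (R : Subring ℝ) (x : ℍ[ℝ]) : Prop := x.re ∈ R ∧ x.imI ∈ R ∧ x.imJ ∈ R ∧ x.imK ∈ R

theorem CoordsIn.mul {R : Subring ℝ} {x y : ℍ[ℝ]} (hx : CoordsIn R x) (hy : CoordsIn R y) :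
    CoordsIn R (x * y) := by
  obtain ⟨x0, x1, x2, x3⟩ := hx
  obtain ⟨y0, y1, y2, y3⟩ := hy
  have m := fun {a b : ℝ} (ha : a ∈ R) (hb : b ∈ R) => R.mul_mem ha hb
  refine ⟨?_, ?_, ?_, ?_⟩
  · rw [Quaternion.re_mul]
    exact R.sub_mem (R.sub_mem (R.sub_mem (m x0 y0) (m x1 y1)) (m x2 y2)) (m x3 y3)
  · rw [Quaternion.imI_mul]
    exact R.sub_mem (R.add_mem (R.add_mem (m x0 y1) (m x1 y0)) (m x2 y3)) (m x3 y2)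
  · rw [Quaternion.imJ_mul]
    exact R.add_mem (R.add_mem (R.sub_mem (m x0 y2) (m x1 y3)) (m x2 y0)) (m x3 y1)
  · rw [Quaternion.imK_mul]
    exact R.add_mem (R.sub_mem (R.add_mem (m x0 y3) (m x1 y2)) (m x2 y1)) (m x3 y0)

theorem coordsIn_closure {R : Subring ℝ} {A : Set HU}
    (hA : ∀ x ∈ A, Quaternion.normSq (x : ℍ[ℝ]) = 1 ∧ CoordsIn R x) :
    ∀ x ∈ Subgroup.closure A, Quaternion.normSq (x : ℍ[ℝ]) = 1 ∧ CoordsIn R x := by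
  intro x hx
  induction hx using Subgroup.closure_induction with
  | mem x hx => exact hA x hx
  | one =>
    refine ⟨map_one _, ?_⟩
    simp [CoordsIn, R.one_mem, R.zero_mem]
  | mul x y _ _ hx hy =>
    exact ⟨by rw [Units.val_mul, map_mul, hx.1, hy.1, one_mul], hx.2.mul hy.2⟩
  | inv x _ hx =>
    obtain ⟨hn, h0, h1, h2, h3⟩ := hx
    rw [inv_eq_star hn]
    refine ⟨by rw [Quaternion.normSq_star, hn], ?_, ?_, ?_, ?_⟩
    · simpa using h0
    · simpa using h1
    · simpa using h2
    · simpa using h3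

/-- All real traces of `nf K u e` lie in any ring containing the real parts of `K`, and real traces
survive conjugation. -/
theorem retr_mem_of_conj {R : Subring ℝ} {K K' : Subgroup HU} {u u' e : HU} (h : IsNF K u e)
    (hK : ∀ x ∈ K, (x : ℍ[ℝ]).re ∈ R) (hc : Conj (nf K' u' e) (nf K u e)) {x : HU} (hx : x ∈ K') :
    2 * (x : ℍ[ℝ]).re ∈ R := by
  obtain ⟨g, hg, hgx, -⟩ := hc.exists_mem (dg_mem_nf hx)
  rw [retr_dg] at hgx
  rw [two_mul, ← hgx]
  obtain ⟨y, hy, s, hs, rfl | rfl⟩ := (mem_nf h).1 hg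
  · rw [retr_dg]
    refine R.add_mem (hK y hy) (hK _ ?_)
    rcases sign_cases h.sign hs with rfl | rfl
    · rwa [one_mul]
    · exact mul_mem h.neg hy
  · rw [retr_ad]
    exact R.zero_mem

/-- The ring of all `a + b √2` with rational `a` and `b`. -/
def sqrtTwoRing : Subring ℝ where
  carrier := {x | ∃ a b : ℚ, x = a + b * √2}
  mul_mem' := by
    rintro _ _ ⟨a, b, rfl⟩ ⟨c, d, rfl⟩
    refine ⟨a * c + 2 * b * d, a * d + b * c, ?_⟩
    have h : √2 ^ 2 = 2 := Real.sq_sqrt (by norm_num)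
    push_cast
    linear_combination (b * d : ℝ) * h
  one_mem' := ⟨1, 0, by simp⟩
  add_mem' := by
    rintro _ _ ⟨a, b, rfl⟩ ⟨c, d, rfl⟩
    exact ⟨a + c, b + d, by push_cast; ring⟩
  zero_mem' := ⟨0, 0, by simp⟩
  neg_mem' := by
    rintro _ ⟨a, b, rfl⟩
    exact ⟨-a, -b, by push_cast; ring⟩

theorem irrational_sqrt_five : Irrational (√5) := by
  have := Nat.Prime.irrational_sqrt (p := 5) (by norm_num)
  exact_mod_cast this

theorem irrational_tau : Irrational tau := by
  intro ⟨q, hq⟩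
  refine irrational_sqrt_five ⟨2 * q - 1, ?_⟩
  push_cast
  rw [hq, tau]
  ring

/-- For `τ = a + b √2` the equation `τ² = τ + 1` forces `b = 0` or `a = 1/2`, as `√2` is irrational.
The first makes `τ` rational; the second gives `8 b² = 5`, so that `10 = (4 b)²` would be a rational
square. -/
theorem tau_notMem_sqrtTwoRing : tau ∉ sqrtTwoRing := by
  rintro ⟨a, b, h⟩
  have h2 : √2 ^ 2 = 2 := Real.sq_sqrt (by norm_num)
  have h3 := tau_sq
  rw [h] at h3
  by_cases hb : b = 0
  · exact irrational_tau ⟨a, by rw [h, hb]; simp⟩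
  by_cases ha : 2 * a - 1 = 0
  · have ha' : (a : ℝ) = 1 / 2 := by
      have : a = 1 / 2 := by linarith
      rw [this]; norm_num
    rw [ha'] at h3
    have h4 : (8 * b ^ 2 : ℝ) = 5 := by linear_combination 4 * h3 - 4 * (b : ℝ) ^ 2 * h2
    have h5 : (8 * b ^ 2 : ℚ) = 5 := by exact_mod_cast h4
    have h6 : IsSquare (10 : ℚ) := ⟨4 * b, by linarith⟩
    rw [Rat.isSquare_iff] at h6
    obtain ⟨⟨k, hk⟩, -⟩ := h6
    have : (Rat.num 10 : ℤ) = 10 := rfl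
    rw [this] at hk
    have : k ≤ 3 := by nlinarith
    have : -3 ≤ k := by nlinarith
    interval_cases k <;> omega
  · refine irrational_sqrt_two ⟨(1 + a - a ^ 2 - 2 * b ^ 2) / ((2 * a - 1) * b), ?_⟩
    have hb' : (b : ℝ) ≠ 0 := by exact_mod_cast hb
    have ha' : (2 * a - 1 : ℝ) ≠ 0 := by exact_mod_cast ha
    push_cast
    rw [div_eq_iff (mul_ne_zero ha' hb')]
    linear_combination -h3 + (b : ℝ) ^ 2 * h2

theorem poly_coords_T : ∀ x ∈ binT, (x : ℍ[ℝ]).re ∈ (Rat.castHom ℝ).range := by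
  have h2 : (1 / 2 : ℝ) ∈ (Rat.castHom ℝ).range := ⟨1 / 2, by simp⟩
  intro x hx
  refine (coordsIn_closure ?_ x hx).2.1
  rintro _ (rfl | rfl)
  · exact ⟨normSq_qi, by simp [CoordsIn, zero_mem, one_mem]⟩
  · exact ⟨normSq_qh, h2, h2, h2, h2⟩

theorem poly_coords_O : ∀ x ∈ binO, (x : ℍ[ℝ]).re ∈ sqrtTwoRing := by
  have h2 : (1 / 2 : ℝ) ∈ sqrtTwoRing := ⟨1 / 2, 0, by simp⟩
  have h3 : (√2)⁻¹ ∈ sqrtTwoRing := by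
    refine ⟨0, 1 / 2, ?_⟩
    have h : √2 ^ 2 = 2 := Real.sq_sqrt (by norm_num)
    have : √2 ≠ 0 := by positivity
    field_simp
    push_cast
    linarith
  intro x hx
  refine (coordsIn_closure ?_ x hx).2.1
  rintro _ (rfl | rfl)
  · exact ⟨normSq_qo, by simp [CoordsIn, zero_mem, h3]⟩
  · exact ⟨normSq_qh, h2, h2, h2, h2⟩

/-- Tetrahedral traces are rational and octahedral ones lie in `ℚ(√2)`, while `uO` contributes `√2`
and `uT` contributes `τ`. -/
theorem poly_not_conj {e : HU} (he : e = 1 ∨ e = -1) {s t : Fin 3} (hst : s < t) :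
    ¬ Conj (nf (polyK t) (polyU t) e) (nf (polyK s) (polyU s) e) := by
  intro h
  have hO : Irrational (2 * (√2)⁻¹) := by
    have : (2 : ℝ) * (√2)⁻¹ = √2 := by
      have h : √2 ^ 2 = 2 := Real.sq_sqrt (by norm_num)
      have : √2 ≠ 0 := by positivity
      field_simp
      linarith
    rw [this]
    exact irrational_sqrt_two
  have e2 : 2 * ((uT : HU) : ℍ[ℝ]).re = tau := by simp; ring
  fin_cases s <;> fin_cases t <;> try exact absurd hst (by decide)
  · obtain ⟨q, hq⟩ := retr_mem_of_conj (isNF_poly 0 he) poly_coords_T h uO_mem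
    exact hO ⟨q, by simpa using hq⟩
  · obtain ⟨q, hq⟩ := retr_mem_of_conj (isNF_poly 0 he) poly_coords_T h uT_mem
    rw [e2] at hq
    exact irrational_tau ⟨q, hq⟩
  · have := retr_mem_of_conj (isNF_poly 1 he) poly_coords_O h uT_mem
    rw [e2] at this
    exact tau_notMem_sqrtTwoRing this

theorem not_conj_of_poly {f : Fin 3 → Subgroup (GLd 2 ℍ[ℝ])} {e : HU} (he : e = 1 ∨ e = -1)
    (hf : ∀ t, Conj (f t) (nf (polyK t) (polyU t) e)) {s t : Fin 3} (hst : s ≠ t) :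
    ¬ Conj (f s) (f t) := by
  intro h
  have h' := (hf s).symm.trans (h.trans (hf t))
  rcases lt_or_gt_of_ne hst with h1 | h1
  · exact poly_not_conj he h1 h'.symm
  · exact poly_not_conj he h1 h'

end Coordinates

/-! ### The three infinite families and the group with five systems -/

theorem omega_mul_pow {a : ℕ} (ha : a ≠ 0) (b : ℕ) : omega (a * b) ^ a = omega b := by
  rw [omega_eq, omega_eq]
  have h : (Complex.exp (2 * Real.pi * Complex.I / ((2 * (a * b) : ℕ) : ℂ))) ^ a =
      Complex.exp (2 * Real.pi * Complex.I / ((2 * b : ℕ) : ℂ)) := by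
    rw [← Complex.exp_nat_mul]
    congr 1
    have : (a : ℂ) ≠ 0 := by exact_mod_cast ha
    push_cast
    by_cases hb : (b : ℂ) = 0
    · simp [hb]
    · field_simp
  rw [← h]
  exact (map_pow Quaternion.ofComplex _ a).symm

theorem omega_pow_self {n : ℕ} (hn : n ≠ 0) : omega n ^ n = -1 :=
  congrArg Units.val (omu_pow_self hn)

theorem nf_dic_le {n : ℕ} {G : Subgroup (GLd 2 ℍ[ℝ])} (h1 : ad uJ uJ⁻¹ ∈ G)
    (h2 : ad (omu n * uJ) (omu n * uJ)⁻¹ ∈ G) (h3 : ad 1 1 ∈ G ∨ ad (-1) (-1) ∈ G)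
    (h4 : dg (-1) 1 ∈ G) : nf (dic n) 1 (-1) ≤ G := by
  have hF : dg 1 (-1) ∈ G := by
    rcases h3 with h | h
    · have := mul_mem (mul_mem h h4) h
      rw [ad_mul_dg, ad_mul_ad] at this
      simpa using this
    · have := mul_mem (mul_mem h h4) h
      rw [ad_mul_dg, ad_mul_ad] at this
      simpa using this
  have hN : dg (-1) (-1) ∈ G := by
    have := mul_mem h4 hF
    rw [dg_mul_dg] at this
    simpa using this
  have hJ : ad 1 (-1) ∈ G := by
    have hS : ad 1 1 ∈ G := by
      rcases h3 with h | h
      · exact h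
      · have := mul_mem hN h
        rw [dg_mul_ad] at this
        simpa using this
    have := mul_mem hF hS
    rw [dg_mul_ad] at this
    simpa using this
  have hj : dg uJ uJ ∈ G := by
    have := mul_mem h1 (inv_mem hJ)
    rw [ad_inv, ad_mul_ad, uJ_inv] at this
    simpa [inv_neg] using this
  refine nf_le (dg_mem_of_closure ?_) hJ h4
  rintro _ (rfl | rfl)
  · have hsq : omu n * uJ * (omu n * uJ) = -1 := by
      rw [mul_assoc, ← mul_assoc uJ, uJ_mul_omu, mul_assoc (omu n)⁻¹, uJ_mul_self]
      simp
    have := mul_mem (mul_mem h2 (inv_mem hJ)) (inv_mem hj)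
    rw [inv_of_sq hsq, ad_inv, ad_mul_ad, dg_inv, dg_mul_dg] at this
    simpa [inv_neg] using this
  · exact hj

theorem ad_inv_mem_nf {K : Subgroup HU} (hneg : -1 ∈ K) {x : HU} (hx : x ∈ K)
    (h : x * x = 1 ∨ x * x = -1) : ad x x⁻¹ ∈ nf K 1 (-1) := by
  rw [mem_nf (isNF_one hneg (Or.inr rfl))]
  rcases h with h | h
  · exact ⟨x, hx, -1, Or.inr rfl, Or.inr (by rw [inv_eq_of_mul_eq_one_right h]; simp)⟩
  · exact ⟨x, hx, 1, Or.inl rfl, Or.inr (by rw [inv_of_sq h]; simp)⟩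

theorem omuJ_sq (n : ℕ) : omu n * uJ * (omu n * uJ) = -1 := by
  rw [mul_assoc, ← mul_assoc uJ, uJ_mul_omu, mul_assoc (omu n)⁻¹, uJ_mul_self]
  simp

/-- Shifting by `u = j` turns the entries `1, ω, j, c j` into `j, ω j, -1, -c`, which lie in `dic n`
and have square `±1`. -/
theorem conj_cl_dic {n : ℕ} {c : HU} (hc : c ∈ dic n) (hc2 : c * c = 1 ∨ c * c = -1) :
    Conj (cl {1, omu n, uJ, c * uJ} (-1)) (nf (dic n) 1 (-1)) := by
  have hN := neg_one_mem_dic n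
  refine ⟨dg 1 uJ⁻¹, le_antisymm (cj_le ?_ ?_) (nf_dic_le ?_ ?_ (Or.inr ?_) ?_)⟩
  · rintro b hb
    rw [conj_ad]
    rcases hb with rfl | rfl | rfl | rfl
    · rw [one_mul]
      exact ad_inv_mem_nf hN (uJ_mem_dic n) (Or.inr uJ_mul_self)
    · exact ad_inv_mem_nf hN (mul_mem (omu_mem n) (uJ_mem_dic n)) (Or.inr (omuJ_sq n))
    · rw [uJ_mul_self]
      exact ad_inv_mem_nf hN hN (Or.inl (by simp))
    · rw [mul_assoc, uJ_mul_self, mul_neg_one]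
      exact ad_inv_mem_nf hN (neg_mem_of hN hc) (by simpa using hc2)
  · rw [conj_sign]
    exact sign_mem_nf
  · have := mem_cj (U := dg 1 uJ⁻¹) (ad_mem_cl (L := {1, omu n, uJ, c * uJ}) (e := -1) (Or.inl rfl))
    rwa [conj_ad, one_mul] at this
  · have := mem_cj (U := dg 1 uJ⁻¹) (ad_mem_cl (L := {1, omu n, uJ, c * uJ}) (e := -1)
      (Or.inr (Or.inl rfl)))
    rwa [conj_ad] at this
  · have := mem_cj (U := dg 1 uJ⁻¹) (ad_mem_cl (L := {1, omu n, uJ, c * uJ}) (e := -1)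
      (Or.inr (Or.inr (Or.inl rfl))))
    rw [conj_ad, uJ_mul_self] at this
    simpa [inv_neg] using this
  · have := mem_cj (U := dg 1 uJ⁻¹) (sign_mem_cl (L := {1, omu n, uJ, c * uJ}) (e := -1))
    rwa [conj_sign] at this

/-- The matrix with columns `(1, i)` and `(1, -i)`. -/
noncomputable def twist : GLd 2 ℍ[ℝ] where
  val := !![1, 1; qi, -qi]
  inv := !![2⁻¹, -(2⁻¹ * qi); 2⁻¹, 2⁻¹ * qi]
  val_inv := by
    have h2 : (2 : ℍ[ℝ])⁻¹ + 2⁻¹ = 1 := by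
      rw [← two_mul, mul_inv_cancel₀ two_ne_zero_quat]
    have h3 : qi * (2⁻¹ * qi) = -2⁻¹ := by
      have h : qi * qi = -1 := congrArg Units.val uI_mul_self
      have : (2 : ℍ[ℝ])⁻¹ = ((2⁻¹ : ℝ) : ℍ[ℝ]) := by rw [Quaternion.coe_inv]; rfl
      rw [this, Quaternion.coe_mul_eq_smul, mul_smul_comm, h, smul_neg,
        ← Quaternion.coe_mul_eq_smul, mul_one]
    simp [Matrix.one_fin_two, h2, h3]
  inv_val := by
    have h2 : (2 : ℍ[ℝ])⁻¹ + 2⁻¹ = 1 := by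
      rw [← two_mul, mul_inv_cancel₀ two_ne_zero_quat]
    have h3 : qi * qi = -1 := congrArg Units.val uI_mul_self
    simp [Matrix.one_fin_two, h2, mul_assoc, h3]

/-- The twist makes an antidiagonal reflection diagonal; in this way the third family, which has no
nontrivial diagonal generator, acquires `diag (-1, 1)`. -/
theorem twist_conj_neg : twist * ad (-1) (-1) * twist⁻¹ = dg (-1) 1 := by
  rw [mul_inv_eq_iff_eq_mul]
  ext1
  simp [twist, ad_val, dg_val]

theorem twist_conj_i : twist * ad (-uI) (-uI)⁻¹ * twist⁻¹ = ad 1 1 := by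
  have h3 : qi * qi = -1 := congrArg Units.val uI_mul_self
  rw [mul_inv_eq_iff_eq_mul, inv_neg, inv_of_sq uI_mul_self, neg_neg]
  ext1
  simp [twist, ad_val, h3]

theorem twist_conj {b : HU} (hb : b * b = -1) (hib : (b : ℍ[ℝ]) * qi = -(qi * b)) :
    twist * ad b b⁻¹ * twist⁻¹ = ad (-(uI * b)) (-(uI * b))⁻¹ := by
  have h3 : qi * qi = -1 := congrArg Units.val uI_mul_self
  have h4 : uI * b * (uI * b) = -1 := by
    ext1
    simp only [Units.val_mul, Units.val_neg, Units.val_one, uI_val]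
    rw [mul_assoc, ← mul_assoc (b : ℍ[ℝ]), hib, neg_mul, mul_neg, mul_assoc,
      ← mul_assoc qi qi, h3, ← Units.val_mul, hb]
    simp
  rw [mul_inv_eq_iff_eq_mul, inv_neg, inv_of_sq h4, inv_of_sq hb, neg_neg]
  ext1
  have h5 : qi * (b : ℍ[ℝ]) * qi = b := by
    rw [mul_assoc, hib, mul_neg, ← mul_assoc, h3]
    simp
  simp [twist, ad_val, h5]

/-- The change of basis is the shift by `j`, then the twist, then the scalar `uO`, which commutes
with `ω` and rotates `-k` to `j`. It carries the four reflections to those with entries `j` and `ω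
j`, to `diag (-1, 1)`, and to the swap of coordinates. -/
theorem conj_cl_dic_odd (n : ℕ) : Conj (cl {1, omu n, uJ, uI * uJ} 1) (nf (dic n) 1 (-1)) := by
  have hN := neg_one_mem_dic n
  set U : GLd 2 ℍ[ℝ] := dg uO uO * twist * dg 1 uJ⁻¹ with hU
  have hconj : ∀ b : HU, U * ad b b⁻¹ * U⁻¹ =
      dg uO uO * (twist * ad (b * uJ) (b * uJ)⁻¹ * twist⁻¹) * (dg uO uO)⁻¹ := by
    intro b
    rw [← conj_ad, hU]
    simp only [mul_inv_rev, mul_assoc]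
  have hO : ∀ a b : HU, dg uO uO * ad a b * (dg uO uO)⁻¹ = ad (uO * a * uO⁻¹) (uO * b * uO⁻¹) := by
    intro a b
    rw [dg_inv, dg_mul_ad, ad_mul_dg]
  have hOI : ∀ x : HU, uO * x⁻¹ * uO⁻¹ = (uO * x * uO⁻¹)⁻¹ := by
    intro x
    simp [mul_assoc]
  have e3 : -(uI * uJ) = -uK := by rw [uI_mul_uJ]
  have r1 : uO * -uK * uO⁻¹ = uJ := by
    rw [mul_inv_eq_iff_eq_mul]
    ext <;> simp
  have r2 : uO * omu n * uO⁻¹ = omu n := by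
    rw [mul_inv_eq_iff_eq_mul]
    ext <;> simp <;> ring
  have g1 : U * ad 1 1⁻¹ * U⁻¹ = ad uJ uJ⁻¹ := by
    rw [hconj, one_mul, twist_conj uJ_mul_self (by ext <;> simp), hO, hOI, e3, r1]
  have g2 : U * ad (omu n) (omu n)⁻¹ * U⁻¹ = ad (omu n * uJ) (omu n * uJ)⁻¹ := by
    have hc : uI * omu n = omu n * uI := by ext <;> simp
    rw [hconj, twist_conj (omuJ_sq n) (by ext <;> simp), hO, hOI]
    have : uO * -(uI * (omu n * uJ)) * uO⁻¹ = omu n * uJ := by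
      have e : uI * (omu n * uJ) = omu n * uK := by rw [← mul_assoc, hc, mul_assoc, uI_mul_uJ]
      rw [e, ← mul_neg]
      have : uO * (omu n * -uK) * uO⁻¹ = uO * omu n * uO⁻¹ * (uO * -uK * uO⁻¹) := by
        simp [mul_assoc]
      rw [this, r1, r2]
    rw [this]
  have g3 : U * ad uJ uJ⁻¹ * U⁻¹ = dg (-1) 1 := by
    have : ad (uJ * uJ) (uJ * uJ)⁻¹ = (ad (-1) (-1) : GLd 2 ℍ[ℝ]) := by
      rw [uJ_mul_self]; simp [inv_neg]
    rw [hconj, this, twist_conj_neg, dg_mul_dg, dg_inv, dg_mul_dg]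
    simp
  have g4 : U * ad (uI * uJ) (uI * uJ)⁻¹ * U⁻¹ = ad 1 1 := by
    rw [hconj, mul_assoc uI, uJ_mul_self, mul_neg_one, twist_conj_i, hO]
    simp
  have m := fun {b : HU} (hb : b ∈ ({1, omu n, uJ, uI * uJ} : Set HU)) =>
    mem_cj (U := U) (ad_mem_cl (e := 1) hb)
  refine ⟨U, le_antisymm (cj_le ?_ ?_) (nf_dic_le ?_ ?_ (Or.inl ?_) ?_)⟩
  · rintro _ (rfl | rfl | rfl | rfl)
    · rw [g1]
      exact ad_inv_mem_nf hN (uJ_mem_dic n) (Or.inr uJ_mul_self)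
    · rw [g2]
      exact ad_inv_mem_nf hN (mul_mem (omu_mem n) (uJ_mem_dic n)) (Or.inr (omuJ_sq n))
    · rw [g3]
      exact sign_mem_nf
    · rw [g4]
      have := ad_inv_mem_nf hN (one_mem _) (Or.inl (mul_one 1))
      rwa [inv_one] at this
  · rw [dg_one, mul_one, mul_inv_cancel]
    exact one_mem _
  · rw [← g1]; exact m (Or.inl rfl)
  · rw [← g2]; exact m (Or.inr (Or.inl rfl))
  · rw [← g4]; exact m (Or.inr (Or.inr (Or.inr rfl)))
  · rw [← g3]; exact m (Or.inr (Or.inr (Or.inl rfl)))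

theorem Gnabr_eq {n a b r : ℕ} {w c e : HU} (hw : omega n ^ a = w) (hc : omega n ^ b = c)
    (he : omega n ^ (2 * n / r) = e) (hwn : Quaternion.normSq (w : ℍ[ℝ]) = 1)
    (hcn : Quaternion.normSq (c : ℍ[ℝ]) = 1) : Gnabr n a b r = cl {1, w, uJ, c * uJ} e := by
  rw [Gnabr, he]
  refine genGroup_eq_of ?_ (Or.inl rfl) ?_
  · simp [Set.image_insert_eq, hw, hc]
  · rintro _ (rfl | rfl | rfl | rfl)
    · exact map_one _
    · exact hwn
    · exact normSq_qj
    · rw [Units.val_mul, map_mul, hcn, one_mul]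
      exact normSq_qj

/-- The order of the cyclic part of the normal form of a member of the families. -/
def famOrder : Fin 3 → ℕ → ℕ := ![fun n => n, fun n => n, fun n => n / 2]

theorem omu_pow_half {m : ℕ} (hm : m ≠ 0) : omu (m * 2) ^ m = uI := by
  ext1
  rw [Units.val_pow_eq_pow_val, omu_val, omega_mul_pow hm, omega_two, uI_val]

theorem Gnabr_half {m : ℕ} (hm : m ≠ 0) :
    Gnabr (m * 2) 1 m 2 = cl {1, omu (m * 2), uJ, uI * uJ} (-1) := by
  refine Gnabr_eq (pow_one _) ?_ ?_ (normSq_omega _) normSq_qi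
  · rw [omega_mul_pow hm, omega_two, uI_val]
  · rw [Nat.mul_div_cancel_left _ two_pos, omega_pow_self (by omega)]
    rfl

theorem Gnabr_half_conj {m : ℕ} (hm : m ≠ 0) :
    Conj (Gnabr (m * 2) 1 m 2) (nf (dic (m * 2)) 1 (-1)) := by
  rw [Gnabr_half hm]
  refine conj_cl_dic ?_ (Or.inr uI_mul_self)
  rw [← omu_pow_half hm]
  exact pow_mem (omu_mem _) _

theorem dic_isQuaternionic {L : Set HU} {n : ℕ} (hn : 2 ≤ n) {e : HU} (he : e = 1 ∨ e = -1)
    (h : Conj (cl L e) (nf (dic n) 1 (-1))) : IsImprimitiveQuaternionicRG (cl L e) :=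
  isQuaternionic_of_conj he h (isNF_one (neg_one_mem_dic n) (Or.inr rfl)) (dic_finite (by omega))
    (dic_centralReal hn) (nf_not_complex_neg (dic_centralReal hn))

theorem Gnabr_two : Gnabr 2 1 1 2 = cl {1, omu 2, uJ, uI * uJ} (-1) := by
  have := Gnabr_half one_ne_zero
  rwa [one_mul] at this

theorem Gnabr_two_conj : Conj (Gnabr 2 1 1 2) (nf (dic 2) 1 (-1)) := by
  have := Gnabr_half_conj one_ne_zero
  rwa [one_mul] at this

theorem Gnabr_two_isQuaternionic : IsImprimitiveQuaternionicRG (Gnabr 2 1 1 2) := by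
  have := Gnabr_two_conj
  rw [Gnabr_two] at this ⊢
  exact dic_isQuaternionic le_rfl (Or.inr rfl) this

/-- In the third family the parameter is halved because `ω²` is the root of unity belonging to `n /
2`, and the diagonal generator is trivial since its exponent is `2 n`. -/
theorem family_spec {t : Fin 3} {n : ℕ} (h : FamIndex t n) : 3 ≤ famOrder t n ∧
    Conj (family t n) (nf (dic (famOrder t n)) 1 (-1)) ∧
      IsImprimitiveQuaternionicRG (family t n) := by
  suffices H : 3 ≤ famOrder t n ∧ Conj (family t n) (nf (dic (famOrder t n)) 1 (-1)) ∧
      ∃ L e, (e = 1 ∨ e = -1) ∧ family t n = cl L e by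
    obtain ⟨h3, hc, L, e, he, hf⟩ := H
    refine ⟨h3, hc, ?_⟩
    rw [hf] at hc ⊢
    exact dic_isQuaternionic (by omega) he hc
  fin_cases t
  · obtain ⟨h3, -⟩ : 3 ≤ n ∧ Odd n := h
    have e : Gnabr n 1 n 2 = cl {1, omu n, uJ, -1 * uJ} (-1) := by
      refine Gnabr_eq (pow_one _) ?_ ?_ (normSq_omega _) (by simp)
      · rw [omega_pow_self (by omega)]; rfl
      · rw [Nat.mul_div_cancel_left _ two_pos, omega_pow_self (by omega)]; rfl
    refine ⟨h3, ?_, _, _, Or.inr rfl, e⟩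
    change Conj (Gnabr n 1 n 2) (nf (dic n) 1 (-1))
    rw [e]
    exact conj_cl_dic (neg_one_mem_dic n) (Or.inl (by simp))
  · obtain ⟨h4, h2⟩ : 4 ≤ n ∧ Even n := h
    obtain ⟨m, rfl⟩ := h2.two_dvd
    rw [mul_comm]
    have hm : m * 2 / 2 = m := Nat.mul_div_cancel m two_pos
    have hf : family 1 (m * 2) = Gnabr (m * 2) 1 m 2 := by
      change Gnabr (m * 2) 1 (m * 2 / 2) 2 = _
      rw [hm]
    have hm0 : m ≠ 0 := by omega
    refine ⟨?_, ?_, _, _, Or.inr rfl, hf.trans (Gnabr_half hm0)⟩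
    · change 3 ≤ m * 2
      omega
    · change Conj (family 1 (m * 2)) _
      rw [hf]
      exact Gnabr_half_conj hm0
  · obtain ⟨h6, h2, -⟩ : 6 ≤ n ∧ Even n ∧ Odd (n / 2) := h
    obtain ⟨m, rfl⟩ := h2.two_dvd
    have hm : 2 * m / 2 = m := Nat.mul_div_cancel_left m two_pos
    have hm0 : m ≠ 0 := by omega
    have hf : family 2 (2 * m) = cl {1, omu m, uJ, uI * uJ} 1 := by
      change Gnabr (2 * m) 2 (2 * m / 2) 1 = _
      rw [hm]
      refine Gnabr_eq ?_ ?_ ?_ (normSq_omega _) normSq_qi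
      · rw [omega_mul_pow two_ne_zero, omu_val]
      · rw [mul_comm, omega_mul_pow hm0, omega_two, uI_val]
      · rw [Nat.div_one, mul_comm 2 (2 * m), pow_mul, omega_pow_self (by omega)]
        simp
    refine ⟨?_, ?_, _, _, Or.inl rfl, hf⟩
    · change 3 ≤ 2 * m / 2
      omega
    · change Conj (family 2 (2 * m)) (nf (dic (2 * m / 2)) 1 (-1))
      rw [hf, hm]
      exact conj_cl_dic_odd m

theorem numSystems_family {t : Fin 3} {n : ℕ} (h : FamIndex t n) : numSystems (family t n) = 3 := by
  obtain ⟨h3, hc, -⟩ := family_spec h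
  rw [hc.numSystems_eq, numSystems_dic h3]

theorem numSystems_Gnabr_two : numSystems (Gnabr 2 1 1 2) = 5 := by
  rw [Gnabr_two_conj.numSystems_eq, numSystems_dic_two]

/-- The normal forms belonging to binary dihedral groups determine the order. -/
theorem dic_order_dvd {m n : ℕ} (hm : 3 ≤ m) (hn : 3 ≤ n)
    (h : Conj (nf (dic m) 1 (-1)) (nf (dic n) 1 (-1))) : m ∣ n := by
  -- The scalar `ω` has order `2 m` and real trace `2 cos (π / m) ≠ 0`. The nonzero trace rules out
  -- antidiagonal matrices, `diag (x, -x)` and scalars `ω ^ k j`, so its conjugate is a scalar power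
  -- of the other `ω`.
  obtain ⟨g, hg, hgt, hgo⟩ := h.exists_mem (dg_mem_nf (omu_mem m))
  have hc := cos_pos hm
  rw [retr_dg, omu_val, omega_re] at hgt
  obtain ⟨x, hx, s, hs, rfl | rfl⟩ := (mem_nf (isNF_one (neg_one_mem_dic n) (Or.inr rfl))).1 hg
  · rw [retr_dg] at hgt
    have hs' : s = 1 := by
      rcases hs with rfl | rfl
      · rfl
      · exfalso
        rw [neg_one_mul, Units.val_neg, Quaternion.re_neg] at hgt
        linarith
    subst hs'
    rw [one_mul] at hgo hgt
    obtain ⟨k, rfl | rfl⟩ := mem_dic (by omega) hx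
    · have hpow : (omu n ^ k) ^ (2 * n) = 1 := by
        rw [← zpow_natCast, ← zpow_mul, mul_comm, zpow_mul, zpow_natCast,
          (omu_pow_eq_one_iff (by omega) _).2 dvd_rfl, one_zpow]
      have hdg : ∀ (a : HU) (l : ℕ), (dg a a) ^ l = dg (a ^ l) (a ^ l) := by
        intro a l
        induction l with
        | zero => simp [dg_one]
        | succ l ih => rw [pow_succ, ih, dg_mul_dg, pow_succ]
      have := (hgo (2 * n)).1 (by rw [hdg, hpow, dg_one])
      rw [hdg, ← dg_one, dg_inj, omu_pow_eq_one_iff (by omega)] at this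
      exact Nat.dvd_of_mul_dvd_mul_left two_pos this.1
    · exfalso
      have hsq : ∀ j : ℤ, omu n ^ j * uJ * (omu n ^ j * uJ) = -1 := by
        intro j
        rw [mul_assoc, ← mul_assoc uJ, uJ_mul_omu_zpow, mul_assoc (omu n ^ (-j)), uJ_mul_self]
        simp
      have := re_of_sq (congrArg Units.val (hsq k))
      rw [this] at hgt
      linarith
  · rw [retr_ad] at hgt
    exfalso
    linarith

theorem family_conj_iff {s t : Fin 3} {m n : ℕ} (hm : FamIndex s m) (hn : FamIndex t n) :
    Conj (family s m) (family t n) ↔ famOrder s m = famOrder t n := by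
  obtain ⟨h3, hc, -⟩ := family_spec hm
  obtain ⟨h3', hc', -⟩ := family_spec hn
  constructor
  · intro h
    have h1 := hc.symm.trans (h.trans hc')
    exact Nat.dvd_antisymm (dic_order_dvd h3 h3' h1) (dic_order_dvd h3' h3 h1.symm)
  · intro h
    rw [h] at hc
    exact hc.trans hc'.symm

theorem exists_family {n : ℕ} (hn : 3 ≤ n) : ∃ t, FamIndex t n ∧ famOrder t n = n := by
  rcases Nat.even_or_odd n with h | h
  · have : n ≠ 3 := by rintro rfl; exact absurd h (by decide)
    exact ⟨1, ⟨by omega, h⟩, rfl⟩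
  · exact ⟨0, ⟨hn, h⟩, rfl⟩

/-! ### Both shapes under one roof, and the group generated by the roots -/

/-- The shape of a group with a second system of imprimitivity, after conjugation. -/
def HasType (G : Subgroup (GLd 2 ℍ[ℝ])) (e : HU) : Prop :=
  (e = 1 ∨ e = -1) ∧ dg e 1 ∈ G ∧ ∀ r ∈ G, IsReflection r → r = dg e 1 ∨ r = dg 1 e ∨
    ∃ b : HU, (b * b = -1 ∨ (e = -1 ∧ b * b = 1)) ∧ r = ad b b⁻¹

theorem TypeOne.hasType {G : Subgroup (GLd 2 ℍ[ℝ])} (h : TypeOne G) : HasType G 1 := by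
  refine ⟨Or.inl rfl, by rw [dg_one]; exact one_mem _, fun r hr hr' => ?_⟩
  obtain ⟨b, hb, rfl⟩ := h.2 r hr hr'
  exact Or.inr (Or.inr ⟨b, Or.inl hb, rfl⟩)

theorem TypeTwo.hasType {G : Subgroup (GLd 2 ℍ[ℝ])} (h : TypeTwo G) : HasType G (-1) := by
  refine ⟨Or.inr rfl, h.2.1, fun r hr hr' => ?_⟩
  rcases h.2.2 r hr hr' with h | h | ⟨b, hb, rfl⟩
  · exact Or.inl h
  · exact Or.inr (Or.inl h)
  · exact Or.inr (Or.inr ⟨b, hb.symm.imp id fun h => ⟨rfl, h⟩, rfl⟩)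

theorem conj_dg_ad (q a b : HU) :
    dg q q * ad a b * (dg q q)⁻¹ = ad (q * a * q⁻¹) (q * b * q⁻¹) := by
  rw [dg_inv, dg_mul_ad, ad_mul_dg]

theorem conj_dg_dg (q a b : HU) :
    dg q q * dg a b * (dg q q)⁻¹ = dg (q * a * q⁻¹) (q * b * q⁻¹) := by
  rw [dg_inv, dg_mul_dg, dg_mul_dg]

theorem conj_sign_eq {e : HU} (he : e = 1 ∨ e = -1) (q : HU) : q * e * q⁻¹ = e := by
  rcases he with rfl | rfl <;> simp

theorem conj_mul_self (q b : HU) : q * b * q⁻¹ * (q * b * q⁻¹) = q * (b * b) * q⁻¹ := by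
  simp [mul_assoc]

theorem HasType.cj {G : Subgroup (GLd 2 ℍ[ℝ])} {e : HU} (h : HasType G e) (q : HU) :
    HasType (cj (dg q q) G) e := by
  obtain ⟨he, h1, h2⟩ := h
  refine ⟨he, ?_, forall_reflection_cj.2 fun r hr hr' => ?_⟩
  · have := mem_cj (U := dg q q) h1
    rwa [conj_dg_dg, conj_sign_eq he, mul_one, mul_inv_cancel] at this
  · rcases h2 r hr hr' with rfl | rfl | ⟨b, hb, rfl⟩
    · left
      rw [conj_dg_dg, conj_sign_eq he, mul_one, mul_inv_cancel]
    · right; left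
      rw [conj_dg_dg, conj_sign_eq he, mul_one, mul_inv_cancel]
    · right; right
      refine ⟨q * b * q⁻¹, ?_, ?_⟩
      · rw [conj_mul_self]
        rcases hb with hb | ⟨h, hb⟩
        · left; rw [hb]; simp
        · right; exact ⟨h, by rw [hb]; simp⟩
      · rw [conj_dg_ad]
        congr 1
        simp [mul_assoc]

/-- The square roots of `-1` belonging to antidiagonal reflections. -/
def roots (G : Subgroup (GLd 2 ℍ[ℝ])) : Set HU := {b | b * b = -1 ∧ ad b b⁻¹ ∈ G}

theorem roots_cj (G : Subgroup (GLd 2 ℍ[ℝ])) (q : HU) :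
    Subgroup.closure (roots (cj (dg q q) G)) = kc q (Subgroup.closure (roots G)) := by
  rw [kc, MonoidHom.map_closure]
  congr 1
  ext x
  constructor
  · rintro ⟨hx, hx'⟩
    refine ⟨q⁻¹ * x * q, ⟨?_, ?_⟩, by simp [mul_assoc]⟩
    · have := conj_mul_self q⁻¹ x
      rw [inv_inv] at this
      rw [this, hx]
      simp
    · rw [mem_map_conj, dg_inv, dg_mul_ad, ad_mul_dg] at hx'
      simpa [mul_assoc] using hx'
  · rintro ⟨b, ⟨hb, hb'⟩, rfl⟩
    refine ⟨?_, ?_⟩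
    · change q * b * q⁻¹ * (q * b * q⁻¹) = -1
      rw [conj_mul_self, hb]
      simp
    · have := mem_cj (U := dg q q) hb'
      rw [conj_dg_ad] at this
      change ad (q * b * q⁻¹) (q * b * q⁻¹)⁻¹ ∈ _
      simpa [mul_assoc] using this

/-! ### Identification of the groups without axis -/

section Polyhedral

variable {G : Subgroup (GLd 2 ℍ[ℝ])} {e : HU}

theorem le_nf {K : Subgroup HU} {u : HU} (hR : IsReflectionGroup G) (h : HasType G e)
    (hNF : IsNF K u e) (h1 : ∀ b ∈ roots G, ∃ a ∈ K, b = a * u)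
    (h2 : e = -1 → ∀ b, b = 1 ∨ b = -1 → ad b b⁻¹ ∈ G → ∃ a ∈ K, b = a * u) : G ≤ nf K u e := by
  refine le_of_reflections hR fun r hr hr' => ?_
  rw [mem_nf hNF]
  rcases h.2.2 r hr hr' with rfl | rfl | ⟨b, hb | ⟨rfl, hb⟩, rfl⟩
  · have he : e ∈ K := by
      rcases h.1 with h | h
      · rw [h]; exact one_mem _
      · rw [h]; exact hNF.neg
    refine ⟨e, he, e, Or.inr rfl, Or.inl ?_⟩
    rcases h.1 with h | h <;> simp [h]
  · exact ⟨1, one_mem _, e, Or.inr rfl, Or.inl (by simp)⟩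
  · obtain ⟨a, ha, hab⟩ := h1 b ⟨hb, hr⟩
    exact ⟨a, ha, 1, Or.inl rfl, Or.inr (by rw [inv_of_sq hb, ← hab]; simp)⟩
  · obtain ⟨a, ha, hab⟩ := h2 rfl b (sq_eq_one_unit hb) hr
    exact ⟨a, ha, -1, Or.inr rfl, Or.inr (by
      rw [inv_eq_of_mul_eq_one_right hb, ← hab]; simp)⟩

/-- Products of the matrices `ad b (-b)` are alternately scalar and of this same antidiagonal form,
up to sign. Hence every element of the generated group is visible in `G`; this also bounds that
group. -/
theorem scalar_mem {x : HU}
    (hx : x ∈ Subgroup.closure (roots G)) :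
    (dg x x ∈ G ∨ ad x (-x) ∈ G) ∨ (dg (-x) (-x) ∈ G ∨ ad (-x) x ∈ G) := by
  induction hx using Subgroup.closure_induction with
  | mem b hb =>
    have := hb.2
    rw [inv_of_sq hb.1] at this
    exact Or.inl (Or.inr this)
  | one => exact Or.inl (Or.inl (by rw [dg_one]; exact one_mem _))
  | mul x y _ _ hx hy =>
    rcases hx with (hx | hx) | (hx | hx) <;> rcases hy with (hy | hy) | (hy | hy) <;>
      have := mul_mem hx hy <;>
      simp only [dg_mul_dg, dg_mul_ad, ad_mul_dg, ad_mul_ad, neg_mul, mul_neg, neg_neg] at this <;>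
      tauto
  | inv x _ hx =>
    rcases hx with (hx | hx) | (hx | hx) <;> have := inv_mem hx <;>
      simp only [dg_inv, ad_inv, inv_neg] at this <;> tauto

/-- If the scalar `-1` were missing, none of `±i, ±j, ±k` could be a scalar in `G`, as their squares
are `-1`. Then `i` and `j` occur antidiagonally, but the product of these matrices is the scalar
`±k`. -/
theorem neg_scalar_mem (hi : uI ∈ Subgroup.closure (roots G))
    (hj : uJ ∈ Subgroup.closure (roots G)) : dg (-1) (-1) ∈ G := by
  have key : ∀ x : HU, x * x = -1 → (dg x x ∈ G ∨ dg (-x) (-x) ∈ G) → dg (-1) (-1) ∈ G := by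
    rintro x hx (h | h) <;> have := mul_mem h h <;>
      simpa [dg_mul_dg, hx] using this
  by_contra hN
  have hI := scalar_mem hi
  have hJ := scalar_mem hj
  have nI := fun h => hN (key uI uI_mul_self h)
  have nJ := fun h => hN (key uJ uJ_mul_self h)
  have nK := fun h => hN (key uK uK_mul_self h)
  have hI' : ad uI (-uI) ∈ G ∨ ad (-uI) uI ∈ G := by tauto
  have hJ' : ad uJ (-uJ) ∈ G ∨ ad (-uJ) uJ ∈ G := by tauto
  rcases hI' with h | h <;> rcases hJ' with h' | h' <;> have := mul_mem h h' <;>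
    simp only [ad_mul_ad, neg_mul, mul_neg, neg_neg, uI_mul_uJ] at this <;> tauto

theorem dg_of_neg (hN : dg (-1) (-1) ∈ G) {x : HU} (h : dg (-x) (-x) ∈ G) : dg x x ∈ G := by
  have := mul_mem hN h
  rw [dg_mul_dg] at this
  simpa using this

theorem ad_of_neg (hN : dg (-1) (-1) ∈ G) {x : HU} (h : ad (-x) x ∈ G) : ad x (-x) ∈ G := by
  have := mul_mem hN h
  rw [dg_mul_ad] at this
  simpa using this

theorem scalar_mem' (hN : dg (-1) (-1) ∈ G) {x : HU} (hx : x ∈ Subgroup.closure (roots G)) :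
    dg x x ∈ G ∨ ad x (-x) ∈ G := by
  rcases scalar_mem hx with h | h | h
  · exact h
  · exact Or.inl (dg_of_neg hN h)
  · exact Or.inr (ad_of_neg hN h)

theorem square_mem (hN : dg (-1) (-1) ∈ G) {x : HU} (hx : x ∈ Subgroup.closure (roots G)) :
    dg (x * x) (x * x) ∈ G := by
  rcases scalar_mem' hN hx with h | h
  · have := mul_mem h h
    rwa [dg_mul_dg] at this
  · have := mul_mem h h
    rw [ad_mul_ad, mul_neg, neg_mul] at this
    exact dg_of_neg hN this

/-- Squares always occur as scalars, and `q⁴ = -q` makes `q` itself a square up to sign. -/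
theorem uQ_scalar_mem (hN : dg (-1) (-1) ∈ G) (hq : uQ ∈ Subgroup.closure (roots G)) :
    dg uQ uQ ∈ G := by
  have h := square_mem hN hq
  have h2 := mul_mem h h
  rw [dg_mul_dg, ← mul_assoc, uQ_cu, neg_one_mul] at h2
  exact dg_of_neg hN h2

/-- Like `q`, the generator `t` is a square up to sign, because `t⁶ = -t`; so all of `binI` occurs
as scalars. -/
theorem uT_pow : uT * uT * (uT * uT) * (uT * uT) = -uT := by
  have h : qt * qt = tau • qt - 1 := by
    have h := sq_eq_tr normSq_qt
    rwa [show tr qt = tau by simp [tr, qt]; ring] at h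
  have hs := tau_sq
  have h4 : qt * qt * (qt * qt) = qt - tau • 1 := by
    have h1 : qt * qt * (qt * qt) = (tau * tau) • (qt * qt) - (2 * tau) • qt + 1 := by
      conv_lhs => rw [h]
      rw [sub_mul, mul_sub, mul_sub, smul_mul_smul_comm]
      simp only [one_mul, mul_one]
      module
    rw [h1, h]
    match_scalars
    · linear_combination (tau + 1) * hs
    · linear_combination -hs
  ext1
  simp only [Units.val_mul, uT_val, Units.val_neg]
  rw [h4, h, sub_mul, mul_sub, mul_smul_comm, h, smul_mul_assoc, one_mul, mul_one]
  match_scalars <;> ring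

theorem exists_root (hi : uI ∈ Subgroup.closure (roots G)) : (roots G).Nonempty := by
  rw [Set.nonempty_iff_ne_empty]
  intro h
  rw [h, Subgroup.closure_empty, Subgroup.mem_bot] at hi
  have := congrArg (fun q : HU => (q : ℍ[ℝ]).imI) hi
  simp at this

theorem ad_one_mem {b : HU} (h1 : ad b (-b) ∈ G) (h2 : dg b b ∈ G) : ad 1 (-1) ∈ G := by
  have := mul_mem (inv_mem h2) h1
  rwa [dg_inv, dg_mul_ad, inv_mul_cancel, mul_neg, inv_mul_cancel] at this

theorem ad_mem_of_one {u : HU} (h1 : ad 1 (-1) ∈ G) (h2 : dg u u ∈ G) : ad u (-u) ∈ G := by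
  have := mul_mem h2 h1
  rwa [dg_mul_ad, mul_one, mul_neg, mul_one] at this

theorem root_mem {b : HU} (hb : b ∈ roots G) : ad b (-b) ∈ G := by
  rw [← inv_of_sq hb.1]
  exact hb.2

theorem eq_nf_of_dg_mem (hR : IsReflectionGroup G) (h : HasType G e)
    (hi : uI ∈ Subgroup.closure (roots G))
    (hd : ∀ x ∈ Subgroup.closure (roots G), dg x x ∈ G) {u : HU}
    (hu : u ∈ Subgroup.closure (roots G)) : G = nf (Subgroup.closure (roots G)) u e := by
  have hneg := neg_one_mem_of hi
  refine le_antisymm (le_nf hR h (isNF_of_mem hu hneg h.1) ?_ ?_) (nf_le hd ?_ h.2.1)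
  · exact fun b hb => ⟨b * u⁻¹, mul_mem (Subgroup.subset_closure hb) (inv_mem hu), by simp⟩
  · rintro - b hb -
    refine ⟨b * u⁻¹, mul_mem ?_ (inv_mem hu), by simp⟩
    rcases hb with rfl | rfl
    exacts [one_mem _, hneg]
  · obtain ⟨b, hb⟩ := exists_root hi
    exact ad_mem_of_one (ad_one_mem (root_mem hb) (hd b (Subgroup.subset_closure hb))) (hd u hu)

theorem eq_nf_binI (hR : IsReflectionGroup G) (h : HasType G e)
    (hK : Subgroup.closure (roots G) = binI) : G = nf binI uP e := by
  have hN := neg_scalar_mem (hK ▸ uI_mem_I) (hK ▸ uJ_mem_of uI_mem_I uQ_mem_I)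
  have hq := uQ_scalar_mem hN (hK ▸ uQ_mem_I)
  have ht : dg uT uT ∈ G := by
    have h2 := square_mem hN (x := uT) (hK ▸ uT_mem)
    have := mul_mem (mul_mem h2 h2) h2
    rw [dg_mul_dg, dg_mul_dg, uT_pow] at this
    exact dg_of_neg hN this
  have := eq_nf_of_dg_mem hR h (hK ▸ uI_mem_I) (u := uP) ?_ (hK ▸ uP_mem)
  · rwa [hK] at this
  · rw [hK]
    refine dg_mem_of_closure ?_
    rintro _ (rfl | rfl)
    exacts [hq, ht]

/-- The element `uX` normalizes `binT` and has square `-1` there, so two cosets suffice. In the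
tetrahedral normal form the antidiagonal entries fill the second coset. -/
theorem binO_cosets : ∀ x ∈ binO, x ∈ binT ∨ ∃ a ∈ binT, x = a * uX := by
  have hnorm := (isNF_T (Or.inl rfl)).norm
  have hneg : ∀ {x}, x ∈ binT → -x ∈ binT := neg_mem_of (neg_one_mem_of uI_mem_T)
  intro x hx
  induction hx using Subgroup.closure_induction with
  | mem x hx =>
    rcases hx with rfl | rfl
    · exact Or.inr ⟨uJ⁻¹, inv_mem (uJ_mem_of uI_mem_T uQ_mem_T), by
        rw [← uJ_mul_uO, inv_mul_cancel_left]⟩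
    · exact Or.inl uQ_mem_T
  | one => exact Or.inl (one_mem _)
  | mul x y _ _ hx hy =>
    rcases hx with hx | ⟨a, ha, rfl⟩ <;> rcases hy with hy | ⟨b, hb, rfl⟩
    · exact Or.inl (mul_mem hx hy)
    · exact Or.inr ⟨x * b, mul_mem hx hb, by rw [mul_assoc]⟩
    · exact Or.inr ⟨a * (uX * y * uX⁻¹), mul_mem ha (hnorm y hy), by simp [mul_assoc]⟩
    · refine Or.inl ?_
      have := hneg (mul_mem ha (hnorm b hb))
      rw [inv_of_sq uX_mul_self, mul_neg, mul_neg, neg_neg, ← mul_assoc, ← mul_assoc] at this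
      rwa [← mul_assoc]
  | inv x _ hx =>
    rcases hx with hx | ⟨a, ha, rfl⟩
    · exact Or.inl (inv_mem hx)
    · refine Or.inr ⟨-(uX * a⁻¹ * uX⁻¹), hneg (hnorm _ (inv_mem ha)), ?_⟩
      rw [mul_inv_rev, inv_of_sq uX_mul_self]
      simp [mul_assoc, uX_mul_self]

/-- Squares supply only the scalars of `binT`. If `uO` is a scalar in `G`, so is all of `binO`.
Otherwise `ad 1 (-1)` is missing from `G`, every antidiagonal entry lies in the coset of `uX`, and
the tetrahedral normal form results. -/
theorem eq_nf_binO (hR : IsReflectionGroup G) (h : HasType G e)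
    (hK : Subgroup.closure (roots G) = binO) : G = nf binO uX e ∨ G = nf binT uX e := by
  have hN := neg_scalar_mem (hK ▸ uI_mem_O) (hK ▸ uJ_mem_of uI_mem_O uQ_mem_O)
  have hq := uQ_scalar_mem hN (hK ▸ uQ_mem_O)
  have hi : dg uI uI ∈ G := uO_mul_self ▸ square_mem hN (x := uO) (hK ▸ uO_mem)
  by_cases ho : dg uO uO ∈ G
  · left
    have := eq_nf_of_dg_mem hR h (hK ▸ uI_mem_O) (u := uX) ?_ (hK ▸ uX_mem)
    · rwa [hK] at this
    · rw [hK]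
      refine dg_mem_of_closure ?_
      rintro _ (rfl | rfl)
      exacts [ho, hq]
  · right
    have hd : ∀ x ∈ binT, dg x x ∈ G := by
      refine dg_mem_of_closure ?_
      rintro _ (rfl | rfl)
      exacts [hi, hq]
    have hO : ad uO (-uO) ∈ G := (scalar_mem' hN (hK ▸ uO_mem)).resolve_left ho
    have h1 : ad 1 (-1) ∉ G := by
      intro h1
      have := mul_mem hO h1
      rw [ad_mul_ad, mul_neg, mul_one, mul_one] at this
      exact ho (dg_of_neg hN this)
    refine le_antisymm (le_nf hR h (isNF_T h.1) ?_ ?_) (nf_le hd ?_ h.2.1)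
    · intro b hb
      rcases binO_cosets b (hK ▸ Subgroup.subset_closure hb) with hb' | hb'
      · exact absurd (ad_one_mem (root_mem hb) (hd b hb')) h1
      · exact hb'
    · rintro rfl b hb hb'
      refine absurd ?_ h1
      have hs := h.2.1
      rcases hb with rfl | rfl
      · have := mul_mem (mul_mem hN hs) hb'
        simpa [dg_mul_dg, dg_mul_ad] using this
      · have := mul_mem hs hb'
        simpa [dg_mul_ad] using this
    · have := mul_mem (hd uJ (uJ_mem_of uI_mem_T uQ_mem_T)) hO
      rwa [dg_mul_ad, mul_neg, uJ_mul_uO] at this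

theorem closure_roots_finite (hG : Finite G) :
    (Subgroup.closure (roots G) : Set HU).Finite := by
  have hG' : (G : Set (GLd 2 ℍ[ℝ])).Finite := hG
  have h1 : Function.Injective fun x : HU => dg x x := fun x y h => (dg_inj.1 h).1
  have h2 : Function.Injective fun x : HU => ad x (-x) := fun x y h => (ad_inj.1 h).1
  have h3 : Function.Injective fun x : HU => dg (-x) (-x) := fun x y h => neg_inj.1 (dg_inj.1 h).1
  have h4 : Function.Injective fun x : HU => ad (-x) x := fun x y h => (ad_inj.1 h).2
  refine Set.Finite.subset (((hG'.preimage h1.injOn).union (hG'.preimage h2.injOn)).union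
    ((hG'.preimage h3.injOn).union (hG'.preimage h4.injOn))) fun x hx => ?_
  exact scalar_mem hx

theorem exists_poly (hR : IsReflectionGroup G) (h : HasType G e) (hne : (roots G).Nonempty)
    (hax : ¬ HasAxis (Subgroup.closure (roots G))) :
    ∃ t, Conj G (nf (polyK t) (polyU t) e) := by
  have hcj := fun q : HU => (conj_cj (dg q q) G).isReflectionGroup hR
  rcases (hasAxis_or_bin hne (fun b hb => hb.1) (closure_roots_finite hR.1)).resolve_left hax with
    ⟨q, hq⟩ | ⟨q, hq⟩
  · rw [← roots_cj] at hq
    rcases eq_nf_binO (hcj q) (h.cj q) hq with h1 | h1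
    · exact ⟨1, h1 ▸ conj_cj _ G⟩
    · exact ⟨0, h1 ▸ conj_cj _ G⟩
  · rw [← roots_cj] at hq
    exact ⟨2, eq_nf_binI (hcj q) (h.cj q) hq ▸ conj_cj _ G⟩

end Polyhedral

/-! ### Groups whose entries preserve an axis -/

theorem exists_cu {x : HU} (h : rot x qi = qi) : ∃ z, cu z = x := by
  rw [rot_eq_self_iff] at h
  have h2 := congrArg (fun q : ℍ[ℝ] => q.imJ) h
  have h3 := congrArg (fun q : ℍ[ℝ] => q.imK) h
  simp at h2 h3
  have hx : ((⟨(x : ℍ[ℝ]).re, (x : ℍ[ℝ]).imI⟩ : ℂ) : ℍ[ℝ]) = x := by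
    ext
    · simp
    · simp
    · simp; linarith
    · simp; linarith
  have h0 : (⟨(x : ℍ[ℝ]).re, (x : ℍ[ℝ]).imI⟩ : ℂ) ≠ 0 := by
    intro h0
    rw [h0] at hx
    exact x.ne_zero (by rw [← hx]; simp)
  exact ⟨Units.mk0 _ h0, Units.ext hx⟩

theorem exists_rot_qi {p : ℍ[ℝ]} (hp : p * p = -1) : ∃ q : HU, rot q p = qi := by
  by_cases h : p = -qi
  · exact ⟨uJ, by rw [h, rot_neg, uJ_qi, neg_neg]⟩
  · obtain ⟨q, -, hq⟩ := exists_rot_eq (congrArg Units.val uI_mul_self) hp h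
    exact ⟨q, hq⟩

theorem HasAxis.exists_sq {K : Subgroup HU} (h : HasAxis K) :
    ∃ p : ℍ[ℝ], p * p = -1 ∧ ∀ g ∈ K, rot g p = p ∨ rot g p = -p := by
  obtain ⟨p, hp, hp0, h⟩ := h
  refine ⟨(√(Quaternion.normSq p))⁻¹ • p, ?_, fun g hg => ?_⟩
  · have hn : Quaternion.normSq p ≠ 0 := Quaternion.normSq_ne_zero.2 hp0
    rw [smul_mul_smul_comm, ← mul_inv, Real.mul_self_sqrt Quaternion.normSq_nonneg,
      mul_self_of_re_eq_zero hp, ← Quaternion.coe_mul_eq_smul, ← Quaternion.coe_mul, mul_neg,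
      inv_mul_cancel₀ hn]
    simp
  · rw [rot_smul]
    rcases h g hg with h | h <;> simp [h]

theorem complex_of_comm {a b : HU} (ha : rot a qi = qi) (hb : rot b qi = qi) {r : GLd 2 ℍ[ℝ]}
    (hr : r = dg a b ∨ r = ad a b) : r ∈ (monoGroup ℂ).map complexToQuaternion := by
  obtain ⟨z, rfl⟩ := exists_cu ha
  obtain ⟨w, rfl⟩ := exists_cu hb
  rcases hr with rfl | rfl
  · exact ⟨dg z w, dg_mem_mono _ _, complexToQuaternion_dg _ _⟩
  · exact ⟨ad z w, ad_mem_mono _ _, complexToQuaternion_ad _ _⟩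

theorem rot_conj_eq {q a : HU} {p p' s : ℍ[ℝ]} (hq : rot q p = p') (ha : rot a p = s) :
    rot (q * a * q⁻¹) p' = rot q s := by
  rw [← hq, rot_mul_left, rot_mul_left, rot_inv_rot, ha]

theorem rot_inv_eq {q : HU} {p : ℍ[ℝ]} (h : rot q p = p) : rot q⁻¹ p = p := by
  conv_lhs => rw [← h]
  exact rot_inv_rot _ _

/-- A rotation taking `p` to `i` turns the centralizer of `p` into `ℂ`, so the whole group would
become complex. -/
theorem false_of_commuting {G : Subgroup (GLd 2 ℍ[ℝ])} (hG : IsImprimitiveQuaternionicRG G)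
    {p : ℍ[ℝ]} (hp : p * p = -1) (h : ∀ r ∈ G, IsReflection r →
      ∃ a b : HU, rot a p = p ∧ rot b p = p ∧ (r = dg a b ∨ r = ad a b)) : False := by
  obtain ⟨q, hq⟩ := exists_rot_qi hp
  refine false_of_complex ((conj_cj (dg q q) G).isQuaternionic hG)
    (forall_reflection_cj.2 fun r hr hr' => ?_)
  obtain ⟨a, b, ha, hb, hab⟩ := h r hr hr'
  refine complex_of_comm ((rot_conj_eq hq ha).trans hq) ((rot_conj_eq hq hb).trans hq) ?_
  exact hab.imp (fun h => by rw [h, conj_dg_dg]) (fun h => by rw [h, conj_dg_ad])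

theorem eq_i_of_comm {b : HU} (hb : b * b = -1) (h : rot b qi = qi) : b = uI ∨ b = -uI := by
  have h1 : b * uI = uI * b := Units.ext (rot_eq_self_iff.1 h)
  have h2 : b * uI * (b * uI) = 1 := by
    rw [mul_assoc, ← mul_assoc uI, ← h1, mul_assoc b, uI_mul_self, mul_neg_one, mul_neg, hb,
      neg_neg]
  rcases sq_eq_one_unit h2 with h3 | h3
  · right
    rw [← inv_of_sq uI_mul_self]
    exact eq_inv_of_mul_eq_one_left h3
  · left
    rw [← mul_left_inj uI, h3, uI_mul_self]

theorem fin_two_ext {a b c d a' b' c' d' : ℍ[ℝ]} (ha : a = a') (hb : b = b') (hc : c = c')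
    (hd : d = d') : !![a, b; c, d] = !![a', b'; c', d'] := by
  rw [ha, hb, hc, hd]

/-- The change of basis with columns `(1, i)` and `(j, -k)`. -/
noncomputable def axisBasis : GLd 2 ℍ[ℝ] where
  val := !![1, uJ; uI, -uK]
  inv := !![(2⁻¹ : ℝ) • 1, -((2⁻¹ : ℝ) • (uI : ℍ[ℝ])); -((2⁻¹ : ℝ) • (uJ : ℍ[ℝ])),
    (2⁻¹ : ℝ) • (uK : ℍ[ℝ])]
  val_inv := by
    rw [Matrix.mul_fin_two, Matrix.one_fin_two]
    refine fin_two_ext ?_ ?_ ?_ ?_ <;> ext <;> simp <;> norm_num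
  inv_val := by
    rw [Matrix.mul_fin_two, Matrix.one_fin_two]
    refine fin_two_ext ?_ ?_ ?_ ?_ <;> ext <;> simp <;> norm_num

theorem axisBasis_comm {b : HU} (h0 : (b : ℍ[ℝ]).re = 0) (h1 : (b : ℍ[ℝ]).imI = 0) :
    axisBasis⁻¹ * ad b (-b) * axisBasis⁻¹⁻¹ = ad (-(b * uK)) (-(uK * b)) := by
  rw [inv_inv, mul_assoc, inv_mul_eq_iff_eq_mul]
  ext1
  rw [Units.val_mul, Units.val_mul, ad_val, ad_val]
  simp only [axisBasis]
  rw [Matrix.mul_fin_two, Matrix.mul_fin_two]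
  refine fin_two_ext ?_ ?_ ?_ ?_ <;> ext <;> simp [h0, h1]

theorem axisBasis_i : axisBasis⁻¹ * ad uI (-uI) * axisBasis⁻¹⁻¹ = dg (-1) 1 := by
  rw [inv_inv, mul_assoc, inv_mul_eq_iff_eq_mul]
  ext1
  rw [Units.val_mul, Units.val_mul, ad_val, dg_val]
  simp only [axisBasis]
  rw [Matrix.mul_fin_two, Matrix.mul_fin_two]
  refine fin_two_ext ?_ ?_ ?_ ?_ <;> ext <;> simp

theorem axisBasis_neg_i : axisBasis⁻¹ * ad (-uI) uI * axisBasis⁻¹⁻¹ = dg 1 (-1) := by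
  rw [inv_inv, mul_assoc, inv_mul_eq_iff_eq_mul]
  ext1
  rw [Units.val_mul, Units.val_mul, ad_val, dg_val]
  simp only [axisBasis]
  rw [Matrix.mul_fin_two, Matrix.mul_fin_two]
  refine fin_two_ext ?_ ?_ ?_ ?_ <;> ext <;> simp

theorem not_isReflection_one : ¬ IsReflection (dg (1 : HU) 1) := by
  intro h
  rcases isReflection_dg h with h | h <;> tauto

theorem re_of_anticomm {b : HU} (hb : b * b = -1) (h : rot b qi = -qi) :
    (b : ℍ[ℝ]).re = 0 ∧ (b : ℍ[ℝ]).imI = 0 := by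
  rw [rot_eq_iff] at h
  have h0 : (b : ℍ[ℝ]).re = 0 := re_of_sq (by rw [← Units.val_mul, hb]; simp)
  have h1 := congrArg (fun q : ℍ[ℝ] => q.re) h
  simp [h0] at h1
  exact ⟨h0, by linarith⟩

/-- The entries are `±i` or orthogonal to `i`. In the basis `axisBasis` the former give diagonal
matrices with entries `±1`, the latter antidiagonal ones with entries `-b k` and `-k b`, which
commute with `i`: the group is complex. -/
theorem false_of_axis_one {G : Subgroup (GLd 2 ℍ[ℝ])} (hG : IsImprimitiveQuaternionicRG G)
    (h : ∀ r ∈ G, IsReflection r → ∃ b : HU, b * b = -1 ∧ (rot b qi = qi ∨ rot b qi = -qi) ∧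
      r = ad b (-b)) : False := by
  have h1 : rot (-1) qi = qi := by rw [rot_neg_left, rot_one_left]
  have h2 : rot 1 qi = qi := rot_one_left _
  refine false_of_complex ((conj_cj axisBasis⁻¹ G).isQuaternionic hG)
    (forall_reflection_cj.2 fun r hr hr' => ?_)
  obtain ⟨b, hb, hbi | hbi, rfl⟩ := h r hr hr'
  · rcases eq_i_of_comm hb hbi with rfl | rfl
    · rw [axisBasis_i]
      exact complex_of_comm h1 h2 (Or.inl rfl)
    · rw [neg_neg, axisBasis_neg_i]
      exact complex_of_comm h2 h1 (Or.inl rfl)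
  · obtain ⟨h0, h1⟩ := re_of_anticomm hb hbi
    rw [axisBasis_comm h0 h1]
    have hK : rot uK qi = -qi := by
      rw [rot_eq_iff]
      ext <;> simp
    refine complex_of_comm ?_ ?_ (Or.inr rfl)
    · rw [rot_neg_left, rot_mul_left, hK, rot_neg, hbi, neg_neg]
    · rw [rot_neg_left, rot_mul_left, hbi, rot_neg, hK, neg_neg]

/-- The reflections are `diag (± 1, ± 1)` or antidiagonal with entries of square `± 1`
preserving the axis of `i`. -/
def AxisType (G : Subgroup (GLd 2 ℍ[ℝ])) : Prop :=
  dg (-1) 1 ∈ G ∧ ∀ r ∈ G, IsReflection r → r = dg (-1) 1 ∨ r = dg 1 (-1) ∨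
    ∃ b : HU, (b * b = 1 ∨ b * b = -1) ∧ (rot b qi = qi ∨ rot b qi = -qi) ∧ r = ad b b⁻¹

theorem comm_or_of_axis {b u : HU} (hu : u * u = 1 ∨ u * u = -1) (hui : rot u qi = qi)
    (hb : rot b qi = qi ∨ rot b qi = -qi) : b * u = u * b ∨ b * u = -(u * b) := by
  have key : b * uI = uI * b ∨ b * uI = -(uI * b) := by
    rcases hb with h | h
    · exact Or.inl (Units.ext (rot_eq_self_iff.1 h))
    · rw [rot_eq_iff] at h
      exact Or.inr (Units.ext (by simpa using h))
  rcases hu with hu | hu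
  · rcases sq_eq_one_unit hu with rfl | rfl <;> simp
  · rcases eq_i_of_comm hu hui with rfl | rfl
    · exact key
    · rcases key with h | h <;> simp [h]

theorem conj_sign' (u e : HU) (he : e = 1 ∨ e = -1) :
    dg 1 u⁻¹ * dg 1 e * (dg 1 u⁻¹)⁻¹ = dg 1 e := by
  rw [dg_inv, dg_mul_dg, dg_mul_dg, inv_one, conj_sign_eq he]
  simp

/-- Each entry `b` commutes or anticommutes with `u`, so `(b u)² = ±b² u²` and the shift by `u`
keeps the type. -/
theorem AxisType.cj {G : Subgroup (GLd 2 ℍ[ℝ])} (h : AxisType G) {u : HU}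
    (hu : u * u = 1 ∨ u * u = -1) (hui : rot u qi = qi) : AxisType (cj (dg 1 u⁻¹) G) := by
  refine ⟨by simpa only [conj_sign] using mem_cj (U := dg 1 u⁻¹) h.1,
    forall_reflection_cj.2 fun r hr hr' => ?_⟩
  rcases h.2 r hr hr' with rfl | rfl | ⟨b, hb, hbi, rfl⟩
  · exact Or.inl (conj_sign _ _)
  · exact Or.inr (Or.inl (conj_sign' _ _ (Or.inr rfl)))
  · refine Or.inr (Or.inr ⟨b * u, ?_, ?_, conj_ad _ _⟩)
    · have : b * u * (b * u) = b * b * (u * u) ∨ b * u * (b * u) = -(b * b * (u * u)) := by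
        rw [mul_assoc, ← mul_assoc u]
        rcases comm_or_of_axis hu hui hbi with h | h
        · left; rw [← h]; simp only [mul_assoc]
        · right
          rw [← neg_eq_iff_eq_neg.2 h]
          simp only [mul_assoc, neg_mul, mul_neg]
      rcases this with h | h <;> rw [h] <;> rcases hb with hb | hb <;>
        rcases hu with hu | hu <;> rw [hb, hu] <;> simp
    · rw [rot_mul_left, hui]
      exact hbi

/-- If every antidiagonal entry anticommuted with `i`, shifting by `j` would make all of them
commute with `i`, and the group would be complex. -/
theorem AxisType.exists_comm {G : Subgroup (GLd 2 ℍ[ℝ])} (hG : IsImprimitiveQuaternionicRG G)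
    (h : AxisType G) : ∃ b : HU, (b * b = 1 ∨ b * b = -1) ∧ rot b qi = qi ∧ ad b b⁻¹ ∈ G := by
  by_contra hcon
  have h1 : rot (-1) qi = qi := by rw [rot_neg_left, rot_one_left]
  have h2 : rot 1 qi = qi := rot_one_left _
  refine false_of_commuting ((conj_cj (dg 1 uJ⁻¹) G).isQuaternionic hG)
    (congrArg Units.val uI_mul_self) (forall_reflection_cj.2 fun r hr hr' => ?_)
  rcases h.2 r hr hr' with rfl | rfl | ⟨b, hb, hbi, rfl⟩
  · exact ⟨-1, 1, h1, h2, Or.inl (conj_sign _ _)⟩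
  · exact ⟨1, -1, h2, h1, Or.inl (conj_sign' _ _ (Or.inr rfl))⟩
  · have hb' : rot b qi = -qi := hbi.resolve_left fun h => hcon ⟨b, hb, h, hr⟩
    have hr : rot (b * uJ) qi = qi := by rw [rot_mul_left, uJ_qi, rot_neg, hb', neg_neg]
    refine ⟨_, _, hr, rot_inv_eq hr, Or.inr (conj_ad _ _)⟩

theorem exists_axis_i {K : Subgroup HU} (h : HasAxis K) :
    ∃ q, ∀ g ∈ kc q K, rot g qi = qi ∨ rot g qi = -qi := by
  obtain ⟨p, hp, h⟩ := h.exists_sq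
  obtain ⟨q, hq⟩ := exists_rot_qi hp
  refine ⟨q, ?_⟩
  rintro _ ⟨g, hg, rfl⟩
  change rot (q * g * q⁻¹) qi = qi ∨ rot (q * g * q⁻¹) qi = -qi
  rcases h g hg with h | h
  · exact Or.inl ((rot_conj_eq hq h).trans hq)
  · exact Or.inr (by rw [rot_conj_eq hq h, rot_neg, hq])

/-- Finite groups of quaternions preserving the axis of `i` and containing `j`. -/
theorem exists_dic {K : Subgroup HU} (hK : (K : Set HU).Finite) (hJ : uJ ∈ K)
    (hax : ∀ x ∈ K, rot x qi = qi ∨ rot x qi = -qi) : ∃ n, n ≠ 0 ∧ K = dic n := by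
  -- The elements of `K` commuting with `i` form a finite group of complex numbers, hence a full
  -- group of roots of unity. It contains `j² = -1`, so its order is some `2 n`.
  let C := K.comap cu
  have hC : Finite C := Set.Finite.preimage (f := cu) cu_injective.injOn hK
  have hN : Nat.card C ≠ 0 := Nat.card_pos.ne'
  have : NeZero (Nat.card C) := ⟨hN⟩
  have hle : C ≤ rootsOfUnity (Nat.card C) ℂ := by
    intro z hz
    rw [mem_rootsOfUnity]
    exact congrArg Subtype.val (pow_card_eq_one' (x := (⟨z, hz⟩ : C)))
  have hCeq : C = rootsOfUnity (Nat.card C) ℂ :=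
    Subgroup.eq_of_le_of_card_ge hle (by rw [Complex.card_rootsOfUnity])
  have hneg : (-1 : ℂˣ) ∈ C := by
    change cu (-1) ∈ K
    rw [show cu (-1) = uJ * uJ by rw [uJ_mul_self]; ext <;> simp]
    exact mul_mem hJ hJ
  have heven : Even (Nat.card C) := by
    have h := hle hneg
    rw [mem_rootsOfUnity] at h
    by_contra hodd
    rw [(Nat.not_even_iff_odd.1 hodd).neg_one_pow] at h
    have := congrArg (fun z : ℂˣ => (z : ℂ)) h
    norm_num at this
  obtain ⟨n, hn⟩ := heven
  have hn0 : n ≠ 0 := by omega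
  rw [← two_mul] at hn
  obtain ⟨z, hz⟩ : ∃ z, cu z = omu n := by
    apply exists_cu
    rw [rot_eq_self_iff]
    ext <;> simp
  have hprim : IsPrimitiveRoot z (2 * n) := by
    have key : ∀ k, z ^ k = 1 ↔ 2 * n ∣ k := fun k => by
      rw [← omu_pow_eq_one_iff hn0, ← hz, ← map_pow, map_eq_one_iff _ cu_injective]
    exact ⟨(key _).2 dvd_rfl, fun k => (key k).1⟩
  have : NeZero (2 * n) := ⟨by omega⟩
  have hCz : C = Subgroup.zpowers z := by rw [hCeq, hprim.zpowers_eq, hn]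
  have hcomm : ∀ x ∈ K, rot x qi = qi → x ∈ dic n := by
    intro x hx hxi
    obtain ⟨w, rfl⟩ := exists_cu hxi
    have hw : w ∈ C := hx
    rw [hCz] at hw
    obtain ⟨k, rfl⟩ := hw
    simp only [map_zpow, hz]
    exact zpow_mem (omu_mem n) k
  refine ⟨n, hn0, le_antisymm (fun x hx => ?_) ?_⟩
  · rcases hax x hx with h | h
    · exact hcomm x hx h
    · have := hcomm (x * uJ) (mul_mem hx hJ) (by rw [rot_mul_left, uJ_qi, rot_neg, h, neg_neg])
      simpa using mul_mem this (inv_mem (uJ_mem_dic n))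
  · rw [dic, Subgroup.closure_le]
    rintro _ (rfl | rfl)
    · have : z ∈ C := by rw [hCz]; exact Subgroup.mem_zpowers z
      rw [← hz]
      exact this
    · exact hJ

theorem cj_nf_one (q : HU) (K : Subgroup HU) {e : HU} (he : e = 1 ∨ e = -1) :
    Conj (nf K 1 e) (nf (kc q K) 1 e) := by
  change ∃ U, cj U _ = _
  have h1 : dg q q * ad 1 (-1) * (dg q q)⁻¹ = ad 1 (-1) := by rw [conj_dg_ad]; simp
  have h2 : dg q q * dg e 1 * (dg q q)⁻¹ = dg e 1 := by
    rw [conj_dg_dg, conj_sign_eq he]; simp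
  refine ⟨dg q q, le_antisymm ?_ (nf_le ?_ ⟨_, ad_mem_nf, h1⟩ ⟨_, sign_mem_nf, h2⟩)⟩
  · rw [Subgroup.map_le_iff_le_comap]
    refine nf_le (G := (nf (kc q K) 1 e).comap (MulAut.conj (dg q q)).toMonoidHom)
      (fun x hx => ?_) ?_ ?_
    · change dg q q * dg x x * (dg q q)⁻¹ ∈ nf (kc q K) 1 e
      rw [conj_dg_dg]
      exact dg_mem_nf (mem_kc hx)
    · change dg q q * ad 1 (-1) * (dg q q)⁻¹ ∈ nf (kc q K) 1 e
      rw [h1]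
      exact ad_mem_nf
    · change dg q q * dg e 1 * (dg q q)⁻¹ ∈ nf (kc q K) 1 e
      rw [h2]
      exact sign_mem_nf
  · rintro _ ⟨x, hx, rfl⟩
    exact ⟨dg x x, dg_mem_nf hx, conj_dg_dg _ _ _⟩

/-- The product of `ad b b⁻¹` with the swap `ad 1 1` is `diag (b, b⁻¹)`, and `b⁻¹ = ±b`; up to `diag
(1, -1)` it is the scalar `b`. -/
theorem AxisType.eq_nf {G : Subgroup (GLd 2 ℍ[ℝ])} (hR : IsReflectionGroup G) (h : AxisType G)
    (h1 : ad 1 1 ∈ G) :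
    G = nf (Subgroup.closure {b : HU | (b * b = 1 ∨ b * b = -1) ∧
      (rot b qi = qi ∨ rot b qi = -qi) ∧ ad b b⁻¹ ∈ G}) 1 (-1) := by
  have hs := h.1
  have hs' : dg 1 (-1) ∈ G := by
    have := mul_mem (mul_mem h1 hs) h1
    rw [ad_mul_dg, ad_mul_ad] at this
    simpa using this
  have hN : dg (-1) (-1) ∈ G := by
    have := mul_mem hs hs'
    rw [dg_mul_dg] at this
    simpa using this
  have hneg : (-1 : HU) ∈ Subgroup.closure {b : HU | (b * b = 1 ∨ b * b = -1) ∧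
      (rot b qi = qi ∨ rot b qi = -qi) ∧ ad b b⁻¹ ∈ G} := by
    refine Subgroup.subset_closure ⟨Or.inl (by simp), Or.inl (by simp), ?_⟩
    have := mul_mem hN h1
    rw [dg_mul_ad] at this
    simpa using this
  have hinv : ∀ {b : HU}, (b * b = 1 ∨ b * b = -1) → b⁻¹ = b ∨ b⁻¹ = -b := by
    rintro b (hb | hb)
    · exact Or.inl (inv_eq_of_mul_eq_one_right hb)
    · exact Or.inr (inv_of_sq hb)
  refine le_antisymm (le_of_reflections hR fun r hr hr' => ?_)
    (nf_le (dg_mem_of_closure ?_) ?_ hs)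
  · rw [mem_nf (isNF_one hneg (Or.inr rfl))]
    rcases h.2 r hr hr' with rfl | rfl | ⟨b, hb, hbi, rfl⟩
    · exact ⟨-1, hneg, -1, Or.inr rfl, Or.inl (by simp)⟩
    · exact ⟨1, one_mem _, -1, Or.inr rfl, Or.inl (by simp)⟩
    · have hbK := Subgroup.subset_closure (k := {b : HU | (b * b = 1 ∨ b * b = -1) ∧
        (rot b qi = qi ∨ rot b qi = -qi) ∧ ad b b⁻¹ ∈ G}) ⟨hb, hbi, hr⟩
      rcases hinv hb with h | h
      · exact ⟨b, hbK, -1, Or.inr rfl, Or.inr (by simp [h])⟩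
      · exact ⟨b, hbK, 1, Or.inl rfl, Or.inr (by simp [h])⟩
  · rintro b ⟨hb, -, hbG⟩
    have := mul_mem hbG h1
    rw [ad_mul_ad, mul_one, mul_one] at this
    rcases hinv hb with h | h
    · rwa [h] at this
    · rw [h] at this
      have := mul_mem hs' this
      rwa [dg_mul_dg, one_mul, neg_one_mul, neg_neg] at this
  · have := mul_mem h1 hs
    rwa [ad_mul_dg, one_mul, one_mul] at this

theorem dg_closure_finite {G : Subgroup (GLd 2 ℍ[ℝ])} (hG : Finite G) {K : Subgroup HU}
    (h : ∀ x ∈ K, dg x x ∈ G) : (K : Set HU).Finite := by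
  have hG' : (G : Set (GLd 2 ℍ[ℝ])).Finite := hG
  have h1 : Function.Injective fun x : HU => dg x x := fun x y h => (dg_inj.1 h).1
  exact (hG'.preimage h1.injOn).subset h

theorem exists_dic_of_axis {G : Subgroup (GLd 2 ℍ[ℝ])} (hG : IsImprimitiveQuaternionicRG G)
    (h : AxisType G) : ∃ n, 2 ≤ n ∧ Conj G (nf (dic n) 1 (-1)) := by
  obtain ⟨b, hb, hbi, hbG⟩ := h.exists_comm hG
  have hb1 : b⁻¹ * b⁻¹ = 1 ∨ b⁻¹ * b⁻¹ = -1 := by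
    rw [← mul_inv_rev]
    rcases hb with h | h <;> simp [h]
  have hbi' := rot_inv_eq hbi
  set G' := cj (dg 1 b⁻¹⁻¹) G with hG'def
  have hGG' : Conj G G' := conj_cj _ _
  have hG' := hGG'.isQuaternionic hG
  have h' : AxisType G' := h.cj hb1 hbi'
  have h1 : ad 1 1 ∈ G' := by
    have := mem_cj (U := dg 1 b⁻¹⁻¹) hbG
    rwa [conj_ad, mul_inv_cancel, inv_one] at this
  have heq := h'.eq_nf hG'.1 h1
  set B := {b : HU | (b * b = 1 ∨ b * b = -1) ∧ (rot b qi = qi ∨ rot b qi = -qi) ∧ ad b b⁻¹ ∈ G'}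
  have hfin : (Subgroup.closure B : Set HU).Finite :=
    dg_closure_finite hG'.1.1 fun x hx => heq ▸ dg_mem_nf hx
  have hrm : rot (-1) qi = qi := by rw [rot_neg_left, rot_one_left]
  -- If all entries commuted with `i` the group would be complex; so some entry reverses the axis,
  -- and it has square `-1`.
  obtain ⟨c, hcB, hc⟩ : ∃ c ∈ B, rot c qi = -qi := by
    by_contra! hcon
    refine false_of_commuting hG' (congrArg Units.val uI_mul_self) fun r hr hr' => ?_
    rcases h'.2 r hr hr' with rfl | rfl | ⟨b, hb, hbi, rfl⟩
    · exact ⟨-1, 1, hrm, rot_one_left _, Or.inl rfl⟩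
    · exact ⟨1, -1, rot_one_left _, hrm, Or.inl rfl⟩
    · have hb' := hbi.resolve_right (hcon b ⟨hb, hbi, hr⟩)
      exact ⟨b, _, hb', rot_inv_eq hb', Or.inr rfl⟩
  have hne : (qi : ℍ[ℝ]) ≠ -qi := by
    intro h
    have := congrArg (fun q : ℍ[ℝ] => q.imI) h
    simp at this
    norm_num at this
  have hc2 : c * c = -1 := by
    refine hcB.1.resolve_left fun h => ?_
    rcases sq_eq_one_unit h with rfl | rfl
    · exact hne ((rot_one_left _).symm.trans hc)
    · exact hne (hrm.symm.trans hc)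
  -- As `c` anticommutes with `i`, a rotation keeps `i` and carries `c` to `j`, which prepares for
  -- `exists_dic`.
  obtain ⟨q, hq1, hq2⟩ := exists_frame (u := qi) (v := c) (congrArg Units.val uI_mul_self)
    (by rw [← Units.val_mul, hc2]; simp) (by
      rw [rot_eq_iff] at hc
      rw [hc]
      simp)
  have hJ : uJ ∈ kc q (Subgroup.closure B) := by
    refine ⟨c, Subgroup.subset_closure hcB, Units.ext ?_⟩
    rw [uJ_val, ← hq2, rot_unit]
    rfl
  obtain ⟨n, hn0, hn⟩ := exists_dic (kc_finite hfin) hJ (by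
    rintro _ ⟨g, hg, rfl⟩
    change rot (q * g * q⁻¹) qi = qi ∨ rot (q * g * q⁻¹) qi = -qi
    rcases rot_closure (fun b hb => hb.2.1) g hg with h | h
    · exact Or.inl ((rot_conj_eq hq1 h).trans hq1)
    · exact Or.inr (by rw [rot_conj_eq hq1 h, rot_neg, hq1]))
  have hfinal : Conj G (nf (dic n) 1 (-1)) := by
    refine hGG'.trans ?_
    rw [heq, ← hn]
    exact cj_nf_one q _ (Or.inr rfl)
  refine ⟨n, ?_, hfinal⟩
  by_contra hlt
  obtain rfl : n = 1 := by omega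
  -- For `n = 1` the group `dic 1` consists of `±1` and `±j`, so everything commutes with `j` and
  -- the group would be complex.
  have hcomm : ∀ x ∈ dic 1, rot x qj = qj := by
    intro x hx
    have h1 : omu 1 = -1 := by rw [← omu_pow_self one_ne_zero, pow_one]
    obtain ⟨k, hk⟩ := mem_dic one_ne_zero hx
    have h2 : ∀ k : ℤ, (-1 : HU) ^ k = 1 ∨ (-1 : HU) ^ k = -1 := fun k => by
      rcases Int.even_or_odd k with h | h
      · exact Or.inl h.neg_one_zpow
      · exact Or.inr h.neg_one_zpow
    have h3 : rot uJ qj = qj := by rw [rot_eq_self_iff]; rfl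
    rw [h1] at hk
    rcases h2 k with h | h <;> rw [h] at hk <;> rcases hk with rfl | rfl <;> simp [h3]
  have hneg := neg_one_mem_dic 1
  refine false_of_commuting (hfinal.isQuaternionic hG) (p := qj)
    (congrArg Units.val uJ_mul_self) fun r hr _ => ?_
  obtain ⟨x, hx, s, hs, h | h⟩ := (mem_nf (isNF_one hneg (Or.inr rfl))).1 hr
  · refine ⟨x, s * x, hcomm x hx, hcomm _ (mul_mem ?_ hx), Or.inl h⟩
    rcases hs with rfl | rfl
    exacts [one_mem _, hneg]
  · refine ⟨x * 1, _, hcomm _ (by rwa [mul_one]), ?_, Or.inr h⟩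
    rw [rot_neg_left, mul_one]
    refine hcomm _ (mul_mem ?_ hx)
    rcases hs with rfl | rfl
    exacts [one_mem _, hneg]

/-- The groups with more than one system of imprimitivity. -/
theorem classification {G : Subgroup (GLd 2 ℍ[ℝ])} (hG : IsImprimitiveQuaternionicRG G)
    (h : 1 < numSystems G) : (∃ t, Conj G (nf (polyK t) (polyU t) 1)) ∨
      (∃ t, Conj G (nf (polyK t) (polyU t) (-1))) ∨
        ∃ n, 2 ≤ n ∧ Conj G (nf (dic n) 1 (-1)) := by
  obtain ⟨G₁, hc, ht⟩ := exists_type hG.1 hG.2.1 h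
  obtain ⟨e, he⟩ : ∃ e, HasType G₁ e := by
    rcases ht with h | h
    exacts [⟨_, h.hasType⟩, ⟨_, h.hasType⟩]
  have hG₁ := hc.isQuaternionic hG
  by_cases hax : HasAxis (Subgroup.closure (roots G₁))
  · obtain ⟨q, hq⟩ := exists_axis_i hax
    rw [← roots_cj] at hq
    have hc2 := conj_cj (dg q q) G₁
    have hG₂ := hc2.isQuaternionic hG₁
    have he2 := he.cj q
    have hroot : ∀ b : HU, b * b = -1 → ad b b⁻¹ ∈ cj (dg q q) G₁ → rot b qi = qi ∨ rot b qi = -qi :=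
      fun b hb hb' => hq b (Subgroup.subset_closure ⟨hb, hb'⟩)
    rcases he.1 with rfl | rfl
    -- For `e = 1` there are no diagonal reflections, and an axis forces a complex group.
    · refine (false_of_axis_one hG₂ fun r hr hr' => ?_).elim
      rcases he2.2.2 r hr hr' with rfl | rfl | ⟨b, hb | ⟨hb, -⟩, rfl⟩
      · exact absurd hr' not_isReflection_one
      · exact absurd hr' not_isReflection_one
      · exact ⟨b, hb, hroot b hb hr, by rw [inv_of_sq hb]⟩
      · exact absurd hb.symm neg_one_ne_one_unit
    · right; right
      obtain ⟨n, hn, hn'⟩ := exists_dic_of_axis hG₂ ⟨he2.2.1, fun r hr hr' => by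
        rcases he2.2.2 r hr hr' with h | h | ⟨b, hb | ⟨-, hb⟩, rfl⟩
        · exact Or.inl h
        · exact Or.inr (Or.inl h)
        · exact Or.inr (Or.inr ⟨b, Or.inr hb, hroot b hb hr, rfl⟩)
        · refine Or.inr (Or.inr ⟨b, Or.inl hb, Or.inl ?_, rfl⟩)
          rcases sq_eq_one_unit hb with rfl | rfl <;> simp⟩
      exact ⟨n, hn, (hc.trans hc2).trans hn'⟩
  · have hne : (roots G₁).Nonempty := by
      rw [Set.nonempty_iff_ne_empty]
      intro h0
      refine hax ⟨qi, rfl, qi_ne_zero, fun g hg => ?_⟩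
      rw [h0, Subgroup.closure_empty, Subgroup.mem_bot] at hg
      exact Or.inl (by rw [hg, rot_one_left])
    obtain ⟨t, ht⟩ := exists_poly hG₁.1 he hne hax
    rcases he.1 with rfl | rfl
    · exact Or.inl ⟨t, hc.trans ht⟩
    · exact Or.inr (Or.inl ⟨t, hc.trans ht⟩)

/-! ### Orders of reflections -/

theorem orderOf_eq_two {g : GLd 2 ℍ[ℝ]} (h : IsReflection g) (hg : g * g = 1) : orderOf g = 2 := by
  refine orderOf_eq_prime (by rwa [pow_two]) ?_
  rintro rfl
  exact not_isReflection_one (by rwa [dg_one])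

theorem isOfFinOrder_of_mem {M : Type*} [Group M] {K : Subgroup M} (hK : Finite K) {x : M}
    (hx : x ∈ K) : IsOfFinOrder x :=
  K.subtype.isOfFinOrder (isOfFinOrder_of_finite (⟨x, hx⟩ : K))

theorem mul_self_of_orderOf {M : Type*} [Monoid M] {g : M} (h : orderOf g = 2) : g * g = 1 := by
  rw [← pow_two, ← h, pow_orderOf_eq_one]

theorem Conj.allReflectionsOrderTwo {G G' : Subgroup (GLd 2 ℍ[ℝ])} (h : Conj G G')
    (hG : AllReflectionsOrderTwo G) : AllReflectionsOrderTwo G' := by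
  obtain ⟨U, rfl⟩ := h
  change ∀ r ∈ cj U G, IsReflection r → orderOf r = 2
  refine forall_reflection_cj.2 fun r hr hr' => ?_
  exact ((MulAut.conj U).orderOf_eq r).trans (hG r hr hr')

theorem sign_mul_self {a : HU} (h : a = 1 ∨ a = -1) : a * a = 1 := by
  rcases h with rfl | rfl <;> simp

/-- In a monomial group all reflections have order two when the diagonal ones have entries `± 1`. -/
theorem allReflectionsOrderTwo_iff {G : Subgroup (GLd 2 ℍ[ℝ])} (hf : Finite G)
    (hm : G ≤ monoGroup ℍ[ℝ]) (hi : IsIrreducible G) :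
    AllReflectionsOrderTwo G ↔ ∀ h : HU, dg h 1 ∈ G → h = 1 ∨ h = -1 := by
  constructor
  · intro h a ha
    by_cases ha1 : a = 1
    · exact Or.inl ha1
    · refine sq_eq_one_unit ?_
      have hfin : IsOfFinOrder (dg a 1) :=
        isOfFinOrder_of_mem hf ha
      have h2 := mul_self_of_orderOf (h _ ha (dg_isReflection (Or.inl ⟨ha1, rfl⟩) hfin))
      rw [dg_mul_dg, ← dg_one, dg_inj] at h2
      exact h2.1
  · intro h r hr hr'
    refine orderOf_eq_two hr' ?_
    obtain ⟨a, b, rfl⟩ | ⟨a, b, rfl⟩ := mem_mono hm hr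
    · rw [dg_mul_dg, ← dg_one]
      rcases isReflection_dg hr' with ⟨-, rfl⟩ | ⟨rfl, -⟩
      · rw [sign_mul_self (h a hr), one_mul]
      · obtain ⟨c, d, hcd⟩ := exists_ad_mem hm hi
        have h1 := mul_mem (mul_mem hcd hr) (inv_mem hcd)
        rw [ad_mul_dg, ad_inv, ad_mul_ad, mul_one, mul_inv_cancel] at h1
        have h2 := sign_mul_self (h _ h1)
        have h3 : b * b = 1 := by
          have : c * (b * b) * c⁻¹ = 1 := by simpa [mul_assoc] using h2
          simpa using this
        rw [h3, one_mul]
    · rw [isReflection_ad.1 hr', ad_mul_ad, mul_inv_cancel, inv_mul_cancel, dg_one]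

theorem mem_setH {G : Subgroup (GLd 2 ℍ[ℝ])} {h : ℍ[ℝ]} :
    h ∈ setH G ↔ ∃ u : HU, dg u 1 ∈ G ∧ (u : ℍ[ℝ]) = h := by
  constructor
  · rintro ⟨g, hg, hgh⟩
    obtain ⟨a, b, ha, hb, rfl⟩ := exists_dg hgh
    obtain rfl : b = 1 := Units.ext hb
    exact ⟨a, hg, ha⟩
  · rintro ⟨u, hu, rfl⟩
    exact ⟨_, hu, by simp [dg_val]⟩

theorem one_mem_setH (G : Subgroup (GLd 2 ℍ[ℝ])) : 1 ∈ setH G :=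
  mem_setH.2 ⟨1, by rw [dg_one]; exact one_mem _, rfl⟩

theorem setH_iff {G : Subgroup (GLd 2 ℍ[ℝ])} :
    (setH G = {1} ∨ setH G = {1, -1}) ↔ ∀ h : HU, dg h 1 ∈ G → h = 1 ∨ h = -1 := by
  constructor
  · intro h a ha
    have h1 : (a : ℍ[ℝ]) ∈ setH G := mem_setH.2 ⟨a, ha, rfl⟩
    have h2 : (a : ℍ[ℝ]) = 1 ∨ (a : ℍ[ℝ]) = -1 := by
      rcases h with h | h <;> rw [h] at h1
      · exact Or.inl h1
      · exact h1
    exact h2.imp (fun h => Units.ext h) fun h => Units.ext (by simpa using h)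
  · intro h
    have h1 : ∀ x ∈ setH G, x = 1 ∨ x = -1 := by
      intro x hx
      obtain ⟨u, hu, rfl⟩ := mem_setH.1 hx
      rcases h u hu with rfl | rfl <;> simp
    by_cases hneg : (-1 : ℍ[ℝ]) ∈ setH G
    · right
      refine Set.Subset.antisymm h1 ?_
      rintro _ (rfl | rfl)
      exacts [one_mem_setH G, hneg]
    · left
      refine Set.Subset.antisymm (fun x hx => ?_) ?_
      · rcases h1 x hx with rfl | rfl
        exacts [rfl, absurd hx hneg]
      · rintro _ rfl
        exact one_mem_setH G

theorem setH_iff_order_two {G : Subgroup (GLd 2 ℍ[ℝ])} (hG : IsImprimitiveQuaternionicRG G)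
    (hm : IsMonomial G) :
    (setH G = {1} ∨ setH G = {1, -1}) ↔ AllReflectionsOrderTwo G := by
  rw [setH_iff, allReflectionsOrderTwo_iff hG.1.1 (isMonomial_iff.1 hm) hG.2.1]

/-- In either shape every reflection is visibly an involution, and orders survive conjugation. -/
theorem allReflectionsOrderTwo_of_systems {G : Subgroup (GLd 2 ℍ[ℝ])}
    (hG : IsImprimitiveQuaternionicRG G) (h : 1 < numSystems G) : AllReflectionsOrderTwo G := by
  obtain ⟨G', hc, ht⟩ := exists_type hG.1 hG.2.1 h
  refine hc.symm.allReflectionsOrderTwo fun r hr hr' => orderOf_eq_two hr' ?_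
  have hT : ∃ e, HasType G' e := by
    rcases ht with h | h
    exacts [⟨_, h.hasType⟩, ⟨_, h.hasType⟩]
  obtain ⟨e, he⟩ := hT
  rcases he.2.2 r hr hr' with rfl | rfl | ⟨b, -, rfl⟩
  · rw [dg_mul_dg, sign_mul_self he.1, one_mul, dg_one]
  · rw [dg_mul_dg, sign_mul_self he.1, one_mul, dg_one]
  · rw [ad_mul_ad, mul_inv_cancel, inv_mul_cancel, dg_one]

/-- The numbers of systems of imprimitivity. -/
theorem systems_cases {G : Subgroup (GLd 2 ℍ[ℝ])} (hG : IsImprimitiveQuaternionicRG G) :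
    numSystems G = 1 ∨ (numSystems G = ⊤ ∧ ∃ t, Conj G (infCase t)) ∨
      (numSystems G = 2 ∧ ∃ t, Conj G (twoCase t)) ∨
      (numSystems G = 3 ∧ ∃ t n, FamIndex t n ∧ Conj G (family t n)) ∨
      (numSystems G = 5 ∧ Conj G (Gnabr 2 1 1 2)) := by
  have h1 : 1 ≤ numSystems G := Order.one_le_iff_pos.2 (pos_iff_ne_zero.2 (numSystems_ne_zero hG.2.2.1))
  rcases h1.eq_or_lt with h1 | h1
  · exact Or.inl h1.symm
  right
  rcases classification hG h1 with ⟨t, ht⟩ | ⟨t, ht⟩ | ⟨n, hn, hc⟩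
  · have := ht.trans (infCase_conj t).symm
    exact Or.inl ⟨this.numSystems_eq.trans (numSystems_infCase t), t, this⟩
  · have := ht.trans (twoCase_conj t).symm
    exact Or.inr (Or.inl ⟨this.numSystems_eq.trans (numSystems_twoCase t), t, this⟩)
  · right; right
    rcases hn.eq_or_lt with rfl | hn
    · have := hc.trans Gnabr_two_conj.symm
      exact Or.inr ⟨this.numSystems_eq.trans numSystems_Gnabr_two, this⟩
    · obtain ⟨t, ht, htn⟩ := exists_family hn
      have hf := (family_spec ht).2.1
      rw [htn] at hf
      have := hc.trans hf.symm
      exact Or.inl ⟨this.numSystems_eq.trans (numSystems_family ht), t, n, ht, this⟩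

/-! ### Groups with one system of imprimitivity -/

/-- The group of all monomial matrices with entries in `K`. -/
def wreath (K : Subgroup HU) : Subgroup (GLd 2 ℍ[ℝ]) where
  carrier := {g | ∃ x ∈ K, ∃ y ∈ K, g = dg x y ∨ g = ad x y}
  one_mem' := ⟨1, one_mem _, 1, one_mem _, Or.inl dg_one.symm⟩
  mul_mem' := by
    rintro _ _ ⟨x, hx, y, hy, rfl | rfl⟩ ⟨z, hz, w, hw, rfl | rfl⟩
    · exact ⟨_, mul_mem hx hz, _, mul_mem hy hw, Or.inl (dg_mul_dg _ _ _ _)⟩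
    · exact ⟨_, mul_mem hx hz, _, mul_mem hy hw, Or.inr (dg_mul_ad _ _ _ _)⟩
    · exact ⟨_, mul_mem hx hw, _, mul_mem hy hz, Or.inr (ad_mul_dg _ _ _ _)⟩
    · exact ⟨_, mul_mem hx hw, _, mul_mem hy hz, Or.inl (ad_mul_ad _ _ _ _)⟩
  inv_mem' := by
    rintro _ ⟨x, hx, y, hy, rfl | rfl⟩
    · exact ⟨_, inv_mem hx, _, inv_mem hy, Or.inl (dg_inv _ _)⟩
    · exact ⟨_, inv_mem hy, _, inv_mem hx, Or.inr (ad_inv _ _)⟩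

theorem dg_mem_wreath {K : Subgroup HU} {x y : HU} (hx : x ∈ K) (hy : y ∈ K) : dg x y ∈ wreath K :=
  ⟨x, hx, y, hy, Or.inl rfl⟩

theorem ad_mem_wreath {K : Subgroup HU} {x y : HU} (hx : x ∈ K) (hy : y ∈ K) : ad x y ∈ wreath K :=
  ⟨x, hx, y, hy, Or.inr rfl⟩

theorem wreath_le_mono (K : Subgroup HU) : wreath K ≤ monoGroup ℍ[ℝ] := by
  rintro _ ⟨x, -, y, -, rfl | rfl⟩
  exacts [dg_mem_mono _ _, ad_mem_mono _ _]

theorem finite_of_le_wreath {K : Subgroup HU} (hK : (K : Set HU).Finite)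
    {G : Subgroup (GLd 2 ℍ[ℝ])} (h : G ≤ wreath K) : Finite G := by
  have h1 := ((hK.prod hK).image fun p => dg p.1 p.2).union ((hK.prod hK).image fun p => ad p.1 p.2)
  refine (h1.subset fun g hg => ?_ : (G : Set (GLd 2 ℍ[ℝ])).Finite)
  obtain ⟨x, hx, y, hy, rfl | rfl⟩ := h hg
  · exact Or.inl ⟨(x, y), ⟨hx, hy⟩, rfl⟩
  · exact Or.inr ⟨(x, y), ⟨hx, hy⟩, rfl⟩

/-- The swap inverts slopes, so an invariant slope is `±1`; but `ad b b⁻¹` exchanges `1` and `-1`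
because `b⁻² = -1`. -/
theorem irreducible_of_root {G : Subgroup (GLd 2 ℍ[ℝ])} {b : HU} (hb : b * b = -1)
    (h1 : ad 1 1 ∈ G) (h2 : ad b b⁻¹ ∈ G) : IsIrreducible G := by
  rw [isIrreducible_iff]
  intro v hv
  by_contra! hcon
  have e1 := hcon _ h1
  have e2 := hcon _ h2
  rcases ray_cases hv with h | ⟨w, h⟩
  · rw [h, mv_ad_inf] at e1
    exact ell_ne_ellInf _ e1
  · rw [h] at e1 e2
    by_cases hw : w = 0
    · rw [hw, mv_ad_zero] at e1
      exact ell_ne_ellInf _ e1.symm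
    · rw [mv_ad_ell _ _ hw, ell_inj] at e1 e2
      simp only [Units.val_one, one_mul, inv_one, mul_one] at e1
      have hw2 : w * w = 1 := by
        nth_rewrite 1 [← e1]
        exact inv_mul_cancel₀ hw
      rw [e1, ← Units.val_inv_eq_inv_val, inv_of_sq hb] at e2
      have hb' : (b : ℍ[ℝ]) * b = -1 := by rw [← Units.val_mul, hb]; simp
      rcases mul_self_eq_one_iff.1 hw2 with rfl | rfl
      · simp [hb'] at e2
        exact neg_one_ne_one_quat e2
      · simp [hb'] at e2
        exact neg_one_ne_one_quat e2.symm

/-- A group with diagonal reflections of order `2 n`. -/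
noncomputable def bigReflGroup (n : ℕ) : Subgroup (GLd 2 ℍ[ℝ]) :=
  Subgroup.closure {ad 1 1, ad uJ uJ⁻¹, dg (omu n) 1}

section BigRefl

variable {n : ℕ}

theorem ad_one_mem_big : ad 1 1 ∈ bigReflGroup n := Subgroup.subset_closure (Or.inl rfl)

theorem ad_uJ_mem_big : ad uJ uJ⁻¹ ∈ bigReflGroup n := Subgroup.subset_closure (Or.inr (Or.inl rfl))

theorem dg_omu_mem_big : dg (omu n) 1 ∈ bigReflGroup n :=
  Subgroup.subset_closure (Or.inr (Or.inr rfl))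

theorem big_le : bigReflGroup n ≤ wreath (dic n) := by
  rw [bigReflGroup, Subgroup.closure_le]
  rintro _ (rfl | rfl | rfl)
  · exact ad_mem_wreath (one_mem _) (one_mem _)
  · exact ad_mem_wreath (uJ_mem_dic n) (inv_mem (uJ_mem_dic n))
  · exact dg_mem_wreath (omu_mem n) (one_mem _)

theorem dg_pow (a b : HU) (k : ℕ) : dg a b ^ k = dg (a ^ k) (b ^ k) := by
  induction k with
  | zero => simp [dg_one]
  | succ k ih => rw [pow_succ, ih, dg_mul_dg, pow_succ, pow_succ]

/-- Containing a dihedral normal form is what shows, by `not_complex_of_nf_le`, that the big group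
is not complex. -/
theorem nf_le_big (hn : n ≠ 0) : nf (dic n) 1 (-1) ≤ bigReflGroup n := by
  have h1 := ad_one_mem_big (n := n)
  have hs : dg (-1) 1 ∈ bigReflGroup n := by
    have := pow_mem (dg_omu_mem_big (n := n)) n
    rwa [dg_pow, omu_pow_self hn, one_pow] at this
  have hsw : ∀ {x : HU}, dg x 1 ∈ bigReflGroup n → dg 1 x ∈ bigReflGroup n := fun h => by
    simpa [ad_mul_dg, ad_mul_ad] using mul_mem (mul_mem h1 h) h1
  refine nf_le (dg_mem_of_closure ?_) ?_ hs
  · rintro _ (rfl | rfl)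
    · simpa [dg_mul_dg] using mul_mem (dg_omu_mem_big (n := n)) (hsw dg_omu_mem_big)
    · have := mul_mem (hsw hs) (mul_mem (ad_uJ_mem_big (n := n)) h1)
      rw [ad_mul_ad, dg_mul_dg, uJ_inv] at this
      simpa using this
  · simpa [ad_mul_dg] using mul_mem h1 hs

theorem omu_ne (hn : 2 ≤ n) : omu n ≠ 1 ∧ omu n ≠ -1 := by
  constructor
  · intro h
    have := (omu_pow_eq_one_iff (by omega : n ≠ 0) 1).1 (by rw [h, pow_one])
    have := Nat.le_of_dvd one_pos this
    omega
  · intro h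
    have := (omu_pow_eq_one_iff (by omega : n ≠ 0) 2).1 (by rw [h]; simp)
    have := Nat.le_of_dvd two_pos this
    omega

theorem big_isQuaternionic (hn : 2 ≤ n) : IsImprimitiveQuaternionicRG (bigReflGroup n) := by
  have hn0 : n ≠ 0 := by omega
  refine ⟨⟨finite_of_le_wreath (dic_finite hn0) big_le, le_antisymm
    ((Subgroup.closure_le _).2 fun g hg => hg.1) ?_⟩,
    irreducible_of_root uJ_mul_self ad_one_mem_big ad_uJ_mem_big,
    ⟨_, isSystem_stdSys_iff.2 (big_le.trans (wreath_le_mono _))⟩,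
    not_complex_of_nf_le (dic_centralReal hn) (nf_le_big hn0)⟩
  conv_lhs => rw [bigReflGroup]
  rw [Subgroup.closure_le]
  rintro _ (rfl | rfl | rfl)
  · exact Subgroup.subset_closure ⟨ad_one_mem_big, isReflection_ad.2 inv_one.symm⟩
  · exact Subgroup.subset_closure ⟨ad_uJ_mem_big, isReflection_ad.2 rfl⟩
  · refine Subgroup.subset_closure ⟨dg_omu_mem_big, dg_isReflection
      (Or.inl ⟨(omu_ne hn).1, rfl⟩) ?_⟩
    rw [isOfFinOrder_iff_pow_eq_one]
    refine ⟨2 * n, by omega, ?_⟩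
    rw [dg_pow, (omu_pow_eq_one_iff hn0 _).2 dvd_rfl, one_pow, dg_one]

/-- A second system would make all reflections involutions, but `diag (ω, 1)` has order `2 n > 2`.
-/
theorem numSystems_big (hn : 2 ≤ n) : numSystems (bigReflGroup n) = 1 := by
  have hG := big_isQuaternionic hn
  refine le_antisymm (not_lt.1 fun h => ?_)
    (Order.one_le_iff_pos.2 (pos_iff_ne_zero.2 (numSystems_ne_zero hG.2.2.1)))
  have := (allReflectionsOrderTwo_iff hG.1.1 (big_le.trans (wreath_le_mono _)) hG.2.1).1
    (allReflectionsOrderTwo_of_systems hG h) _ dg_omu_mem_big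
  have := omu_ne hn
  tauto

theorem dic_pow (hn : n ≠ 0) {x : HU} (hx : x ∈ dic n) : x ^ (4 * n) = 1 := by
  obtain ⟨k, rfl | rfl⟩ := mem_dic hn hx
  · rw [← zpow_natCast, ← zpow_mul, mul_comm, zpow_mul, zpow_natCast,
      (omu_pow_eq_one_iff hn _).2 ⟨2, by ring⟩, one_zpow]
  · have : omu n ^ k * uJ * (omu n ^ k * uJ) = -1 := by
      rw [mul_assoc, ← mul_assoc uJ, uJ_mul_omu_zpow, mul_assoc, uJ_mul_self, ← mul_assoc,
        ← zpow_add]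
      simp
    rw [show 4 * n = 2 * (2 * n) by ring, pow_mul, pow_two, this, pow_mul, neg_one_sq, one_pow]

theorem big_pow (hn : n ≠ 0) {g : GLd 2 ℍ[ℝ]} (hg : g ∈ bigReflGroup n) : g ^ (8 * n) = 1 := by
  have key : ∀ x ∈ dic n, ∀ y ∈ dic n, dg x y ^ (4 * n) = 1 := fun x hx y hy => by
    rw [dg_pow, dic_pow hn hx, dic_pow hn hy, dg_one]
  rw [show 8 * n = 2 * (4 * n) by ring, pow_mul, pow_two]
  obtain ⟨x, hx, y, hy, rfl | rfl⟩ := big_le hg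
  · rw [dg_mul_dg]
    exact key _ (mul_mem hx hx) _ (mul_mem hy hy)
  · rw [ad_mul_ad]
    exact key _ (mul_mem hx hy) _ (mul_mem hy hx)

/-- The order `2 m` of `diag (ω, 1)` must divide `8 n`, a multiple of the exponent of the other
group. -/
theorem dvd_of_big_conj {m : ℕ} (hm : m ≠ 0) (hn : n ≠ 0)
    (h : Conj (bigReflGroup m) (bigReflGroup n)) : m ∣ 4 * n := by
  obtain ⟨g, hg, -, hgn⟩ := h.exists_mem dg_omu_mem_big
  have := (hgn _).1 (big_pow hn hg)
  rw [dg_pow, ← dg_one, dg_inj, omu_pow_eq_one_iff hm] at this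
  obtain ⟨k, hk⟩ := this.1
  exact ⟨k, by nlinarith⟩

theorem big_not_conj {m n : ℕ} (hmn : m < n) :
    ¬ Conj (bigReflGroup (5 ^ (n + 1))) (bigReflGroup (5 ^ (m + 1))) := by
  intro h
  have h1 := dvd_of_big_conj (by positivity) (by positivity) h
  -- Powers of `5` are used as parameters because the spare factor `4` cannot supply another factor
  -- `5`.
  have h2 : 5 ^ (m + 1) * 5 ∣ 5 ^ (m + 1) * 4 := by
    rw [← pow_succ, mul_comm _ 4]
    exact (pow_dvd_pow 5 (by omega)).trans h1
  have := Nat.dvd_of_mul_dvd_mul_left (by positivity) h2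
  omega

end BigRefl

/-! ### Galois conjugation in the golden field, twisted by a rotation -/

section Galois

/-- `a` and `b` are conjugate elements `r + s τ`, `r + s σ` of the field `ℚ(√5)`. -/
def GalReal (a b : ℝ) : Prop := ∃ r s : ℚ, a = r + s * tau ∧ b = r + s * (1 - tau)

variable {a b c d : ℝ}

theorem GalReal.symm (h : GalReal a b) : GalReal b a := by
  obtain ⟨r, s, rfl, rfl⟩ := h
  exact ⟨r + s, -s, by push_cast; ring, by push_cast; ring⟩

theorem GalReal.add (h : GalReal a b) (h' : GalReal c d) : GalReal (a + c) (b + d) := by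
  obtain ⟨r, s, rfl, rfl⟩ := h
  obtain ⟨r', s', rfl, rfl⟩ := h'
  exact ⟨r + r', s + s', by push_cast; ring, by push_cast; ring⟩

theorem GalReal.neg (h : GalReal a b) : GalReal (-a) (-b) := by
  obtain ⟨r, s, rfl, rfl⟩ := h
  exact ⟨-r, -s, by push_cast; ring, by push_cast; ring⟩

theorem GalReal.sub (h : GalReal a b) (h' : GalReal c d) : GalReal (a - c) (b - d) := by
  rw [sub_eq_add_neg, sub_eq_add_neg]
  exact h.add h'.neg

theorem GalReal.mul (h : GalReal a b) (h' : GalReal c d) : GalReal (a * c) (b * d) := by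
  obtain ⟨r, s, rfl, rfl⟩ := h
  obtain ⟨r', s', rfl, rfl⟩ := h'
  refine ⟨r * r' + s * s', r * s' + s * r' + s * s', ?_, ?_⟩
  · push_cast
    linear_combination (s * s' : ℝ) * tau_sq
  · push_cast
    linear_combination (s * s' : ℝ) * tau_sq

theorem GalReal.rat (r : ℚ) : GalReal r r := ⟨r, 0, by simp, by simp⟩

theorem GalReal.tau : GalReal tau (1 - tau) := ⟨0, 1, by simp, by simp⟩

theorem GalReal.unique (h : GalReal a b) (h' : GalReal a c) : b = c := by
  obtain ⟨r, s, rfl, rfl⟩ := h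
  obtain ⟨r', s', h, rfl⟩ := h'
  by_cases hs : s = s'
  · subst hs
    linarith
  · refine absurd ⟨(r' - r) / (s - s'), ?_⟩ irrational_tau
    have hs' : (s : ℝ) - s' ≠ 0 := by
      rw [sub_ne_zero]
      exact_mod_cast hs
    push_cast
    rw [div_eq_iff hs']
    linarith

/-- `q` is the image of `p` under the Galois conjugation of coordinates followed by the rotation
`qx`. -/
def Gal (p q : ℍ[ℝ]) : Prop :=
  GalReal p.re q.re ∧ GalReal p.imI (-q.imI) ∧ GalReal p.imJ (-q.imK) ∧ GalReal p.imK (-q.imJ)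

variable {p q p' q' : ℍ[ℝ]}

theorem Gal.symm (h : Gal p q) : Gal q p := by
  obtain ⟨h0, h1, h2, h3⟩ := h
  refine ⟨h0.symm, ?_, ?_, ?_⟩
  · simpa using h1.neg.symm
  · simpa using h3.neg.symm
  · simpa using h2.neg.symm

/-- Galois conjugation respects sums and products of coordinates, and the substitution `i, j, k ↦
-i, -k, -j` is a rotation, hence multiplicative. -/
theorem Gal.mul (h : Gal p q) (h' : Gal p' q') : Gal (p * p') (q * q') := by
  obtain ⟨a0, a1, a2, a3⟩ := h
  obtain ⟨b0, b1, b2, b3⟩ := h'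
  refine ⟨?_, ?_, ?_, ?_⟩
  · rw [Quaternion.re_mul, Quaternion.re_mul]
    convert (((a0.mul b0).sub (a1.mul b1)).sub (a2.mul b2)).sub (a3.mul b3) using 1
    ring
  · rw [Quaternion.imI_mul, Quaternion.imI_mul]
    convert (((a0.mul b1).add (a1.mul b0)).add (a2.mul b3)).sub (a3.mul b2) using 1
    ring
  · rw [Quaternion.imJ_mul, Quaternion.imK_mul]
    convert (((a0.mul b2).sub (a1.mul b3)).add (a2.mul b0)).add (a3.mul b1) using 1
    ring
  · rw [Quaternion.imK_mul, Quaternion.imJ_mul]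
    convert (((a0.mul b3).add (a1.mul b2)).sub (a2.mul b1)).add (a3.mul b0) using 1
    ring

theorem Gal.unique (h : Gal p q) (h' : Gal p q') : q = q' := by
  obtain ⟨a0, a1, a2, a3⟩ := h
  obtain ⟨b0, b1, b2, b3⟩ := h'
  ext
  · exact a0.unique b0
  · exact neg_inj.1 (a1.unique b1)
  · exact neg_inj.1 (a3.unique b3)
  · exact neg_inj.1 (a2.unique b2)

theorem Gal.star (h : Gal p q) : Gal (star p) (star q) := by
  obtain ⟨h0, h1, h2, h3⟩ := h
  refine ⟨?_, ?_, ?_, ?_⟩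
  · simpa using h0
  · simpa using h1.neg
  · simpa using h2.neg
  · simpa using h3.neg

theorem gal_one : Gal 1 1 := by
  refine ⟨?_, ?_, ?_, ?_⟩
  · simpa using GalReal.rat 1
  all_goals simpa using GalReal.rat 0

/-- Pairs of unit quaternions related by `Gal`, up to sign when `e = -1`. -/
def GalPair (e x y : HU) : Prop :=
  (Quaternion.normSq (x : ℍ[ℝ]) = 1 ∧ Quaternion.normSq (y : ℍ[ℝ]) = 1) ∧
    (Gal x y ∨ (e = -1 ∧ Gal x (-y)))

variable {e x y z w : HU}

theorem GalPair.mul (h : GalPair e x y) (h' : GalPair e z w) : GalPair e (x * z) (y * w) := by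
  obtain ⟨⟨hx, hy⟩, h⟩ := h
  obtain ⟨⟨hz, hw⟩, h'⟩ := h'
  refine ⟨⟨by simp [hx, hz], by simp [hy, hw]⟩, ?_⟩
  rw [Units.val_mul, Units.val_mul]
  rcases h with h | ⟨he, h⟩ <;> rcases h' with h' | ⟨he', h'⟩ <;> have := h.mul h'
  · exact Or.inl this
  · exact Or.inr ⟨he', by rwa [mul_neg] at this⟩
  · exact Or.inr ⟨he, by rwa [neg_mul] at this⟩
  · exact Or.inl (by rwa [neg_mul_neg] at this)

theorem Gal.neg_left (h : Gal p (-q)) : Gal (-p) q := by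
  obtain ⟨h0, h1, h2, h3⟩ := h
  refine ⟨?_, ?_, ?_, ?_⟩
  · simpa using h0.neg
  · simpa using h1.neg
  · simpa using h2.neg
  · simpa using h3.neg

theorem GalPair.symm (h : GalPair e x y) : GalPair e y x := by
  refine ⟨⟨h.1.2, h.1.1⟩, ?_⟩
  rcases h.2 with h | ⟨he, h⟩
  · exact Or.inl h.symm
  · exact Or.inr ⟨he, h.neg_left.symm⟩

theorem GalPair.inv (h : GalPair e x y) : GalPair e x⁻¹ y⁻¹ := by
  obtain ⟨⟨hx, hy⟩, h⟩ := h
  rw [GalPair, inv_eq_star hx, inv_eq_star hy]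
  refine ⟨⟨by rwa [Quaternion.normSq_star], by rwa [Quaternion.normSq_star]⟩, ?_⟩
  rcases h with h | ⟨he, h⟩
  · exact Or.inl h.star
  · exact Or.inr ⟨he, by simpa using h.star⟩

/-- The monomial matrices whose entries are Galois pairs. -/
def galGroup (e : HU) : Subgroup (GLd 2 ℍ[ℝ]) where
  carrier := {g | ∃ x y, GalPair e x y ∧ (g = dg x y ∨ g = ad x y)}
  one_mem' := ⟨1, 1, ⟨⟨map_one _, map_one _⟩, Or.inl gal_one⟩, Or.inl dg_one.symm⟩
  mul_mem' := by
    rintro _ _ ⟨x, y, h, rfl | rfl⟩ ⟨z, w, h', rfl | rfl⟩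
    · exact ⟨_, _, h.mul h', Or.inl (dg_mul_dg _ _ _ _)⟩
    · exact ⟨_, _, h.mul h', Or.inr (dg_mul_ad _ _ _ _)⟩
    · exact ⟨_, _, h.mul h'.symm, Or.inr (ad_mul_dg _ _ _ _)⟩
    · exact ⟨_, _, h.mul h'.symm, Or.inl (ad_mul_ad _ _ _ _)⟩
  inv_mem' := by
    rintro _ ⟨x, y, h, rfl | rfl⟩
    · exact ⟨_, _, h.inv, Or.inl (dg_inv _ _)⟩
    · exact ⟨_, _, h.symm.inv, Or.inr (ad_inv _ _)⟩

/-- One entry determines the other, up to sign when `e = -1`; since `1` corresponds to `1`, the set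
`H` can contain nothing but `1` and `e`. -/
theorem eq_sign_of_mem_galGroup (h : dg x 1 ∈ galGroup e) : x = 1 ∨ (e = -1 ∧ x = -1) := by
  obtain ⟨a, b, hab, h | h⟩ := h
  · obtain ⟨rfl, rfl⟩ := dg_inj.1 h
    rcases hab.symm.2 with h | ⟨he, h⟩
    · exact Or.inl (Units.ext (h.unique gal_one))
    · refine Or.inr ⟨he, Units.ext ?_⟩
      rw [Units.val_neg, Units.val_one, ← h.unique gal_one, neg_neg]
  · exact absurd h dg_ne_ad

end Galois

/-! ### The icosahedral groups with a single system -/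

section GI20

variable {e : HU}

/-- The generating set of the icosahedral groups with one system of imprimitivity. -/
def icoL : Set HU := {1, uI, uQ, uY}

theorem normSq_icoL : ∀ b ∈ icoL, Quaternion.normSq (b : ℍ[ℝ]) = 1 := by
  rintro _ (rfl | rfl | rfl | rfl)
  exacts [map_one _, normSq_qi, normSq_qh, normSq_qy]

theorem GI20_eq : GI20 = cl icoL 1 :=
  genGroup_eq_of (by simp [icoL, Set.image_insert_eq]) (Or.inr ⟨rfl, rfl⟩) normSq_icoL

theorem GI20C2_eq : GI20C2 = cl icoL (-1) :=
  genGroup_eq_of (by simp [icoL, Set.image_insert_eq]) (Or.inl (by simp)) normSq_icoL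

theorem cl_icoL_le_wreath (he : e = 1 ∨ e = -1) : cl icoL e ≤ wreath binI := by
  refine cl_le (fun b hb => ?_) (dg_mem_wreath ?_ (one_mem _))
  · have : b ∈ binI := by
      rcases hb with rfl | rfl | rfl | rfl
      exacts [one_mem _, uI_mem_I, uQ_mem_I, uY_mem]
    exact ad_mem_wreath this (inv_mem this)
  · rcases he with rfl | rfl
    exacts [one_mem _, neg_one_mem_of uI_mem_I]

/-- On the four generating entries the twisted Galois conjugation agrees with inversion; thus their
reflections lie in `galGroup`, although the entries generate a large group. -/
theorem gal_icoL : ∀ b ∈ icoL, Gal b (star (b : ℍ[ℝ])) := by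
  have h0 : GalReal 0 0 := by simpa using GalReal.rat 0
  have h2 : GalReal (1 / 2) (1 / 2) := by simpa using GalReal.rat (1 / 2)
  have ht : GalReal (tau / 2) ((1 - tau) / 2) := by
    simpa only [mul_one_div] using GalReal.tau.mul h2
  rintro _ (rfl | rfl | rfl | rfl)
  · simpa using gal_one
  · refine ⟨?_, ?_, ?_, ?_⟩
    · simpa using h0
    · simpa using GalReal.rat 1
    all_goals simpa using h0
  · refine ⟨?_, ?_, ?_, ?_⟩ <;> simpa using h2
  · refine ⟨?_, ?_, ?_, ?_⟩
    · simpa using h0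
    · simpa using h2
    · simpa using ht.symm
    · simpa using ht

theorem cl_icoL_le_gal (he : e = 1 ∨ e = -1) : cl icoL e ≤ galGroup e := by
  refine cl_le (fun b hb => ⟨b, b⁻¹, ?_, Or.inr rfl⟩) ⟨e, 1, ?_, Or.inl rfl⟩
  · have hn := normSq_icoL b hb
    rw [GalPair, inv_eq_star hn]
    exact ⟨⟨hn, by rwa [Quaternion.normSq_star]⟩, Or.inl (gal_icoL b hb)⟩
  · rcases he with rfl | rfl
    · exact ⟨⟨map_one _, map_one _⟩, Or.inl gal_one⟩
    · refine ⟨⟨by simp, map_one _⟩, Or.inr ⟨rfl, ?_⟩⟩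
      have h : Gal 1 (- -1) := by rw [neg_neg]; exact gal_one
      simpa using h.neg_left

theorem ad_one_mem_ico : ad 1 1 ∈ cl icoL e := by
  simpa using ad_mem_cl (L := icoL) (e := e) (b := 1) (Or.inl rfl)

theorem ico_irreducible : IsIrreducible (cl icoL e) :=
  irreducible_of_root uI_mul_self ad_one_mem_ico (ad_mem_cl (Or.inr (Or.inl rfl)))

/-- Products of two generating reflections. -/
theorem dg_mem_ico {b c : HU} (hb : b ∈ icoL) (hc : c ∈ icoL) :
    dg (b * c⁻¹) (b⁻¹ * c) ∈ cl icoL e := by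
  simpa [ad_mul_ad] using mul_mem (ad_mem_cl (e := e) hb) (ad_mem_cl hc)

theorem ico_isQuaternionic (he : e = 1 ∨ e = -1) : IsImprimitiveQuaternionicRG (cl icoL e) := by
  have h1 := cl_icoL_le_wreath he
  refine ⟨cl_isReflectionGroup he (finite_of_le_wreath binI_finite h1), ico_irreducible,
    ⟨_, isSystem_stdSys_iff.2 (h1.trans (wreath_le_mono _))⟩, ?_⟩
  have hq := dg_mem_ico (e := e) (b := uQ) (c := 1) (by simp [icoL]) (by simp [icoL])
  have hi := dg_mem_ico (e := e) (b := uI) (c := 1) (by simp [icoL]) (by simp [icoL])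
  refine not_complex_of_sq hq (mul_mem hi hq) ?_
  simp only [dg_mul_dg, Ne, dg_inj, inv_one, mul_one]
  exact fun h => poly_sq_ne h.1

/-- A permutation of two lines has trivial square, so squares fix each slope. This removes the
choice between fixing and exchanging. -/
theorem square_fixes {G : Subgroup (GLd 2 ℍ[ℝ])} {w w' : ℍ[ℝ]}
    (hS : IsSystem G {ell w, ell w'}) {a b : HU} (h : dg a b ∈ G) :
    ((b * b : HU) : ℍ[ℝ]) * w = w * ((a * a : HU) : ℍ[ℝ]) := by
  have hperm := (isSystem_iff.1 hS).2
  have hsq : mv (dg (a * a) (b * b)) (ell w) = ell w := by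
    rw [← dg_mul_dg, mv_mul]
    rcases hperm _ h _ (Or.inl rfl) with h1 | h1
    · rw [h1, h1]
    · rw [h1]
      rcases hperm _ h _ (Or.inr rfl) with h2 | h2
      · exact h2
      · have := mv_injective (dg a b) (h1.trans h2.symm)
        rw [h2, this]
  rw [mv_dg_ell, ell_inj, ← Units.val_inv_eq_inv_val, Units.mul_inv_eq_iff_eq_mul] at hsq
  exact hsq

theorem sq_of_half {x : HU} (hn : Quaternion.normSq (x : ℍ[ℝ]) = 1) (h : (x : ℍ[ℝ]).re = 1 / 2) :
    ((x * x : HU) : ℍ[ℝ]) = x - 1 := by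
  rw [Units.val_mul, sq_eq_tr hn, tr, h]
  simp

/-- Unit quaternions of real part `1/2` satisfy `a² = a - 1`, so the relation for the squares
becomes the same relation for `a` and `b` themselves. -/
theorem half_fixes {G : Subgroup (GLd 2 ℍ[ℝ])} {w w' : ℍ[ℝ]}
    (hS : IsSystem G {ell w, ell w'}) {a b : HU} (h : dg a b ∈ G)
    (ha : Quaternion.normSq (a : ℍ[ℝ]) = 1) (hb : Quaternion.normSq (b : ℍ[ℝ]) = 1)
    (ha' : (a : ℍ[ℝ]).re = 1 / 2) (hb' : (b : ℍ[ℝ]).re = 1 / 2) :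
    (b : ℍ[ℝ]) * w = w * a := by
  have := square_fixes hS h
  rw [sq_of_half ha ha', sq_of_half hb hb', sub_mul, mul_sub, one_mul, mul_one] at this
  exact sub_left_injective this

/-- For `b = 1, i, y` the products `b q⁻¹` and `b⁻¹ q` have real part `1/2`. By `half_fixes` a
second system gives the linear equations `b⁻¹ q w = w b q⁻¹`, whose only common solution is `w = 0`.
-/
theorem numSystems_ico (he : e = 1 ∨ e = -1) : numSystems (cl icoL e) = 1 := by
  have hmono := (cl_icoL_le_wreath he).trans (wreath_le_mono _)
  have hset : {S | IsSystem (cl icoL e) S} = {stdSys ℍ[ℝ]} := by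
    ext S
    refine ⟨fun hS => ?_, ?_⟩
    · by_contra hne
      obtain ⟨w, w', hw, -, -, rfl⟩ := system_eq_pair hmono ico_irreducible hS hne
      have key : ∀ b ∈ icoL, ((b * uQ⁻¹ : HU) : ℍ[ℝ]).re = 1 / 2 →
          ((b⁻¹ * uQ : HU) : ℍ[ℝ]).re = 1 / 2 →
            ((b⁻¹ * uQ : HU) : ℍ[ℝ]) * w = w * ((b * uQ⁻¹ : HU) : ℍ[ℝ]) := fun b hb h1 h2 => by
        have hn := normSq_icoL b hb
        refine half_fixes hS (dg_mem_ico hb (by simp [icoL])) ?_ ?_ h1 h2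
        · rw [Units.val_mul, map_mul, hn, inv_eq_star normSq_qh, Quaternion.normSq_star]
          simp [normSq_qh]
        · rw [Units.val_mul, map_mul, inv_eq_star hn, Quaternion.normSq_star, hn]
          simp [normSq_qh]
      have k1 := key 1 (by simp [icoL])
      have k2 := key uI (by simp [icoL])
      have k3 := key uY (by simp [icoL])
      have eq : ((uQ⁻¹ : HU) : ℍ[ℝ]) = star qh := inv_eq_star (x := uQ) normSq_qh
      have ei : ((uI⁻¹ : HU) : ℍ[ℝ]) = star qi := inv_eq_star (x := uI) normSq_qi
      have ey : ((uY⁻¹ : HU) : ℍ[ℝ]) = star qy := inv_eq_star (x := uY) normSq_qy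
      simp only [Units.val_mul, inv_one, one_mul, eq, ei, ey] at k1 k2 k3
      replace k1 := k1 (by simp) (by simp)
      replace k2 := k2 (by simp) (by simp)
      replace k3 := k3 (by simp; ring) (by simp; ring)
      have hr := fun {x y : ℍ[ℝ]} (h : x = y) => congrArg (fun q : ℍ[ℝ] => q.re) h
      have a1 := hr k1
      have a2 := congrArg (fun q : ℍ[ℝ] => q.imI) k1
      have b1 := hr k2
      have c1 := hr k3
      simp at a1 a2 b1 c1
      have w0 : w.re = 0 := by linarith
      have w1 : w.imI = 0 := by linarith
      have w3 : w.imK = -w.imJ := by linarith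
      rw [w0, w1, w3] at c1
      -- The remaining coefficient is `2 τ - 1 = √5`, which is not zero.
      have w2 : w.imJ = 0 := by
        have : w.imJ * (2 * tau - 1) = 0 := by linarith
        refine (mul_eq_zero.1 this).resolve_right fun h => ?_
        linarith [tau_bounds.1]
      refine hw ?_
      ext <;> simp [w0, w1, w2, w3]
    · rintro rfl
      exact isSystem_stdSys_iff.2 hmono
  rw [numSystems, hset, Set.encard_singleton]

theorem ico_order_two (he : e = 1 ∨ e = -1) : AllReflectionsOrderTwo (cl icoL e) := by
  have hmono := (cl_icoL_le_wreath he).trans (wreath_le_mono _)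
  have hG := ico_isQuaternionic he
  refine (allReflectionsOrderTwo_iff hG.1.1 hmono hG.2.1).2 fun x hx => ?_
  exact (eq_sign_of_mem_galGroup (cl_icoL_le_gal he hx)).imp id And.right

theorem setH_ico (he : e = 1 ∨ e = -1) : setH (cl icoL e) = {1, (e : ℍ[ℝ])} := by
  ext h
  rw [mem_setH]
  constructor
  · rintro ⟨u, hu, rfl⟩
    rcases eq_sign_of_mem_galGroup (cl_icoL_le_gal he hu) with rfl | ⟨rfl, rfl⟩
    · exact Or.inl rfl
    · exact Or.inr rfl
  · rintro (rfl | rfl)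
    · exact ⟨1, by rw [dg_one]; exact one_mem _, rfl⟩
    · exact ⟨e, sign_mem_cl, rfl⟩

end GI20

/-! ### Assembly of the statement -/

theorem GI20_spec : IsImprimitiveQuaternionicRG GI20 ∧ setH GI20 = {1} ∧
    AllReflectionsOrderTwo GI20 ∧ numSystems GI20 = 1 := by
  rw [GI20_eq]
  refine ⟨ico_isQuaternionic (Or.inl rfl), ?_, ico_order_two (Or.inl rfl),
    numSystems_ico (Or.inl rfl)⟩
  simp [setH_ico (Or.inl rfl)]

theorem GI20C2_spec : IsImprimitiveQuaternionicRG GI20C2 ∧ setH GI20C2 = {1, -1} ∧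
    AllReflectionsOrderTwo GI20C2 ∧ numSystems GI20C2 = 1 := by
  rw [GI20C2_eq]
  refine ⟨ico_isQuaternionic (Or.inr rfl), ?_, ico_order_two (Or.inr rfl),
    numSystems_ico (Or.inr rfl)⟩
  simp [setH_ico (Or.inr rfl)]

theorem exists_one_system : ∃ f : ℕ → Subgroup (GLd 2 ℍ[ℝ]),
    (∀ m, IsImprimitiveQuaternionicRG (f m) ∧ numSystems (f m) = 1) ∧
      ∀ m n, m ≠ n → ¬ Conj (f m) (f n) := by
  have h2 : ∀ k, 2 ≤ 5 ^ (k + 1) := fun k => by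
    have := Nat.one_le_pow k 5 (by norm_num)
    rw [pow_succ]
    omega
  refine ⟨fun k => bigReflGroup (5 ^ (k + 1)),
    fun m => ⟨big_isQuaternionic (h2 m), numSystems_big (h2 m)⟩, fun m n hmn h => ?_⟩
  rcases lt_or_gt_of_ne hmn with hlt | hlt
  · exact big_not_conj hlt h.symm
  · exact big_not_conj hlt h

/-- The number of systems of imprimitivity determines the type of the group. -/
theorem systems_iff {G : Subgroup (GLd 2 ℍ[ℝ])} (hG : IsImprimitiveQuaternionicRG G) :
    (numSystems G = 1 ∨ numSystems G = 2 ∨ numSystems G = 3 ∨ numSystems G = 5 ∨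
        numSystems G = ⊤) ∧
      (numSystems G = 2 ↔ ∃ t, Conj G (twoCase t)) ∧
      (numSystems G = 3 ↔ ∃ t n, FamIndex t n ∧ Conj G (family t n)) ∧
      (numSystems G = 5 ↔ Conj G (Gnabr 2 1 1 2)) ∧
      (numSystems G = ⊤ ↔ ∃ t, Conj G (infCase t)) := by
  have hc := systems_cases hG
  have h2 : (∃ t, Conj G (twoCase t)) → numSystems G = 2 :=
    fun ⟨t, ht⟩ => ht.numSystems_eq.trans (numSystems_twoCase t)
  have h3 : (∃ t n, FamIndex t n ∧ Conj G (family t n)) → numSystems G = 3 :=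
    fun ⟨t, n, h, ht⟩ => ht.numSystems_eq.trans (numSystems_family h)
  have h5 : Conj G (Gnabr 2 1 1 2) → numSystems G = 5 :=
    fun h => h.numSystems_eq.trans numSystems_Gnabr_two
  have ht : (∃ t, Conj G (infCase t)) → numSystems G = ⊤ :=
    fun ⟨t, ht⟩ => ht.numSystems_eq.trans (numSystems_infCase t)
  have n12 : (1 : ℕ∞) ≠ 2 := by decide
  have n13 : (1 : ℕ∞) ≠ 3 := by decide
  have n15 : (1 : ℕ∞) ≠ 5 := by decide
  have n23 : (2 : ℕ∞) ≠ 3 := by decide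
  have n25 : (2 : ℕ∞) ≠ 5 := by decide
  have n35 : (3 : ℕ∞) ≠ 5 := by decide
  have n1t : (1 : ℕ∞) ≠ ⊤ := by decide
  have n2t : (2 : ℕ∞) ≠ ⊤ := by decide
  have n3t : (3 : ℕ∞) ≠ ⊤ := by decide
  have n5t : (5 : ℕ∞) ≠ ⊤ := by decide
  refine ⟨?_, ⟨fun h => ?_, h2⟩, ⟨fun h => ?_, h3⟩, ⟨fun h => ?_, h5⟩, ⟨fun h => ?_, ht⟩⟩
  · tauto
  all_goals
    rw [h] at hc
    rcases hc with h | ⟨h, h'⟩ | ⟨h, h'⟩ | ⟨h, h'⟩ | ⟨h, h'⟩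
    all_goals first
      | exact h'
      | exact absurd h (by assumption)
      | exact absurd h.symm (by assumption)

theorem family_not_conj {t : Fin 3} {m n : ℕ} (hm : FamIndex t m) (hn : FamIndex t n)
    (hmn : m ≠ n) : ¬ Conj (family t m) (family t n) := by
  rw [family_conj_iff hm hn]
  fin_cases t
  · exact hmn
  · exact hmn
  · obtain ⟨-, h1, -⟩ : 6 ≤ m ∧ Even m ∧ Odd (m / 2) := hm
    obtain ⟨-, h2, -⟩ : 6 ≤ n ∧ Even n ∧ Odd (n / 2) := hn
    change m / 2 ≠ n / 2
    rw [Nat.even_iff] at h1 h2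
    omega

theorem family_not_conj_even {t : Fin 3} {m n : ℕ} (ht : t ≠ 1) (hm : FamIndex t m)
    (hn : FamIndex 1 n) : ¬ Conj (family t m) (family 1 n) := by
  rw [family_conj_iff hm hn]
  obtain ⟨-, h2⟩ : 4 ≤ n ∧ Even n := hn
  rw [← Nat.not_odd_iff_even] at h2
  change famOrder t m ≠ n
  rintro rfl
  fin_cases t
  · exact h2 (show 3 ≤ m ∧ Odd m from hm).2
  · exact ht rfl
  · exact h2 (show 6 ≤ m ∧ Even m ∧ Odd (m / 2) from hm).2.2

theorem family_conj_zero_two {m n : ℕ} (hm : FamIndex 0 m) (hn : FamIndex 2 n) :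
    Conj (family 0 m) (family 2 n) ↔ n = 2 * m := by
  rw [family_conj_iff hm hn]
  obtain ⟨-, h, -⟩ : 6 ≤ n ∧ Even n ∧ Odd (n / 2) := hn
  rw [Nat.even_iff] at h
  change m = n / 2 ↔ _
  omega

end QRefl

theorem mainTheorem6 :
    -- for every imprimitive quaternionic reflection group `G` of rank two
    (∀ G : Subgroup (QRefl.GLd 2 ℍ[ℝ]), QRefl.IsImprimitiveQuaternionicRG G →
      -- more than one system of imprimitivity forces `H = 1` or `H = C₂` in every monomial
      -- form of `G`, and all reflections to have order two
      (1 < QRefl.numSystems G →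
        (∀ G' : Subgroup (QRefl.GLd 2 ℍ[ℝ]), QRefl.Conj G G' → QRefl.IsMonomial G' →
          QRefl.setH G' = {1} ∨ QRefl.setH G' = {1, -1}) ∧
        QRefl.AllReflectionsOrderTwo G) ∧
      -- these two conditions are the same one
      (QRefl.IsMonomial G →
        ((QRefl.setH G = {1} ∨ QRefl.setH G = {1, -1}) ↔ QRefl.AllReflectionsOrderTwo G)) ∧
      -- the possible numbers of systems
      (QRefl.numSystems G = 1 ∨ QRefl.numSystems G = 2 ∨ QRefl.numSystems G = 3 ∨
        QRefl.numSystems G = 5 ∨ QRefl.numSystems G = ⊤) ∧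
      -- the groups with two, three, five and infinitely many systems
      (QRefl.numSystems G = 2 ↔ ∃ t, QRefl.Conj G (QRefl.twoCase t)) ∧
      (QRefl.numSystems G = 3 ↔
        ∃ t n, QRefl.FamIndex t n ∧ QRefl.Conj G (QRefl.family t n)) ∧
      (QRefl.numSystems G = 5 ↔ QRefl.Conj G (QRefl.Gnabr 2 1 1 2)) ∧
      (QRefl.numSystems G = ⊤ ↔ ∃ t, QRefl.Conj G (QRefl.infCase t))) ∧
    -- one system: infinitely many groups up to conjugacy
    (∃ f : ℕ → Subgroup (QRefl.GLd 2 ℍ[ℝ]),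
      (∀ m, QRefl.IsImprimitiveQuaternionicRG (f m) ∧ QRefl.numSystems (f m) = 1) ∧
      ∀ m n, m ≠ n → ¬ QRefl.Conj (f m) (f n)) ∧
    -- two systems: three groups, pairwise not conjugate
    ((∀ t, QRefl.IsImprimitiveQuaternionicRG (QRefl.twoCase t)) ∧
      ∀ s t, s ≠ t → ¬ QRefl.Conj (QRefl.twoCase s) (QRefl.twoCase t)) ∧
    -- three systems: three infinite families, each of pairwise nonconjugate groups;
    -- the only coincidences are between the first and the third family
    ((∀ t n, QRefl.FamIndex t n → QRefl.IsImprimitiveQuaternionicRG (QRefl.family t n)) ∧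
      (∀ t m n, QRefl.FamIndex t m → QRefl.FamIndex t n → m ≠ n →
        ¬ QRefl.Conj (QRefl.family t m) (QRefl.family t n)) ∧
      (∀ t m n, t ≠ 1 → QRefl.FamIndex t m → QRefl.FamIndex 1 n →
        ¬ QRefl.Conj (QRefl.family t m) (QRefl.family 1 n)) ∧
      (∀ m n, QRefl.FamIndex 0 m → QRefl.FamIndex 2 n →
        (QRefl.Conj (QRefl.family 0 m) (QRefl.family 2 n) ↔ n = 2 * m))) ∧
    -- five systems: one group
    QRefl.IsImprimitiveQuaternionicRG (QRefl.Gnabr 2 1 1 2) ∧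
    -- infinitely many systems: three groups, pairwise not conjugate
    ((∀ t, QRefl.IsImprimitiveQuaternionicRG (QRefl.infCase t)) ∧
      ∀ s t, s ≠ t → ¬ QRefl.Conj (QRefl.infCase s) (QRefl.infCase t)) ∧
    -- the necessary condition is not sufficient
    (QRefl.IsImprimitiveQuaternionicRG QRefl.GI20 ∧ QRefl.setH QRefl.GI20 = {1} ∧
      QRefl.AllReflectionsOrderTwo QRefl.GI20 ∧ QRefl.numSystems QRefl.GI20 = 1) ∧
    (QRefl.IsImprimitiveQuaternionicRG QRefl.GI20C2 ∧ QRefl.setH QRefl.GI20C2 = {1, -1} ∧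
      QRefl.AllReflectionsOrderTwo QRefl.GI20C2 ∧ QRefl.numSystems QRefl.GI20C2 = 1) := by
  refine ⟨fun G hG => ⟨fun h => ?_, QRefl.setH_iff_order_two hG, QRefl.systems_iff hG⟩,
    QRefl.exists_one_system, ⟨QRefl.twoCase_isQuaternionic, fun s t => ?_⟩,
    ⟨fun t n h => (QRefl.family_spec h).2.2, fun t m n => QRefl.family_not_conj,
      fun t m n => QRefl.family_not_conj_even, fun m n => QRefl.family_conj_zero_two⟩,
    QRefl.Gnabr_two_isQuaternionic, ⟨QRefl.infCase_isQuaternionic, fun s t => ?_⟩,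
    QRefl.GI20_spec, QRefl.GI20C2_spec⟩
  · have h2 := QRefl.allReflectionsOrderTwo_of_systems hG h
    exact ⟨fun G' hc hm => (QRefl.setH_iff_order_two (hc.isQuaternionic hG) hm).2
      (hc.allReflectionsOrderTwo h2), h2⟩
  · exact QRefl.not_conj_of_poly (Or.inr rfl) QRefl.twoCase_conj
  · exact QRefl.not_conj_of_poly (Or.inl rfl) QRefl.infCase_conj
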